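/- **Setting.** Let $n\ge 0$ be an even integer, $q$ an indeterminate, $\mathbb K=\mathbb C(q)$, and put $[s]=\frac{q^s-q^{-s}}{q-q^{-1}}$, $[z;s]_d=\frac{zq^{ds}-z^{-1}q^{-ds}}{q^d-q^{-d}}$ for $d\ge1$, $s\in\mathbb Z$, $0\neq z\in\mathbb K$. *Quantum groups.* $U=U_q(\mathfrak{gl}_n)$ is the $\mathbb K$-algebra generated by $\mathbf q^h$ ($h\in\mathbb Z^n$), $E_i,F_i$ ($1\le i\le n-1$) with the usual relations (with $K_i=\mathbf q^{h_i}$, $h_i=\varepsilon_i-\varepsilon_{i+1}$) and with $\Delta(\mathbf q^h)=\mathbf q^h\otimes\mathbf q^h$, $\Delta(E_i)=E_i\otimes K_i+1\otimes E_i$, $\Delta(F_i)=F_i\otimes1+K_i^{-1}\otimes F_i$. Let $U'=U'_q(\mathfrak{sp}_n)\subset U$ be the subalgebra generated by $E_i,F_i,K_i^{\pm1}$ for $i=1,3,\dots,n-1$ and, for $i=2,4,\dots,n-2$, $$B_i=F_i-K_i^{-1}\bigl(E_{i-1}E_{i+1}E_i-q^{-1}E_{i-1}E_iE_{i+1}-q^{-1}E_{i+1}E_iE_{i-1}+q^{-2}E_iE_{i-1}E_{i+1}\bigr).$$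 It is a left coideal subalgebra, $\Delta(U')\subset U\otimes U'$, so the monoidal category $\mathrm{Rep}(U)$ of finite-dimensional representations acts by $\otimes$ on the category $\mathrm{Rep}(U')$ of finite-dimensional representations. Let $V$ be the vector representation with basis $v_1,\dots,v_n$ ($\mathbf q^hv_j=q^{h_j}v_j$, $E_iv_{i+1}=v_i$, $F_iv_i=v_{i+1}$, all other $E_iv_j,F_iv_j$ zero). Let $\bigwedge^aV$ and $\mathrm{Sym}^aV$ be the degree $a$ parts of the quotients of the tensor algebra of $V$ by the ideals generated by $v_i\otimes v_i$ and $q^{-1}v_i\otimes v_j+v_j\otimes v_i$ ($i<j$), respectively by $qv_i\otimes v_j-v_j\otimes v_i$ ($i<j$). *Type A webs.* $\mathrm{Web}_A$ is the additive closure of the strict monoidal $\mathbb K$-linear category with objects the finite sequences of positive integers, generated by merges $a\otimes b\to a+b$ and splits $a+b\to a\otimes b$ subject to associativity, coassociativity, and the thin square switch: for $a,b\ge0$, let $\mathsf F$ move a thin strand from the left strand to the right one, $(a,b)\to(a-1,b+1)$ (a split followed by a merge), and let $\mathsf E$ move one from right to left; then $\mathsf E\mathsf F=\mathsf F\mathsf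 E+[a-b]\,\mathrm{id}$ on $(a,b)$. Here strands of thickness $0$ are erased, and webs with an edge of negative thickness are zero. *Dot webs and cup webs.* Each of the following is the additive closure of the $\mathbb K$-linear category with a bilinear left action of $\mathrm{Web}_A$ that is generated by one object $\varnothing$ and the given morphisms, subject to the given relations. Write $X$ for $X\otimes\varnothing$; $m_{a,b}$, $s_{a,b}$ for the merge and split; $\mu_{a,b}=s_{a,b}m_{a,b}$ and $\mu=\mu_{1,1}$; $\mathrm{id}_a$ for the identity of the strand $a$; composition is from right to left. $\mathrm{Web}^{\bullet}_{z}$ has generators $\mathsf s:\varnothing\to2$ (start dot) and $\mathsf e:2\to\varnothing$ (end dot) and relations $\mathsf e\mathsf s=[z;0]_2$; $(\mathrm{id}_1\otimes\mathsf e)\mu_{1,2}(\mathrm{id}_1\otimes\mathsf s)=[z;-1]_2\,\mathrm{id}_1$; $(\mathrm{id}_2\otimes\mathsf e)\mu_{2,2}(\mathrm{id}_2\otimes\mathsf s)=\mathsf s\mathsf e+[z;-2]_2\,\mathrm{id}_2$; and, with $\cup:=s_{1,1}\mathsf s$, $\cap:=\mathsf e\,m_{1,1}$, $\cup_2:=(\mathrm{id}_{1\otimes1}\otimes\cup)\cup$,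 $\cap_2:=\cap(\mathrm{id}_{1\otimes1}\otimes\cap)$, the sliding relations $$\cap_2(\mathrm{id}\otimes\mu\otimes\mathrm{id})(\mu\otimes\mathrm{id}\otimes\mathrm{id})=\cap_2(\mathrm{id}\otimes\mu\otimes\mathrm{id})(\mathrm{id}\otimes\mathrm{id}\otimes\mu),$$ $$(\mu\otimes\mathrm{id}\otimes\mathrm{id})(\mathrm{id}\otimes\mu\otimes\mathrm{id})\cup_2=(\mathrm{id}\otimes\mathrm{id}\otimes\mu)(\mathrm{id}\otimes\mu\otimes\mathrm{id})\cup_2 .$$ $\mathrm{Web}^{\cup}_{z}$ has generators $\cup:\varnothing\to1\otimes1$ and $\cap:1\otimes1\to\varnothing$ and relations $\cap\cup=[z;0]_1$; $(\mathrm{id}_1\otimes\cap)(\mu\otimes\mathrm{id}_1)(\mathrm{id}_1\otimes\cup)=[z;-1]_1\,\mathrm{id}_1$; with $\beta^{+}=\mu-q^{-1}\mathrm{id}$, $\beta^{-}=\mu-q\,\mathrm{id}$, $$(\mathrm{id}_{1\otimes1}\otimes\cap)(\mathrm{id}_1\otimes\beta^{+}\otimes\mathrm{id}_1)(\mu\otimes\mu)(\mathrm{id}_1\otimes\beta^{-}\otimes\mathrm{id}_1)(\mathrm{id}_{1\otimes1}\otimes\cup)=\cup\cap+[z;-2]_1\,\mathrm{id}_{1\otimes1};$$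 $m_{1,1}\cup=0$, $\cap s_{1,1}=0$; and the same two sliding relations. *Presentation functors.* The type A functors $\Gamma_A^{\mathrm{ext}},\Gamma_A^{\mathrm{sym}}:\mathrm{Web}_A\to\mathrm{Rep}(U)$ are the $\mathbb K$-linear monoidal functors which send $a$ to $\bigwedge^aV$, respectively $\mathrm{Sym}^aV$, the merges to the multiplication maps, and the splits to the comultiplication maps $$v_{w_1}\cdots v_{w_{a+b}}\mapsto\sum_{|A|=a}c_A(w)\;v_{w_A}\otimes v_{w_{A^c}},$$ on the basis of all strictly (respectively weakly) increasing words $w$. Here $A$ runs through the subsets of size $a$ of $\{1,\dots,a+b\}$, $w_A$ is the subword at the positions in $A$, and, with $\ell=\#\{(u,v)\in A\times A^c:v<u\}$ and $\ell_0$ the number of those pairs which also satisfy $w_u=w_v$, $c_A=(-1)^{\ell}q^{ab-\ell}$ in the exterior and $c_A=q^{\ell-ab+\ell_0}$ in the symmetric case. The functor $\Gamma_C^{\mathrm{ext}}:\mathrm{Web}^{\bullet}_{q^n}\to\mathrm{Rep}(U')$ is defined to be $\Gamma_A^{\mathrm{ext}}$ (followed by restriction) on type A webs, to be compatible with the actions,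 i.e. $\Gamma_C(f\otimes t)=\Gamma_A(f)\otimes\Gamma_C(t)$, and by $$\mathsf s\mapsto\Bigl(1\mapsto\sum_{i=1}^{n/2}q^{1-i}\,v_{2i-1}\wedge v_{2i}\Bigr),\qquad \mathsf e\mapsto\Bigl(v_i\wedge v_j\mapsto\begin{cases}q^{\,n-\frac{3i+1}2}&i\text{ odd},\ j=i+1\\0&\text{else}\end{cases}\quad(i<j)\Bigr).$$ The functor $\Gamma_C^{\mathrm{sym}}:\mathrm{Web}^{\cup}_{-q^{-n}}\to\mathrm{Rep}(U')$ is defined in the same way from $\Gamma_A^{\mathrm{sym}}$ and $$\cup\mapsto\Bigl(1\mapsto\sum_{i=1}^{n/2}q^{1-i}(q\,v_{2i-1}\otimes v_{2i}-v_{2i}\otimes v_{2i-1})\Bigr),\qquad\cap\mapsto\Bigl(v_i\otimes v_j\mapsto\begin{cases}q^{\,n-\frac{3i+1}2}&i\text{ odd},\ j=i+1\\-q^{\,n-\frac{3i}2}&i\text{ even},\ j=i-1\\0&\text{else}\end{cases}\Bigr).$$ **Proposition.** The functors $\Gamma_A^{\mathrm{ext}}$ and $\Gamma_A^{\mathrm{sym}}$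 exist and are unique, and the functors $\Gamma_C^{\mathrm{ext}}$ and $\Gamma_C^{\mathrm{sym}}$ are well-defined: there is exactly one $\mathbb K$-linear functor with the prescribed properties. Moreover, these functors intertwine the actions of $\mathrm{Web}_A$ and of $\mathrm{Rep}(U)$: for $\bullet\in\{\mathrm{ext},\mathrm{sym}\}$, and $\mathcal W=\mathrm{Web}^{\bullet}_{q^n}$, respectively $\mathcal W=\mathrm{Web}^{\cup}_{-q^{-n}}$, the square $$\begin{array}{ccc}\mathrm{Web}_A\times\mathcal W&\xrightarrow{\ \otimes\ }&\mathcal W\\ {\scriptstyle\Gamma_A^{\bullet}\times\Gamma_C^{\bullet}}\big\downarrow&&\big\downarrow{\scriptstyle\Gamma_C^{\bullet}}\\ \mathrm{Rep}(U)\times\mathrm{Rep}(U')&\xrightarrow{\ \otimes\ }&\mathrm{Rep}(U')\end{array}$$ commutes up to the canonical natural isomorphism $\Gamma_C(X\otimes Y)\cong\Gamma_A(X)\otimes\Gamma_C(Y)$. -/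

import Mathlib

set_option linter.unusedVariables false
set_option linter.unusedSimpArgs false
set_option linter.unnecessarySeqFocus false

open CategoryTheory MonoidalCategory TensorProduct
open scoped MonoidalLeftAction

/-- The field `ℂ(q)` of rational functions. -/
def Kq : Type := RatFunc ℂ

noncomputable instance : Field Kq := inferInstanceAs (Field (RatFunc ℂ))

/-- The generic parameter `q`. -/
noncomputable def qpar : Kq := (RatFunc.X : RatFunc ℂ)

lemma qpar_ne_zero : qpar ≠ 0 := (RatFunc.X_ne_zero : (RatFunc.X : RatFunc ℂ) ≠ 0)

/-- The quantum number `[s] = (q^s - q^{-s}) / (q - q^{-1})`. -/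
noncomputable def qnum (s : ℤ) : Kq := (qpar ^ s - qpar ^ (-s)) / (qpar - qpar⁻¹)

/-- The quantum number `[z; s]_d = (z q^{ds} - z^{-1} q^{-ds}) / (q^d - q^{-d})`. -/
noncomputable def zqnum (z : Kq) (d : ℕ) (s : ℤ) : Kq :=
  (z * (qpar ^ d) ^ s - z⁻¹ * (qpar ^ d) ^ (-s)) / (qpar ^ d - (qpar ^ d)⁻¹)

section Outer

variable {k : Type} [Field k] {A : Type} [Ring A] [Algebra k A] {B : Type} [Ring B] [Algebra k B]
  {U : Type} [AddCommGroup U] [Module k U] {V : Type} [AddCommGroup V] [Module k V]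
  {W : Type} [AddCommGroup W] [Module k W]

/-- The action of `A ⊗ B` on `U ⊗ V`, for `A` acting on `U` and `B` on `V`. -/
noncomputable def outer (φ : A →ₐ[k] Module.End k U) (ψ : B →ₐ[k] Module.End k V) :
    A ⊗[k] B →ₐ[k] Module.End k (U ⊗[k] V) :=
  (Module.endTensorEndAlgHom (R := k) (S := k) (A := k) (M := U) (N := V)).comp
    (Algebra.TensorProduct.map φ ψ)

lemma outer_tmul (φ : A →ₐ[k] Module.End k U) (ψ : B →ₐ[k] Module.End k V) (a : A) (b : B) :
    outer φ ψ (a ⊗ₜ b) = TensorProduct.map (φ a) (ψ b) := by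
  simp [outer, Module.endTensorEndAlgHom_apply]
  rfl

lemma outer_natural {U' V' : Type} [AddCommGroup U'] [Module k U'] [AddCommGroup V'] [Module k V']
    {φ : A →ₐ[k] Module.End k U} {ψ : B →ₐ[k] Module.End k V}
    {φ' : A →ₐ[k] Module.End k U'} {ψ' : B →ₐ[k] Module.End k V'}
    (f : U →ₗ[k] U') (g : V →ₗ[k] V') (hf : ∀ a, f ∘ₗ φ a = φ' a ∘ₗ f)
    (hg : ∀ b, g ∘ₗ ψ b = ψ' b ∘ₗ g) (t : A ⊗[k] B) :
    TensorProduct.map f g ∘ₗ outer φ ψ t = outer φ' ψ' t ∘ₗ TensorProduct.map f g := by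
  induction t using TensorProduct.induction_on with
  | zero => simp
  | tmul a b =>
    rw [outer_tmul, outer_tmul, ← TensorProduct.map_comp, ← TensorProduct.map_comp, hf, hg]
  | add x y hx hy => rw [map_add, map_add, LinearMap.comp_add, hx, hy, LinearMap.add_comp]

lemma outer_map {A' B' : Type} [Ring A'] [Algebra k A'] [Ring B'] [Algebra k B']
    (α : A' →ₐ[k] A) (β : B' →ₐ[k] B)
    (φ : A →ₐ[k] Module.End k U) (ψ : B →ₐ[k] Module.End k V) (t : A' ⊗[k] B') :
    outer φ ψ (Algebra.TensorProduct.map α β t) = outer (φ.comp α) (ψ.comp β) t := by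
  induction t using TensorProduct.induction_on with
  | zero => rw [map_zero, map_zero, map_zero]
  | tmul a b => rw [Algebra.TensorProduct.map_tmul, outer_tmul, outer_tmul]; rfl
  | add x y hx hy => rw [map_add, map_add, map_add, hx, hy]

lemma assoc_outer {C : Type} [Ring C] [Algebra k C] (φ : A →ₐ[k] Module.End k U)
    (ψ : B →ₐ[k] Module.End k V) (χ : C →ₐ[k] Module.End k W) (t : (A ⊗[k] B) ⊗[k] C) :
    (TensorProduct.assoc k U V W).toLinearMap ∘ₗ outer (outer φ ψ) χ t =
      outer φ (outer ψ χ) (TensorProduct.assoc k A B C t) ∘ₗ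
        (TensorProduct.assoc k U V W).toLinearMap := by
  induction t using TensorProduct.induction_on with
  | zero => simp
  | tmul a c =>
    induction a using TensorProduct.induction_on with
    | zero => simp
    | tmul a b =>
      rw [outer_tmul, outer_tmul, TensorProduct.assoc_tmul, outer_tmul, outer_tmul]
      ext x y z
      rfl
    | add x y hx hy =>
      rw [TensorProduct.add_tmul, map_add, LinearMap.comp_add, hx, hy, map_add, map_add,
        LinearMap.add_comp]
  | add x y hx hy =>
    rw [map_add, LinearMap.comp_add, hx, hy, map_add, map_add, LinearMap.add_comp]

lemma lid_outer (ε : A →ₐ[k] k) (ψ : B →ₐ[k] Module.End k V) (t : A ⊗[k] B) :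
    (TensorProduct.lid k V).toLinearMap ∘ₗ outer ((Algebra.lmul k k).comp ε) ψ t =
      ψ (TensorProduct.lid k B (Algebra.TensorProduct.map ε (AlgHom.id k B) t)) ∘ₗ
        (TensorProduct.lid k V).toLinearMap := by
  induction t using TensorProduct.induction_on with
  | zero => simp
  | tmul a b =>
    rw [outer_tmul, Algebra.TensorProduct.map_tmul, TensorProduct.lid_tmul]
    apply TensorProduct.ext'
    intro x y
    change (ε a * x) • ψ b y = ψ (ε a • b) (x • y)
    simp [mul_smul, smul_comm x (ε a)]
  | add x y hx hy =>
    rw [map_add, LinearMap.comp_add, hx, hy, map_add, map_add, map_add, LinearMap.add_comp]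

lemma rid_outer (ε : B →ₐ[k] k) (φ : A →ₐ[k] Module.End k U) (t : A ⊗[k] B) :
    (TensorProduct.rid k U).toLinearMap ∘ₗ outer φ ((Algebra.lmul k k).comp ε) t =
      φ (TensorProduct.rid k A (Algebra.TensorProduct.map (AlgHom.id k A) ε t)) ∘ₗ
        (TensorProduct.rid k U).toLinearMap := by
  induction t using TensorProduct.induction_on with
  | zero => simp
  | tmul a b =>
    rw [outer_tmul, Algebra.TensorProduct.map_tmul, TensorProduct.rid_tmul]
    apply TensorProduct.ext'
    intro x y
    change (ε b * y) • φ a x = φ (ε b • a) (y • x)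
    simp [mul_smul, smul_comm y (ε b)]
  | add x y hx hy =>
    rw [map_add, LinearMap.comp_add, hx, hy, map_add, map_add, map_add, LinearMap.add_comp]

end Outer

section Rep

variable (k : Type) [Field k] (A : Type) [Ring A] [Algebra k A]

/-- A finite-dimensional representation of the `k`-algebra `A`. -/
structure AlgRep where
  V : Type
  [acg : AddCommGroup V]
  [mod : Module k V]
  [fd : FiniteDimensional k V]
  ρ : A →ₐ[k] Module.End k V

attribute [instance] AlgRep.acg AlgRep.mod AlgRep.fd

variable {k A}

namespace AlgRep

/-- The space of intertwiners between two representations. -/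
def homs (M N : AlgRep k A) : Submodule k (M.V →ₗ[k] N.V) where
  carrier := {f | ∀ a, f ∘ₗ M.ρ a = N.ρ a ∘ₗ f}
  add_mem' := by
    intro f g hf hg a
    change ∀ a, f ∘ₗ M.ρ a = N.ρ a ∘ₗ f at hf
    change ∀ a, g ∘ₗ M.ρ a = N.ρ a ∘ₗ g at hg
    rw [LinearMap.add_comp, LinearMap.comp_add, hf, hg]
  zero_mem' := by intro a; simp
  smul_mem' := by
    intro c f hf a
    change ∀ a, f ∘ₗ M.ρ a = N.ρ a ∘ₗ f at hf
    rw [LinearMap.smul_comp, LinearMap.comp_smul, hf]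

instance : Category (AlgRep k A) where
  Hom M N := homs M N
  id M := ⟨LinearMap.id, fun _ => rfl⟩
  comp {M N P} f g := ⟨g.1 ∘ₗ f.1, fun a => by
    rw [LinearMap.comp_assoc, f.2, ← LinearMap.comp_assoc, g.2, LinearMap.comp_assoc]⟩

/-- The linear map underlying a morphism of representations. -/
abbrev lin {M N : AlgRep k A} (f : M ⟶ N) : M.V →ₗ[k] N.V := f.1

lemma hom_ext {M N : AlgRep k A} {f g : M ⟶ N} (h : lin f = lin g) : f = g := Subtype.ext h

instance : Preadditive (AlgRep k A) where
  homGroup M N := inferInstanceAs (AddCommGroup (homs M N))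
  add_comp _ _ _ _ _ _ := Subtype.ext (LinearMap.comp_add _ _ _)
  comp_add _ _ _ _ _ _ := Subtype.ext (LinearMap.add_comp _ _ _)

instance : Linear k (AlgRep k A) where
  homModule M N := inferInstanceAs (Module k (homs M N))
  smul_comp _ _ _ _ _ _ := Subtype.ext (LinearMap.comp_smul _ _ _)
  comp_smul _ _ _ _ _ _ := Subtype.ext (LinearMap.smul_comp _ _ _)

/-- An equivariant linear isomorphism gives an isomorphism of representations. -/
def mkIso {M N : AlgRep k A} (e : M.V ≃ₗ[k] N.V)
    (h : ∀ a, e.toLinearMap ∘ₗ M.ρ a = N.ρ a ∘ₗ e.toLinearMap) : M ≅ N where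
  hom := ⟨e.toLinearMap, h⟩
  inv := ⟨e.symm.toLinearMap, fun a => by
    ext x
    apply e.injective
    have := LinearMap.congr_fun (h a) (e.symm x)
    simp only [LinearMap.comp_apply, LinearEquiv.coe_coe, LinearEquiv.apply_symm_apply] at this ⊢
    exact this.symm⟩
  hom_inv_id := by apply hom_ext; ext x; exact e.symm_apply_apply x
  inv_hom_id := by apply hom_ext; ext x; exact e.apply_symm_apply x

variable {B : Type} [Ring B] [Algebra k B]

/-- The representation of `B` on `M ⊗ N` obtained from a coaction `δ : B → A ⊗ B`. -/
noncomputable abbrev tens (δ : B →ₐ[k] A ⊗[k] B) (M : AlgRep k A) (N : AlgRep k B) :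
    AlgRep k B where
  V := M.V ⊗[k] N.V
  ρ := (outer M.ρ N.ρ).comp δ

/-- The tensor product of two intertwiners. -/
noncomputable def tensHom (δ : B →ₐ[k] A ⊗[k] B) {M M' : AlgRep k A} {N N' : AlgRep k B}
    (f : M ⟶ M') (g : N ⟶ N') : tens δ M N ⟶ tens δ M' N' :=
  ⟨TensorProduct.map (lin f) (lin g), fun b => outer_natural _ _ f.2 g.2 (δ b)⟩

end AlgRep

end Rep

section Monoidal

variable (k : Type) [Field k] (A : Type) [Ring A] [Bialgebra k A]

/-- `B` is a left comodule algebra over the bialgebra `A`. -/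
class LeftComoduleAlgebra (B : Type) [Ring B] [Algebra k B] where
  coact : B →ₐ[k] A ⊗[k] B
  coassoc : ∀ b, (TensorProduct.assoc k A A B)
      (Algebra.TensorProduct.map (Bialgebra.comulAlgHom k A) (AlgHom.id k B) (coact b)) =
        Algebra.TensorProduct.map (AlgHom.id k A) coact (coact b)
  counit : ∀ b, (TensorProduct.lid k B)
      (Algebra.TensorProduct.map (Bialgebra.counitAlgHom k A) (AlgHom.id k B) (coact b)) = b

variable {k A} {B : Type} [Ring B] [Algebra k B]

namespace AlgRep

/-- The trivial representation, given by the counit. -/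
noncomputable abbrev triv : AlgRep k A where
  V := k
  ρ := (Algebra.lmul k k).comp (Bialgebra.counitAlgHom k A)

lemma tens_assoc (M M' : AlgRep k A) (N : AlgRep k B) (δ : B →ₐ[k] A ⊗[k] B) (b : B)
    (h : TensorProduct.assoc k A A B
      (Algebra.TensorProduct.map (Bialgebra.comulAlgHom k A) (AlgHom.id k B) (δ b)) =
        Algebra.TensorProduct.map (AlgHom.id k A) δ (δ b)) :
    (TensorProduct.assoc k M.V M'.V N.V).toLinearMap ∘ₗ
        (tens δ (tens (Bialgebra.comulAlgHom k A) M M') N).ρ b =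
      (tens δ M (tens δ M' N)).ρ b ∘ₗ (TensorProduct.assoc k M.V M'.V N.V).toLinearMap := by
  have h1 := assoc_outer M.ρ M'.ρ N.ρ
    (Algebra.TensorProduct.map (Bialgebra.comulAlgHom k A) (AlgHom.id k B) (δ b))
  rw [h, outer_map, outer_map] at h1
  exact h1

lemma comul_coassoc (a : A) : TensorProduct.assoc k A A A
      (Algebra.TensorProduct.map (Bialgebra.comulAlgHom k A) (AlgHom.id k A)
        (Bialgebra.comulAlgHom k A a)) =
        Algebra.TensorProduct.map (AlgHom.id k A) (Bialgebra.comulAlgHom k A)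
          (Bialgebra.comulAlgHom k A a) :=
  Coalgebra.coassoc_apply a

lemma comul_lid (a : A) : TensorProduct.lid k A
      (Algebra.TensorProduct.map (Bialgebra.counitAlgHom k A) (AlgHom.id k A)
        (Bialgebra.comulAlgHom k A a)) = a := by
  have h := Coalgebra.rTensor_counit_comul (R := k) a
  exact (congrArg (TensorProduct.lid k A) h).trans (by simp)

lemma comul_rid (a : A) : TensorProduct.rid k A
      (Algebra.TensorProduct.map (AlgHom.id k A) (Bialgebra.counitAlgHom k A)
        (Bialgebra.comulAlgHom k A a)) = a := by
  have h := Coalgebra.lTensor_counit_comul (R := k) a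
  exact (congrArg (TensorProduct.rid k A) h).trans (by simp)

/-- Representations of a bialgebra form a monoidal category. -/
noncomputable instance : MonoidalCategory (AlgRep k A) where
  tensorObj M N := tens (Bialgebra.comulAlgHom k A) M N
  tensorHom f g := tensHom _ f g
  whiskerLeft M _ _ g := tensHom _ (𝟙 M) g
  whiskerRight f N := tensHom _ f (𝟙 N)
  tensorUnit := triv
  associator M N P := mkIso (TensorProduct.assoc k M.V N.V P.V) fun a =>
    tens_assoc M N P (Bialgebra.comulAlgHom k A) a (comul_coassoc a)
  leftUnitor M := mkIso (TensorProduct.lid k M.V) fun a =>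
    (lid_outer (Bialgebra.counitAlgHom k A) M.ρ (Bialgebra.comulAlgHom k A a)).trans
      (congrArg (fun x => M.ρ x ∘ₗ (TensorProduct.lid k M.V).toLinearMap) (comul_lid a))
  rightUnitor M := mkIso (TensorProduct.rid k M.V) fun a =>
    (rid_outer (Bialgebra.counitAlgHom k A) M.ρ (Bialgebra.comulAlgHom k A a)).trans
      (congrArg (fun x => M.ρ x ∘ₗ (TensorProduct.rid k M.V).toLinearMap) (comul_rid a))
  tensorHom_def f g := hom_ext (TensorProduct.ext' fun x y => rfl)
  id_tensorHom_id M N := hom_ext (TensorProduct.ext' fun x y => rfl)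
  tensorHom_comp_tensorHom f₁ f₂ g₁ g₂ := hom_ext (TensorProduct.ext' fun x y => rfl)
  whiskerLeft_id M N := hom_ext (TensorProduct.ext' fun x y => rfl)
  id_whiskerRight M N := hom_ext (TensorProduct.ext' fun x y => rfl)
  associator_naturality f g h := hom_ext (TensorProduct.ext_threefold fun x y z => rfl)
  leftUnitor_naturality f := hom_ext (TensorProduct.ext' fun x y =>
    ((lin f).map_smul x y).symm)
  rightUnitor_naturality f := hom_ext (TensorProduct.ext' fun x y =>
    ((lin f).map_smul y x).symm)
  pentagon M N P Q := hom_ext (TensorProduct.ext_fourfold fun x y z w => rfl)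
  triangle M N := hom_ext (TensorProduct.ext_threefold fun x y z =>
    (TensorProduct.smul_tmul (R := k) (y : k) x z).symm)

/-- Representations of the bialgebra `A` act on representations of the comodule algebra `B`. -/
noncomputable instance [LeftComoduleAlgebra k A B] :
    MonoidalLeftAction (AlgRep k A) (AlgRep k B) where
  actionObj M N := tens (LeftComoduleAlgebra.coact (k := k) (A := A)) M N
  actionHom f g := tensHom _ f g
  actionHomRight M _ _ g := tensHom _ (𝟙 M) g
  actionHomLeft f N := tensHom _ f (𝟙 N)
  actionAssocIso M N P := mkIso (TensorProduct.assoc k M.V N.V P.V) fun b =>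
    tens_assoc M N P LeftComoduleAlgebra.coact b (LeftComoduleAlgebra.coassoc b)
  actionUnitIso M := mkIso (TensorProduct.lid k M.V) fun b =>
    (lid_outer (Bialgebra.counitAlgHom k A) M.ρ (LeftComoduleAlgebra.coact b)).trans
      (congrArg (fun x => M.ρ x ∘ₗ (TensorProduct.lid k M.V).toLinearMap)
        (LeftComoduleAlgebra.counit b))
  actionHom_def f g := hom_ext (TensorProduct.ext' fun x y => rfl)
  actionHomRight_id M N := hom_ext (TensorProduct.ext' fun x y => rfl)
  id_actionHomLeft M N := hom_ext (TensorProduct.ext' fun x y => rfl)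
  actionHom_comp f₁ f₂ g₁ g₂ := hom_ext (TensorProduct.ext' fun x y => rfl)
  actionAssocIso_hom_naturality f g h :=
    hom_ext (TensorProduct.ext_threefold fun x y z => rfl)
  actionUnitIso_hom_naturality f := hom_ext (TensorProduct.ext' fun x y =>
    ((lin f).map_smul x y))
  whiskerLeft_actionHomLeft c _ _ f d := hom_ext (TensorProduct.ext_threefold fun x y z => rfl)
  whiskerRight_actionHomLeft c f d := hom_ext (TensorProduct.ext_threefold fun x y z => rfl)
  associator_actionHom M N P Q := hom_ext (TensorProduct.ext_fourfold fun x y z w => rfl)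
  leftUnitor_actionHom M N := hom_ext (TensorProduct.ext_threefold fun x y z =>
    rfl)
  rightUnitor_actionHom M N := hom_ext (TensorProduct.ext_threefold fun x y z =>
    (TensorProduct.smul_tmul (R := k) (y : k) x z))

end AlgRep
end Monoidal

section QuantumGroup

/-- Generators of the quantized enveloping algebra of `gl_n`: `q^h` for `h` in the weight lattice
`ℤ^n`, and `E_i`, `F_i` for `1 ≤ i ≤ n - 1`; indices are counted from `0` in the code. -/
inductive UqGen (n : ℕ)
  | qh (h : Fin n → ℤ)
  | E (i : Fin (n - 1))
  | F (i : Fin (n - 1))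

namespace UqGen

variable {n : ℕ}

/-- The position `i` in `{1, ..., n}`, for `1 ≤ i ≤ n - 1`. -/
def lo (i : Fin (n - 1)) : Fin n := ⟨i.1, by omega⟩

/-- The position `i + 1` in `{1, ..., n}`, for `1 ≤ i ≤ n - 1`. -/
def hi (i : Fin (n - 1)) : Fin n := ⟨i.1 + 1, by omega⟩

/-- The weight `h_i = ε_i - ε_{i+1}`, which is also the simple root `α_i`. -/
def hroot (i : Fin (n - 1)) : Fin n → ℤ := Pi.single (lo i) 1 - Pi.single (hi i) 1

/-- The pairing of a weight with the simple root `α_i = ε_i - ε_{i+1}`. -/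
def pair (h : Fin n → ℤ) (i : Fin (n - 1)) : ℤ := h (lo i) - h (hi i)

/-- The indices `i` and `j` are neighbours. -/
def Nbr (i j : Fin (n - 1)) : Prop := i.1 + 1 = j.1 ∨ j.1 + 1 = i.1

end UqGen

/-- The word algebra on the generators. -/
abbrev UqFree (n : ℕ) : Type := FreeAlgebra Kq (UqGen n)

/-- The generator `x` as an element of the word algebra. -/
noncomputable abbrev fgen {n : ℕ} (x : UqGen n) : UqFree n := FreeAlgebra.ι Kq x

open UqGen in
/-- The defining relations of the quantized enveloping algebra of `gl_n`. -/
inductive UqRel (n : ℕ) : UqFree n → UqFree n → Prop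
  | qzero : UqRel n (fgen (qh 0)) 1
  | qadd (h h' : Fin n → ℤ) : UqRel n (fgen (qh h) * fgen (qh h')) (fgen (qh (h + h')))
  | qE (h : Fin n → ℤ) (i : Fin (n - 1)) :
      UqRel n (fgen (qh h) * fgen (E i)) (qpar ^ pair h i • (fgen (E i) * fgen (qh h)))
  | qF (h : Fin n → ℤ) (i : Fin (n - 1)) :
      UqRel n (fgen (qh h) * fgen (F i)) (qpar ^ (-pair h i) • (fgen (F i) * fgen (qh h)))
  | EF (i : Fin (n - 1)) :
      UqRel n (fgen (E i) * fgen (F i) - fgen (F i) * fgen (E i))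
        ((qpar - qpar⁻¹)⁻¹ • (fgen (qh (hroot i)) - fgen (qh (-hroot i))))
  | EFne (i j : Fin (n - 1)) (h : i ≠ j) :
      UqRel n (fgen (E i) * fgen (F j)) (fgen (F j) * fgen (E i))
  | serreE (i j : Fin (n - 1)) (h : Nbr i j) :
      UqRel n (fgen (E i) * fgen (E i) * fgen (E j) + fgen (E j) * fgen (E i) * fgen (E i))
        (qnum 2 • (fgen (E i) * fgen (E j) * fgen (E i)))
  | serreF (i j : Fin (n - 1)) (h : Nbr i j) :
      UqRel n (fgen (F i) * fgen (F i) * fgen (F j) + fgen (F j) * fgen (F i) * fgen (F i))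
        (qnum 2 • (fgen (F i) * fgen (F j) * fgen (F i)))
  | farE (i j : Fin (n - 1)) (h : ¬ Nbr i j) :
      UqRel n (fgen (E i) * fgen (E j)) (fgen (E j) * fgen (E i))
  | farF (i j : Fin (n - 1)) (h : ¬ Nbr i j) :
      UqRel n (fgen (F i) * fgen (F j)) (fgen (F j) * fgen (F i))

/-- The quantized enveloping algebra of `gl_n` over `ℂ(q)`. -/
def Uq (n : ℕ) : Type := RingQuot (UqRel n)

noncomputable instance (n : ℕ) : Ring (Uq n) := inferInstanceAs (Ring (RingQuot (UqRel n)))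

noncomputable instance (n : ℕ) : Algebra Kq (Uq n) :=
  inferInstanceAs (Algebra Kq (RingQuot (UqRel n)))

namespace Uq

variable {n : ℕ}

/-- The quotient map from the word algebra. -/
noncomputable def mk (n : ℕ) : UqFree n →ₐ[Kq] Uq n := RingQuot.mkAlgHom Kq (UqRel n)

lemma mk_surjective (n : ℕ) : Function.Surjective (mk n) :=
  RingQuot.mkAlgHom_surjective Kq (UqRel n)

/-- The class of a generator. -/
noncomputable def gen (x : UqGen n) : Uq n := mk n (fgen x)

/-- The element `q^h`. -/
noncomputable abbrev qh (h : Fin n → ℤ) : Uq n := gen (UqGen.qh h)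

/-- The element `E_i`. -/
noncomputable abbrev E (i : Fin (n - 1)) : Uq n := gen (UqGen.E i)

/-- The element `F_i`. -/
noncomputable abbrev F (i : Fin (n - 1)) : Uq n := gen (UqGen.F i)

/-- The element `K_i = q^{h_i}`. -/
noncomputable abbrev K (i : Fin (n - 1)) : Uq n := qh (UqGen.hroot i)

/-- The element `K_i^{-1} = q^{-h_i}`. -/
noncomputable abbrev Kinv (i : Fin (n - 1)) : Uq n := qh (-UqGen.hroot i)

lemma rel {x y : UqFree n} (h : UqRel n x y) :
    FreeAlgebra.lift Kq (gen (n := n)) x = FreeAlgebra.lift Kq gen y := by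
  have h1 : FreeAlgebra.lift Kq (gen (n := n)) = mk n := by
    apply FreeAlgebra.hom_ext
    funext x
    exact FreeAlgebra.lift_ι_apply _ _
  rw [h1]
  exact RingQuot.mkAlgHom_rel Kq h

/-- An algebra map out of the quantum group is given by images of the generators which satisfy
the defining relations. -/
noncomputable def lift {A : Type*} [Ring A] [Algebra Kq A] (f : UqGen n → A)
    (hf : ∀ x y, UqRel n x y → FreeAlgebra.lift Kq f x = FreeAlgebra.lift Kq f y) :
    Uq n →ₐ[Kq] A :=
  RingQuot.liftAlgHom Kq ⟨FreeAlgebra.lift Kq f, fun {x y} h => hf x y h⟩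

lemma lift_gen {A : Type*} [Ring A] [Algebra Kq A] (f : UqGen n → A)
    (hf : ∀ x y, UqRel n x y → FreeAlgebra.lift Kq f x = FreeAlgebra.lift Kq f y) (x : UqGen n) :
    lift f hf (gen x) = f x := by
  refine (RingQuot.liftAlgHom_mkAlgHom_apply Kq _ _ _).trans ?_
  simp

lemma hom_ext {A : Type*} [Ring A] [Algebra Kq A] {f g : Uq n →ₐ[Kq] A}
    (h : ∀ x, f (gen x) = g (gen x)) : f = g := by
  refine RingQuot.ringQuot_ext' Kq f g ?_
  apply FreeAlgebra.hom_ext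
  funext x
  exact h x

end Uq
end QuantumGroup

section Hopf

lemma qpar_sq_ne_one : qpar ^ 2 ≠ 1 := by
  intro h
  have h1 : (algebraMap (Polynomial ℂ) (RatFunc ℂ)) (Polynomial.X ^ 2) =
      algebraMap (Polynomial ℂ) (RatFunc ℂ) 1 := by
    rw [map_pow, RatFunc.algebraMap_X, map_one]
    exact h
  have h2 := RatFunc.algebraMap_injective ℂ h1
  have h3 := congrArg Polynomial.natDegree h2
  simp at h3

lemma qpar_sub_ne_zero : qpar - qpar⁻¹ ≠ 0 := by
  intro h
  apply qpar_sq_ne_one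
  have := qpar_ne_zero
  field_simp at h
  linear_combination h

lemma qnum_two : qnum 2 = qpar + qpar⁻¹ := by
  have h := qpar_sub_ne_zero
  have h0 := qpar_ne_zero
  have h2 : qpar ^ 2 - 1 ≠ 0 := sub_ne_zero.mpr qpar_sq_ne_one
  rw [qnum, div_eq_iff h, zpow_neg]
  rw [show (2 : ℤ) = ((2 : ℕ) : ℤ) from rfl, zpow_natCast]
  field_simp
  ring

open UqGen in
lemma pair_hroot_self {n : ℕ} (i : Fin (n - 1)) : pair (hroot i) i = 2 := by
  have h : lo i ≠ hi i := by intro h; simp [lo, hi] at h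
  simp [pair, hroot, Pi.single_apply, h, h.symm]

open UqGen in
lemma pair_hroot_nbr {n : ℕ} {i j : Fin (n - 1)} (h : Nbr i j) : pair (hroot i) j = -1 := by
  simp only [Nbr] at h
  simp only [pair, hroot, Pi.single_apply, lo, hi, Pi.sub_apply, Fin.mk.injEq]
  split_ifs <;> omega

open UqGen in
lemma pair_hroot_far {n : ℕ} {i j : Fin (n - 1)} (h : ¬ Nbr i j) (hij : i ≠ j) :
    pair (hroot i) j = 0 := by
  simp only [Nbr] at h
  have : i.1 ≠ j.1 := fun h => hij (Fin.ext h)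
  simp only [pair, hroot, Pi.single_apply, lo, hi, Pi.sub_apply, Fin.mk.injEq]
  split_ifs <;> omega

open UqGen in
lemma pair_hroot_symm {n : ℕ} (i j : Fin (n - 1)) : pair (hroot i) j = pair (hroot j) i := by
  simp only [pair, hroot, Pi.single_apply, lo, hi, Pi.sub_apply, Fin.mk.injEq]
  split_ifs <;> omega

/-- The Serre relation is inherited by sums of suitably `q`-commuting elements. -/
lemma serre_add {R : Type*} [Ring R] [Algebra Kq R] {a b c d : R}
    (hab : a * b = qpar ^ 2 • (b * a)) (had : a * d = qpar⁻¹ • (d * a))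
    (hcb : c * b = qpar⁻¹ • (b * c))
    (h1 : a * a * c + c * a * a = qnum 2 • (a * c * a))
    (h2 : b * b * d + d * b * b = qnum 2 • (b * d * b)) :
    (a + b) * (a + b) * (c + d) + (c + d) * (a + b) * (a + b) =
      qnum 2 • ((a + b) * (c + d) * (a + b)) := by
  have h0 := qpar_ne_zero
  have e1 : a * b * c = qpar ^ 2 • (b * a * c) := by rw [hab, smul_mul_assoc]
  have e2 : a * c * b = qpar • (b * a * c) := by
    rw [mul_assoc, hcb, mul_smul_comm, ← mul_assoc, hab, smul_mul_assoc, smul_smul]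
    congr 1; field_simp
  have e3 : c * a * b = qpar • (b * c * a) := by
    rw [mul_assoc, hab, mul_smul_comm, ← mul_assoc, hcb, smul_mul_assoc, smul_smul]
    congr 1; field_simp
  have e4 : c * b * a = qpar⁻¹ • (b * c * a) := by rw [hcb, smul_mul_assoc]
  have e5 : a * a * d = qpar⁻¹ ^ 2 • (d * a * a) := by
    rw [mul_assoc, had, mul_smul_comm, ← mul_assoc, had, smul_mul_assoc, smul_smul, sq]
  have e6 : a * d * a = qpar⁻¹ • (d * a * a) := by rw [had, smul_mul_assoc]
  have e7 : c * b * b = qpar⁻¹ ^ 2 • (b * b * c) := by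
    rw [hcb, smul_mul_assoc, mul_assoc, hcb, mul_smul_comm, ← mul_assoc, smul_smul, sq]
  have e8 : b * c * b = qpar⁻¹ • (b * b * c) := by
    rw [mul_assoc, hcb, mul_smul_comm, ← mul_assoc]
  have e9 : a * b * d = qpar • (b * d * a) := by
    rw [hab, smul_mul_assoc, mul_assoc, had, mul_smul_comm, ← mul_assoc, smul_smul]
    congr 1; field_simp
  have e10 : b * a * d = qpar⁻¹ • (b * d * a) := by
    rw [mul_assoc, had, mul_smul_comm, ← mul_assoc]
  have e11 : a * d * b = qpar • (d * b * a) := by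
    rw [had, smul_mul_assoc, mul_assoc, hab, mul_smul_comm, ← mul_assoc, smul_smul]
    congr 1; field_simp
  have e12 : d * a * b = qpar ^ 2 • (d * b * a) := by
    rw [mul_assoc, hab, mul_smul_comm, ← mul_assoc]
  have h1' : c * a * a = qnum 2 • (a * c * a) - a * a * c := by rw [← h1]; abel
  have h2' : d * b * b = qnum 2 • (b * d * b) - b * b * d := by rw [← h2]; abel
  simp only [mul_add, add_mul, smul_add, e1, e2, e3, e4, e5, e6, e7, e8, e9, e10, e11, e12,
    h1', h2', qnum_two]
  match_scalars <;> field_simp <;> ring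

namespace Uq

variable {n : ℕ}

open UqGen (pair hroot Nbr)

lemma qh_zero : (qh 0 : Uq n) = 1 := by
  simpa using rel (UqRel.qzero (n := n))

lemma qh_mul (h h' : Fin n → ℤ) : (qh h * qh h' : Uq n) = qh (h + h') := by
  simpa using rel (UqRel.qadd h h')

lemma qh_E (h : Fin n → ℤ) (i : Fin (n - 1)) :
    qh h * E i = qpar ^ pair h i • (E i * qh h) := by
  simpa using rel (UqRel.qE h i)

lemma qh_F (h : Fin n → ℤ) (i : Fin (n - 1)) :
    qh h * F i = qpar ^ (-pair h i) • (F i * qh h) := by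
  simpa only [map_mul, map_smul, FreeAlgebra.lift_ι_apply] using rel (UqRel.qF h i)

lemma E_F (i : Fin (n - 1)) :
    E i * F i - F i * E i = (qpar - qpar⁻¹)⁻¹ • (K i - Kinv i) := by
  simpa using rel (UqRel.EF i)

lemma E_F_ne {i j : Fin (n - 1)} (h : i ≠ j) : E i * F j = F j * E i := by
  simpa using rel (UqRel.EFne i j h)

lemma serre_E {i j : Fin (n - 1)} (h : Nbr i j) :
    E i * E i * E j + E j * E i * E i = qnum 2 • (E i * E j * E i) := by
  simpa using rel (UqRel.serreE i j h)

lemma serre_F {i j : Fin (n - 1)} (h : Nbr i j) :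
    F i * F i * F j + F j * F i * F i = qnum 2 • (F i * F j * F i) := by
  simpa using rel (UqRel.serreF i j h)

lemma far_E {i j : Fin (n - 1)} (h : ¬ Nbr i j) : E i * E j = E j * E i := by
  simpa using rel (UqRel.farE i j h)

lemma far_F {i j : Fin (n - 1)} (h : ¬ Nbr i j) : F i * F j = F j * F i := by
  simpa using rel (UqRel.farF i j h)

lemma Kinv_E (i j : Fin (n - 1)) :
    Kinv i * E j = qpar ^ (-pair (hroot i) j) • (E j * Kinv i) := by
  have := qh_E (-hroot i) j
  rwa [show pair (-hroot i) j = -pair (hroot i) j by simp [pair]; ring] at this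

lemma Kinv_F (i j : Fin (n - 1)) :
    Kinv i * F j = qpar ^ pair (hroot i) j • (F j * Kinv i) := by
  have := qh_F (-hroot i) j
  rwa [show -pair (-hroot i) j = pair (hroot i) j by simp [pair]; ring] at this

/-- The values of the comultiplication on generators:
`q^h ↦ q^h ⊗ q^h`, `E_i ↦ E_i ⊗ K_i + 1 ⊗ E_i`, `F_i ↦ F_i ⊗ 1 + K_i^{-1} ⊗ F_i`. -/
noncomputable def comulGen : UqGen n → Uq n ⊗[Kq] Uq n
  | UqGen.qh h => qh h ⊗ₜ qh h
  | UqGen.E i => E i ⊗ₜ K i + 1 ⊗ₜ E i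
  | UqGen.F i => F i ⊗ₜ 1 + Kinv i ⊗ₜ F i

/-- The values of the counit on generators: `q^h ↦ 1`, `E_i ↦ 0`, `F_i ↦ 0`. -/
noncomputable def counitGen : UqGen n → Kq
  | UqGen.qh _ => 1
  | UqGen.E _ => 0
  | UqGen.F _ => 0

lemma counit_rel (x y : UqFree n) (h : UqRel n x y) :
    FreeAlgebra.lift Kq (counitGen (n := n)) x = FreeAlgebra.lift Kq counitGen y := by
  cases h <;> simp [counitGen]

lemma cross_E (i j : Fin (n - 1)) :
    (E i ⊗ₜ[Kq] K i) * (1 ⊗ₜ E j) =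
      qpar ^ pair (hroot i) j • (((1 : Uq n) ⊗ₜ[Kq] E j) * (E i ⊗ₜ K i)) := by
  rw [Algebra.TensorProduct.tmul_mul_tmul, Algebra.TensorProduct.tmul_mul_tmul, qh_E, tmul_smul,
    one_mul, mul_one]

lemma cross_F (i j : Fin (n - 1)) :
    (Kinv i ⊗ₜ[Kq] F i) * (F j ⊗ₜ 1) =
      qpar ^ pair (hroot i) j • ((F j ⊗ₜ[Kq] (1 : Uq n)) * (Kinv i ⊗ₜ F i)) := by
  rw [Algebra.TensorProduct.tmul_mul_tmul, Algebra.TensorProduct.tmul_mul_tmul, Kinv_F, smul_tmul',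
    one_mul, mul_one]

lemma qh_comm (h h' : Fin n → ℤ) : (qh h * qh h' : Uq n) = qh h' * qh h := by
  rw [qh_mul, qh_mul, add_comm]

lemma qh_rot (h h' : Fin n → ℤ) : (qh h' * qh h * qh h : Uq n) = qh h * qh h * qh h' := by
  rw [qh_mul, qh_mul, qh_mul, qh_mul, add_rotate]

lemma qh_rot' (h h' : Fin n → ℤ) : (qh h * qh h' * qh h : Uq n) = qh h * qh h * qh h' := by
  rw [mul_assoc, qh_comm h', ← mul_assoc]

lemma comul_EF (i j : Fin (n - 1)) :
    (E i ⊗ₜ[Kq] K i + 1 ⊗ₜ E i) * (F j ⊗ₜ[Kq] 1 + Kinv j ⊗ₜ F j) -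
      (F j ⊗ₜ[Kq] 1 + Kinv j ⊗ₜ F j) * (E i ⊗ₜ[Kq] K i + 1 ⊗ₜ E i) =
    (E i * F j - F j * E i) ⊗ₜ[Kq] K i + Kinv j ⊗ₜ[Kq] (E i * F j - F j * E i) := by
  have h1 : (E i * Kinv j) ⊗ₜ[Kq] (K i * F j) = (Kinv j * E i) ⊗ₜ[Kq] (F j * K i) := by
    rw [Kinv_E, qh_F, tmul_smul, smul_tmul', pair_hroot_symm]
  simp only [mul_add, add_mul, Algebra.TensorProduct.tmul_mul_tmul, one_mul, mul_one, h1,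
    sub_tmul, tmul_sub]
  abel

lemma comul_rel (x y : UqFree n) (h : UqRel n x y) :
    FreeAlgebra.lift Kq (comulGen (n := n)) x = FreeAlgebra.lift Kq comulGen y := by
  have h0 := qpar_ne_zero
  cases h with
  | qzero => simp [comulGen, qh_zero, Algebra.TensorProduct.one_def]
  | qadd h h' => simp [comulGen, qh_mul]
  | qE h i =>
    simp only [map_mul, map_smul, FreeAlgebra.lift_ι_apply, comulGen, mul_add, add_mul,
      Algebra.TensorProduct.tmul_mul_tmul, qh_E, qh_mul, one_mul, mul_one, tmul_smul, smul_tmul',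
      smul_add, add_comm h]
  | qF h i =>
    simp only [map_mul, map_smul, FreeAlgebra.lift_ι_apply, comulGen, mul_add, add_mul,
      Algebra.TensorProduct.tmul_mul_tmul, qh_F, qh_mul, one_mul, mul_one, tmul_smul, smul_tmul',
      smul_add, add_comm h]
  | EF i =>
    simp only [map_mul, map_smul, map_sub, FreeAlgebra.lift_ι_apply, comulGen]
    rw [comul_EF, E_F, ← smul_tmul', tmul_smul, ← smul_add]
    congr 1
    rw [sub_tmul, tmul_sub]
    abel
  | EFne i j h =>
    simp only [map_mul, FreeAlgebra.lift_ι_apply, comulGen]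
    rw [← sub_eq_zero, comul_EF, E_F_ne h, sub_self, zero_tmul, tmul_zero, add_zero]
  | serreE i j h =>
    simp only [map_mul, map_smul, map_add, FreeAlgebra.lift_ι_apply, comulGen]
    apply serre_add
    · rw [cross_E, pair_hroot_self]; rfl
    · rw [cross_E, pair_hroot_nbr h, zpow_neg_one]
    · rw [cross_E, pair_hroot_nbr h.symm, zpow_neg_one]
    · simp only [Algebra.TensorProduct.tmul_mul_tmul]
      rw [qh_rot, qh_rot', ← add_tmul, serre_E h, smul_tmul']
    · simp only [Algebra.TensorProduct.tmul_mul_tmul, mul_one]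
      rw [← tmul_add, serre_E h, tmul_smul]
  | serreF i j h =>
    simp only [map_mul, map_smul, map_add, FreeAlgebra.lift_ι_apply, comulGen]
    rw [add_comm (F i ⊗ₜ 1), add_comm (F j ⊗ₜ 1)]
    apply serre_add
    · rw [cross_F, pair_hroot_self]; rfl
    · rw [cross_F, pair_hroot_nbr h, zpow_neg_one]
    · rw [cross_F, pair_hroot_nbr h.symm, zpow_neg_one]
    · simp only [Algebra.TensorProduct.tmul_mul_tmul]
      rw [qh_rot, qh_rot', ← tmul_add, serre_F h, tmul_smul]
    · simp only [Algebra.TensorProduct.tmul_mul_tmul, mul_one]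
      rw [← add_tmul, serre_F h, smul_tmul']
  | farE i j h =>
    by_cases hij : i = j
    · rw [hij]
    have h' : ¬ Nbr j i := fun h' => h h'.symm
    simp only [map_mul, FreeAlgebra.lift_ι_apply, comulGen, mul_add, add_mul, cross_E,
      pair_hroot_far h hij, pair_hroot_far h' (Ne.symm hij), zpow_zero, one_smul]
    simp only [Algebra.TensorProduct.tmul_mul_tmul, mul_one, one_mul]
    rw [far_E h, qh_comm (hroot i)]
    abel
  | farF i j h =>
    by_cases hij : i = j
    · rw [hij]
    have h' : ¬ Nbr j i := fun h' => h h'.symm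
    simp only [map_mul, FreeAlgebra.lift_ι_apply, comulGen, mul_add, add_mul, cross_F,
      pair_hroot_far h hij, pair_hroot_far h' (Ne.symm hij), zpow_zero, one_smul]
    simp only [Algebra.TensorProduct.tmul_mul_tmul, mul_one, one_mul]
    rw [far_F h, qh_comm (-hroot i)]
    abel

/-- The comultiplication. -/
noncomputable def comulHom : Uq n →ₐ[Kq] Uq n ⊗[Kq] Uq n := lift comulGen comul_rel

/-- The counit. -/
noncomputable def counitHom : Uq n →ₐ[Kq] Kq := lift counitGen counit_rel

lemma comulHom_gen (x : UqGen n) : comulHom (gen x) = comulGen x := lift_gen _ _ x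

lemma counitHom_gen (x : UqGen n) : counitHom (gen x) = counitGen x := lift_gen _ _ x

/-- The bialgebra structure of the quantum group. -/
noncomputable instance : Bialgebra Kq (Uq n) :=
  Bialgebra.ofAlgHom comulHom counitHom
    (by
      apply hom_ext
      intro x
      cases x <;>
        simp [comulHom_gen, comulGen, tmul_add, add_tmul, Algebra.TensorProduct.one_def,
          add_assoc])
    (by
      apply hom_ext
      intro x
      cases x <;> simp [comulHom_gen, counitHom_gen, comulGen, counitGen])
    (by
      apply hom_ext
      intro x
      cases x <;> simp [comulHom_gen, counitHom_gen, comulGen, counitGen])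

lemma comulAlgHom_gen (x : UqGen n) : Bialgebra.comulAlgHom Kq (Uq n) (gen x) = comulGen x :=
  comulHom_gen x

end Uq

end Hopf

section Coideal

namespace Uq

variable {n : ℕ}

open UqGen (pair hroot Nbr)

/-- The cubic element `T_i` for consecutive indices `l = i - 1`, `i`, `r = i + 1`. -/
noncomputable def T (l i r : Fin (n - 1)) : Uq n :=
  E l * E r * E i - qpar⁻¹ • (E l * E i * E r) - qpar⁻¹ • (E r * E i * E l) +
    qpar⁻¹ ^ 2 • (E i * E l * E r)

/-- The element `B_i = F_i - K_i^{-1} T_i`, where `l = i - 1` and `r = i + 1`. -/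
noncomputable def B (l i r : Fin (n - 1)) : Uq n := F i - Kinv i * T l i r

end Uq

open Uq in
/-- The generators of the coideal subalgebra: `E_i`, `F_i`, `K_i`, `K_i^{-1}` for
`i = 1, 3, 5, ...`, and `B_i` for `i = 2, 4, 6, ...`. (The code counts from `0`, which swaps
even and odd.) -/
inductive SpGen (n : ℕ) : Uq n → Prop
  | E (i : Fin (n - 1)) (hi : Even i.1) : SpGen n (E i)
  | F (i : Fin (n - 1)) (hi : Even i.1) : SpGen n (F i)
  | K (i : Fin (n - 1)) (hi : Even i.1) : SpGen n (K i)
  | Kinv (i : Fin (n - 1)) (hi : Even i.1) : SpGen n (Kinv i)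
  | B (l i r : Fin (n - 1)) (hi : Odd i.1) (hl : l.1 + 1 = i.1) (hr : i.1 + 1 = r.1) :
      SpGen n (B l i r)

/-- The coideal subalgebra `U'_q(sp_n)` of the quantized enveloping algebra of `gl_n`. -/
noncomputable def Uqsp (n : ℕ) : Subalgebra Kq (Uq n) := Algebra.adjoin Kq {x | SpGen n x}

namespace Uq

variable {n : ℕ}

open UqGen (pair hroot Nbr)

lemma adE_comul {i r : Fin (n - 1)} (h : Nbr i r) :
    (E r ⊗ₜ[Kq] K r + 1 ⊗ₜ E r) * (E i ⊗ₜ[Kq] K i + 1 ⊗ₜ E i) -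
      qpar⁻¹ • ((E i ⊗ₜ[Kq] K i + 1 ⊗ₜ E i) * (E r ⊗ₜ[Kq] K r + 1 ⊗ₜ E r)) =
    (E r * E i - qpar⁻¹ • (E i * E r)) ⊗ₜ[Kq] (K i * K r) +
      (qpar - qpar⁻¹) • (E i ⊗ₜ[Kq] (K i * E r)) +
      1 ⊗ₜ[Kq] (E r * E i - qpar⁻¹ • (E i * E r)) := by
  have h0 := qpar_ne_zero
  have h1 : K r * E i = qpar⁻¹ • (E i * K r) := by
    rw [qh_E, pair_hroot_nbr h.symm, zpow_neg_one]
  have h2 : K i * E r = qpar⁻¹ • (E r * K i) := by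
    rw [qh_E, pair_hroot_nbr h, zpow_neg_one]
  simp only [mul_add, add_mul, Algebra.TensorProduct.tmul_mul_tmul, one_mul, mul_one, h1, h2,
    sub_tmul, tmul_sub, ← smul_tmul', tmul_smul, qh_comm (hroot r)]
  match_scalars <;> field_simp
  all_goals ring

lemma comul_T {l i r : Fin (n - 1)} (hl : Nbr i l) (hr : Nbr i r) (hlr : ¬ Nbr l r)
    (hne : l ≠ r) :
    comulHom (T l i r) = T l i r ⊗ₜ (K i * (K l * K r)) +
      (qpar - qpar⁻¹) • ((E r * E i - qpar⁻¹ • (E i * E r)) ⊗ₜ[Kq] (K i * (K r * E l))) +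
      (qpar - qpar⁻¹) • ((E l * E i - qpar⁻¹ • (E i * E l)) ⊗ₜ[Kq] (K i * (K l * E r))) +
      (qpar - qpar⁻¹) ^ 2 • (E i ⊗ₜ[Kq] (K i * (E l * E r))) + 1 ⊗ₜ T l i r := by
  have h0 := qpar_ne_zero
  have hlr' : ¬ Nbr r l := fun h => hlr h.symm
  set X := E r * E i - qpar⁻¹ • (E i * E r) with hX
  have hT : T l i r = E l * X - qpar⁻¹ • (X * E l) := by
    rw [hX, T]
    rw [show E i * E l * E r = E i * E r * E l by rw [mul_assoc, far_E hlr, mul_assoc]]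
    simp only [mul_sub, sub_mul, mul_smul_comm, smul_mul_assoc, mul_assoc, smul_sub]
    match_scalars <;> ring
  have hcX : comulHom X = X ⊗ₜ[Kq] (K i * K r) +
      (qpar - qpar⁻¹) • (E i ⊗ₜ[Kq] (K i * E r)) + 1 ⊗ₜ[Kq] X := by
    rw [hX, map_sub, map_smul, map_mul, map_mul, comulHom_gen, comulHom_gen]
    exact adE_comul hr
  have k1 : E l * K i = qpar • (K i * E l) := by
    rw [qh_E, pair_hroot_nbr hl, zpow_neg_one, smul_smul, mul_inv_cancel₀ h0, one_smul]
  have k2 : E l * K r = K r * E l := by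
    rw [qh_E, pair_hroot_far hlr' hne.symm, zpow_zero, one_smul]
  have k3 : K l * E r = E r * K l := by
    rw [qh_E, pair_hroot_far hlr hne, zpow_zero, one_smul]
  have k4 : K l * E i = qpar⁻¹ • (E i * K l) := by
    rw [qh_E, pair_hroot_nbr hl.symm, zpow_neg_one]
  have m1 : K l * (K i * K r) = K i * (K l * K r) := by
    rw [← mul_assoc, qh_comm (hroot l), mul_assoc]
  have m1' : K i * K r * K l = K i * (K l * K r) := by
    rw [mul_assoc, qh_comm (hroot r)]
  have m2 : E l * (K i * K r) = qpar • (K i * (K r * E l)) := by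
    rw [← mul_assoc, k1, smul_mul_assoc, mul_assoc, k2]
  have m3 : K l * (K i * E r) = K i * (K l * E r) := by
    rw [← mul_assoc, qh_comm (hroot l), mul_assoc]
  have m3' : K i * E r * K l = K i * (K l * E r) := by
    rw [mul_assoc, ← k3]
  have m4 : E l * (K i * E r) = qpar • (K i * (E l * E r)) := by
    rw [← mul_assoc, k1, smul_mul_assoc, mul_assoc]
  have m4' : K i * E r * E l = K i * (E l * E r) := by
    rw [mul_assoc, far_E hlr]
  have m5 : K l * X = qpar⁻¹ • (X * K l) := by
    rw [hX]
    simp only [mul_sub, sub_mul, mul_smul_comm, smul_mul_assoc]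
    rw [← mul_assoc, k3, mul_assoc, k4, ← mul_assoc, k4, smul_mul_assoc, mul_assoc, k3]
    simp only [mul_smul_comm, mul_assoc, smul_sub]
  rw [hT, map_sub, map_smul, map_mul, map_mul, hcX, comulHom_gen]
  simp only [comulGen]
  simp only [mul_add, add_mul, Algebra.TensorProduct.tmul_mul_tmul, one_mul, mul_one,
    sub_tmul, tmul_sub, ← smul_tmul', tmul_smul, mul_smul_comm, smul_mul_assoc, m1, m1', m2, m3,
    m3', m4, m4', m5, mul_assoc (K i) (K r) (E l)]
  match_scalars <;> field_simp <;> ring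

lemma mem_of_gen {x : Uq n} (h : SpGen n x) : x ∈ Uqsp n := Algebra.subset_adjoin h

/-- The inclusion of `U ⊗ U'` in `U ⊗ U`. -/
noncomputable def incl (n : ℕ) : Uq n ⊗[Kq] Uqsp n →ₐ[Kq] Uq n ⊗[Kq] Uq n :=
  Algebra.TensorProduct.map (AlgHom.id Kq (Uq n)) (Uqsp n).val

lemma incl_injective : Function.Injective (incl n) :=
  Module.Flat.lTensor_preserves_injective_linearMap (M := Uq n) (Uqsp n).val.toLinearMap
    Subtype.val_injective

lemma tmul_mem (x : Uq n) {y : Uq n} (hy : y ∈ Uqsp n) : x ⊗ₜ[Kq] y ∈ (incl n).range :=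
  ⟨x ⊗ₜ ⟨y, hy⟩, by simp [incl]⟩

lemma comul_B_mem {l i r : Fin (n - 1)} (hi : Odd i.1) (hl : l.1 + 1 = i.1)
    (hr : i.1 + 1 = r.1) : comulHom (B l i r) ∈ (incl n).range := by
  have nl : Nbr i l := Or.inr hl
  have nr : Nbr i r := Or.inl hr
  have nlr : ¬ Nbr l r := by simp only [Nbr]; omega
  have ne : l ≠ r := by intro h; rw [h] at hl; omega
  have el : Even l.1 := by
    obtain ⟨k, hk⟩ := hi
    exact ⟨k, by omega⟩
  have er : Even r.1 := by
    obtain ⟨k, hk⟩ := hi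
    exact ⟨k + 1, by omega⟩
  have hKK : Kinv i * K i = 1 := by rw [qh_mul, neg_add_cancel, qh_zero]
  have key : comulHom (B l i r) = F i ⊗ₜ[Kq] 1 -
      ((Kinv i * T l i r) ⊗ₜ[Kq] (K l * K r) +
      (qpar - qpar⁻¹) • ((Kinv i * (E r * E i - qpar⁻¹ • (E i * E r))) ⊗ₜ[Kq] (K r * E l)) +
      (qpar - qpar⁻¹) • ((Kinv i * (E l * E i - qpar⁻¹ • (E i * E l))) ⊗ₜ[Kq] (K l * E r)) +
      (qpar - qpar⁻¹) ^ 2 • ((Kinv i * E i) ⊗ₜ[Kq] (E l * E r))) + Kinv i ⊗ₜ[Kq] B l i r := by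
    rw [B, map_sub, map_mul, comul_T nl nr nlr ne, comulHom_gen, comulHom_gen]
    simp only [comulGen, mul_add, mul_smul_comm, Algebra.TensorProduct.tmul_mul_tmul, mul_one]
    simp only [← mul_assoc (Kinv i) (K i), hKK, one_mul, tmul_sub]
    abel
  rw [key]
  have hE {j : Fin (n - 1)} (h : Even j.1) : E j ∈ Uqsp n := mem_of_gen (SpGen.E j h)
  have hK {j : Fin (n - 1)} (h : Even j.1) : K j ∈ Uqsp n := mem_of_gen (SpGen.K j h)
  refine add_mem (sub_mem (tmul_mem _ (one_mem _)) (add_mem (add_mem (add_mem ?_ ?_) ?_) ?_)) ?_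
  · exact tmul_mem _ (mul_mem (hK el) (hK er))
  · exact Subalgebra.smul_mem _ (tmul_mem _ (mul_mem (hK er) (hE el))) _
  · exact Subalgebra.smul_mem _ (tmul_mem _ (mul_mem (hK el) (hE er))) _
  · exact Subalgebra.smul_mem _ (tmul_mem _ (mul_mem (hE el) (hE er))) _
  · exact tmul_mem _ (mem_of_gen (SpGen.B l i r hi hl hr))

lemma comul_mem (b : Uqsp n) : comulHom b.1 ∈ (incl n).range := by
  have h : Uqsp n ≤ (incl n).range.comap comulHom := by
    refine Algebra.adjoin_le ?_
    intro x hx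
    change comulHom x ∈ (incl n).range
    cases hx with
    | E i hi =>
      rw [comulHom_gen]
      exact add_mem (tmul_mem _ (mem_of_gen (SpGen.K i hi))) (tmul_mem _ (mem_of_gen (SpGen.E i hi)))
    | F i hi =>
      rw [comulHom_gen]
      exact add_mem (tmul_mem _ (one_mem _)) (tmul_mem _ (mem_of_gen (SpGen.F i hi)))
    | K i hi =>
      rw [comulHom_gen]
      exact tmul_mem _ (mem_of_gen (SpGen.K i hi))
    | Kinv i hi =>
      rw [comulHom_gen]
      exact tmul_mem _ (mem_of_gen (SpGen.Kinv i hi))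
    | B l i r hi hl hr => exact comul_B_mem hi hl hr
  exact h b.2

/-- The coaction `U' → U ⊗ U'`, which is the restriction of the comultiplication. -/
noncomputable def coactHom : Uqsp n →ₐ[Kq] Uq n ⊗[Kq] Uqsp n :=
  (AlgEquiv.ofInjective (incl n) incl_injective).symm.toAlgHom.comp
    ((comulHom.comp (Uqsp n).val).codRestrict (incl n).range comul_mem)

lemma incl_coactHom (b : Uqsp n) : incl n (coactHom b) = comulHom b.1 :=
  congrArg Subtype.val ((AlgEquiv.ofInjective (incl n) incl_injective).apply_symm_apply
    ⟨comulHom b.1, comul_mem b⟩)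

lemma incl_eq (t : Uq n ⊗[Kq] Uqsp n) :
    incl n t = (LinearMap.lTensor (Uq n) (Uqsp n).val.toLinearMap) t := rfl

/-- `U'_q(sp_n)` is a left comodule algebra over the quantized enveloping algebra of `gl_n`. -/
noncomputable instance : LeftComoduleAlgebra Kq (Uq n) (Uqsp n) where
  coact := coactHom
  coassoc b := by
    have hinj : Function.Injective (LinearMap.lTensor (Uq n)
        (LinearMap.lTensor (Uq n) (Uqsp n).val.toLinearMap)) :=
      Module.Flat.lTensor_preserves_injective_linearMap _ incl_injective
    have aux : ∀ (s : Uq n ⊗[Kq] Uq n) (y : Uqsp n), (LinearMap.lTensor (Uq n)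
        (LinearMap.lTensor (Uq n) (Uqsp n).val.toLinearMap))
          ((TensorProduct.assoc Kq _ _ _) (s ⊗ₜ[Kq] y)) =
        (TensorProduct.assoc Kq _ _ _) (s ⊗ₜ[Kq] y.1) := by
      intro s y
      induction s using TensorProduct.induction_on with
      | zero => simp only [zero_tmul, map_zero]
      | tmul a b => rfl
      | add x z hx hz => simp only [add_tmul, map_add, hx, hz]
    apply hinj
    have h1 : ∀ t : Uq n ⊗[Kq] Uqsp n, (LinearMap.lTensor (Uq n)
        (LinearMap.lTensor (Uq n) (Uqsp n).val.toLinearMap)) ((TensorProduct.assoc Kq _ _ _)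
          (Algebra.TensorProduct.map (Bialgebra.comulAlgHom Kq (Uq n)) (AlgHom.id Kq (Uqsp n)) t)) =
        (TensorProduct.assoc Kq _ _ _) (Algebra.TensorProduct.map (Bialgebra.comulAlgHom Kq (Uq n))
          (AlgHom.id Kq (Uq n)) (incl n t)) := by
      intro t
      induction t using TensorProduct.induction_on with
      | zero => simp only [map_zero]
      | tmul x y =>
        exact aux (Bialgebra.comulAlgHom Kq (Uq n) x) y
      | add x y hx hy => simp only [map_add, hx, hy]
    have h2 : ∀ t : Uq n ⊗[Kq] Uqsp n, (LinearMap.lTensor (Uq n)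
        (LinearMap.lTensor (Uq n) (Uqsp n).val.toLinearMap))
          (Algebra.TensorProduct.map (AlgHom.id Kq (Uq n)) coactHom t) =
        Algebra.TensorProduct.map (AlgHom.id Kq (Uq n)) (Bialgebra.comulAlgHom Kq (Uq n))
          (incl n t) := by
      intro t
      induction t using TensorProduct.induction_on with
      | zero => simp only [map_zero]
      | tmul x y =>
        exact congrArg (fun z => x ⊗ₜ[Kq] z) (incl_coactHom y)
      | add x y hx hy => simp only [map_add, hx, hy]
    rw [h1, h2, incl_coactHom]
    exact AlgRep.comul_coassoc b.1
  counit b := by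
    apply Subtype.val_injective
    have h1 : ∀ t : Uq n ⊗[Kq] Uqsp n, ((TensorProduct.lid Kq (Uqsp n)) (Algebra.TensorProduct.map
        (Bialgebra.counitAlgHom Kq (Uq n)) (AlgHom.id Kq (Uqsp n)) t)).1 =
        (TensorProduct.lid Kq (Uq n)) (Algebra.TensorProduct.map
          (Bialgebra.counitAlgHom Kq (Uq n)) (AlgHom.id Kq (Uq n)) (incl n t)) := by
      intro t
      induction t using TensorProduct.induction_on with
      | zero => rw [map_zero, map_zero, map_zero, map_zero, map_zero]; rfl
      | tmul x y => rfl
      | add x y hx hy => rw [map_add, map_add, map_add, map_add, map_add, ← hx, ← hy]; rfl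
    rw [h1, incl_coactHom]
    exact AlgRep.comul_lid b.1

end Uq

end Coideal

section VectorRep

open UqGen (lo hi pair hroot Nbr)

lemma lo_ne_hi {n : ℕ} (i : Fin (n - 1)) : lo i ≠ hi i := by
  intro h
  simp [lo, hi] at h

/-- The matrices of the generators in the vector representation:
`q^h v_j = q^{h_j} v_j`, `E_i v_{i+1} = v_i` and `F_i v_i = v_{i+1}`. -/
noncomputable def vecMat {n : ℕ} : UqGen n → Matrix (Fin n) (Fin n) Kq
  | UqGen.qh h => Matrix.diagonal fun j => qpar ^ h j
  | UqGen.E i => Matrix.single (lo i) (hi i) 1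
  | UqGen.F i => Matrix.single (hi i) (lo i) 1

lemma vecMat_rel {n : ℕ} (x y : UqFree n) (h : UqRel n x y) :
    FreeAlgebra.lift Kq (vecMat (n := n)) x = FreeAlgebra.lift Kq vecMat y := by
  have h0 := qpar_ne_zero
  cases h with
  | qzero => simp [vecMat]
  | qadd h h' => simp [vecMat, zpow_add₀ h0]
  | qE h i =>
    simp only [map_mul, map_smul, FreeAlgebra.lift_ι_apply, vecMat]
    ext a b
    simp only [Matrix.diagonal_mul, Matrix.smul_apply, Matrix.mul_diagonal, Matrix.single_apply,
      smul_eq_mul]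
    split_ifs with hab
    · rw [← hab.1, ← hab.2, mul_one, one_mul, pair, ← zpow_add₀ h0]
      congr 1; ring
    · simp
  | qF h i =>
    simp only [map_mul, map_smul, FreeAlgebra.lift_ι_apply, vecMat]
    ext a b
    simp only [Matrix.diagonal_mul, Matrix.smul_apply, Matrix.mul_diagonal, Matrix.single_apply,
      smul_eq_mul]
    split_ifs with hab
    · rw [← hab.1, ← hab.2, mul_one, one_mul, pair, ← zpow_add₀ h0]
      congr 1; ring
    · simp
  | EF i =>
    have hq := qpar_sub_ne_zero
    have hn := lo_ne_hi i
    simp only [map_mul, map_smul, map_sub, FreeAlgebra.lift_ι_apply, vecMat,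
      Matrix.single_mul_single_same, mul_one]
    ext a b
    simp only [Matrix.sub_apply, Matrix.smul_apply, Matrix.single_apply, Matrix.diagonal_apply,
      smul_eq_mul, hroot, Pi.sub_apply, Pi.neg_apply, Pi.single_apply]
    by_cases hab : a = b
    · subst hab
      by_cases h1 : a = lo i
      · subst h1
        simp [hn, hn.symm]
        exact (inv_mul_cancel₀ hq).symm
      · by_cases h2 : a = hi i
        · subst h2
          simp [hn, hn.symm]
          linear_combination inv_mul_cancel₀ hq
        · simp [h1, h2, Ne.symm h1, Ne.symm h2]
    · have h1 : ¬ (lo i = a ∧ lo i = b) := fun h => hab (h.1.symm.trans h.2)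
      have h2 : ¬ (hi i = a ∧ hi i = b) := fun h => hab (h.1.symm.trans h.2)
      simp [hab, h1, h2]
  | EFne i j h =>
    have h1 : hi i ≠ hi j := by
      intro h'; apply h; apply Fin.ext; simpa [hi] using h'
    have h2 : lo j ≠ lo i := by
      intro h'; apply h; apply Fin.ext; simp only [lo, Fin.mk.injEq] at h'; exact h'.symm
    simp only [map_mul, FreeAlgebra.lift_ι_apply, vecMat]
    rw [Matrix.single_mul_single_of_ne _ _ _ _ h1, Matrix.single_mul_single_of_ne _ _ _ _ h2]
  | serreE i j h =>
    simp only [map_mul, map_smul, map_add, FreeAlgebra.lift_ι_apply, vecMat]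
    rw [Matrix.single_mul_single_of_ne _ _ _ _ (lo_ne_hi i).symm, mul_assoc _ _ (Matrix.single _ _ _),
      Matrix.single_mul_single_of_ne _ _ _ _ (lo_ne_hi i).symm]
    by_cases h1 : hi i = lo j
    · have h2 : hi j ≠ lo i := by
        simp only [lo, hi, Fin.mk.injEq, ne_eq] at h1 ⊢; omega
      rw [mul_assoc, Matrix.single_mul_single_of_ne _ _ _ _ h2]
      simp
    · rw [Matrix.single_mul_single_of_ne _ _ _ _ h1]
      simp
  | serreF i j h =>
    simp only [map_mul, map_smul, map_add, FreeAlgebra.lift_ι_apply, vecMat]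
    rw [Matrix.single_mul_single_of_ne _ _ _ _ (lo_ne_hi i), mul_assoc _ _ (Matrix.single _ _ _),
      Matrix.single_mul_single_of_ne _ _ _ _ (lo_ne_hi i)]
    by_cases h1 : lo i = hi j
    · have h2 : lo j ≠ hi i := by
        simp only [lo, hi, Fin.mk.injEq, ne_eq] at h1 ⊢; omega
      rw [mul_assoc, Matrix.single_mul_single_of_ne _ _ _ _ h2]
      simp
    · rw [Matrix.single_mul_single_of_ne _ _ _ _ h1]
      simp
  | farE i j h =>
    simp only [Nbr] at h
    have h1 : hi i ≠ lo j := by simp only [lo, hi, Fin.mk.injEq, ne_eq]; omega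
    have h2 : hi j ≠ lo i := by simp only [lo, hi, Fin.mk.injEq, ne_eq]; omega
    simp only [map_mul, FreeAlgebra.lift_ι_apply, vecMat]
    rw [Matrix.single_mul_single_of_ne _ _ _ _ h1, Matrix.single_mul_single_of_ne _ _ _ _ h2]
  | farF i j h =>
    simp only [Nbr] at h
    have h1 : lo i ≠ hi j := by simp only [lo, hi, Fin.mk.injEq, ne_eq]; omega
    have h2 : lo j ≠ hi i := by simp only [lo, hi, Fin.mk.injEq, ne_eq]; omega
    simp only [map_mul, FreeAlgebra.lift_ι_apply, vecMat]
    rw [Matrix.single_mul_single_of_ne _ _ _ _ h1, Matrix.single_mul_single_of_ne _ _ _ _ h2]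

/-- The vector representation `V_q` of the quantized enveloping algebra of `gl_n`. -/
noncomputable abbrev vecRep (n : ℕ) : AlgRep Kq (Uq n) where
  V := Fin n → Kq
  ρ := (Matrix.toLinAlgEquiv' (R := Kq) (n := Fin n)).toAlgHom.comp (Uq.lift vecMat vecMat_rel)

/-- The basis vectors `v_1, ..., v_n` of the vector representation. -/
noncomputable def bv {n : ℕ} (i : Fin n) : Fin n → Kq := Pi.single i 1

section Action

variable {n : ℕ}

lemma vecRep_gen (x : UqGen n) (v : Fin n → Kq) :
    (vecRep n).ρ (Uq.gen x) v = (vecMat x).mulVec v := by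
  change (Matrix.toLinAlgEquiv' (Uq.lift vecMat vecMat_rel (Uq.gen x))) v = _
  rw [Uq.lift_gen, Matrix.toLinAlgEquiv'_apply]

lemma vecRep_qh (h : Fin n → ℤ) (j : Fin n) :
    (vecRep n).ρ (Uq.qh h) (bv j) = qpar ^ h j • bv j := by
  rw [vecRep_gen]
  ext a
  simp only [vecMat, bv, Matrix.mulVec_diagonal, Pi.smul_apply, Pi.single_apply, smul_eq_mul]
  split_ifs with h
  · rw [h]
  · simp

lemma vecRep_E (i : Fin (n - 1)) (j : Fin n) :
    (vecRep n).ρ (Uq.E i) (bv j) = if j = hi i then bv (lo i) else 0 := by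
  rw [vecRep_gen]
  ext a
  simp only [vecMat, bv, Matrix.mulVec_single_one, Matrix.col_apply, Matrix.single_apply]
  split_ifs <;> simp_all [Pi.single_apply]

lemma vecRep_F (i : Fin (n - 1)) (j : Fin n) :
    (vecRep n).ρ (Uq.F i) (bv j) = if j = lo i then bv (hi i) else 0 := by
  rw [vecRep_gen]
  ext a
  simp only [vecMat, bv, Matrix.mulVec_single_one, Matrix.col_apply, Matrix.single_apply]
  split_ifs <;> simp_all [Pi.single_apply]

end Action

/-- The tensor square of the vector representation. -/
noncomputable abbrev vecSq (n : ℕ) : AlgRep Kq (Uq n) := vecRep n ⊗ vecRep n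

/-- The relations of the quantum exterior algebra: `v_i ⊗ v_i`, and
`q^{-1} v_i ⊗ v_j + v_j ⊗ v_i` for `i < j`. -/
noncomputable def extRel (n : ℕ) : Submodule Kq (vecSq n).V :=
  Submodule.span Kq ({x | ∃ i, x = bv i ⊗ₜ[Kq] bv i} ∪
    {x | ∃ i j, i < j ∧ x = qpar⁻¹ • (bv i ⊗ₜ[Kq] bv j) + bv j ⊗ₜ[Kq] bv i})

/-- The relations of the quantum symmetric algebra: `q v_i ⊗ v_j - v_j ⊗ v_i` for `i < j`. -/
noncomputable def symRel (n : ℕ) : Submodule Kq (vecSq n).V :=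
  Submodule.span Kq {x | ∃ i j, i < j ∧ x = qpar • (bv i ⊗ₜ[Kq] bv j) - bv j ⊗ₜ[Kq] bv i}

/-- A submodule is stable under an algebra action. -/
def AlgRep.Stable {k : Type} [Field k] {A : Type} [Ring A] [Algebra k A] (M : AlgRep k A)
    (P : Submodule k M.V) : Prop := ∀ a, P ≤ P.comap (M.ρ a)

lemma stable_of_gen {n : ℕ} (M : AlgRep Kq (Uq n)) (P : Submodule Kq M.V)
    (h : ∀ x, P ≤ P.comap (M.ρ (Uq.gen x))) : M.Stable P := by
  intro a
  obtain ⟨a, rfl⟩ := Uq.mk_surjective n a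
  induction a using FreeAlgebra.induction with
  | grade0 r =>
    intro v hv
    rw [Submodule.mem_comap, AlgHom.commutes, AlgHom.commutes, Module.algebraMap_end_apply]
    exact P.smul_mem r hv
  | grade1 x => exact h x
  | mul x y hx hy =>
    intro v hv
    rw [Submodule.mem_comap, map_mul, map_mul]
    exact hx (hy hv)
  | add x y hx hy =>
    intro v hv
    rw [Submodule.mem_comap, map_add, map_add]
    exact P.add_mem (hx hv) (hy hv)

section Action

variable {n : ℕ}

lemma vecSq_qh (h : Fin n → ℤ) (i j : Fin n) :
    (vecSq n).ρ (Uq.qh h) (bv i ⊗ₜ[Kq] bv j) =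
      (qpar ^ h i * qpar ^ h j) • (bv i ⊗ₜ[Kq] bv j) := by
  change outer (vecRep n).ρ (vecRep n).ρ (Uq.comulHom (Uq.gen _)) _ = _
  rw [Uq.comulHom_gen, Uq.comulGen, outer_tmul, TensorProduct.map_tmul, vecRep_qh, vecRep_qh,
    smul_tmul_smul]

lemma vecSq_E (k : Fin (n - 1)) (i j : Fin n) :
    (vecSq n).ρ (Uq.E k) (bv i ⊗ₜ[Kq] bv j) =
      (if i = hi k then qpar ^ hroot k j • (bv (lo k) ⊗ₜ[Kq] bv j) else 0) +
      (if j = hi k then bv i ⊗ₜ[Kq] bv (lo k) else 0) := by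
  change outer (vecRep n).ρ (vecRep n).ρ (Uq.comulHom (Uq.gen _)) _ = _
  rw [Uq.comulHom_gen, Uq.comulGen, map_add, LinearMap.add_apply, outer_tmul, outer_tmul,
    TensorProduct.map_tmul, TensorProduct.map_tmul, vecRep_qh, vecRep_E, vecRep_E, map_one]
  split_ifs <;> simp

lemma vecSq_F (k : Fin (n - 1)) (i j : Fin n) :
    (vecSq n).ρ (Uq.F k) (bv i ⊗ₜ[Kq] bv j) =
      (if i = lo k then bv (hi k) ⊗ₜ[Kq] bv j else 0) +
      (if j = lo k then qpar ^ (-hroot k i) • (bv i ⊗ₜ[Kq] bv (hi k)) else 0) := by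
  change outer (vecRep n).ρ (vecRep n).ρ (Uq.comulHom (Uq.gen _)) _ = _
  rw [Uq.comulHom_gen, Uq.comulGen, map_add, LinearMap.add_apply, outer_tmul, outer_tmul,
    TensorProduct.map_tmul, TensorProduct.map_tmul, vecRep_qh, vecRep_F, vecRep_F, map_one]
  split_ifs <;> simp [smul_tmul']

end Action

lemma extRel_stable (n : ℕ) : (vecSq n).Stable (extRel n) := by
  have h0 := qpar_ne_zero
  have m1 : ∀ i : Fin n, bv i ⊗ₜ[Kq] bv i ∈ extRel n := fun i =>
    Submodule.subset_span (Or.inl ⟨i, rfl⟩)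
  have m2 : ∀ i j : Fin n, i < j →
      qpar⁻¹ • (bv i ⊗ₜ[Kq] bv j) + bv j ⊗ₜ[Kq] bv i ∈ extRel n := fun i j hij =>
    Submodule.subset_span (Or.inr ⟨i, j, hij, rfl⟩)
  apply stable_of_gen
  intro x
  rw [extRel, Submodule.span_le, ← extRel]
  rintro v (⟨i, rfl⟩ | ⟨i, j, hij, rfl⟩)
  · change (vecSq n).ρ (Uq.gen x) _ ∈ extRel n
    cases x with
    | qh h =>
      rw [vecSq_qh]
      exact Submodule.smul_mem _ _ (m1 i)
    | E k =>
      rw [vecSq_E]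
      by_cases h : i = hi k
      · have := m2 (lo k) (hi k) (by simp [lo, hi])
        subst h
        simpa [hroot, (lo_ne_hi k).symm, lo_ne_hi k] using this
      · simp [h]
    | F k =>
      rw [vecSq_F]
      by_cases h : i = lo k
      · have := m2 (lo k) (hi k) (by simp [lo, hi])
        subst h
        rw [add_comm] at this
        simpa [hroot, (lo_ne_hi k).symm, lo_ne_hi k] using this
      · simp [h]
  · change (vecSq n).ρ (Uq.gen x) _ ∈ extRel n
    rw [map_add, map_smul]
    cases x with
    | qh h =>
      rw [vecSq_qh, vecSq_qh, mul_comm (qpar ^ h j), smul_comm, ← smul_add]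
      exact Submodule.smul_mem _ _ (m2 i j hij)
    | E k =>
      rw [vecSq_E, vecSq_E]
      by_cases h1 : i = hi k
      · have hj : j ≠ hi k := fun h => by rw [h1, h] at hij; exact lt_irrefl _ hij
        have hj' : j ≠ lo k := fun h => by rw [h1, h] at hij; simp [lo, hi, Fin.lt_def] at hij
        have := m2 (lo k) j (lt_trans (by simp [lo, hi, Fin.lt_def]) (h1 ▸ hij))
        simpa [h1, hj, hj', hroot] using this
      · by_cases h2 : j = hi k
        · by_cases h3 : i = lo k
          · subst h2 h3
            have := Submodule.smul_mem _ (qpar⁻¹ + qpar) (m1 (lo k))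
            rw [add_smul] at this
            simpa [h1, hroot, lo_ne_hi k] using this
          · have hlt : i < lo k := by
              rw [h2] at hij
              simp only [lo, hi, Fin.lt_def, Fin.ext_iff] at hij h3 ⊢
              omega
            have := m2 i (lo k) hlt
            simpa [h1, h2, h3, hroot, lo_ne_hi k] using this
        · simp [h1, h2]
    | F k =>
      rw [vecSq_F, vecSq_F]
      by_cases h1 : j = lo k
      · have hj : i ≠ lo k := fun h => by rw [h1, h] at hij; exact lt_irrefl _ hij
        have hj' : i ≠ hi k := fun h => by rw [h1, h] at hij; simp [lo, hi, Fin.lt_def] at hij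
        have := m2 i (hi k) (lt_trans (h1 ▸ hij) (by simp [lo, hi, Fin.lt_def]))
        simpa [h1, hj, hj', hroot] using this
      · by_cases h2 : i = lo k
        · by_cases h3 : j = hi k
          · subst h2 h3
            have := Submodule.smul_mem _ (qpar⁻¹ + qpar) (m1 (hi k))
            rw [add_smul] at this
            simpa [h1, hroot, lo_ne_hi k, (lo_ne_hi k).symm] using this
          · have hlt : hi k < j := by
              rw [h2] at hij
              simp only [lo, hi, Fin.lt_def, Fin.ext_iff] at hij h3 ⊢
              omega
            have := m2 (hi k) j hlt
            simpa [h1, h2, h3, hroot, lo_ne_hi k] using this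
        · simp [h1, h2]

lemma symRel_stable (n : ℕ) : (vecSq n).Stable (symRel n) := by
  have h0 := qpar_ne_zero
  have m2 : ∀ i j : Fin n, i < j →
      qpar • (bv i ⊗ₜ[Kq] bv j) - bv j ⊗ₜ[Kq] bv i ∈ symRel n := fun i j hij =>
    Submodule.subset_span ⟨i, j, hij, rfl⟩
  apply stable_of_gen
  intro x
  rw [symRel, Submodule.span_le, ← symRel]
  rintro v ⟨i, j, hij, rfl⟩
  change (vecSq n).ρ (Uq.gen x) _ ∈ symRel n
  rw [map_sub, map_smul]
  cases x with
  | qh h =>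
    rw [vecSq_qh, vecSq_qh, mul_comm (qpar ^ h j), smul_comm, ← smul_sub]
    exact Submodule.smul_mem _ _ (m2 i j hij)
  | E k =>
    rw [vecSq_E, vecSq_E]
    by_cases h1 : i = hi k
    · have hj : j ≠ hi k := fun h => by rw [h1, h] at hij; exact lt_irrefl _ hij
      have hj' : j ≠ lo k := fun h => by rw [h1, h] at hij; simp [lo, hi, Fin.lt_def] at hij
      have := m2 (lo k) j (lt_trans (by simp [lo, hi, Fin.lt_def]) (h1 ▸ hij))
      simpa [h1, hj, hj', hroot] using this
    · by_cases h2 : j = hi k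
      · by_cases h3 : i = lo k
        · subst h2 h3
          simp [h1, hroot, lo_ne_hi k]
        · have hlt : i < lo k := by
            rw [h2] at hij
            simp only [lo, hi, Fin.lt_def, Fin.ext_iff] at hij h3 ⊢
            omega
          have := m2 i (lo k) hlt
          simpa [h1, h2, h3, hroot, lo_ne_hi k] using this
      · simp [h1, h2]
  | F k =>
    rw [vecSq_F, vecSq_F]
    by_cases h1 : j = lo k
    · have hj : i ≠ lo k := fun h => by rw [h1, h] at hij; exact lt_irrefl _ hij
      have hj' : i ≠ hi k := fun h => by rw [h1, h] at hij; simp [lo, hi, Fin.lt_def] at hij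
      have := m2 i (hi k) (lt_trans (h1 ▸ hij) (by simp [lo, hi, Fin.lt_def]))
      simpa [h1, hj, hj', hroot] using this
    · by_cases h2 : i = lo k
      · by_cases h3 : j = hi k
        · subst h2 h3
          simp [h1, hroot, lo_ne_hi k, (lo_ne_hi k).symm]
        · have hlt : hi k < j := by
            rw [h2] at hij
            simp only [lo, hi, Fin.lt_def, Fin.ext_iff] at hij h3 ⊢
            omega
          have := m2 (hi k) j hlt
          simpa [h1, h2, h3, hroot, lo_ne_hi k] using this
      · simp [h1, h2]

end VectorRep

section Powers

lemma outer_stable {k : Type} [Field k] {A : Type} [Ring A] [Algebra k A] {B : Type} [Ring B]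
    [Algebra k B] {U : Type} [AddCommGroup U] [Module k U] {V : Type} [AddCommGroup V] [Module k V]
    (φ : A →ₐ[k] Module.End k U) (ψ : B →ₐ[k] Module.End k V) (P : Submodule k U)
    (Q : Submodule k V) (hP : ∀ a, P ≤ P.comap (φ a)) (hQ : ∀ b, Q ≤ Q.comap (ψ b))
    (t : A ⊗[k] B) :
    Submodule.map₂ (TensorProduct.mk k U V) P Q ≤
      (Submodule.map₂ (TensorProduct.mk k U V) P Q).comap (outer φ ψ t) := by
  induction t using TensorProduct.induction_on with
  | zero => intro v _; simp
  | tmul a b =>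
    rw [Submodule.map₂_le]
    intro x hx y hy
    rw [Submodule.mem_comap, outer_tmul]
    exact Submodule.apply_mem_map₂ _ (hP a hx) (hQ b hy)
  | add x y hx hy =>
    intro v hv
    rw [Submodule.mem_comap, map_add]
    exact Submodule.add_mem _ (hx hv) (hy hv)

namespace AlgRep

variable {k : Type} [Field k] {A : Type} [Ring A] [Algebra k A]

/-- The quotient of a representation by a stable subspace. -/
noncomputable def quot (M : AlgRep k A) (P : Submodule k M.V) (h : M.Stable P) :
    AlgRep k A where
  V := M.V ⧸ P
  ρ := AlgHom.ofLinearMap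
    { toFun := fun a => P.mapQ P (M.ρ a) (h a)
      map_add' := fun a b => by
        apply Submodule.linearMap_qext
        ext x
        simp
      map_smul' := fun c a => by
        apply Submodule.linearMap_qext
        ext x
        simp }
    (by
      apply Submodule.linearMap_qext
      ext x
      simp)
    (fun a b => by
      apply Submodule.linearMap_qext
      ext x
      simp)

end AlgRep

variable (n : ℕ)

/-- The tensor powers of the vector representation. -/
noncomputable def tpow : ℕ → AlgRep Kq (Uq n)
  | 0 => 𝟙_ (AlgRep Kq (Uq n))
  | a + 1 => tpow a ⊗ vecRep n

/-- The degree `a` part of the two-sided ideal of the tensor algebra of the vector representation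
generated by a space `R` of quadratic relations, which is
`J_a ⊗ V + V^{⊗ (a - 2)} ⊗ R` by recursion. -/
noncomputable def ideal (R : Submodule Kq (vecSq n).V) : (a : ℕ) → Submodule Kq (tpow n a).V
  | 0 => ⊥
  | 1 => ⊥
  | a + 2 =>
    Submodule.map₂ (TensorProduct.mk Kq (tpow n (a + 1)).V (vecRep n).V) (ideal R (a + 1)) ⊤ ⊔
    (Submodule.map₂ (TensorProduct.mk Kq (tpow n a).V (vecSq n).V) ⊤ R).map
      (TensorProduct.assoc Kq (tpow n a).V (vecRep n).V (vecRep n).V).symm.toLinearMap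

lemma ideal_stable {R : Submodule Kq (vecSq n).V} (hR : (vecSq n).Stable R) :
    ∀ a, (tpow n a).Stable (ideal n R a)
  | 0 => fun x v hv => by
    rw [(Submodule.mem_bot Kq).mp hv]
    exact Submodule.zero_mem _
  | 1 => fun x v hv => by
    rw [(Submodule.mem_bot Kq).mp hv]
    exact Submodule.zero_mem _
  | a + 2 => fun x => by
    refine sup_le ?_ ?_
    · exact (outer_stable (tpow n (a + 1)).ρ (vecRep n).ρ _ ⊤ (ideal_stable hR (a + 1))
        (fun _ => le_top) (Bialgebra.comulAlgHom Kq (Uq n) x)).trans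
          (Submodule.comap_mono le_sup_left)
    · rintro _ ⟨v, hv, rfl⟩
      have h1 := outer_stable (tpow n a).ρ (vecSq n).ρ ⊤ R (fun _ => le_top) hR
        (Bialgebra.comulAlgHom Kq (Uq n) x) hv
      have h2 := LinearMap.congr_fun
        ((α_ (tpow n a) (vecRep n) (vecRep n)).inv.2 x) v
      refine Submodule.mem_sup_right ?_
      exact ⟨_, h1, h2⟩

/-- The quantum exterior power `∧^a V_q`. -/
noncomputable def extPow (a : ℕ) : AlgRep Kq (Uq n) :=
  (tpow n a).quot (ideal n (extRel n) a) (ideal_stable n (extRel_stable n) a)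

/-- The quantum symmetric power `Sym^a V_q`. -/
noncomputable def symPow (a : ℕ) : AlgRep Kq (Uq n) :=
  (tpow n a).quot (ideal n (symRel n) a) (ideal_stable n (symRel_stable n) a)

variable {n}

/-- The vector `v_{w_1} ⊗ ... ⊗ v_{w_a}`. -/
noncomputable def wordVec : {a : ℕ} → (Fin a → Fin n) → (tpow n a).V
  | 0, _ => (1 : Kq)
  | a + 1, w => wordVec (Fin.init w) ⊗ₜ[Kq] bv (w (Fin.last a))

/-- The vector `v_{w_1} ∧ ... ∧ v_{w_a}`. -/
noncomputable def extVec {a : ℕ} (w : Fin a → Fin n) : (extPow n a).V :=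
  (ideal n (extRel n) a).mkQ (wordVec w)

/-- The vector `v_{w_1} ... v_{w_a}` of the symmetric power. -/
noncomputable def symVec {a : ℕ} (w : Fin a → Fin n) : (symPow n a).V :=
  (ideal n (symRel n) a).mkQ (wordVec w)

end Powers

section Restriction

namespace AlgRep

variable {k : Type} [Field k] {A : Type} [Ring A] [Algebra k A] {B : Type} [Ring B] [Algebra k B]

/-- Restriction of representations along an algebra map. -/
def res (ι : B →ₐ[k] A) : AlgRep k A ⥤ AlgRep k B where
  obj M := { V := M.V, ρ := M.ρ.comp ι }
  map {M N} f := ⟨(f.1 : M.V →ₗ[k] N.V), fun b => f.2 (ι b)⟩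

end AlgRep

/-- Restriction from the quantized enveloping algebra to the coideal subalgebra. -/
noncomputable abbrev resSp (n : ℕ) : AlgRep Kq (Uq n) ⥤ AlgRep Kq (Uqsp n) := AlgRep.res (Uqsp n).val

/-- Restriction is compatible with tensor products. -/
noncomputable def resTens (n : ℕ) (M N : AlgRep Kq (Uq n)) :
    (resSp n).obj (M ⊗ N) ≅ M ⊙ₗ (resSp n).obj N :=
  AlgRep.mkIso (LinearEquiv.refl Kq (M.V ⊗[Kq] N.V)) fun b => by
    have h : Bialgebra.comulAlgHom Kq (Uq n) b.1 = Uq.incl n (Uq.coactHom b) :=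
      (Uq.incl_coactHom b).symm
    change outer M.ρ N.ρ (Bialgebra.comulAlgHom Kq (Uq n) b.1) =
      outer M.ρ (N.ρ.comp (Uqsp n).val) (Uq.coactHom b)
    rw [h, Uq.incl, outer_map]
    rfl

end Restriction

section WebA

/-- Formal expressions for morphisms of type A webs. Objects are finite sequences of positive
integers, tensor product is concatenation, composition is written in diagrammatic order, and
`cast` denotes an identity morphism. -/
inductive WebTm : List ℕ+ → List ℕ+ → Type
  | cast {X Y : List ℕ+} (h : X = Y) : WebTm X Y
  | merge (a b : ℕ+) : WebTm [a, b] [a + b]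
  | split (a b : ℕ+) : WebTm [a + b] [a, b]
  | comp {X Y Z : List ℕ+} (f : WebTm X Y) (g : WebTm Y Z) : WebTm X Z
  | tens {X Y X' Y' : List ℕ+} (f : WebTm X Y) (g : WebTm X' Y') : WebTm (X ++ X') (Y ++ Y')
  | zero {X Y : List ℕ+} : WebTm X Y
  | add {X Y : List ℕ+} (f g : WebTm X Y) : WebTm X Y
  | smul {X Y : List ℕ+} (c : Kq) (f : WebTm X Y) : WebTm X Y

namespace WebTm

/-- A strand of thickness `a`; a strand of thickness `0` is erased. -/
def strand : ℕ → List ℕ+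
  | 0 => []
  | a + 1 => [a.succPNat]

/-- The identity of a strand of thickness `a`. -/
def one (a : ℕ) : WebTm (strand a) (strand a) := cast rfl

/-- The merge of strands of thickness `a` and `b`, where `0` is allowed. -/
def nmerge : (a b : ℕ) → WebTm (strand a ++ strand b) (strand (a + b))
  | 0, b => cast (by rw [Nat.zero_add]; rfl)
  | a + 1, 0 => cast rfl
  | a + 1, b + 1 => comp (merge a.succPNat b.succPNat)
      (cast (congrArg (fun x => [x]) (PNat.eq (by simp; omega))))

/-- The split into strands of thickness `a` and `b`, where `0` is allowed. -/
def nsplit : (a b : ℕ) → WebTm (strand (a + b)) (strand a ++ strand b)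
  | 0, b => cast (by rw [Nat.zero_add]; rfl)
  | a + 1, 0 => cast rfl
  | a + 1, b + 1 => comp (cast (congrArg (fun x => [x]) (PNat.eq (by simp; omega))))
      (split a.succPNat b.succPNat)

/-- A thin strand is moved from the left strand to the right one:
`(a + 1, b) → (a, 1, b) → (a, 1 + b)`. -/
def rungR (a b : ℕ) : WebTm (strand (a + 1) ++ strand b) (strand a ++ strand (1 + b)) :=
  comp (tens (nsplit a 1) (one b))
    (comp (cast (List.append_assoc _ _ _)) (tens (one a) (nmerge 1 b)))

/-- A thin strand is moved from the right strand to the left one: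
`(a, 1 + b) → (a, 1, b) → (a + 1, b)`. -/
def rungL (a b : ℕ) : WebTm (strand a ++ strand (1 + b)) (strand (a + 1) ++ strand b) :=
  comp (tens (one a) (nsplit 1 b))
    (comp (cast (List.append_assoc _ _ _).symm) (tens (nmerge a 1) (one b)))

/-- The congruence on formal expressions generated by the axioms of a `ℂ(q)`-linear strict
monoidal category together with associativity, coassociativity and the thin square switch. -/
inductive Rel : {X Y : List ℕ+} → WebTm X Y → WebTm X Y → Prop
  | refl {X Y : List ℕ+} (f : WebTm X Y) : Rel f f
  | symm {X Y : List ℕ+} {f g : WebTm X Y} : Rel f g → Rel g f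
  | trans {X Y : List ℕ+} {f g h : WebTm X Y} : Rel f g → Rel g h → Rel f h
  | comp {X Y Z : List ℕ+} {f f' : WebTm X Y} {g g' : WebTm Y Z} :
      Rel f f' → Rel g g' → Rel (comp f g) (comp f' g')
  | tens {X Y X' Y' : List ℕ+} {f f' : WebTm X Y} {g g' : WebTm X' Y'} :
      Rel f f' → Rel g g' → Rel (tens f g) (tens f' g')
  | add {X Y : List ℕ+} {f f' g g' : WebTm X Y} :
      Rel f f' → Rel g g' → Rel (add f g) (add f' g')
  | smul {X Y : List ℕ+} (c : Kq) {f g : WebTm X Y} :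
      Rel f g → Rel (smul c f) (smul c g)
  -- the axioms of a vector space
  | add_assoc {X Y : List ℕ+} (f g h : WebTm X Y) : Rel (add (add f g) h) (add f (add g h))
  | add_comm {X Y : List ℕ+} (f g : WebTm X Y) : Rel (add f g) (add g f)
  | add_zero {X Y : List ℕ+} (f : WebTm X Y) : Rel (add f zero) f
  | zero_smul {X Y : List ℕ+} (f : WebTm X Y) : Rel (smul 0 f) zero
  | one_smul {X Y : List ℕ+} (f : WebTm X Y) : Rel (smul 1 f) f
  | mul_smul {X Y : List ℕ+} (c d : Kq) (f : WebTm X Y) :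
      Rel (smul (c * d) f) (smul c (smul d f))
  | add_smul {X Y : List ℕ+} (c d : Kq) (f : WebTm X Y) :
      Rel (smul (c + d) f) (add (smul c f) (smul d f))
  | smul_add {X Y : List ℕ+} (c : Kq) (f g : WebTm X Y) :
      Rel (smul c (add f g)) (add (smul c f) (smul c g))
  -- the axioms of a linear category
  | id_comp {X Y : List ℕ+} (f : WebTm X Y) : Rel (WebTm.comp (cast rfl) f) f
  | comp_id {X Y : List ℕ+} (f : WebTm X Y) : Rel (WebTm.comp f (cast rfl)) f
  | assoc {W X Y Z : List ℕ+} (f : WebTm W X) (g : WebTm X Y) (h : WebTm Y Z) :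
      Rel (WebTm.comp (WebTm.comp f g) h) (WebTm.comp f (WebTm.comp g h))
  | add_comp {X Y Z : List ℕ+} (f f' : WebTm X Y) (g : WebTm Y Z) :
      Rel (WebTm.comp (WebTm.add f f') g) (WebTm.add (WebTm.comp f g) (WebTm.comp f' g))
  | comp_add {X Y Z : List ℕ+} (f : WebTm X Y) (g g' : WebTm Y Z) :
      Rel (WebTm.comp f (WebTm.add g g')) (WebTm.add (WebTm.comp f g) (WebTm.comp f g'))
  | smul_comp {X Y Z : List ℕ+} (c : Kq) (f : WebTm X Y) (g : WebTm Y Z) :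
      Rel (WebTm.comp (WebTm.smul c f) g) (WebTm.smul c (WebTm.comp f g))
  | comp_smul {X Y Z : List ℕ+} (c : Kq) (f : WebTm X Y) (g : WebTm Y Z) :
      Rel (WebTm.comp f (WebTm.smul c g)) (WebTm.smul c (WebTm.comp f g))
  -- the axioms of a linear strict monoidal category
  | tens_id {X Y : List ℕ+} :
      Rel (WebTm.tens (cast (rfl : X = X)) (cast (rfl : Y = Y))) (cast rfl)
  | tens_comp {X Y Z X' Y' Z' : List ℕ+} (f : WebTm X Y) (g : WebTm Y Z) (f' : WebTm X' Y')
      (g' : WebTm Y' Z') : Rel (WebTm.tens (WebTm.comp f g) (WebTm.comp f' g'))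
        (WebTm.comp (WebTm.tens f f') (WebTm.tens g g'))
  | add_tens {X Y X' Y' : List ℕ+} (f f' : WebTm X Y) (g : WebTm X' Y') :
      Rel (WebTm.tens (WebTm.add f f') g) (WebTm.add (WebTm.tens f g) (WebTm.tens f' g))
  | tens_add {X Y X' Y' : List ℕ+} (f : WebTm X Y) (g g' : WebTm X' Y') :
      Rel (WebTm.tens f (WebTm.add g g')) (WebTm.add (WebTm.tens f g) (WebTm.tens f g'))
  | smul_tens {X Y X' Y' : List ℕ+} (c : Kq) (f : WebTm X Y) (g : WebTm X' Y') :
      Rel (WebTm.tens (WebTm.smul c f) g) (WebTm.smul c (WebTm.tens f g))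
  | tens_smul {X Y X' Y' : List ℕ+} (c : Kq) (f : WebTm X Y) (g : WebTm X' Y') :
      Rel (WebTm.tens f (WebTm.smul c g)) (WebTm.smul c (WebTm.tens f g))
  | tens_assoc {X Y X' Y' X'' Y'' : List ℕ+} (f : WebTm X Y) (g : WebTm X' Y')
      (h : WebTm X'' Y'') :
      Rel (WebTm.comp (WebTm.tens (WebTm.tens f g) h) (cast (List.append_assoc _ _ _)))
        (WebTm.comp (cast (List.append_assoc _ _ _)) (WebTm.tens f (WebTm.tens g h)))
  | unit_tens {X Y : List ℕ+} (f : WebTm X Y) :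
      Rel (WebTm.tens (cast (rfl : ([] : List ℕ+) = [])) f) f
  | tens_unit {X Y : List ℕ+} (f : WebTm X Y) :
      Rel (WebTm.comp (WebTm.tens f (cast (rfl : ([] : List ℕ+) = []))) (cast (List.append_nil _)))
        (WebTm.comp (cast (List.append_nil _)) f)
  -- the web relations
  | merge_assoc (a b c : ℕ+) :
      Rel (WebTm.comp (WebTm.comp (WebTm.tens (X := [a, b]) (X' := [c]) (merge a b) (cast rfl))
          (merge (a + b) c)) (cast (congrArg (fun x => [x]) (_root_.add_assoc a b c))))
        (WebTm.comp (WebTm.tens (X := [a]) (X' := [b, c]) (cast rfl) (merge b c)) (merge a (b + c)))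
  | split_coassoc (a b c : ℕ+) :
      Rel (WebTm.comp (cast (congrArg (fun x => [x]) (_root_.add_assoc a b c).symm))
          (WebTm.comp (split (a + b) c) (WebTm.tens (Y := [a, b]) (Y' := [c]) (split a b) (cast rfl))))
        (WebTm.comp (split a (b + c)) (WebTm.tens (Y := [a]) (Y' := [b, c]) (cast rfl) (split b c)))
  | square (a b : ℕ) :
      Rel (WebTm.comp (rungR a (1 + b)) (rungL a (1 + b)))
        (WebTm.add (WebTm.comp (rungL (a + 1) b) (rungR (a + 1) b))
          (WebTm.smul (qnum ((a + 1 : ℤ) - (1 + b))) (cast rfl)))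
  -- the square switch for strands `(a + 1, 0)` and `(0, 1 + b)`, where webs with an edge of
  -- negative thickness are zero; these are the digon removals for a thin edge
  | square_left (a : ℕ) :
      Rel (WebTm.comp (rungR a 0) (rungL a 0))
        (WebTm.smul (qnum ((a + 1 : ℤ) - 0)) (cast rfl))
  | square_right (b : ℕ) :
      Rel zero (WebTm.add (WebTm.comp (rungL 0 b) (rungR 0 b))
        (WebTm.smul (qnum ((0 : ℤ) - (1 + b))) (cast rfl)))

end WebTm

open WebTm (Rel)

/-- The type of morphisms between type A webs. -/
def WHom (X Y : List ℕ+) : Type :=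
  Quotient (⟨Rel, Rel.refl, Rel.symm, Rel.trans⟩ : Setoid (WebTm X Y))

namespace WHom

variable {X Y Z X' Y' X'' Y'' : List ℕ+}

/-- The class of a formal expression. -/
def mk (f : WebTm X Y) : WHom X Y := Quotient.mk _ f

lemma sound {f g : WebTm X Y} (h : Rel f g) : mk f = mk g := Quotient.sound h

lemma mk_surj (f : WHom X Y) : ∃ t, mk t = f := Quotient.exists_rep f

/-- An identity morphism, between equal objects. -/
def cast (h : X = Y) : WHom X Y := mk (WebTm.cast h)

/-- The identity of the object `X`. -/
def one (X : List ℕ+) : WHom X X := cast rfl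

/-- Composition in diagrammatic order. -/
def comp (f : WHom X Y) (g : WHom Y Z) : WHom X Z :=
  Quotient.map₂ WebTm.comp (fun _ _ h _ _ h' => Rel.comp h h') f g

/-- Tensor product of morphisms. -/
def tens (f : WHom X Y) (g : WHom X' Y') : WHom (X ++ X') (Y ++ Y') :=
  Quotient.map₂ WebTm.tens (fun _ _ h _ _ h' => Rel.tens h h') f g

/-- The merge vertex. -/
def merge (a b : ℕ+) : WHom [a, b] [a + b] := mk (WebTm.merge a b)

/-- The split vertex. -/
def split (a b : ℕ+) : WHom [a + b] [a, b] := mk (WebTm.split a b)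

instance : Zero (WHom X Y) := ⟨mk WebTm.zero⟩

instance : Add (WHom X Y) := ⟨Quotient.map₂ WebTm.add (fun _ _ h _ _ h' => Rel.add h h')⟩

instance : SMul Kq (WHom X Y) :=
  ⟨fun c => Quotient.map (WebTm.smul c) (fun _ _ h => Rel.smul c h)⟩

noncomputable instance : Neg (WHom X Y) := ⟨fun f => (-1 : Kq) • f⟩

noncomputable instance acg : AddCommGroup (WHom X Y) where
  add_assoc := by
    rintro ⟨f⟩ ⟨g⟩ ⟨h⟩
    exact sound (Rel.add_assoc f g h)
  add_comm := by
    rintro ⟨f⟩ ⟨g⟩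
    exact sound (Rel.add_comm f g)
  zero_add := by
    rintro ⟨f⟩
    exact sound ((Rel.add_comm _ _).trans (Rel.add_zero f))
  add_zero := by
    rintro ⟨f⟩
    exact sound (Rel.add_zero f)
  nsmul := nsmulRec
  zsmul := zsmulRec
  neg_add_cancel := by
    rintro ⟨f⟩
    refine sound ((Rel.add (Rel.refl _) (Rel.one_smul f).symm).trans
      ((Rel.add_smul (-1) 1 f).symm.trans ?_))
    rw [neg_add_cancel]
    exact Rel.zero_smul f

noncomputable instance mod : Module Kq (WHom X Y) where
  one_smul := by
    rintro ⟨f⟩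
    exact sound (Rel.one_smul f)
  mul_smul := by
    rintro c d ⟨f⟩
    exact sound (Rel.mul_smul c d f)
  add_smul := by
    rintro c d ⟨f⟩
    exact sound (Rel.add_smul c d f)
  smul_add := by
    rintro c ⟨f⟩ ⟨g⟩
    exact sound (Rel.smul_add c f g)
  zero_smul := by
    rintro ⟨f⟩
    exact sound (Rel.zero_smul f)
  smul_zero := by
    intro c
    refine sound ((Rel.smul c (Rel.zero_smul WebTm.zero).symm).trans
      ((Rel.mul_smul c 0 _).symm.trans ?_))
    rw [mul_zero]
    exact Rel.zero_smul _

lemma id_comp (f : WHom X Y) : comp (one X) f = f := by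
  obtain ⟨f, rfl⟩ := mk_surj f
  exact sound (Rel.id_comp f)

lemma comp_id (f : WHom X Y) : comp f (one Y) = f := by
  obtain ⟨f, rfl⟩ := mk_surj f
  exact sound (Rel.comp_id f)

lemma assoc {W : List ℕ+} (f : WHom W X) (g : WHom X Y) (h : WHom Y Z) :
    comp (comp f g) h = comp f (comp g h) := by
  obtain ⟨f, rfl⟩ := mk_surj f
  obtain ⟨g, rfl⟩ := mk_surj g
  obtain ⟨h, rfl⟩ := mk_surj h
  exact sound (Rel.assoc f g h)

lemma tens_comp (f : WHom X Y) (g : WHom Y Z) {Z' : List ℕ+} (f' : WHom X' Y') (g' : WHom Y' Z') :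
    tens (comp f g) (comp f' g') = comp (tens f f') (tens g g') := by
  obtain ⟨f, rfl⟩ := mk_surj f
  obtain ⟨g, rfl⟩ := mk_surj g
  obtain ⟨f', rfl⟩ := mk_surj f'
  obtain ⟨g', rfl⟩ := mk_surj g'
  exact sound (Rel.tens_comp f g f' g')

lemma tens_one : tens (one X) (one Y) = one (X ++ Y) := sound Rel.tens_id

lemma tens_assoc (f : WHom X Y) (g : WHom X' Y') (h : WHom X'' Y'') :
    comp (tens (tens f g) h) (cast (List.append_assoc _ _ _)) =
      comp (cast (List.append_assoc _ _ _)) (tens f (tens g h)) := by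
  obtain ⟨f, rfl⟩ := mk_surj f
  obtain ⟨g, rfl⟩ := mk_surj g
  obtain ⟨h, rfl⟩ := mk_surj h
  exact sound (Rel.tens_assoc f g h)

lemma unit_tens (f : WHom X Y) : tens (one []) f = f := by
  obtain ⟨f, rfl⟩ := mk_surj f
  exact sound (Rel.unit_tens f)

lemma tens_unit (f : WHom X Y) :
    comp (tens f (one [])) (cast (List.append_nil _)) = comp (cast (List.append_nil _)) f := by
  obtain ⟨f, rfl⟩ := mk_surj f
  exact sound (Rel.tens_unit f)

lemma cast_comp_cast (h : X = Y) (h' : Y = Z) : comp (cast h) (cast h') = cast (h.trans h') := by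
  subst h h'
  exact id_comp _

lemma cast_tens_cast (h : X = Y) (h' : X' = Y') :
    tens (cast h) (cast h') = cast (congrArg₂ (fun a b => a ++ b) h h') := by
  subst h h'
  exact tens_one

lemma tens_def (f : WHom X Y) (g : WHom X' Y') :
    tens f g = comp (tens f (one X')) (tens (one Y) g) := by
  rw [← tens_comp, comp_id, id_comp]

lemma pentagon (W X Y Z : List ℕ+) :
    comp (tens (cast (List.append_assoc W X Y)) (one Z)) (comp (cast (List.append_assoc _ _ _))
      (tens (one W) (cast (List.append_assoc X Y Z)))) =
    comp (cast (List.append_assoc (W ++ X) Y Z)) (cast (List.append_assoc _ _ _)) := by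
  rw [one, one, cast_tens_cast, cast_tens_cast, cast_comp_cast, cast_comp_cast, cast_comp_cast]

lemma triangle (X Y : List ℕ+) :
    comp (cast (List.append_assoc X [] Y)) (tens (one X) (cast (List.nil_append Y))) =
      tens (cast (List.append_nil X)) (one Y) := by
  rw [one, one, cast_tens_cast, cast_tens_cast, cast_comp_cast]

end WHom

/-- The category of type A webs over `ℂ(q)` (before passing to the additive closure). -/
def WebA : Type := List ℕ+

namespace WebA

instance : Category WebA where
  Hom X Y := WHom X Y
  id X := WHom.one X
  comp f g := WHom.comp f g
  id_comp := WHom.id_comp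
  comp_id := WHom.comp_id
  assoc := WHom.assoc

noncomputable instance : Preadditive WebA where
  homGroup X Y := WHom.acg (X := X) (Y := Y)
  add_comp := by
    rintro X Y Z ⟨f⟩ ⟨f'⟩ ⟨g⟩
    exact WHom.sound (Rel.add_comp f f' g)
  comp_add := by
    rintro X Y Z ⟨f⟩ ⟨g⟩ ⟨g'⟩
    exact WHom.sound (Rel.comp_add f g g')

noncomputable instance : Linear Kq WebA where
  homModule X Y := WHom.mod (X := X) (Y := Y)
  smul_comp := by
    rintro X Y Z c ⟨f⟩ ⟨g⟩
    exact WHom.sound (Rel.smul_comp c f g)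
  comp_smul := by
    rintro X Y Z ⟨f⟩ c ⟨g⟩
    exact WHom.sound (Rel.comp_smul c f g)

/-- Equal objects are isomorphic. -/
def castIso {X Y : List ℕ+} (h : X = Y) : @Iso WebA _ X Y where
  hom := WHom.cast h
  inv := WHom.cast h.symm
  hom_inv_id := WHom.cast_comp_cast _ _
  inv_hom_id := WHom.cast_comp_cast _ _

instance : MonoidalCategory WebA where
  tensorObj X Y := List.append X Y
  tensorUnit := ([] : List ℕ+)
  tensorHom f g := WHom.tens f g
  whiskerLeft X _ _ g := WHom.tens (WHom.one X) g
  whiskerRight f X := WHom.tens f (WHom.one X)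
  associator X Y Z := castIso (List.append_assoc X Y Z)
  leftUnitor X := castIso (List.nil_append X)
  rightUnitor X := castIso (List.append_nil X)
  tensorHom_def f g := WHom.tens_def f g
  id_tensorHom_id X Y := WHom.tens_one
  tensorHom_comp_tensorHom f₁ f₂ g₁ g₂ := (WHom.tens_comp f₁ g₁ f₂ g₂).symm
  whiskerLeft_id X Y := WHom.tens_one
  id_whiskerRight X Y := WHom.tens_one
  associator_naturality f g h := WHom.tens_assoc f g h
  leftUnitor_naturality f := by
    refine (congrArg (fun x => WHom.comp x (WHom.one _)) (WHom.unit_tens f)).trans ?_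
    exact (WHom.comp_id f).trans (WHom.id_comp f).symm
  rightUnitor_naturality f := WHom.tens_unit f
  pentagon W X Y Z := WHom.pentagon W X Y Z
  triangle X Y := WHom.triangle X Y

/-- The category of type A webs is monoidal linear: the tensor product is bilinear. -/
lemma tens_bilin {X Y X' Y' : WebA} (f f' : X ⟶ Y) (g g' : X' ⟶ Y') (c : Kq) :
    (f + f') ⊗ₘ g = f ⊗ₘ g + f' ⊗ₘ g ∧ f ⊗ₘ (g + g') = f ⊗ₘ g + f ⊗ₘ g' ∧
      (c • f) ⊗ₘ g = c • (f ⊗ₘ g) ∧ f ⊗ₘ (c • g) = c • (f ⊗ₘ g) := by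
  obtain ⟨f, rfl⟩ := WHom.mk_surj f
  obtain ⟨f', rfl⟩ := WHom.mk_surj f'
  obtain ⟨g, rfl⟩ := WHom.mk_surj g
  obtain ⟨g', rfl⟩ := WHom.mk_surj g'
  exact ⟨WHom.sound (Rel.add_tens f f' g), WHom.sound (Rel.tens_add f g g'),
    WHom.sound (Rel.smul_tens c f g), WHom.sound (Rel.tens_smul c f g)⟩

end WebA

end WebA

section ActWeb

/-- Formal expressions for the morphisms of a linear category with an action of the category of
type A webs, generated by one object `∅` and a family `G` of morphisms. The object `X ⊗ ∅` is
denoted by `X`; `onUnit f` is `f ⊗ id_∅`, and `act f t` is `f ⊗ t`. -/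
inductive ActTm (G : List ℕ+ → List ℕ+ → Type) : List ℕ+ → List ℕ+ → Type
  | gen {X Y : List ℕ+} (g : G X Y) : ActTm G X Y
  | onUnit {X Y : List ℕ+} (f : WHom X Y) : ActTm G X Y
  | act {X Y X' Y' : List ℕ+} (f : WHom X Y) (t : ActTm G X' Y') : ActTm G (X ++ X') (Y ++ Y')
  | comp {X Y Z : List ℕ+} (s : ActTm G X Y) (t : ActTm G Y Z) : ActTm G X Z
  | zero {X Y : List ℕ+} : ActTm G X Y
  | add {X Y : List ℕ+} (s t : ActTm G X Y) : ActTm G X Y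
  | smul {X Y : List ℕ+} (c : Kq) (t : ActTm G X Y) : ActTm G X Y

namespace ActTm

variable {G : List ℕ+ → List ℕ+ → Type}

/-- The identity of the object `X ⊗ ∅`. -/
def one (X : List ℕ+) : ActTm G X X := onUnit (WHom.one X)

/-- The congruence generated by the axioms of a `ℂ(q)`-linear category with a bilinear action of
the category of type A webs, and by the relations `R`. -/
inductive Rel (R : {X Y : List ℕ+} → ActTm G X Y → ActTm G X Y → Prop) :
    {X Y : List ℕ+} → ActTm G X Y → ActTm G X Y → Prop
  | of {X Y : List ℕ+} {s t : ActTm G X Y} : R s t → Rel R s t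
  | refl {X Y : List ℕ+} (s : ActTm G X Y) : Rel R s s
  | symm {X Y : List ℕ+} {s t : ActTm G X Y} : Rel R s t → Rel R t s
  | trans {X Y : List ℕ+} {s t u : ActTm G X Y} : Rel R s t → Rel R t u → Rel R s u
  | comp {X Y Z : List ℕ+} {s s' : ActTm G X Y} {t t' : ActTm G Y Z} :
      Rel R s s' → Rel R t t' → Rel R (comp s t) (comp s' t')
  | act {X Y X' Y' : List ℕ+} (f : WHom X Y) {t t' : ActTm G X' Y'} :
      Rel R t t' → Rel R (act f t) (act f t')
  | add {X Y : List ℕ+} {s s' t t' : ActTm G X Y} :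
      Rel R s s' → Rel R t t' → Rel R (add s t) (add s' t')
  | smul {X Y : List ℕ+} (c : Kq) {s t : ActTm G X Y} :
      Rel R s t → Rel R (smul c s) (smul c t)
  -- the axioms of a vector space
  | add_assoc {X Y : List ℕ+} (s t u : ActTm G X Y) :
      Rel R (ActTm.add (ActTm.add s t) u) (ActTm.add s (ActTm.add t u))
  | add_comm {X Y : List ℕ+} (s t : ActTm G X Y) : Rel R (ActTm.add s t) (ActTm.add t s)
  | add_zero {X Y : List ℕ+} (s : ActTm G X Y) : Rel R (ActTm.add s zero) s
  | zero_smul {X Y : List ℕ+} (s : ActTm G X Y) : Rel R (ActTm.smul 0 s) zero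
  | one_smul {X Y : List ℕ+} (s : ActTm G X Y) : Rel R (ActTm.smul 1 s) s
  | mul_smul {X Y : List ℕ+} (c d : Kq) (s : ActTm G X Y) :
      Rel R (ActTm.smul (c * d) s) (ActTm.smul c (ActTm.smul d s))
  | add_smul {X Y : List ℕ+} (c d : Kq) (s : ActTm G X Y) :
      Rel R (ActTm.smul (c + d) s) (ActTm.add (ActTm.smul c s) (ActTm.smul d s))
  | smul_add {X Y : List ℕ+} (c : Kq) (s t : ActTm G X Y) :
      Rel R (ActTm.smul c (ActTm.add s t)) (ActTm.add (ActTm.smul c s) (ActTm.smul c t))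
  -- the axioms of a linear category
  | id_comp {X Y : List ℕ+} (s : ActTm G X Y) : Rel R (ActTm.comp (one X) s) s
  | comp_id {X Y : List ℕ+} (s : ActTm G X Y) : Rel R (ActTm.comp s (one Y)) s
  | assoc {W X Y Z : List ℕ+} (s : ActTm G W X) (t : ActTm G X Y) (u : ActTm G Y Z) :
      Rel R (ActTm.comp (ActTm.comp s t) u) (ActTm.comp s (ActTm.comp t u))
  | add_comp {X Y Z : List ℕ+} (s s' : ActTm G X Y) (t : ActTm G Y Z) :
      Rel R (ActTm.comp (ActTm.add s s') t) (ActTm.add (ActTm.comp s t) (ActTm.comp s' t))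
  | comp_add {X Y Z : List ℕ+} (s : ActTm G X Y) (t t' : ActTm G Y Z) :
      Rel R (ActTm.comp s (ActTm.add t t')) (ActTm.add (ActTm.comp s t) (ActTm.comp s t'))
  | smul_comp {X Y Z : List ℕ+} (c : Kq) (s : ActTm G X Y) (t : ActTm G Y Z) :
      Rel R (ActTm.comp (ActTm.smul c s) t) (ActTm.smul c (ActTm.comp s t))
  | comp_smul {X Y Z : List ℕ+} (c : Kq) (s : ActTm G X Y) (t : ActTm G Y Z) :
      Rel R (ActTm.comp s (ActTm.smul c t)) (ActTm.smul c (ActTm.comp s t))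
  -- `f ↦ f ⊗ id_∅` is a linear functor
  | onUnit_comp {X Y Z : List ℕ+} (f : WHom X Y) (g : WHom Y Z) :
      Rel R (onUnit (WHom.comp f g)) (ActTm.comp (onUnit f) (onUnit g))
  | onUnit_add {X Y : List ℕ+} (f g : WHom X Y) :
      Rel R (onUnit (f + g)) (ActTm.add (onUnit f) (onUnit g))
  | onUnit_smul {X Y : List ℕ+} (c : Kq) (f : WHom X Y) :
      Rel R (onUnit (c • f)) (ActTm.smul c (onUnit f))
  -- the axioms of a bilinear action
  | act_onUnit {X Y X' Y' : List ℕ+} (f : WHom X Y) (g : WHom X' Y') :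
      Rel R (ActTm.act f (onUnit g)) (onUnit (WHom.tens f g))
  | act_comp {X Y Z X' Y' Z' : List ℕ+} (f : WHom X Y) (g : WHom Y Z) (s : ActTm G X' Y')
      (t : ActTm G Y' Z') : Rel R (ActTm.act (WHom.comp f g) (ActTm.comp s t))
        (ActTm.comp (ActTm.act f s) (ActTm.act g t))
  | add_act {X Y X' Y' : List ℕ+} (f g : WHom X Y) (t : ActTm G X' Y') :
      Rel R (ActTm.act (f + g) t) (ActTm.add (ActTm.act f t) (ActTm.act g t))
  | act_add {X Y X' Y' : List ℕ+} (f : WHom X Y) (s t : ActTm G X' Y') :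
      Rel R (ActTm.act f (ActTm.add s t)) (ActTm.add (ActTm.act f s) (ActTm.act f t))
  | smul_act {X Y X' Y' : List ℕ+} (c : Kq) (f : WHom X Y) (t : ActTm G X' Y') :
      Rel R (ActTm.act (c • f) t) (ActTm.smul c (ActTm.act f t))
  | act_smul {X Y X' Y' : List ℕ+} (c : Kq) (f : WHom X Y) (t : ActTm G X' Y') :
      Rel R (ActTm.act f (ActTm.smul c t)) (ActTm.smul c (ActTm.act f t))
  | tens_act {X Y X' Y' X'' Y'' : List ℕ+} (f : WHom X Y) (g : WHom X' Y')
      (t : ActTm G X'' Y'') :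
      Rel R (ActTm.comp (ActTm.act (WHom.tens f g) t)
          (onUnit (WHom.cast (List.append_assoc _ _ _))))
        (ActTm.comp (onUnit (WHom.cast (List.append_assoc _ _ _)))
          (ActTm.act f (ActTm.act g t)))
  | unit_act {X Y : List ℕ+} (t : ActTm G X Y) : Rel R (ActTm.act (WHom.one []) t) t

end ActTm

variable {G : List ℕ+ → List ℕ+ → Type}
  {R : {X Y : List ℕ+} → ActTm G X Y → ActTm G X Y → Prop}

/-- The morphisms `X ⊗ ∅ → Y ⊗ ∅` of the category with generators `G` and relations `R`. -/
def AHom (G : List ℕ+ → List ℕ+ → Type)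
    (R : {X Y : List ℕ+} → ActTm G X Y → ActTm G X Y → Prop) (X Y : List ℕ+) : Type :=
  Quotient (⟨ActTm.Rel R, ActTm.Rel.refl, ActTm.Rel.symm, ActTm.Rel.trans⟩ :
    Setoid (ActTm G X Y))

namespace AHom

open ActTm (Rel)

variable {X Y Z X' Y' X'' Y'' : List ℕ+}

/-- The class of a formal expression. -/
def mk (t : ActTm G X Y) : AHom G R X Y := Quotient.mk _ t

lemma sound {s t : ActTm G X Y} (h : Rel R s t) : (mk s : AHom G R X Y) = mk t := Quotient.sound h

lemma mk_surj (f : AHom G R X Y) : ∃ t, mk t = f := Quotient.exists_rep f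

/-- A generating morphism. -/
def gen (g : G X Y) : AHom G R X Y := mk (ActTm.gen g)

/-- The morphism `f ⊗ id_∅`. -/
def onUnit (f : WHom X Y) : AHom G R X Y := mk (ActTm.onUnit f)

/-- The identity of `X ⊗ ∅`. -/
def one (X : List ℕ+) : AHom G R X X := onUnit (WHom.one X)

/-- Composition in diagrammatic order. -/
def comp (s : AHom G R X Y) (t : AHom G R Y Z) : AHom G R X Z :=
  Quotient.map₂ ActTm.comp (fun _ _ h _ _ h' => Rel.comp h h') s t

/-- The action of a web on a morphism. -/
def act (f : WHom X Y) (t : AHom G R X' Y') : AHom G R (X ++ X') (Y ++ Y') :=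
  Quotient.map (ActTm.act f) (fun _ _ h => Rel.act f h) t

instance : Zero (AHom G R X Y) := ⟨mk ActTm.zero⟩

instance : Add (AHom G R X Y) := ⟨Quotient.map₂ ActTm.add (fun _ _ h _ _ h' => Rel.add h h')⟩

instance : SMul Kq (AHom G R X Y) :=
  ⟨fun c => Quotient.map (ActTm.smul c) (fun _ _ h => Rel.smul c h)⟩

noncomputable instance : Neg (AHom G R X Y) := ⟨fun f => (-1 : Kq) • f⟩

noncomputable instance acg : AddCommGroup (AHom G R X Y) where
  add_assoc := by
    rintro ⟨f⟩ ⟨g⟩ ⟨h⟩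
    exact sound (Rel.add_assoc f g h)
  add_comm := by
    rintro ⟨f⟩ ⟨g⟩
    exact sound (Rel.add_comm f g)
  zero_add := by
    rintro ⟨f⟩
    exact sound ((Rel.add_comm _ _).trans (Rel.add_zero f))
  add_zero := by
    rintro ⟨f⟩
    exact sound (Rel.add_zero f)
  nsmul := nsmulRec
  zsmul := zsmulRec
  neg_add_cancel := by
    rintro ⟨f⟩
    refine sound ((Rel.add (Rel.refl _) (Rel.one_smul f).symm).trans
      ((Rel.add_smul (-1) 1 f).symm.trans ?_))
    rw [neg_add_cancel]
    exact Rel.zero_smul f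

noncomputable instance mod : Module Kq (AHom G R X Y) where
  one_smul := by
    rintro ⟨f⟩
    exact sound (Rel.one_smul f)
  mul_smul := by
    rintro c d ⟨f⟩
    exact sound (Rel.mul_smul c d f)
  add_smul := by
    rintro c d ⟨f⟩
    exact sound (Rel.add_smul c d f)
  smul_add := by
    rintro c ⟨f⟩ ⟨g⟩
    exact sound (Rel.smul_add c f g)
  zero_smul := by
    rintro ⟨f⟩
    exact sound (Rel.zero_smul f)
  smul_zero := by
    intro c
    refine sound ((Rel.smul c (Rel.zero_smul ActTm.zero).symm).trans
      ((Rel.mul_smul c 0 _).symm.trans ?_))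
    rw [mul_zero]
    exact Rel.zero_smul _

lemma id_comp (s : AHom G R X Y) : comp (one X) s = s := by
  obtain ⟨s, rfl⟩ := mk_surj s
  exact sound (Rel.id_comp s)

lemma comp_id (s : AHom G R X Y) : comp s (one Y) = s := by
  obtain ⟨s, rfl⟩ := mk_surj s
  exact sound (Rel.comp_id s)

lemma assoc {W : List ℕ+} (s : AHom G R W X) (t : AHom G R X Y) (u : AHom G R Y Z) :
    comp (comp s t) u = comp s (comp t u) := by
  obtain ⟨s, rfl⟩ := mk_surj s
  obtain ⟨t, rfl⟩ := mk_surj t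
  obtain ⟨u, rfl⟩ := mk_surj u
  exact sound (Rel.assoc s t u)

lemma onUnit_comp (f : WHom X Y) (g : WHom Y Z) :
    (onUnit (WHom.comp f g) : AHom G R X Z) = comp (onUnit f) (onUnit g) :=
  sound (Rel.onUnit_comp f g)

lemma act_onUnit (f : WHom X Y) (g : WHom X' Y') :
    act f (onUnit g : AHom G R X' Y') = onUnit (WHom.tens f g) := sound (Rel.act_onUnit f g)

lemma act_comp {Z' : List ℕ+} (f : WHom X Y) (g : WHom Y Z) (s : AHom G R X' Y')
    (t : AHom G R Y' Z') : act (WHom.comp f g) (comp s t) = comp (act f s) (act g t) := by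
  obtain ⟨s, rfl⟩ := mk_surj s
  obtain ⟨t, rfl⟩ := mk_surj t
  exact sound (Rel.act_comp f g s t)

lemma act_one : act (WHom.one X) (one Y : AHom G R Y Y) = one (X ++ Y) :=
  (act_onUnit _ _).trans (congrArg onUnit WHom.tens_one)

lemma act_def (f : WHom X Y) (t : AHom G R X' Y') :
    act f t = comp (act f (one X')) (act (WHom.one Y) t) := by
  rw [← act_comp, WHom.comp_id, id_comp]

lemma tens_act (f : WHom X Y) (g : WHom X' Y') (t : AHom G R X'' Y'') :
    comp (act (WHom.tens f g) t) (onUnit (WHom.cast (List.append_assoc _ _ _))) =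
      comp (onUnit (WHom.cast (List.append_assoc _ _ _))) (act f (act g t)) := by
  obtain ⟨t, rfl⟩ := mk_surj t
  exact sound (Rel.tens_act f g t)

lemma unit_act (t : AHom G R X Y) : act (WHom.one []) t = t := by
  obtain ⟨t, rfl⟩ := mk_surj t
  exact sound (Rel.unit_act t)

lemma cast_comp_cast (h : X = Y) (h' : Y = Z) :
    comp (onUnit (WHom.cast h) : AHom G R X Y) (onUnit (WHom.cast h')) =
      onUnit (WHom.cast (h.trans h')) := by
  rw [← onUnit_comp, WHom.cast_comp_cast]

lemma act_cast (h : X = Y) (h' : X' = Y') :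
    act (WHom.cast h) (onUnit (WHom.cast h') : AHom G R X' Y') =
      onUnit (WHom.cast (congrArg₂ (fun a b => a ++ b) h h')) := by
  rw [act_onUnit, WHom.cast_tens_cast]

lemma tens_act' (f : WHom X Y) (g : WHom X' Y') (t : AHom G R X'' Y'') :
    act (WHom.tens f g) t = comp (onUnit (WHom.cast (List.append_assoc _ _ _)))
      (comp (act f (act g t)) (onUnit (WHom.cast (List.append_assoc _ _ _).symm))) := by
  rw [← assoc, ← tens_act, assoc, cast_comp_cast]
  exact (comp_id _).symm

lemma associator_act (X Y Z W : List ℕ+) :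
    comp (act (WHom.cast (List.append_assoc X Y Z)) (one W))
      (comp (onUnit (WHom.cast (List.append_assoc X (Y ++ Z) W)))
        (act (WHom.one X) (onUnit (WHom.cast (List.append_assoc Y Z W))))) =
    comp (onUnit (WHom.cast (List.append_assoc (X ++ Y) Z W)) : AHom G R _ _)
      (onUnit (WHom.cast (List.append_assoc X Y (Z ++ W)))) := by
  rw [one, WHom.one, WHom.one, act_cast, act_cast, cast_comp_cast, cast_comp_cast, cast_comp_cast]

end AHom

/-- The linear category with an action of the category of type A webs which is generated by an
object `∅` and the morphisms `G`, modulo the relations `R` (before passing to the additive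
closure). Its objects are the `X ⊗ ∅`, for `X` a finite sequence of positive integers. -/
def ActWeb (G : List ℕ+ → List ℕ+ → Type)
    (R : {X Y : List ℕ+} → ActTm G X Y → ActTm G X Y → Prop) : Type := List ℕ+

namespace ActWeb

open ActTm (Rel)

instance : Category (ActWeb G R) where
  Hom X Y := AHom G R X Y
  id X := AHom.one X
  comp f g := AHom.comp f g
  id_comp := AHom.id_comp
  comp_id := AHom.comp_id
  assoc := AHom.assoc

noncomputable instance : Preadditive (ActWeb G R) where
  homGroup X Y := AHom.acg (X := X) (Y := Y)
  add_comp := by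
    rintro X Y Z ⟨f⟩ ⟨f'⟩ ⟨g⟩
    exact AHom.sound (Rel.add_comp f f' g)
  comp_add := by
    rintro X Y Z ⟨f⟩ ⟨g⟩ ⟨g'⟩
    exact AHom.sound (Rel.comp_add f g g')

noncomputable instance : Linear Kq (ActWeb G R) where
  homModule X Y := AHom.mod (X := X) (Y := Y)
  smul_comp := by
    rintro X Y Z c ⟨f⟩ ⟨g⟩
    exact AHom.sound (Rel.smul_comp c f g)
  comp_smul := by
    rintro X Y Z ⟨f⟩ c ⟨g⟩
    exact AHom.sound (Rel.comp_smul c f g)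

/-- Equal objects are isomorphic. -/
def castIso {X Y : List ℕ+} (h : X = Y) : @Iso (ActWeb G R) _ X Y where
  hom := AHom.onUnit (WHom.cast h)
  inv := AHom.onUnit (WHom.cast h.symm)
  hom_inv_id := AHom.cast_comp_cast _ _
  inv_hom_id := AHom.cast_comp_cast _ _

instance : MonoidalLeftAction WebA (ActWeb G R) where
  actionObj X Y := List.append X Y
  actionHom f t := AHom.act f t
  actionHomLeft f Y := AHom.act f (AHom.one Y)
  actionHomRight X _ _ t := AHom.act (WHom.one X) t
  actionAssocIso X Y Z := castIso (List.append_assoc X Y Z)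
  actionUnitIso X := castIso (List.nil_append X)
  actionHom_def f t := AHom.act_def f t
  actionHomRight_id X Y := AHom.act_one
  id_actionHomLeft X Y := AHom.act_one
  actionHom_comp f f' t t' := AHom.act_comp f f' t t'
  actionAssocIso_hom_naturality f g t := AHom.tens_act f g t
  actionUnitIso_hom_naturality t :=
    (AHom.id_comp t).trans ((AHom.unit_act t).symm.trans (AHom.comp_id _).symm)
  whiskerLeft_actionHomLeft X _ _ f Z := AHom.tens_act' (WHom.one X) f (AHom.one Z)
  whiskerRight_actionHomLeft Y f Z :=
    (AHom.tens_act' f (WHom.one Y) (AHom.one Z)).trans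
      (congrArg (fun x => AHom.comp (AHom.onUnit (WHom.cast (List.append_assoc _ _ _)))
        (AHom.comp (AHom.act f x) (AHom.onUnit (WHom.cast (List.append_assoc _ _ _).symm))))
          AHom.act_one)
  associator_actionHom X Y Z W := AHom.associator_act X Y Z W
  leftUnitor_actionHom X Y := AHom.act_one.trans (AHom.id_comp _).symm
  rightUnitor_actionHom X Y := by
    refine (AHom.act_cast (List.append_nil X) (rfl : (Y : List ℕ+) = Y)).trans ?_
    refine Eq.trans ?_ (congrArg (AHom.comp _)
      (AHom.act_cast (rfl : (X : List ℕ+) = X) (List.nil_append Y)).symm)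
    exact (AHom.cast_comp_cast _ _).symm

end ActWeb

end ActWeb

section SymplecticWebs

/-- The split of a `2`-labelled strand after a merge of two `1`-labelled strands. -/
def ms : WHom [1, 1] [1, 1] := WHom.comp (WHom.merge 1 1) (WHom.split 1 1)

/-- The overcrossing of two thin strands. -/
noncomputable def crossOver : WHom [1, 1] [1, 1] := (-qpar⁻¹) • WHom.one [1, 1] + ms

/-- The undercrossing of two thin strands. -/
noncomputable def crossUnder : WHom [1, 1] [1, 1] := (-qpar) • WHom.one [1, 1] + ms

/-- The generating morphisms of dot webs: start dot and end dot. -/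
inductive DotGen : List ℕ+ → List ℕ+ → Type
  | startDot : DotGen [] [2]
  | endDot : DotGen [2] []

/-- The start dot. -/
def startDot : ActTm DotGen [] [2] := ActTm.gen DotGen.startDot

/-- The end dot. -/
def endDot : ActTm DotGen [2] [] := ActTm.gen DotGen.endDot

/-- The morphism `id_X ⊗ t`. -/
def pad {G : List ℕ+ → List ℕ+ → Type} (X : List ℕ+) {Y Z : List ℕ+} (t : ActTm G Y Z) :
    ActTm G (X ++ Y) (X ++ Z) := ActTm.act (WHom.one X) t

/-- The cup made of a start dot and a split. -/
def dotCup : ActTm DotGen [] [1, 1] := startDot.comp (ActTm.onUnit (WHom.split 1 1))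

/-- The cap made of a merge and an end dot. -/
def dotCap : ActTm DotGen [1, 1] [] := (ActTm.onUnit (WHom.merge 1 1)).comp endDot

/-- The morphism `id_X ⊗ f ⊗ id_Y`. -/
def mid (X Y : List ℕ+) {Z W : List ℕ+} (f : WHom Z W) : WHom (X ++ (Z ++ Y)) (X ++ (W ++ Y)) :=
  WHom.tens (WHom.one X) (WHom.tens f (WHom.one Y))

/-- The web `ms ⊗ ms`. -/
def msms : WHom [1, 1, 1, 1] [1, 1, 1, 1] := WHom.tens ms ms

/-- The web `ms ⊗ id_{1 ⊗ 1}`. -/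
def msLeft : WHom [1, 1, 1, 1] [1, 1, 1, 1] := WHom.tens ms (WHom.one [1, 1])

/-- The web `id_{1 ⊗ 1} ⊗ ms`. -/
def msRight : WHom [1, 1, 1, 1] [1, 1, 1, 1] := WHom.tens (WHom.one [1, 1]) ms

/-- The two sides of the sliding relation for a cap, `(f ⊗ id) (id ⊗ f ⊗ id) (id ⊗ cap) cap`,
with `f` on the left strands or on the right strands first. -/
def slideCap {G : List ℕ+ → List ℕ+ → Type} (cap : ActTm G [1, 1] [])
    (f : WHom [1, 1, 1, 1] [1, 1, 1, 1]) : ActTm G [1, 1, 1, 1] [] :=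
  (ActTm.onUnit (WHom.comp f (mid [1] [1] ms))).comp ((pad [1, 1] cap).comp cap)

/-- The two sides of the sliding relation for a cup. -/
def slideCup {G : List ℕ+ → List ℕ+ → Type} (cup : ActTm G [] [1, 1])
    (f : WHom [1, 1, 1, 1] [1, 1, 1, 1]) : ActTm G [] [1, 1, 1, 1] :=
  (cup.comp (pad [1, 1] cup)).comp (ActTm.onUnit (WHom.comp (mid [1] [1] ms) f))

/-- The relations of dot webs with parameter `z`. -/
inductive DotRel (z : Kq) : {X Y : List ℕ+} → ActTm DotGen X Y → ActTm DotGen X Y → Prop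
  | barbell : DotRel z (startDot.comp endDot) (ActTm.smul (zqnum z 2 0) (ActTm.one []))
  | thinK : DotRel z
      ((pad [1] startDot).comp ((ActTm.onUnit (WHom.comp (WHom.merge 1 2) (WHom.split 1 2))).comp
        (pad [1] endDot)))
      (ActTm.smul (zqnum z 2 (-1)) (ActTm.one [1]))
  | thickK : DotRel z
      ((pad [2] startDot).comp ((ActTm.onUnit (WHom.comp (WHom.merge 2 2) (WHom.split 2 2))).comp
        (pad [2] endDot)))
      (ActTm.add (endDot.comp startDot) (ActTm.smul (zqnum z 2 (-2)) (ActTm.one [2])))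
  | slideCap : DotRel z (slideCap dotCap msLeft)
      (slideCap dotCap msRight)
  | slideCup : DotRel z (slideCup dotCup msLeft)
      (slideCup dotCup msRight)

/-- The category of dot webs with parameter `z`. -/
abbrev DotWeb (z : Kq) : Type := ActWeb DotGen (DotRel z)

/-- The generating morphisms of cup webs: cup and cap. -/
inductive CupGen : List ℕ+ → List ℕ+ → Type
  | cup : CupGen [] [1, 1]
  | cap : CupGen [1, 1] []

/-- The cup. -/
def cup : ActTm CupGen [] [1, 1] := ActTm.gen CupGen.cup

/-- The cap. -/
def cap : ActTm CupGen [1, 1] [] := ActTm.gen CupGen.cap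

/-- The relations of cup webs with parameter `z`. -/
inductive CupRel (z : Kq) : {X Y : List ℕ+} → ActTm CupGen X Y → ActTm CupGen X Y → Prop
  | circle : CupRel z (cup.comp cap) (ActTm.smul (zqnum z 1 0) (ActTm.one []))
  | bubble : CupRel z
      ((pad [1] cup).comp ((ActTm.onUnit (WHom.tens ms (WHom.one [1]))).comp (pad [1] cap)))
      (ActTm.smul (zqnum z 1 (-1)) (ActTm.one [1]))
  | lasso : CupRel z
      ((pad [1, 1] cup).comp ((ActTm.onUnit (WHom.comp (mid [1] [1] crossUnder)
        (WHom.comp msms (mid [1] [1] crossOver)))).comp (pad [1, 1] cap)))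
      (ActTm.add (cap.comp cup) (ActTm.smul (zqnum z 1 (-2)) (ActTm.one [1, 1])))
  | lollipopCup : CupRel z (cup.comp (ActTm.onUnit (WHom.merge 1 1))) ActTm.zero
  | lollipopCap : CupRel z ((ActTm.onUnit (WHom.split 1 1)).comp cap) ActTm.zero
  | slideCap : CupRel z (slideCap cap msLeft)
      (slideCap cap msRight)
  | slideCup : CupRel z (slideCup cup msLeft)
      (slideCup cup msRight)

/-- The category of cup webs with parameter `z`. -/
abbrev CupWeb (z : Kq) : Type := ActWeb CupGen (CupRel z)

end SymplecticWebs

section Closure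

namespace AlgRep

variable {k : Type} [Field k] {A : Type} [Ring A] [Algebra k A]

/-- The direct sum of a finite family of representations. -/
noncomputable def dsum {J : Type} [Fintype J] (f : J → AlgRep k A) : AlgRep k A where
  V := ∀ j, (f j).V
  ρ := AlgHom.ofLinearMap
    { toFun := fun a => LinearMap.pi fun j => (f j).ρ a ∘ₗ LinearMap.proj j
      map_add' := fun a b => by ext x j; simp
      map_smul' := fun c a => by ext x j; simp }
    (by ext x j; simp)
    (fun a b => by ext x j; simp)

open scoped Classical in
/-- The inclusion of a direct summand. -/
noncomputable def incl {J : Type} [Fintype J] (f : J → AlgRep k A) (j : J) : f j ⟶ dsum f :=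
  ⟨LinearMap.single k (fun j => (f j).V) j, fun a => by
    refine LinearMap.ext fun x => funext fun i => ?_
    change (Pi.single j ((f j).ρ a x) : ∀ j, (f j).V) i = (f i).ρ a
      ((Pi.single j x : ∀ j, (f j).V) i)
    by_cases h : i = j
    · subst h; simp
    · simp [Pi.single_eq_of_ne h]⟩

lemma pi_sum_apply {I J : Type} [Fintype I] {U : I → Type} {V : J → Type}
    [∀ i, AddCommGroup (U i)] [∀ i, Module k (U i)] [∀ j, AddCommGroup (V j)]
    [∀ j, Module k (V j)] (m : ∀ i j, U i →ₗ[k] V j) (x : ∀ i, U i) (j : J) :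
    (LinearMap.pi fun j => ∑ i, m i j ∘ₗ LinearMap.proj i) x j = ∑ i, m i j (x i) := by
  rw [LinearMap.pi_apply, LinearMap.sum_apply]
  rfl

/-- The morphism of direct sums given by a matrix of morphisms. -/
noncomputable def matrix {I J : Type} [Fintype I] [Fintype J] {f : I → AlgRep k A}
    {g : J → AlgRep k A} (m : ∀ i j, f i ⟶ g j) : dsum f ⟶ dsum g :=
  ⟨LinearMap.pi fun j => ∑ i, lin (m i j) ∘ₗ LinearMap.proj i, fun a => by
    refine LinearMap.ext fun x => funext fun j => ?_
    have h : ∀ i, lin (m i j) ((f i).ρ a (x i)) = (g j).ρ a (lin (m i j) (x i)) := fun i =>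
      LinearMap.congr_fun ((m i j).2 a) (x i)
    refine (pi_sum_apply (fun i j => lin (m i j)) (fun i => (f i).ρ a (x i)) j).trans ?_
    refine Eq.trans ?_ (congrArg ((g j).ρ a) (pi_sum_apply (fun i j => lin (m i j)) x j)).symm
    rw [map_sum]
    exact Finset.sum_congr rfl fun i _ => h i⟩

lemma matrix_apply {I J : Type} [Fintype I] [Fintype J] {f : I → AlgRep k A}
    {g : J → AlgRep k A} (m : ∀ i j, f i ⟶ g j) (x : (dsum f).V) (j : J) :
    (lin (matrix m) x : ∀ j, (g j).V) j = ∑ i, lin (m i j) ((x : ∀ i, (f i).V) i) :=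
  pi_sum_apply (fun i j => lin (m i j)) x j

lemma lin_sum {M N : AlgRep k A} {J : Type} (s : Finset J) (f : J → (M ⟶ N)) :
    lin (∑ j ∈ s, f j) = ∑ j ∈ s, lin (f j) :=
  map_sum (homs M N).subtype f s

end AlgRep

variable {G : List ℕ+ → List ℕ+ → Type}
  {R : {X Y : List ℕ+} → ActTm G X Y → ActTm G X Y → Prop}

namespace ActWeb

open ActTm (Rel)

/-- The action of type A webs is bilinear. -/
lemma act_bilin {X Y : WebA} {X' Y' : ActWeb G R} (f g : X ⟶ Y) (s t : X' ⟶ Y') (c : Kq) :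
    (f + g) ⊙ₗₘ s = f ⊙ₗₘ s + g ⊙ₗₘ s ∧ f ⊙ₗₘ (s + t) = f ⊙ₗₘ s + f ⊙ₗₘ t ∧
      (c • f) ⊙ₗₘ s = c • (f ⊙ₗₘ s) ∧ f ⊙ₗₘ (c • s) = c • (f ⊙ₗₘ s) := by
  obtain ⟨s, rfl⟩ := AHom.mk_surj s
  obtain ⟨t, rfl⟩ := AHom.mk_surj t
  exact ⟨AHom.sound (Rel.add_act f g s), AHom.sound (Rel.act_add f s t),
    AHom.sound (Rel.smul_act c f s), AHom.sound (Rel.act_smul c f s)⟩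

lemma zero_act {X Y : WebA} {X' Y' : ActWeb G R} (t : X' ⟶ Y') :
    (0 : X ⟶ Y) ⊙ₗₘ t = 0 := by
  have h := (act_bilin (0 : X ⟶ Y) 0 t 0 0).1
  rw [add_zero] at h
  exact left_eq_add.mp h

lemma act_zero {X Y : WebA} {X' Y' : ActWeb G R} (f : X ⟶ Y) :
    f ⊙ₗₘ (0 : X' ⟶ Y') = 0 := by
  have h := (act_bilin f 0 (0 : X' ⟶ Y') 0 0).2.1
  rw [add_zero] at h
  exact left_eq_add.mp h

lemma act_sum {X Y : WebA} {X' Y' : ActWeb G R} {I J : Type} [Fintype I] [Fintype J]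
    (f : I → (X ⟶ Y)) (t : J → (X' ⟶ Y')) :
    (∑ i, f i) ⊙ₗₘ (∑ j, t j) = ∑ p : I × J, f p.1 ⊙ₗₘ t p.2 := by
  let L : (X ⟶ Y) →+ (X' ⟶ Y') →+ (X ⊙ₗ X' ⟶ Y ⊙ₗ Y') :=
    AddMonoidHom.mk' (fun f => AddMonoidHom.mk' (fun t => f ⊙ₗₘ t)
      fun s t => (act_bilin f 0 s t 0).2.1) fun f g => by
        ext t
        exact (act_bilin f g t 0 0).1
  change L (∑ i, f i) (∑ j, t j) = _
  rw [map_sum L, AddMonoidHom.finsetSum_apply, Fintype.sum_prod_type]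
  exact Finset.sum_congr rfl fun i _ => map_sum _ _ _

/-- The action of type A webs on objects, extended to formal direct sums componentwise. -/
def matObj (P : Mat_ WebA × Mat_ (ActWeb G R)) : Mat_ (ActWeb G R) :=
  ⟨P.1.ι × P.2.ι, fun p => P.1.X p.1 ⊙ₗ P.2.X p.2⟩

/-- The action of type A webs, extended to the additive closures componentwise. -/
noncomputable def matAct : Mat_ WebA × Mat_ (ActWeb G R) ⥤ Mat_ (ActWeb G R) where
  obj P := matObj P
  map f := fun p q => f.1 p.1 q.1 ⊙ₗₘ f.2 p.2 q.2
  map_id P := by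
    apply Mat_.hom_ext
    rintro ⟨i, j⟩ ⟨i', j'⟩
    change (𝟙 P.1 : Mat_.Hom _ _) i i' ⊙ₗₘ (𝟙 P.2 : Mat_.Hom _ _) j j' = _
    by_cases h : i = i'
    · subst h
      by_cases h' : j = j'
      · subst h'
        rw [Mat_.id_apply_self, Mat_.id_apply_self]
        exact (MonoidalLeftAction.id_actionHom _ _).trans
          ((MonoidalLeftAction.actionHomRight_id _ _).trans
            (Mat_.id_apply_self (matObj P) (i, j)).symm)
      · rw [Mat_.id_apply_of_ne P.2 j j' h', act_zero]
        exact (Mat_.id_apply_of_ne (matObj P) (i, j) (i, j') fun e => h' (Prod.mk.inj e).2).symm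
    · rw [Mat_.id_apply_of_ne P.1 i i' h, zero_act]
      exact (Mat_.id_apply_of_ne (matObj P) (i, j) (i', j') fun e => h (Prod.mk.inj e).1).symm
  map_comp f g := by
    apply Mat_.hom_ext
    rintro ⟨i, j⟩ ⟨i', j'⟩
    change (f.1 ≫ g.1) i i' ⊙ₗₘ (f.2 ≫ g.2) j j' = _
    rw [Mat_.comp_apply, Mat_.comp_apply, act_sum]
    refine Finset.sum_congr rfl fun p _ => ?_
    exact MonoidalLeftAction.actionHom_comp _ _ _ _

end ActWeb

end Closure

section Presentation

/-- A `ℂ(q)`-linear functor between linear categories with prescribed values on objects. -/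
structure LinFunctorOn {C : Type} [Category.{0} C] [Preadditive C] [Linear Kq C]
    {D : Type 1} [Category.{0} D] [Preadditive D] [Linear Kq D] (obj : C → D) where
  map {X Y : C} : (X ⟶ Y) →ₗ[Kq] (obj X ⟶ obj Y)
  map_id (X : C) : map (𝟙 X) = 𝟙 (obj X)
  map_comp {X Y Z : C} (f : X ⟶ Y) (g : Y ⟶ Z) : map (f ≫ g) = map f ≫ map g

namespace LinFunctorOn

/-- The extension of a linear functor to the additive closure: a formal direct sum is sent to the
direct sum, and a matrix of morphisms to the matrix of their images. -/
noncomputable def closure {C : Type} [Category.{0} C] [Preadditive C] [Linear Kq C] {A : Type}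
    [Ring A] [Algebra Kq A] {obj : C → AlgRep Kq A} (F : LinFunctorOn obj) :
    Mat_ C ⥤ AlgRep Kq A where
  obj M := AlgRep.dsum fun i => obj (M.X i)
  map f := AlgRep.matrix fun i j => F.map (f i j)
  map_id M := by
    apply AlgRep.hom_ext
    refine LinearMap.ext fun x => funext fun j => ?_
    refine (AlgRep.matrix_apply _ x j).trans ?_
    rw [Finset.sum_eq_single j]
    · rw [Mat_.id_apply_self, F.map_id]
      rfl
    · intro i _ h
      rw [Mat_.id_apply_of_ne M i j h, map_zero]
      rfl
    · intro h
      exact absurd (Finset.mem_univ j) h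
  map_comp {L M N} f g := by
    apply AlgRep.hom_ext
    refine LinearMap.ext fun x => funext fun l => ?_
    refine (AlgRep.matrix_apply (fun i l => F.map ((f ≫ g) i l)) x l).trans ?_
    refine Eq.trans ?_ (AlgRep.matrix_apply (fun j l => F.map (g j l))
      (AlgRep.lin (AlgRep.matrix fun i j => F.map (f i j)) x) l).symm
    have h : ∀ i, AlgRep.lin (F.map ((f ≫ g) i l)) =
        ∑ j, AlgRep.lin (F.map (g j l)) ∘ₗ AlgRep.lin (F.map (f i j)) := fun i => by
      rw [Mat_.comp_apply, map_sum, AlgRep.lin_sum]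
      exact Finset.sum_congr rfl fun j _ => congrArg AlgRep.lin (F.map_comp _ _)
    have h' : ∀ j, (AlgRep.lin (AlgRep.matrix fun i j => F.map (f i j)) x : ∀ j, _) j =
      ∑ i, AlgRep.lin (F.map (f i j)) ((x : ∀ i, (obj (L.X i)).V) i) :=
        AlgRep.matrix_apply (fun i j => F.map (f i j)) x
    let T : L.ι → M.ι → (obj (N.X l)).V := fun i j =>
      AlgRep.lin (F.map (g j l)) (AlgRep.lin (F.map (f i j)) ((x : ∀ i, (obj (L.X i)).V) i))
    refine Eq.trans (b := ∑ i, ∑ j, T i j) (Finset.sum_congr rfl fun i _ => ?_)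
      (Finset.sum_comm.trans (Finset.sum_congr rfl fun j _ => ?_))
    · rw [h i, LinearMap.sum_apply]
      rfl
    · rw [h' j, map_sum]

end LinFunctorOn

variable {n : ℕ}

/-- The tensor product of the representations `P a`, where `a` runs through a sequence. -/
noncomputable def seqObj (P : ℕ → AlgRep Kq (Uq n)) : List ℕ+ → AlgRep Kq (Uq n)
  | [] => 𝟙_ (AlgRep Kq (Uq n))
  | a :: X => P a ⊗ seqObj P X

/-- Concatenation of sequences corresponds to the tensor product. -/
noncomputable def seqMu (P : ℕ → AlgRep Kq (Uq n)) :
    (X Y : List ℕ+) → (seqObj P (X ++ Y) ≅ seqObj P X ⊗ seqObj P Y)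
  | [], Y => (λ_ (seqObj P Y)).symm
  | a :: X, Y => whiskerLeftIso (P a) (seqMu P X Y) ≪≫ (α_ (P a) (seqObj P X) (seqObj P Y)).symm

/-- The object map of a presentation functor with values in representations of the coideal
subalgebra. -/
noncomputable abbrev seqRes (P : ℕ → AlgRep Kq (Uq n)) (X : List ℕ+) : AlgRep Kq (Uqsp n) :=
  (resSp n).obj (seqObj P X)

/-- Concatenation of sequences corresponds to the action. -/
noncomputable def seqNu (P : ℕ → AlgRep Kq (Uq n)) (X Y : List ℕ+) :
    seqRes P (X ++ Y) ≅ seqObj P X ⊙ₗ seqRes P Y :=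
  (resSp n).mapIso (seqMu P X Y) ≪≫ resTens n (seqObj P X) (seqObj P Y)

/-- The action of representations of the quantized enveloping algebra on representations of the
coideal subalgebra, as a functor on the product. -/
noncomputable def repAct (n : ℕ) : AlgRep Kq (Uq n) × AlgRep Kq (Uqsp n) ⥤ AlgRep Kq (Uqsp n) :=
  Functor.uncurry.obj (MonoidalLeftAction.curriedAction _ _)

/-- The subset `A` of the positions `0, ..., a + b - 1` selects the letters `w_i`, `i ∈ A`. -/
def pick {n m a : ℕ} (w : Fin m → Fin n) (A : Finset (Fin m)) (h : A.card = a) : Fin a → Fin n :=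
  w ∘ A.orderEmbOfFin h

lemma card_compl' {a b : ℕ} {A : Finset (Fin (a + b))} (h : A.card = a) : Aᶜ.card = b := by
  rw [Finset.card_compl, Fintype.card_fin, h, Nat.add_sub_cancel_left]

/-- The pairs of a position `u` in `A` and a position `v` not in `A` with `v < u`. -/
def invPairs {m : ℕ} (A : Finset (Fin m)) : Finset (Fin m × Fin m) :=
  (A ×ˢ Aᶜ).filter fun p => p.2 < p.1

variable (P : ℕ → AlgRep Kq (Uq n))

/-- The element `1` of the trivial representation. -/
noncomputable def unitVec : (seqObj P []).V := (1 : Kq)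

/-- A vector of `P a`, as a vector of the tensor product of a sequence of length one. -/
noncomputable def vec1 {a : ℕ+} (x : (P a).V) : (seqObj P [a]).V := x ⊗ₜ[Kq] unitVec P

/-- The vector `x ⊗ y` of `P a ⊗ P b`. -/
noncomputable def vec2 {a b : ℕ+} (x : (P a).V) (y : (P b).V) : (seqObj P [a, b]).V :=
  x ⊗ₜ[Kq] vec1 P y

/-- The defining properties of a type A presentation functor with values `P a`. Here
`vec` gives the quantum exterior or symmetric monomials in the `P a`, the words satisfying `std` index a basis,
and the split map sends a basis vector to the sum over all ways of distributing the letters, with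
coefficients `coef`. -/
structure IsGammaA (vec : {a : ℕ} → (Fin a → Fin n) → (P a).V)
    (std : {a : ℕ} → (Fin a → Fin n) → Prop)
    (coef : (a b : ℕ) → (Fin (a + b) → Fin n) → Finset (Fin (a + b)) → Kq)
    (F : LinFunctorOn (C := WebA) (seqObj P)) : Prop where
  tens {X Y X' Y' : WebA} (f : X ⟶ Y) (g : X' ⟶ Y') :
    F.map (f ⊗ₘ g) = (seqMu P X X').hom ≫ (F.map f ⊗ₘ F.map g) ≫ (seqMu P Y Y').inv
  merge (a b : ℕ+) (v : Fin a → Fin n) (w : Fin b → Fin n) :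
    AlgRep.lin (F.map (X := ([a, b] : List ℕ+)) (Y := ([a + b] : List ℕ+)) (WHom.merge a b))
      (vec2 P (vec v) (vec w)) = vec1 P (a := a + b) (vec (Fin.append v w))
  split (a b : ℕ+) (w : Fin (a + b : ℕ) → Fin n) (hw : std w) :
    AlgRep.lin (F.map (X := ([a + b] : List ℕ+)) (Y := ([a, b] : List ℕ+)) (WHom.split a b))
      (vec1 P (a := a + b) (vec w)) =
        ∑ A : {A : Finset (Fin (a + b : ℕ)) // A.card = a}, coef a b w A.1 •
          vec2 P (a := a) (b := b) (vec (pick w A.1 A.2)) (vec (pick w A.1ᶜ (card_compl' A.2)))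

/-- The functor `F` is the exterior presentation functor of type A. -/
def IsGammaAExt (n : ℕ) (F : LinFunctorOn (C := WebA) (seqObj (extPow n))) : Prop :=
  IsGammaA (extPow n) extVec (fun w => StrictMono w)
    (fun a b _ A => (-1) ^ (invPairs A).card * qpar ^ ((a : ℤ) * b - (invPairs A).card)) F

/-- The functor `F` is the symmetric presentation functor of type A. -/
def IsGammaASym (n : ℕ) (F : LinFunctorOn (C := WebA) (seqObj (symPow n))) : Prop :=
  IsGammaA (symPow n) symVec (fun w => Monotone w)
    (fun a b w A => qpar ^ (((invPairs A).card : ℤ) - a * b +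
      ((invPairs A).filter fun p => w p.1 = w p.2).card)) F

/-- The functor `F` extends the type A presentation functor `FA` and is compatible with
the actions of the category of type A webs and of the category of representations. -/
structure IsExtension {G : List ℕ+ → List ℕ+ → Type}
    {R : {X Y : List ℕ+} → ActTm G X Y → ActTm G X Y → Prop}
    (FA : LinFunctorOn (C := WebA) (seqObj P))
    (F : LinFunctorOn (C := ActWeb G R) (seqRes P)) : Prop where
  onUnit {X Y : WebA} (f : X ⟶ Y) :
    F.map (X := (X : List ℕ+)) (Y := (Y : List ℕ+)) (AHom.onUnit f) = (resSp n).map (FA.map f)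
  act {X Y : WebA} {X' Y' : ActWeb G R} (f : X ⟶ Y) (t : X' ⟶ Y') :
    F.map (f ⊙ₗₘ t) = (seqNu P X X').hom ≫ (FA.map f ⊙ₗₘ F.map t) ≫ (seqNu P Y Y').inv

/-- The index `2 k` of a basis vector, counted from `0`. -/
def evenIdx (k : Fin (n / 2)) : Fin n := ⟨2 * k, by omega⟩

/-- The index `2 k + 1` of a basis vector, counted from `0`. -/
def oddIdx (k : Fin (n / 2)) : Fin n := ⟨2 * k + 1, by omega⟩

/-- The functor `F` is the exterior presentation functor of type C, on the part `FA` of type A. -/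
structure IsGammaCExt (n : ℕ) (FA : LinFunctorOn (C := WebA) (seqObj (extPow n)))
    (F : LinFunctorOn (C := DotWeb (qpar ^ n)) (seqRes (extPow n))) : Prop
    extends IsExtension (extPow n) FA F where
  startDot :
    AlgRep.lin (F.map (X := ([] : List ℕ+)) (Y := ([2] : List ℕ+)) (AHom.gen DotGen.startDot))
      (unitVec (extPow n)) =
        ∑ k : Fin (n / 2), qpar ^ (-(k : ℤ)) •
          vec1 (extPow n) (a := 2) (extVec (a := 2) ![evenIdx k, oddIdx k])
  endDot (i j : Fin n) (hij : i < j) :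
    AlgRep.lin (F.map (X := ([2] : List ℕ+)) (Y := ([] : List ℕ+)) (AHom.gen DotGen.endDot))
      (vec1 (extPow n) (a := 2) (extVec (a := 2) ![i, j])) =
        (if Even (i : ℕ) ∧ (j : ℕ) = i + 1 then qpar ^ ((n : ℤ) - 3 * (i / 2 : ℕ) - 2) else 0) •
          unitVec (extPow n)

/-- The functor `F` is the symmetric presentation functor of type C, on the part `FA` of type A. -/
structure IsGammaCSym (n : ℕ) (FA : LinFunctorOn (C := WebA) (seqObj (symPow n)))
    (F : LinFunctorOn (C := CupWeb (-(qpar ^ n)⁻¹)) (seqRes (symPow n))) : Prop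
    extends IsExtension (symPow n) FA F where
  cup :
    AlgRep.lin (F.map (X := ([] : List ℕ+)) (Y := ([1, 1] : List ℕ+)) (AHom.gen CupGen.cup))
      (unitVec (symPow n)) =
        ∑ k : Fin (n / 2), qpar ^ (-(k : ℤ)) •
          (qpar • vec2 (symPow n) (a := 1) (b := 1) (symVec (a := 1) ![evenIdx k])
              (symVec (a := 1) ![oddIdx k]) -
            vec2 (symPow n) (a := 1) (b := 1) (symVec (a := 1) ![oddIdx k])
              (symVec (a := 1) ![evenIdx k]))
  cap (i j : Fin n) :
    AlgRep.lin (F.map (X := ([1, 1] : List ℕ+)) (Y := ([] : List ℕ+)) (AHom.gen CupGen.cap))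
      (vec2 (symPow n) (a := 1) (b := 1) (symVec (a := 1) ![i]) (symVec (a := 1) ![j])) =
        (if Even (i : ℕ) ∧ (j : ℕ) = i + 1 then qpar ^ ((n : ℤ) - 3 * (i / 2 : ℕ) - 2)
          else if Odd (i : ℕ) ∧ (i : ℕ) = j + 1 then -qpar ^ ((n : ℤ) - 3 * (i / 2 : ℕ) - 3)
          else 0) • unitVec (symPow n)

section Square

variable {G : List ℕ+ → List ℕ+ → Type} {R : {X Y : List ℕ+} → ActTm G X Y → ActTm G X Y → Prop}
  (FA : LinFunctorOn (C := WebA) (seqObj P)) (F : LinFunctorOn (C := ActWeb G R) (seqRes P))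

/-- First let type A webs act, then apply the presentation functor, on the additive closures. -/
noncomputable def actThenF : Mat_ WebA × Mat_ (ActWeb G R) ⥤ AlgRep Kq (Uqsp n) :=
  ActWeb.matAct ⋙ F.closure

/-- First apply the presentation functors, then let representations act, on the additive
closures. -/
noncomputable def fThenAct : Mat_ WebA × Mat_ (ActWeb G R) ⥤ AlgRep Kq (Uqsp n) :=
  FA.closure.prod F.closure ⋙ repAct n

/-- The inclusion of a direct summand. -/
noncomputable def actThenFIncl (M : Mat_ WebA) (N : Mat_ (ActWeb G R)) (i : M.ι) (j : N.ι) :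
    seqRes P (List.append (M.X i) (N.X j)) ⟶ (actThenF P F).obj (M, N) :=
  AlgRep.incl (fun p : M.ι × N.ι => seqRes P (List.append (M.X p.1) (N.X p.2))) (i, j)

/-- The inclusion of a direct summand. -/
noncomputable def fThenActIncl (M : Mat_ WebA) (N : Mat_ (ActWeb G R)) (i : M.ι) (j : N.ι) :
    seqObj P (M.X i) ⊙ₗ seqRes P (N.X j) ⟶ (fThenAct P FA F).obj (M, N) :=
  (AlgRep.incl (fun i => seqObj P (M.X i)) i ⊙ₗₘ AlgRep.incl (fun j => seqRes P (N.X j)) j)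

/-- The functors `FA` and `F`, extended to the additive closures, intertwine the actions, by a
natural isomorphism which is given by the canonical isomorphisms
`F (X ⊗ Y) ≅ FA X ⊗ F Y` on the summands. -/
def Commutes : Prop :=
  ∃ e : actThenF P F ≅ fThenAct P FA F,
    ∀ (M : Mat_ WebA) (N : Mat_ (ActWeb G R)) (i : M.ι) (j : N.ι),
      actThenFIncl P F M N i j ≫ e.hom.app (M, N) =
        (seqNu P (M.X i) (N.X j)).hom ≫ fThenActIncl P FA F M N i j

end Square

end Presentation

section QuantumIntegers

lemma qpar_sq_sub_ne_zero : qpar ^ 2 - 1 ≠ 0 := sub_ne_zero.mpr qpar_sq_ne_one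

lemma qnum_zero : qnum 0 = 0 := by simp [qnum]

lemma qnum_one : qnum 1 = 1 := by
  have h := qpar_sub_ne_zero
  simp [qnum, div_self h]

lemma qnum_neg (k : ℤ) : qnum (-k) = -qnum k := by
  simp only [qnum, neg_neg, ← neg_div, neg_sub]

lemma qpar_pow_ne_one {k : ℕ} (hk : k ≠ 0) : qpar ^ k ≠ 1 := by
  intro h
  have h1 : (algebraMap (Polynomial ℂ) (RatFunc ℂ)) (Polynomial.X ^ k) =
      algebraMap (Polynomial ℂ) (RatFunc ℂ) 1 := by
    rw [map_pow, RatFunc.algebraMap_X, map_one]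
    exact h
  have h3 := congrArg Polynomial.natDegree (RatFunc.algebraMap_injective ℂ h1)
  simp at h3
  exact hk h3

lemma qnum_ne_zero {k : ℕ} (hk : k ≠ 0) : qnum k ≠ 0 := by
  have h0 := qpar_ne_zero
  have h := qpar_sub_ne_zero
  rw [qnum, Ne, div_eq_zero_iff, not_or]
  refine ⟨fun h1 => qpar_pow_ne_one (k := 2 * k) (by omega) ?_, h⟩
  rw [zpow_neg, zpow_natCast] at h1
  have h2 : qpar ^ k ≠ 0 := pow_ne_zero _ h0
  field_simp at h1
  rw [pow_mul, pow_right_comm]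
  linear_combination h1

/-- The sign of a flavor: `1` for symmetric powers (`true`), `-1` for exterior powers (`false`). -/
noncomputable def eps (s : Bool) : Kq := if s then 1 else -1

/-- The parameter `q⁻¹` for symmetric powers, `q` for exterior powers. -/
noncomputable def qp (s : Bool) : Kq := if s then qpar⁻¹ else qpar

/-- The coefficient of the relation `v_k v_j = c v_j v_k` for `j < k`. -/
noncomputable def cc (s : Bool) : Kq := eps s * (qp s)⁻¹

lemma qp_ne_zero (s : Bool) : qp s ≠ 0 := by
  cases s <;> simp [qp, qpar_ne_zero]

lemma eps_mul_eps (s : Bool) : eps s * eps s = 1 := by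
  cases s <;> simp [eps]

lemma qp_sq_sub_ne_zero (s : Bool) : qp s ^ 2 - 1 ≠ 0 := by
  have h := qpar_sq_sub_ne_zero
  have h0 := qpar_ne_zero
  cases s
  · simpa [qp] using h
  · simp only [qp, if_true]
    intro h1
    apply h
    field_simp at h1
    linear_combination -h1

lemma qnum_eq (s : Bool) (k : ℤ) :
    qnum k = (qp s ^ k - qp s ^ (-k)) / (qp s - (qp s)⁻¹) := by
  cases s
  · simp [qp, qnum]
  · simp only [qp, if_true, qnum, inv_zpow', neg_neg, inv_inv]
    rw [← neg_sub (qpar ^ k) (qpar ^ (-k)), ← neg_sub qpar qpar⁻¹, neg_div_neg_eq]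

/-- Quantum integers in terms of the parameter of a flavor. -/
lemma qnum_nat (s : Bool) (k : ℕ) :
    qnum k = (qp s ^ (2 * k) - 1) / (qp s ^ 2 - 1) * qp s * (qp s ^ k)⁻¹ := by
  have h0 := qp_ne_zero s
  have h := qp_sq_sub_ne_zero s
  have h2 : qp s ^ k ≠ 0 := pow_ne_zero _ h0
  rw [qnum_eq s, zpow_neg, zpow_natCast]
  field_simp
  ring

end QuantumIntegers

section Content

variable {ι : Type} [LinearOrder ι]

/-- The number of letters below `j`. -/
def cntLt (j : ι) (m : Multiset ι) : ℕ := m.countP (· < j)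

/-- The number of letters above `j`. -/
def cntGt (j : ι) (m : Multiset ι) : ℕ := m.countP (j < ·)

@[simp] lemma cntLt_zero (j : ι) : cntLt j 0 = 0 := rfl

@[simp] lemma cntGt_zero (j : ι) : cntGt j 0 = 0 := rfl

lemma cntLt_cons (j k : ι) (m : Multiset ι) :
    cntLt j (k ::ₘ m) = cntLt j m + if k < j then 1 else 0 := Multiset.countP_cons _ _ _

lemma cntGt_cons (j k : ι) (m : Multiset ι) :
    cntGt j (k ::ₘ m) = cntGt j m + if j < k then 1 else 0 := Multiset.countP_cons _ _ _

lemma cnt_add (j : ι) (m : Multiset ι) : cntLt j m + m.count j + cntGt j m = m.card := by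
  induction m using Multiset.induction with
  | empty => rfl
  | cons k m ih =>
    rw [cntLt_cons, cntGt_cons, Multiset.count_cons, Multiset.card_cons, ← ih]
    rcases lt_trichotomy j k with h | h | h
    · simp [h, h.not_gt, h.ne]; omega
    · simp [h]; omega
    · simp [h, h.not_gt, h.ne']; omega

lemma cntGt_eq_zero {j : ι} {m : Multiset ι} (h : ∀ x ∈ m, x ≤ j) : cntGt j m = 0 := by
  rw [cntGt, Multiset.countP_eq_zero]
  exact fun x hx => (h x hx).not_gt

lemma exists_max {m : Multiset ι} (hm : m ≠ 0) :
    ∃ (k : ι) (m' : Multiset ι), m = k ::ₘ m' ∧ ∀ x ∈ m', x ≤ k := by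
  have hne : m.toFinset.Nonempty := Multiset.toFinset_nonempty.mpr hm
  have hmem : m.toFinset.max' hne ∈ m := Multiset.mem_toFinset.mp (m.toFinset.max'_mem hne)
  refine ⟨m.toFinset.max' hne, m.erase (m.toFinset.max' hne), (Multiset.cons_erase hmem).symm, ?_⟩
  exact fun x hx => m.toFinset.le_max' x (Multiset.mem_toFinset.mpr (Multiset.mem_of_mem_erase hx))

/-- Induction on a multiset by adding its largest element. -/
lemma max_induction {p : Multiset ι → Prop} (h0 : p 0)
    (h1 : ∀ k m, (∀ x ∈ m, x ≤ k) → p m → p (k ::ₘ m)) (m : Multiset ι) : p m := by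
  induction hn : m.card generalizing m with
  | zero => rw [Multiset.card_eq_zero.mp hn]; exact h0
  | succ N ih =>
    obtain ⟨k, m', rfl, hk⟩ := exists_max (m := m) (by rintro rfl; simp at hn)
    exact h1 k m' hk (ih m' (by simpa using hn))

variable [Fintype ι]

/-- The weight of the letter `l` in the telescoping sum. -/
noncomputable def wt (s : Bool) (m : Multiset ι) (l : ι) : Kq :=
  qp s ^ cntLt l m * (qp s ^ cntGt l m)⁻¹ * qnum (m.count l)

/-- The quantum number of all letters is the weighted sum of the quantum numbers of the letters. -/
lemma sum_wt (s : Bool) (m : Multiset ι) : ∑ l, wt s m l = qnum m.card := by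
  have h0 := qp_ne_zero s
  have h := qp_sq_sub_ne_zero s
  induction m using max_induction with
  | h0 => simp [wt, qnum_zero]
  | h1 k m hk ih =>
    have hG : cntGt k m = 0 := cntGt_eq_zero hk
    have hcard : m.card = cntLt k m + m.count k := by
      have := cnt_add k m
      omega
    have e1 : ∀ l, wt s (k ::ₘ m) l = (qp s)⁻¹ * wt s m l +
        if l = k then wt s (k ::ₘ m) k - (qp s)⁻¹ * wt s m k else 0 := by
      intro l
      by_cases hl : l = k
      · subst hl; simp
      · rw [if_neg hl, add_zero]
        rcases lt_or_gt_of_ne hl with h1 | h1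
        · simp only [wt, cntLt_cons, cntGt_cons, Multiset.count_cons_of_ne hl, h1, h1.not_gt,
            if_true, if_false, add_zero, pow_succ]
          field_simp
        · have : m.count l = 0 := Multiset.count_eq_zero.mpr fun hl' => (hk l hl').not_gt h1
          simp [wt, Multiset.count_cons_of_ne hl, this, qnum_zero]
    rw [Finset.sum_congr rfl fun l _ => e1 l, Finset.sum_add_distrib, ← Finset.mul_sum, ih,
      Finset.sum_ite_eq' Finset.univ k, if_pos (Finset.mem_univ k), wt, wt, cntLt_cons, cntGt_cons,
      Multiset.count_cons_self, Multiset.card_cons, hcard, hG]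
    simp only [lt_irrefl, if_false, add_zero, pow_zero, inv_one, mul_one]
    rw [qnum_nat s, qnum_nat s, qnum_nat s, qnum_nat s]
    simp only [pow_add, mul_add, pow_one, mul_one, pow_mul]
    have h2 : qp s ^ cntLt k m ≠ 0 := pow_ne_zero _ h0
    have h3 : qp s ^ m.count k ≠ 0 := pow_ne_zero _ h0
    field_simp
    ring

/-- The diagonal coefficients of `μ`. -/
noncomputable def fmu (s : Bool) (l j : ι) : Kq :=
  if l < j then qp s else if j < l then (qp s)⁻¹ else if s then qnum 2 else 0

lemma sum_wt_lt (s : Bool) (m : Multiset ι) (j : ι) :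
    ∑ l, (if l < j then wt s m l else 0) =
      (qp s ^ (m.count j + cntGt j m))⁻¹ * qnum (cntLt j m) := by
  have h0 := qp_ne_zero s
  have hc : (m.filter (· < j)).card = cntLt j m := (Multiset.countP_eq_card_filter _ _).symm
  have h1 : ∀ l, (if l < j then wt s m l else 0) =
      (qp s ^ (m.count j + cntGt j m))⁻¹ * wt s (m.filter (· < j)) l := by
    intro l
    split_ifs with hl
    · have e1 : cntLt l (m.filter (· < j)) = cntLt l m := by
        rw [cntLt, Multiset.countP_filter, cntLt]
        exact Multiset.countP_congr rfl fun x _ => by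
          simpa using fun h => lt_trans h hl
      have e2 : cntGt l m = cntGt l (m.filter (· < j)) + (m.count j + cntGt j m) := by
        have a1 := cnt_add l m
        have a2 := cnt_add j m
        have a3 := cnt_add l (m.filter (· < j))
        rw [hc, e1, Multiset.count_filter_of_pos (p := (· < j)) hl] at a3
        omega
      rw [wt, wt, e1, e2, Multiset.count_filter_of_pos (p := (· < j)) hl, pow_add _ (cntGt l _)]
      field_simp
    · rw [wt, Multiset.count_filter_of_neg (p := (· < j)) hl, Nat.cast_zero, qnum_zero]
      simp
  rw [Finset.sum_congr rfl fun l _ => h1 l, ← Finset.mul_sum, sum_wt, hc]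

lemma sum_wt_gt (s : Bool) (m : Multiset ι) (j : ι) :
    ∑ l, (if j < l then wt s m l else 0) =
      qp s ^ (m.count j + cntLt j m) * qnum (cntGt j m) := by
  have h0 := qp_ne_zero s
  have h := qp_sq_sub_ne_zero s
  have h1 : ∀ l, wt s m l = (if l < j then wt s m l else 0) + (if j < l then wt s m l else 0) +
      if l = j then wt s m j else 0 := by
    intro l
    rcases lt_trichotomy l j with h | h | h
    · simp [h, h.not_gt, h.ne]
    · simp [h]
    · simp [h, h.not_gt, h.ne']
  have h2 := sum_wt s m
  rw [Finset.sum_congr rfl fun l _ => h1 l, Finset.sum_add_distrib, Finset.sum_add_distrib,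
    sum_wt_lt, Finset.sum_ite_eq' Finset.univ j, if_pos (Finset.mem_univ j), ← cnt_add j m, wt] at h2
  rw [qnum_nat s, qnum_nat s, qnum_nat s] at h2
  rw [qnum_nat s]
  have h3 : qp s ^ cntLt j m ≠ 0 := pow_ne_zero _ h0
  have h4 : qp s ^ m.count j ≠ 0 := pow_ne_zero _ h0
  have h5 : qp s ^ cntGt j m ≠ 0 := pow_ne_zero _ h0
  set X := ∑ l, (if j < l then wt s m l else 0)
  rw [← sub_eq_zero] at h2 ⊢
  rw [← h2]
  simp only [pow_add, mul_add, pow_one, mul_one, pow_mul]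
  field_simp
  ring

/-- The coefficient identity behind the one-sided square switch relation. -/
lemma sum_fmu_wt (s : Bool) (m : Multiset ι) (j : ι) (hm : m ≠ 0) (hj : s = false → m.Nodup) :
    ∑ l, fmu s l j * wt s m l = (if s = false ∧ j ∈ m then 0 else
      qp s ^ cntLt j m * (qp s ^ cntGt j m)⁻¹ * qnum ((m.count j + 1 : ℕ) : ℤ)) +
        qnum ((m.card : ℤ) - 1) := by
  have h0 := qp_ne_zero s
  have h := qp_sq_sub_ne_zero s
  have h1 : ∀ l, fmu s l j * wt s m l = qp s * (if l < j then wt s m l else 0) +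
      (qp s)⁻¹ * (if j < l then wt s m l else 0) +
        if l = j then (if s then qnum 2 else 0) * wt s m j else 0 := by
    intro l
    rcases lt_trichotomy l j with h | h | h
    · simp [fmu, h, h.not_gt, h.ne]
    · simp [fmu, h]
    · simp [fmu, h, h.not_gt, h.ne']
  obtain ⟨N, hN⟩ : ∃ N, m.card = N + 1 :=
    Nat.exists_eq_succ_of_ne_zero (by simpa using hm)
  have hN' := cnt_add j m
  rw [Finset.sum_congr rfl fun l _ => h1 l, Finset.sum_add_distrib, Finset.sum_add_distrib,
    ← Finset.mul_sum, ← Finset.mul_sum, sum_wt_lt, sum_wt_gt,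
    Finset.sum_ite_eq' Finset.univ j, if_pos (Finset.mem_univ j), hN, wt]
  rw [show ((N + 1 : ℕ) : ℤ) - 1 = N by push_cast; ring]
  have h3 : qp s ^ cntLt j m ≠ 0 := pow_ne_zero _ h0
  have h4 : qp s ^ m.count j ≠ 0 := pow_ne_zero _ h0
  have h5 : qp s ^ cntGt j m ≠ 0 := pow_ne_zero _ h0
  have h6 : qp s ^ N * qp s = qp s ^ cntLt j m * qp s ^ m.count j * qp s ^ cntGt j m := by
    rw [← pow_succ, ← pow_add, ← pow_add]
    congr 1
    omega
  have h7 : qp s ^ N = qp s ^ cntLt j m * qp s ^ m.count j * qp s ^ cntGt j m * (qp s)⁻¹ := by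
    rw [← h6]; field_simp
  have h8 : (2 : ℤ) = ((2 : ℕ) : ℤ) := rfl
  rw [h8, qnum_nat s, qnum_nat s, qnum_nat s, qnum_nat s, qnum_nat s, qnum_nat s]
  cases s with
  | true =>
    simp only [Bool.true_eq_false, false_and, if_false, if_true]
    simp only [pow_add, mul_add, pow_one, mul_one, mul_comm 2, pow_mul, h7]
    field_simp
    ring
  | false =>
    by_cases hjm : j ∈ m
    · have hc : m.count j = 1 := Multiset.count_eq_one_of_mem (hj rfl) hjm
      rw [hc] at h7 ⊢
      simp only [hjm, and_true, if_true, Bool.false_eq_true, if_false, zero_mul, zero_add, add_zero]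
      simp only [pow_add, mul_add, pow_one, mul_one, mul_comm 2, pow_mul, h7]
      field_simp
      ring
    · have hc : m.count j = 0 := Multiset.count_eq_zero.mpr hjm
      rw [hc] at h7 ⊢
      simp only [hjm, and_false, if_false, Bool.false_eq_true, zero_mul, zero_add, add_zero]
      simp only [pow_add, mul_add, pow_one, mul_one, mul_comm 2, pow_mul, h7]
      field_simp
      ring

end Content
section Model

set_option linter.unusedSectionVars false

variable {ι : Type} [LinearOrder ι]

/-- The space with a basis indexed by multisets of letters, the model of the quantum exterior and
symmetric algebras. -/
abbrev Mdl (ι : Type) : Type := Multiset ι →₀ Kq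

/-- The basis vectors of the model. -/
noncomputable def ee (m : Multiset ι) : Mdl ι := Finsupp.single m 1

/-- The operator which sends the basis vector of `m` to a multiple of the basis vector of `g m`. -/
noncomputable def mon (c : Multiset ι → Kq) (g : Multiset ι → Multiset ι) : Mdl ι →ₗ[Kq] Mdl ι :=
  Finsupp.linearCombination Kq fun m => c m • ee (g m)

@[simp] lemma mon_ee (c : Multiset ι → Kq) (g : Multiset ι → Multiset ι) (m : Multiset ι) :
    mon c g (ee m) = c m • ee (g m) := by
  simp [mon, ee, Finsupp.linearCombination_single]

lemma mdl_ext {M : Type*} [AddCommMonoid M] [Module Kq M] {f g : Mdl ι →ₗ[Kq] M}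
    (h : ∀ m, f (ee m) = g (ee m)) : f = g :=
  Finsupp.lhom_ext' fun m => LinearMap.ext_ring (h m)

/-- The multisets whose basis vectors occur: all for symmetric powers, sets for exterior powers. -/
def Good (s : Bool) (m : Multiset ι) : Prop := s = false → m.Nodup

lemma good_of_cons {s : Bool} {k : ι} {m : Multiset ι} (h : Good s (k ::ₘ m)) : Good s m :=
  fun hs => (Multiset.nodup_cons.mp (h hs)).2

lemma not_mem_of_good_cons {s : Bool} {k : ι} {m : Multiset ι} (h : Good s (k ::ₘ m)) :
    ¬ (s = false ∧ k ∈ m) := fun hs => (Multiset.nodup_cons.mp (h hs.1)).1 hs.2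

lemma good_of_le {s : Bool} {m m' : Multiset ι} (h : Good s m) (hle : m' ≤ m) : Good s m' :=
  fun hs => Multiset.nodup_of_le hle (h hs)

/-- Right multiplication by the letter `j`. -/
noncomputable def mulR (s : Bool) (j : ι) : Mdl ι →ₗ[Kq] Mdl ι :=
  mon (fun m => if s = false ∧ j ∈ m then 0 else cc s ^ cntGt j m) (j ::ₘ ·)

/-- Left multiplication by the letter `j`. -/
noncomputable def mulL (s : Bool) (j : ι) : Mdl ι →ₗ[Kq] Mdl ι :=
  mon (fun m => if s = false ∧ j ∈ m then 0 else cc s ^ cntLt j m) (j ::ₘ ·)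

/-- Scaling by the degree. -/
noncomputable def scS (s : Bool) : Mdl ι →ₗ[Kq] Mdl ι := mon (fun m => qp s ^ m.card) id

/-- The coefficient of moving the letter `k` to the front of `m`. -/
noncomputable def ccoef (s : Bool) (k : ι) (m : Multiset ι) : Kq :=
  (m.map fun x => if x = k then qpar else eps s).prod

/-- Scaling by the coefficient of moving the letter `k` to the front. -/
noncomputable def scC (s : Bool) (k : ι) : Mdl ι →ₗ[Kq] Mdl ι := mon (ccoef s k) id

/-- The operator which extends a coproduct by a largest letter. -/
noncomputable def stepT (s : Bool) (k : ι) : Mdl ι ⊗[Kq] Mdl ι →ₗ[Kq] Mdl ι ⊗[Kq] Mdl ι :=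
  TensorProduct.map (scS s) (mulR s k) + TensorProduct.map (mulR s k) (scC s k)

/-- The coproduct of the model. -/
noncomputable def comulF (s : Bool) : Mdl ι →ₗ[Kq] Mdl ι ⊗[Kq] Mdl ι :=
  Finsupp.linearCombination Kq fun m =>
    (m.sort (· ≤ ·)).foldl (fun t k => stepT s k t) (ee 0 ⊗ₜ[Kq] ee 0)

lemma comulF_ee (s : Bool) (m : Multiset ι) : comulF s (ee m) =
    (m.sort (· ≤ ·)).foldl (fun t k => stepT s k t) (ee 0 ⊗ₜ[Kq] ee 0) := by
  exact (Finsupp.linearCombination_single _ _ _).trans (one_smul _ _)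

lemma comulF_zero (s : Bool) : comulF s (ee (0 : Multiset ι)) = ee 0 ⊗ₜ[Kq] ee 0 := by
  rw [comulF_ee]
  simp

lemma sort_cons_max {k : ι} {m : Multiset ι} (hk : ∀ x ∈ m, x ≤ k) :
    (k ::ₘ m).sort (· ≤ ·) = m.sort (· ≤ ·) ++ [k] := by
  refine List.Perm.eq_of_pairwise' (r := (· ≤ ·)) (Multiset.pairwise_sort _ _) ?_ ?_
  · rw [List.pairwise_append]
    refine ⟨Multiset.pairwise_sort _ _, List.pairwise_singleton _ _, ?_⟩
    intro x hx y hy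
    rw [List.mem_singleton.mp hy]
    exact hk x ((Multiset.mem_sort (· ≤ ·)).mp hx)
  · rw [← Multiset.coe_eq_coe]
    simp [← Multiset.coe_add, add_comm, ← Multiset.singleton_add]

lemma comulF_cons (s : Bool) {k : ι} {m : Multiset ι} (hk : ∀ x ∈ m, x ≤ k) :
    comulF s (ee (k ::ₘ m)) = stepT s k (comulF s (ee m)) := by
  rw [comulF_ee, comulF_ee, sort_cons_max hk, List.foldl_append]
  rfl

lemma stepT_tmul (s : Bool) (k : ι) (a b : Multiset ι) :
    stepT s k (ee a ⊗ₜ[Kq] ee b) =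
      (qp s ^ a.card) • (ee a ⊗ₜ[Kq] mulR s k (ee b)) +
        ccoef s k b • (mulR s k (ee a) ⊗ₜ[Kq] ee b) := by
  simp [stepT, scS, scC, TensorProduct.smul_tmul']

lemma mulR_ee_max {s : Bool} {k : ι} {m : Multiset ι} (hk : ∀ x ∈ m, x ≤ k)
    (hm : ¬ (s = false ∧ k ∈ m)) : mulR s k (ee m) = ee (k ::ₘ m) := by
  rw [mulR, mon_ee, if_neg hm, cntGt_eq_zero hk, pow_zero, one_smul]

lemma comulF_mem (s : Bool) (m : Multiset ι) : comulF s (ee m) ∈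
    Submodule.span Kq {t | ∃ a b, a + b = m ∧ t = ee a ⊗ₜ[Kq] ee b} := by
  induction m using max_induction with
  | h0 =>
    rw [comulF_zero]
    exact Submodule.subset_span ⟨0, 0, rfl, rfl⟩
  | h1 k m hk ih =>
    rw [comulF_cons s hk]
    have h : Submodule.span Kq {t | ∃ a b, a + b = m ∧ t = ee a ⊗ₜ[Kq] ee b} ≤
        (Submodule.span Kq {t | ∃ a b, a + b = k ::ₘ m ∧ t = ee a ⊗ₜ[Kq] ee b}).comap
          (stepT s k) := by
      rw [Submodule.span_le]
      rintro _ ⟨a, b, rfl, rfl⟩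
      rw [SetLike.mem_coe, Submodule.mem_comap, stepT_tmul, mulR, mon_ee, mon_ee, tmul_smul,
        ← smul_tmul']
      refine add_mem (Submodule.smul_mem _ _ (Submodule.smul_mem _ _ ?_))
        (Submodule.smul_mem _ _ (Submodule.smul_mem _ _ ?_))
      · exact Submodule.subset_span ⟨a, k ::ₘ b, by simp, rfl⟩
      · exact Submodule.subset_span ⟨k ::ₘ a, b, by simp, rfl⟩
    exact h ih

lemma comulF_congr (s : Bool) {m : Multiset ι} {M : Type*} [AddCommMonoid M] [Module Kq M]
    {f g : Mdl ι ⊗[Kq] Mdl ι →ₗ[Kq] M}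
    (h : ∀ a b, a + b = m → f (ee a ⊗ₜ[Kq] ee b) = g (ee a ⊗ₜ[Kq] ee b)) :
    f (comulF s (ee m)) = g (comulF s (ee m)) := by
  refine LinearMap.eqOn_span (s := {t | ∃ a b, a + b = m ∧ t = ee a ⊗ₜ[Kq] ee b}) ?_
    (comulF_mem s m)
  rintro _ ⟨a, b, hab, rfl⟩
  exact h a b hab

lemma ccoef_add (s : Bool) (k : ι) (a b : Multiset ι) :
    ccoef s k (a + b) = ccoef s k a * ccoef s k b := by
  simp [ccoef]

lemma comulF_scC (s : Bool) (k : ι) (m : Multiset ι) :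
    TensorProduct.map (scC s k) (scC s k) (comulF s (ee m)) = ccoef s k m • comulF s (ee m) := by
  refine (comulF_congr s (f := TensorProduct.map (scC s k) (scC s k))
    (g := ccoef s k m • LinearMap.id) ?_)
  rintro a b rfl
  simp only [TensorProduct.map_tmul, scC, mon_ee, id, ccoef_add, TensorProduct.smul_tmul_smul,
    LinearMap.smul_apply, LinearMap.id_apply]

/-- The coproduct of the model is coassociative. -/
lemma comulF_coassoc (s : Bool) {m : Multiset ι} (hm : Good s m) :
    TensorProduct.assoc Kq _ _ _ ((comulF s).rTensor _ (comulF s (ee m))) =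
      (comulF s).lTensor _ (comulF s (ee m)) := by
  induction m using max_induction with
  | h0 =>
    rw [comulF_zero]
    simp [comulF_zero]
  | h1 k m hk ih =>
    have hm' := good_of_cons hm
    have hn := not_mem_of_good_cons hm
    let U : Mdl ι ⊗[Kq] (Mdl ι ⊗[Kq] Mdl ι) →ₗ[Kq] Mdl ι ⊗[Kq] (Mdl ι ⊗[Kq] Mdl ι) :=
      TensorProduct.map (scS s) (stepT s k) +
        TensorProduct.map (mulR s k) (TensorProduct.map (scC s k) (scC s k))
    rw [comulF_cons s hk]
    have hR : ∀ a ≤ m, mulR s k (ee a) = ee (k ::ₘ a) := fun a ha =>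
      mulR_ee_max (fun x hx => hk x (Multiset.mem_of_le ha hx))
        fun h => hn ⟨h.1, Multiset.mem_of_le ha h.2⟩
    have hD : ∀ a ≤ m, comulF s (ee (k ::ₘ a)) = stepT s k (comulF s (ee a)) := fun a ha =>
      comulF_cons s fun x hx => hk x (Multiset.mem_of_le ha hx)
    have e1 : TensorProduct.assoc Kq _ _ _ ((comulF s).rTensor _ (stepT s k (comulF s (ee m)))) =
        U (TensorProduct.assoc Kq _ _ _ ((comulF s).rTensor _ (comulF s (ee m)))) := by
      refine comulF_congr s
        (f := (TensorProduct.assoc Kq _ _ _).toLinearMap ∘ₗ (comulF s).rTensor _ ∘ₗ stepT s k)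
        (g := U ∘ₗ (TensorProduct.assoc Kq _ _ _).toLinearMap ∘ₗ (comulF s).rTensor _) ?_
      rintro a b rfl
      simp only [LinearMap.comp_apply, LinearEquiv.coe_coe, stepT_tmul, map_add, map_smul,
        LinearMap.rTensor_tmul, hR a (Multiset.le_add_right _ _), hD a (Multiset.le_add_right _ _)]
      have key := comulF_congr s (m := a)
        (f := (TensorProduct.assoc Kq _ _ _).toLinearMap ∘ₗ
          (qp s ^ a.card • (TensorProduct.mk Kq _ _).flip (mulR s k (ee b)) +
            ccoef s k b • ((TensorProduct.mk Kq _ _).flip (ee b) ∘ₗ stepT s k)))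
        (g := U ∘ₗ (TensorProduct.assoc Kq _ _ _).toLinearMap ∘ₗ
          (TensorProduct.mk Kq _ _).flip (ee b)) ?_
      · simpa only [LinearMap.comp_apply, LinearMap.add_apply, LinearMap.smul_apply,
          LinearMap.flip_apply, TensorProduct.mk_apply, LinearEquiv.coe_coe, map_add,
          map_smul] using key
      · rintro a b rfl
        simp only [LinearMap.comp_apply, LinearMap.add_apply, LinearMap.smul_apply,
          LinearMap.flip_apply, TensorProduct.mk_apply, TensorProduct.map_tmul, scS, mon_ee,
          stepT_tmul, LinearEquiv.coe_coe, TensorProduct.assoc_tmul, U, scC, id,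
          ← smul_tmul', add_tmul, map_add, map_smul, tmul_smul, tmul_add, smul_add,
          Multiset.card_add, pow_add]
        simp only [smul_smul, add_assoc, mul_comm]
    have e2 : (comulF s).lTensor _ (stepT s k (comulF s (ee m))) =
        U ((comulF s).lTensor _ (comulF s (ee m))) := by
      refine comulF_congr s (f := (comulF s).lTensor _ ∘ₗ stepT s k)
        (g := U ∘ₗ (comulF s).lTensor _) ?_
      rintro a b rfl
      simp only [LinearMap.comp_apply, stepT_tmul, map_add, map_smul, LinearMap.lTensor_tmul,
        hR b (Multiset.le_add_left _ _), hD b (Multiset.le_add_left _ _), U, LinearMap.add_apply,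
        TensorProduct.map_tmul, comulF_scC, scS, mon_ee, id, ← smul_tmul', tmul_smul]
    rw [e1, e2, ih hm']

/-- The coefficient of the basis vector of `c` in the first factor. -/
noncomputable def coef1 (c : Multiset ι) : Mdl ι ⊗[Kq] Mdl ι →ₗ[Kq] Mdl ι :=
  (TensorProduct.lid Kq (Mdl ι)).toLinearMap ∘ₗ (Finsupp.lapply c).rTensor (Mdl ι)

/-- The coefficient of the basis vector of `c` in the second factor. -/
noncomputable def coef2 (c : Multiset ι) : Mdl ι ⊗[Kq] Mdl ι →ₗ[Kq] Mdl ι :=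
  (TensorProduct.rid Kq (Mdl ι)).toLinearMap ∘ₗ (Finsupp.lapply c).lTensor (Mdl ι)

lemma coef1_tmul (c a : Multiset ι) (x : Mdl ι) :
    coef1 c (ee a ⊗ₜ[Kq] x) = if a = c then x else 0 := by
  simp only [coef1, ee, LinearMap.comp_apply, LinearMap.rTensor_tmul, Finsupp.lapply_apply,
    Finsupp.single_apply, LinearEquiv.coe_coe, TensorProduct.lid_tmul]
  split_ifs <;> simp

lemma coef2_tmul (c b : Multiset ι) (x : Mdl ι) :
    coef2 c (x ⊗ₜ[Kq] ee b) = if b = c then x else 0 := by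
  simp only [coef2, ee, LinearMap.comp_apply, LinearMap.lTensor_tmul, Finsupp.lapply_apply,
    Finsupp.single_apply, LinearEquiv.coe_coe, TensorProduct.rid_tmul]
  split_ifs <;> simp

lemma mulR_ee (s : Bool) (j : ι) (m : Multiset ι) : mulR s j (ee m) =
    (if s = false ∧ j ∈ m then 0 else cc s ^ cntGt j m) • ee (j ::ₘ m) := by
  rw [mulR, mon_ee]

lemma mulL_ee (s : Bool) (j : ι) (m : Multiset ι) : mulL s j (ee m) =
    (if s = false ∧ j ∈ m then 0 else cc s ^ cntLt j m) • ee (j ::ₘ m) := by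
  rw [mulL, mon_ee]

lemma tensor_mdl_ext {M : Type*} [AddCommMonoid M] [Module Kq M]
    {f g : Mdl ι ⊗[Kq] Mdl ι →ₗ[Kq] M}
    (h : ∀ a b, f (ee a ⊗ₜ[Kq] ee b) = g (ee a ⊗ₜ[Kq] ee b)) : f = g :=
  TensorProduct.ext (mdl_ext fun a => mdl_ext fun b => h a b)

lemma coef2_zero_stepT (s : Bool) (k : ι) (t : Mdl ι ⊗[Kq] Mdl ι) :
    coef2 0 (stepT s k t) = mulR s k (coef2 0 t) := by
  refine LinearMap.congr_fun (f := coef2 0 ∘ₗ stepT s k) (g := mulR s k ∘ₗ coef2 0)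
    (tensor_mdl_ext fun a b => ?_) t
  simp only [LinearMap.comp_apply, stepT_tmul, map_add, map_smul, mulR_ee s k b, tmul_smul,
    coef2_tmul, Multiset.cons_ne_zero, if_false, smul_zero, zero_add]
  split_ifs with h
  · subst h; simp [ccoef]
  · simp

lemma coef1_zero_stepT (s : Bool) (k : ι) (t : Mdl ι ⊗[Kq] Mdl ι) :
    coef1 0 (stepT s k t) = mulR s k (coef1 0 t) := by
  refine LinearMap.congr_fun (f := coef1 0 ∘ₗ stepT s k) (g := mulR s k ∘ₗ coef1 0)
    (tensor_mdl_ext fun a b => ?_) t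
  simp only [LinearMap.comp_apply, stepT_tmul, map_add, map_smul, mulR_ee s k a, ← smul_tmul',
    coef1_tmul, Multiset.cons_ne_zero, if_false, smul_zero, add_zero]
  split_ifs with h
  · subst h; simp
  · simp

lemma coef2_single_stepT (s : Bool) (i k : ι) (t : Mdl ι ⊗[Kq] Mdl ι) :
    coef2 {i} (stepT s k t) = (if i = k then scS s (coef2 0 t) else 0) +
      (if i = k then qpar else eps s) • mulR s k (coef2 {i} t) := by
  refine LinearMap.congr_fun (f := coef2 {i} ∘ₗ stepT s k)
    (g := (if i = k then scS s ∘ₗ coef2 0 else 0) +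
      (if i = k then qpar else eps s) • (mulR s k ∘ₗ coef2 {i})) (tensor_mdl_ext fun a b => ?_) t
    |>.trans ?_
  · simp only [LinearMap.comp_apply, stepT_tmul, map_add, map_smul, mulR_ee s k b, tmul_smul,
      coef2_tmul, LinearMap.add_apply, LinearMap.smul_apply]
    have h1 : k ::ₘ b = {i} ↔ i = k ∧ b = 0 := by
      rw [← Multiset.cons_zero, Multiset.cons_eq_cons]
      constructor
      · rintro (⟨rfl, rfl⟩ | ⟨_, c, _, h⟩)
        · exact ⟨rfl, rfl⟩
        · exact absurd h.symm (Multiset.cons_ne_zero)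
      · rintro ⟨rfl, rfl⟩
        exact Or.inl ⟨rfl, rfl⟩
    congr 1
    · by_cases hi : i = k
      · by_cases hb : b = 0
        · subst hb hi
          simp [scS, coef2_tmul]
        · rw [if_neg (fun h => hb (h1.mp h).2)]
          simp [hi, coef2_tmul, hb]
      · rw [if_neg (fun h => hi (h1.mp h).1)]
        simp [hi]
    · split_ifs with hb hi hi
      · subst hb; simp [ccoef, hi]
      · subst hb; simp [ccoef, hi]
      · simp
      · simp
  · simp only [LinearMap.add_apply, LinearMap.smul_apply]
    split_ifs <;> rfl

lemma coef1_single_stepT (s : Bool) (i k : ι) (t : Mdl ι ⊗[Kq] Mdl ι) :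
    coef1 {i} (stepT s k t) = qp s • mulR s k (coef1 {i} t) +
      (if i = k then scC s k (coef1 0 t) else 0) := by
  refine LinearMap.congr_fun (f := coef1 {i} ∘ₗ stepT s k)
    (g := qp s • (mulR s k ∘ₗ coef1 {i}) + (if i = k then scC s k ∘ₗ coef1 0 else 0))
      (tensor_mdl_ext fun a b => ?_) t |>.trans ?_
  · simp only [LinearMap.comp_apply, stepT_tmul, map_add, map_smul, mulR_ee s k a, ← smul_tmul',
      coef1_tmul, LinearMap.add_apply, LinearMap.smul_apply]
    have h1 : k ::ₘ a = {i} ↔ i = k ∧ a = 0 := by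
      rw [← Multiset.cons_zero, Multiset.cons_eq_cons]
      constructor
      · rintro (⟨rfl, rfl⟩ | ⟨_, c, _, h⟩)
        · exact ⟨rfl, rfl⟩
        · exact absurd h.symm (Multiset.cons_ne_zero)
      · rintro ⟨rfl, rfl⟩
        exact Or.inl ⟨rfl, rfl⟩
    congr 1
    · split_ifs with ha
      · subst ha; simp
      · simp
    · by_cases hi : i = k
      · by_cases hb : a = 0
        · subst hb hi
          simp [scC, coef1_tmul]
        · rw [if_neg (fun h => hb (h1.mp h).2)]
          simp [hi, coef1_tmul, hb]
      · rw [if_neg (fun h => hi (h1.mp h).1)]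
        simp [hi]
  · simp only [LinearMap.add_apply, LinearMap.smul_apply]
    split_ifs <;> rfl

lemma coef2_zero_comulF (s : Bool) {m : Multiset ι} (hm : Good s m) :
    coef2 0 (comulF s (ee m)) = ee m := by
  induction m using max_induction with
  | h0 => rw [comulF_zero, coef2_tmul, if_pos rfl]
  | h1 k m hk ih =>
    rw [comulF_cons s hk, coef2_zero_stepT, ih (good_of_cons hm),
      mulR_ee_max hk (not_mem_of_good_cons hm)]

lemma coef1_zero_comulF (s : Bool) {m : Multiset ι} (hm : Good s m) :
    coef1 0 (comulF s (ee m)) = ee m := by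
  induction m using max_induction with
  | h0 => rw [comulF_zero, coef1_tmul, if_pos rfl]
  | h1 k m hk ih =>
    rw [comulF_cons s hk, coef1_zero_stepT, ih (good_of_cons hm),
      mulR_ee_max hk (not_mem_of_good_cons hm)]

/-- The coefficient of removing the letter `i` on the right. -/
noncomputable def rcoef (s : Bool) (i : ι) (m : Multiset ι) : Kq :=
  qp s ^ cntLt i m * eps s ^ cntGt i m * qnum (m.count i)

/-- The coefficient of removing the letter `i` on the left. -/
noncomputable def lcoef (s : Bool) (i : ι) (m : Multiset ι) : Kq :=
  qp s ^ cntGt i m * eps s ^ cntLt i m * qnum (m.count i)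

lemma qnum_succ_left (k : ℕ) : qpar⁻¹ * qnum k + qpar ^ k = qnum ((k + 1 : ℕ) : ℤ) := by
  have h0 := qpar_ne_zero
  have h := qpar_sq_sub_ne_zero
  have h2 : qpar ^ k ≠ 0 := pow_ne_zero _ h0
  rw [qnum_nat false, qnum_nat false]
  simp only [qp, Bool.false_eq_true, if_false, pow_add, mul_add, mul_one, pow_one, mul_comm 2,
    pow_mul]
  field_simp
  ring

lemma qnum_succ_right (k : ℕ) : (qpar ^ k)⁻¹ + qpar * qnum k = qnum ((k + 1 : ℕ) : ℤ) := by
  have h0 := qpar_ne_zero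
  have h := qpar_sq_sub_ne_zero
  have h2 : qpar ^ k ≠ 0 := pow_ne_zero _ h0
  rw [qnum_nat false, qnum_nat false]
  simp only [qp, Bool.false_eq_true, if_false, pow_add, mul_add, mul_one, pow_one, mul_comm 2,
    pow_mul]
  field_simp
  ring

lemma erase_cons_of_ne' {i k : ι} (h : i ≠ k) (m : Multiset ι) :
    (k ::ₘ m).erase i = k ::ₘ m.erase i := Multiset.erase_cons_tail m h.symm

lemma card_eq_of_max {k : ι} {m : Multiset ι} (hk : ∀ x ∈ m, x ≤ k) :
    m.card = cntLt k m + m.count k := by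
  have := cnt_add k m
  rw [cntGt_eq_zero hk] at this
  omega

/-- The removal of a letter on the right. -/
lemma coef2_comulF (s : Bool) (i : ι) {m : Multiset ι} (hm : Good s m) :
    coef2 {i} (comulF s (ee m)) = rcoef s i m • ee (m.erase i) := by
  have h0 := qp_ne_zero s
  induction m using max_induction with
  | h0 =>
    rw [comulF_zero, coef2_tmul, if_neg (by simp)]
    simp [rcoef, qnum_zero]
  | h1 k m hk ih =>
    have hm' := good_of_cons hm
    have hn := not_mem_of_good_cons hm
    have hR : mulR s k (ee (m.erase i)) = ee (k ::ₘ m.erase i) :=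
      mulR_ee_max (fun x hx => hk x (Multiset.mem_of_mem_erase hx))
        fun h => hn ⟨h.1, Multiset.mem_of_mem_erase h.2⟩
    rw [comulF_cons s hk, coef2_single_stepT, ih hm', coef2_zero_comulF s hm', map_smul, hR]
    by_cases hi : i = k
    · subst hi
      simp only [if_true, Multiset.erase_cons_head, scS, mon_ee, id, rcoef, cntLt_cons, cntGt_cons,
        lt_irrefl, if_false, add_zero, cntGt_eq_zero hk, pow_zero, mul_one,
        Multiset.count_cons_self, card_eq_of_max hk]
      by_cases him : i ∈ m
      · have hs : s = true := by
          by_contra h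
          exact hn ⟨by simpa using h, him⟩
        subst hs
        rw [Multiset.cons_erase him, smul_smul, ← add_smul, ← qnum_succ_right, pow_add]
        congr 1
        simp only [qp, if_true, inv_pow]
        ring
      · rw [Multiset.count_eq_zero.mpr him]
        simp [qnum_zero, qnum_one]
    · rw [if_neg hi, if_neg hi, zero_add, erase_cons_of_ne' hi, smul_smul]
      congr 1
      rw [rcoef, rcoef, Multiset.count_cons_of_ne hi, cntLt_cons, cntGt_cons]
      rcases lt_or_gt_of_ne hi with h | h
      · simp only [h, h.not_gt, if_true, if_false, add_zero, pow_succ]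
        ring
      · have : m.count i = 0 := Multiset.count_eq_zero.mpr fun h' => (hk i h').not_gt h
        simp [this, qnum_zero]

lemma ccoef_max (s : Bool) {k : ι} {m : Multiset ι} (hk : ∀ x ∈ m, x ≤ k) :
    ccoef s k m = eps s ^ cntLt k m * qpar ^ m.count k := by
  induction m using Multiset.induction with
  | empty => simp [ccoef]
  | cons a m ih =>
    have h1 := ih fun x hx => hk x (Multiset.mem_cons_of_mem hx)
    rw [ccoef, Multiset.map_cons, Multiset.prod_cons, ← ccoef, h1, cntLt_cons, Multiset.count_cons]
    rcases (hk a (Multiset.mem_cons_self a m)).lt_or_eq with h | h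
    · simp only [h, h.ne, h.ne', if_true, if_false, add_zero, pow_succ]
      ring
    · simp only [h, lt_irrefl, if_true, if_false, add_zero, pow_succ]
      ring

/-- The removal of a letter on the left. -/
lemma coef1_comulF (s : Bool) (i : ι) {m : Multiset ι} (hm : Good s m) :
    coef1 {i} (comulF s (ee m)) = lcoef s i m • ee (m.erase i) := by
  have h0 := qp_ne_zero s
  induction m using max_induction with
  | h0 =>
    rw [comulF_zero, coef1_tmul, if_neg (by simp)]
    simp [lcoef, qnum_zero]
  | h1 k m hk ih =>
    have hm' := good_of_cons hm
    have hn := not_mem_of_good_cons hm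
    have hR : mulR s k (ee (m.erase i)) = ee (k ::ₘ m.erase i) :=
      mulR_ee_max (fun x hx => hk x (Multiset.mem_of_mem_erase hx))
        fun h => hn ⟨h.1, Multiset.mem_of_mem_erase h.2⟩
    rw [comulF_cons s hk, coef1_single_stepT, ih hm', coef1_zero_comulF s hm', map_smul, hR]
    by_cases hi : i = k
    · subst hi
      simp only [if_true, Multiset.erase_cons_head, scC, mon_ee, id, lcoef, cntLt_cons, cntGt_cons,
        lt_irrefl, if_false, add_zero, cntGt_eq_zero hk, pow_zero, one_mul,
        Multiset.count_cons_self, ccoef_max s hk]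
      by_cases him : i ∈ m
      · have hs : s = true := by
          by_contra h
          exact hn ⟨by simpa using h, him⟩
        subst hs
        rw [Multiset.cons_erase him, smul_smul, ← add_smul, ← qnum_succ_left]
        congr 1
        simp only [qp, if_true]
        ring
      · rw [Multiset.count_eq_zero.mpr him]
        simp [qnum_zero, qnum_one]
    · rw [if_neg hi, add_zero, erase_cons_of_ne' hi, smul_smul]
      congr 1
      rw [lcoef, lcoef, Multiset.count_cons_of_ne hi, cntLt_cons, cntGt_cons]
      rcases lt_or_gt_of_ne hi with h | h
      · simp only [h, h.not_gt, if_true, if_false, add_zero, pow_succ]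
        ring
      · have : m.count i = 0 := Multiset.count_eq_zero.mpr fun h' => (hk i h').not_gt h
        simp [this, qnum_zero]

end Model
section ModelRelations

variable {ι : Type} [LinearOrder ι]

set_option linter.unusedSectionVars false

lemma cntLt_dual (j : ι) (m : Multiset ι) :
    cntLt (OrderDual.toDual j) (m.map OrderDual.toDual) = cntGt j m := by
  rw [cntLt, cntGt, Multiset.countP_map, Multiset.countP_eq_card_filter]
  rfl

lemma cntGt_dual (j : ι) (m : Multiset ι) :
    cntGt (OrderDual.toDual j) (m.map OrderDual.toDual) = cntLt j m := by
  rw [cntLt, cntGt, Multiset.countP_map, Multiset.countP_eq_card_filter]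
  rfl

lemma count_dual (j : ι) (m : Multiset ι) :
    (m.map OrderDual.toDual).count (OrderDual.toDual j) = m.count j :=
  Multiset.count_map_eq_count' _ _ OrderDual.toDual.injective _

lemma fmu_dual (s : Bool) (l j : ι) :
    fmu s (OrderDual.toDual l) (OrderDual.toDual j) = fmu s j l := by
  simp only [fmu, OrderDual.toDual_lt_toDual]

lemma wt_dual (s : Bool) (m : Multiset ι) (l : ι) :
    wt s (m.map OrderDual.toDual) (OrderDual.toDual l) =
      qp s ^ cntGt l m * (qp s ^ cntLt l m)⁻¹ * qnum (m.count l) := by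
  rw [wt, cntLt_dual, cntGt_dual, count_dual]

/-- Removal of a letter on the right. -/
noncomputable def remR (s : Bool) (i : ι) : Mdl ι →ₗ[Kq] Mdl ι := coef2 {i} ∘ₗ comulF s

/-- Removal of a letter on the left. -/
noncomputable def remL (s : Bool) (i : ι) : Mdl ι →ₗ[Kq] Mdl ι := coef1 {i} ∘ₗ comulF s

lemma remR_ee (s : Bool) (i : ι) {m : Multiset ι} (hm : Good s m) :
    remR s i (ee m) = rcoef s i m • ee (m.erase i) := coef2_comulF s i hm

lemma remL_ee (s : Bool) (i : ι) {m : Multiset ι} (hm : Good s m) :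
    remL s i (ee m) = lcoef s i m • ee (m.erase i) := coef1_comulF s i hm

lemma eps_pow_mul (s : Bool) (k : ℕ) : eps s ^ k * eps s ^ k = 1 := by
  rw [← mul_pow, eps_mul_eps, one_pow]

lemma cc_pow (s : Bool) (k : ℕ) : cc s ^ k = eps s ^ k * (qp s ^ k)⁻¹ := by
  rw [cc, mul_pow, inv_pow]

lemma mulR_remR (s : Bool) (l : ι) {m : Multiset ι} (hm : Good s m) :
    mulR s l (remR s l (ee m)) = wt s m l • ee m := by
  rw [remR_ee s l hm, map_smul, mulR_ee]
  by_cases hl : l ∈ m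
  · obtain ⟨m', rfl⟩ := Multiset.exists_cons_of_mem hl
    have hn := not_mem_of_good_cons hm
    rw [Multiset.erase_cons_head, if_neg hn, smul_smul, rcoef, wt, cc_pow]
    congr 1
    simp only [cntGt_cons, lt_irrefl, if_false, add_zero]
    linear_combination (qp s ^ cntLt l (l ::ₘ m') * (qp s ^ cntGt l m')⁻¹ *
      qnum (Multiset.count l (l ::ₘ m'))) * eps_pow_mul s (cntGt l m')
  · have h0 : m.count l = 0 := Multiset.count_eq_zero.mpr hl
    simp [rcoef, wt, h0, qnum_zero]

lemma mulL_remL (s : Bool) (l : ι) {m : Multiset ι} (hm : Good s m) :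
    mulL s l (remL s l (ee m)) =
      wt s (m.map OrderDual.toDual) (OrderDual.toDual l) • ee m := by
  rw [remL_ee s l hm, map_smul, mulL_ee, wt_dual]
  by_cases hl : l ∈ m
  · obtain ⟨m', rfl⟩ := Multiset.exists_cons_of_mem hl
    have hn := not_mem_of_good_cons hm
    rw [Multiset.erase_cons_head, if_neg hn, smul_smul, lcoef, cc_pow]
    congr 1
    simp only [cntLt_cons, lt_irrefl, if_false, add_zero]
    linear_combination (qp s ^ cntGt l (l ::ₘ m') * (qp s ^ cntLt l m')⁻¹ *
      qnum (Multiset.count l (l ::ₘ m'))) * eps_pow_mul s (cntLt l m')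
  · have h0 : m.count l = 0 := Multiset.count_eq_zero.mpr hl
    simp [lcoef, h0, qnum_zero]

lemma remR_mulR_of_ne (s : Bool) {i j : ι} (hij : i ≠ j) {m : Multiset ι} (hm : Good s m) :
    remR s i (mulR s j (ee m)) = eps s • mulR s j (remR s i (ee m)) := by
  have h0 := qp_ne_zero s
  rw [remR_ee s i hm, mulR_ee, map_smul, map_smul, mulR_ee]
  have hmem : j ∈ m.erase i ↔ j ∈ m := Multiset.mem_erase_of_ne hij.symm
  by_cases hj : s = false ∧ j ∈ m
  · rw [if_pos hj, if_pos ⟨hj.1, hmem.mpr hj.2⟩]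
    simp
  · have hg : Good s (j ::ₘ m) := fun hs =>
      Multiset.nodup_cons.mpr ⟨fun h => hj ⟨hs, h⟩, hm hs⟩
    rw [if_neg hj, if_neg (by rwa [hmem]), remR_ee s i hg, erase_cons_of_ne' hij, smul_smul,
      smul_smul, smul_smul]
    congr 1
    by_cases hi : i ∈ m
    · obtain ⟨m', rfl⟩ := Multiset.exists_cons_of_mem hi
      rw [Multiset.erase_cons_head]
      simp only [rcoef, cntLt_cons, cntGt_cons, Multiset.count_cons_of_ne hij, lt_irrefl, if_false,
        add_zero]
      rcases lt_or_gt_of_ne hij with h | h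
      · simp only [h, h.not_gt, if_true, if_false, add_zero, pow_succ]
        ring
      · simp only [h, h.not_gt, if_true, if_false, add_zero, pow_succ, cc]
        field_simp
    · have h1 : m.count i = 0 := Multiset.count_eq_zero.mpr hi
      simp [rcoef, Multiset.count_cons_of_ne hij, h1, qnum_zero]

lemma remL_mulL_of_ne (s : Bool) {i j : ι} (hij : i ≠ j) {m : Multiset ι} (hm : Good s m) :
    remL s i (mulL s j (ee m)) = eps s • mulL s j (remL s i (ee m)) := by
  have h0 := qp_ne_zero s
  rw [remL_ee s i hm, mulL_ee, map_smul, map_smul, mulL_ee]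
  have hmem : j ∈ m.erase i ↔ j ∈ m := Multiset.mem_erase_of_ne hij.symm
  by_cases hj : s = false ∧ j ∈ m
  · rw [if_pos hj, if_pos ⟨hj.1, hmem.mpr hj.2⟩]
    simp
  · have hg : Good s (j ::ₘ m) := fun hs =>
      Multiset.nodup_cons.mpr ⟨fun h => hj ⟨hs, h⟩, hm hs⟩
    rw [if_neg hj, if_neg (by rwa [hmem]), remL_ee s i hg, erase_cons_of_ne' hij, smul_smul,
      smul_smul, smul_smul]
    congr 1
    by_cases hi : i ∈ m
    · obtain ⟨m', rfl⟩ := Multiset.exists_cons_of_mem hi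
      rw [Multiset.erase_cons_head]
      simp only [lcoef, cntLt_cons, cntGt_cons, Multiset.count_cons_of_ne hij, lt_irrefl, if_false,
        add_zero]
      rcases lt_or_gt_of_ne hij with h | h
      · simp only [h, h.not_gt, if_true, if_false, add_zero, pow_succ, cc]
        field_simp
      · simp only [h, h.not_gt, if_true, if_false, add_zero, pow_succ]
        ring
    · have h1 : m.count i = 0 := Multiset.count_eq_zero.mpr hi
      simp [lcoef, Multiset.count_cons_of_ne hij, h1, qnum_zero]

variable [Fintype ι]

lemma sum_mulR_remR (s : Bool) {m : Multiset ι} (hm : Good s m) :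
    ∑ l, mulR s l (remR s l (ee m)) = qnum m.card • ee m := by
  rw [Finset.sum_congr rfl fun l _ => mulR_remR s l hm, ← Finset.sum_smul, sum_wt]

lemma sum_mulL_remL (s : Bool) {m : Multiset ι} (hm : Good s m) :
    ∑ l, mulL s l (remL s l (ee m)) = qnum m.card • ee m := by
  rw [Finset.sum_congr rfl fun l _ => mulL_remL s l hm, ← Finset.sum_smul]
  have h := sum_wt s (m.map OrderDual.toDual)
  rw [Multiset.card_map] at h
  exact congrArg (· • ee m) h

lemma remR_mulR_self (s : Bool) (j : ι) {m : Multiset ι} (hm : Good s m) (hne : m ≠ 0) :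
    remR s j (mulR s j (ee m)) =
      ∑ l, fmu s l j • mulR s l (remR s l (ee m)) - qnum ((m.card : ℤ) - 1) • ee m := by
  have h0 := qp_ne_zero s
  rw [Finset.sum_congr rfl fun l _ => congrArg (fmu s l j • ·) (mulR_remR s l hm)]
  simp only [smul_smul]
  rw [← Finset.sum_smul, ← sub_smul, sum_fmu_wt s m j hne hm, add_sub_cancel_right, mulR_ee,
    map_smul]
  by_cases hj : s = false ∧ j ∈ m
  · simp [hj]
  · have hg : Good s (j ::ₘ m) := fun hs =>
      Multiset.nodup_cons.mpr ⟨fun h => hj ⟨hs, h⟩, hm hs⟩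
    rw [if_neg hj, if_neg hj, remR_ee s j hg, Multiset.erase_cons_head, smul_smul]
    congr 1
    simp only [rcoef, cntLt_cons, cntGt_cons, lt_irrefl, if_false, add_zero,
      Multiset.count_cons_self, cc_pow]
    linear_combination (qp s ^ cntLt j m * (qp s ^ cntGt j m)⁻¹ *
      qnum ((m.count j + 1 : ℕ) : ℤ)) * eps_pow_mul s (cntGt j m)

lemma remL_mulL_self (s : Bool) (j : ι) {m : Multiset ι} (hm : Good s m) (hne : m ≠ 0) :
    remL s j (mulL s j (ee m)) =
      ∑ l, fmu s j l • mulL s l (remL s l (ee m)) - qnum ((m.card : ℤ) - 1) • ee m := by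
  have h0 := qp_ne_zero s
  rw [Finset.sum_congr rfl fun l _ => congrArg (fmu s j l • ·) (mulL_remL s l hm)]
  simp only [smul_smul]
  have hd := sum_fmu_wt s (m.map OrderDual.toDual) (OrderDual.toDual j) (by simpa using hne)
    fun hs => (Multiset.nodup_map_iff_of_injective OrderDual.toDual.injective).mpr (hm hs)
  rw [Multiset.card_map, cntLt_dual, cntGt_dual, count_dual] at hd
  simp only [Multiset.mem_map_of_injective OrderDual.toDual.injective] at hd
  have hd' := (Fintype.sum_equiv OrderDual.toDual
    (fun l => fmu s j l * wt s (m.map OrderDual.toDual) (OrderDual.toDual l)) _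
      fun l => by rw [fmu_dual]).trans hd
  rw [← Finset.sum_smul, ← sub_smul, hd', add_sub_cancel_right, mulL_ee, map_smul]
  by_cases hj : s = false ∧ j ∈ m
  · simp [hj]
  · have hg : Good s (j ::ₘ m) := fun hs =>
      Multiset.nodup_cons.mpr ⟨fun h => hj ⟨hs, h⟩, hm hs⟩
    rw [if_neg hj, if_neg hj, remL_ee s j hg, Multiset.erase_cons_head, smul_smul]
    congr 1
    simp only [lcoef, cntLt_cons, cntGt_cons, lt_irrefl, if_false, add_zero,
      Multiset.count_cons_self, cc_pow]
    linear_combination (qp s ^ cntGt j m * (qp s ^ cntLt j m)⁻¹ *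
      qnum ((m.count j + 1 : ℕ) : ℤ)) * eps_pow_mul s (cntLt j m)

lemma mulR_mulL_comm (s : Bool) (j k : ι) : mulR s k ∘ₗ mulL s j = mulL s j ∘ₗ mulR s k := by
  refine mdl_ext fun m => ?_
  simp only [LinearMap.comp_apply, mulR_ee, mulL_ee, map_smul, smul_smul, Multiset.mem_cons,
    cntLt_cons, cntGt_cons]
  rw [Multiset.cons_swap]
  congr 1
  by_cases h1 : s = false
  · by_cases h2 : j = k
    · subst h2; simp [h1]
    · by_cases h3 : j ∈ m
      · simp [h1, h3]
      · by_cases h4 : k ∈ m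
        · simp [h1, h4]
        · simp only [h1, h2, Ne.symm h2, h3, h4, or_self, and_false, if_false]
          split_ifs <;> ring
  · obtain rfl : s = true := by simpa using h1
    simp only [Bool.true_eq_false, false_and, if_false]
    split_ifs <;> ring

end ModelRelations

section Powers

variable {n : ℕ}

/-- The quadratic relations of symmetric powers (`s = true`) and exterior powers (`s = false`). -/
noncomputable def qRel (n : ℕ) : Bool → Submodule Kq (vecSq n).V
  | true => symRel n
  | false => extRel n

lemma qRel_stable (s : Bool) : (vecSq n).Stable (qRel n s) := by
  cases s
  · exact extRel_stable n
  · exact symRel_stable n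

/-- The symmetric powers (`s = true`) and the exterior powers (`s = false`). -/
noncomputable def qPow (n : ℕ) (s : Bool) (a : ℕ) : AlgRep Kq (Uq n) :=
  (tpow n a).quot (ideal n (qRel n s) a) (ideal_stable n (qRel_stable s) a)

/-- The quotient map from a tensor power. -/
noncomputable def qProj (s : Bool) (a : ℕ) : tpow n a ⟶ qPow n s a :=
  ⟨(ideal n (qRel n s) a).mkQ, fun _ => rfl⟩

/-- The monomial of a word. -/
noncomputable def qVec (s : Bool) {a : ℕ} (w : Fin a → Fin n) : (qPow n s a).V :=
  (ideal n (qRel n s) a).mkQ (wordVec w)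

lemma qProj_wordVec (s : Bool) {a : ℕ} (w : Fin a → Fin n) :
    AlgRep.lin (qProj s a) (wordVec w) = qVec s w := rfl

lemma qProj_surjective (s : Bool) (a : ℕ) :
    Function.Surjective (AlgRep.lin (qProj (n := n) s a)) := Submodule.mkQ_surjective _

/-- The words of the basis vectors: increasing, and strictly increasing for exterior powers. -/
def Std (s : Bool) {a : ℕ} (w : Fin a → Fin n) : Prop :=
  match s with
  | true => Monotone w
  | false => StrictMono w

/-- The multiset of letters of a word. -/
def cont {a : ℕ} (w : Fin a → Fin n) : Multiset (Fin n) := Finset.univ.val.map w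

lemma cont_zero (w : Fin 0 → Fin n) : cont w = 0 := rfl

lemma card_cont {a : ℕ} (w : Fin a → Fin n) : (cont w).card = a := by simp [cont]

lemma cont_succ {a : ℕ} (w : Fin (a + 1) → Fin n) :
    cont w = w (Fin.last a) ::ₘ cont (Fin.init w) := by
  rw [cont, Fin.univ_castSuccEmb, Finset.cons_val, Multiset.map_cons, Finset.map_val,
    Multiset.map_map]
  rfl

lemma mem_cont {a : ℕ} {w : Fin a → Fin n} {x : Fin n} : x ∈ cont w ↔ ∃ i, w i = x := by
  simp [cont]

lemma std_succ {s : Bool} {a : ℕ} {w : Fin (a + 1) → Fin n} :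
    Std s w ↔ Std s (Fin.init w) ∧ ∀ x ∈ cont (Fin.init w),
      x ≤ w (Fin.last a) ∧ (s = false → x ≠ w (Fin.last a)) := by
  have hlt : ∀ i : Fin a, i.castSucc < Fin.last a := Fin.castSucc_lt_last
  constructor
  · intro h
    cases s with
    | true =>
      refine ⟨fun i j hij => h (Fin.castSucc_le_castSucc_iff.mpr hij), fun x hx => ?_⟩
      obtain ⟨i, rfl⟩ := mem_cont.mp hx
      exact ⟨h (hlt i).le, fun h => by simp at h⟩
    | false =>
      refine ⟨fun i j hij => h (Fin.castSucc_lt_castSucc_iff.mpr hij), fun x hx => ?_⟩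
      obtain ⟨i, rfl⟩ := mem_cont.mp hx
      exact ⟨(h (hlt i)).le, fun _ => (h (hlt i)).ne⟩
  · rintro ⟨h1, h2⟩
    have h2' : ∀ i : Fin a, w i.castSucc ≤ w (Fin.last a) ∧
        (s = false → w i.castSucc ≠ w (Fin.last a)) := fun i => h2 _ (mem_cont.mpr ⟨i, rfl⟩)
    cases s with
    | true =>
      intro i j hij
      induction j using Fin.lastCases with
      | last =>
        induction i using Fin.lastCases with
        | last => exact le_rfl
        | cast i => exact (h2' i).1
      | cast j =>
        induction i using Fin.lastCases with
        | last => exact absurd (hlt j) (not_lt.mpr hij)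
        | cast i => exact h1 (Fin.castSucc_le_castSucc_iff.mp hij)
    | false =>
      intro i j hij
      induction j using Fin.lastCases with
      | last =>
        induction i using Fin.lastCases with
        | last => exact absurd hij (lt_irrefl _)
        | cast i => exact lt_of_le_of_ne (h2' i).1 ((h2' i).2 rfl)
      | cast j =>
        induction i using Fin.lastCases with
        | last => exact absurd (hlt j) (not_lt.mpr hij.le)
        | cast i => exact h1 (Fin.castSucc_lt_castSucc_iff.mp hij)

lemma good_cont {s : Bool} {a : ℕ} {w : Fin a → Fin n} (hw : Std s w) : Good s (cont w) := by
  rintro rfl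
  exact Multiset.Nodup.map (StrictMono.injective hw) Finset.univ.nodup

lemma std_snoc {s : Bool} {a : ℕ} {w : Fin a → Fin n} {k : Fin n} (hw : Std s w)
    (hk : ∀ x ∈ cont w, x ≤ k ∧ (s = false → x ≠ k)) :
    Std s (Fin.snoc (α := fun _ => Fin n) w k) := by
  rw [std_succ, Fin.init_snoc, Fin.snoc_last]
  exact ⟨hw, hk⟩

lemma cont_snoc {a : ℕ} (w : Fin a → Fin n) (k : Fin n) :
    cont (Fin.snoc (α := fun _ => Fin n) w k) = k ::ₘ cont w := by
  rw [cont_succ, Fin.init_snoc, Fin.snoc_last]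

lemma exists_std {s : Bool} {m : Multiset (Fin n)} (hm : Good s m) {a : ℕ} (ha : m.card = a) :
    ∃ w : Fin a → Fin n, Std s w ∧ cont w = m := by
  induction m using max_induction generalizing a with
  | h0 =>
    subst ha
    refine ⟨Fin.elim0, ?_, rfl⟩
    cases s
    · exact fun i => i.elim0
    · exact fun i => i.elim0
  | h1 k m hk ih =>
    rw [Multiset.card_cons] at ha
    subst ha
    obtain ⟨w, hw, hc⟩ := ih (good_of_cons hm) rfl
    refine ⟨Fin.snoc (α := fun _ => Fin n) w k, std_snoc hw fun x hx => ⟨hk x (hc ▸ hx), ?_⟩, ?_⟩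
    · rintro hs rfl
      exact not_mem_of_good_cons hm ⟨hs, hc ▸ hx⟩
    · rw [cont_snoc, hc]

/-- Adding a vector on the right of a tensor. -/
noncomputable def tsnoc {a : ℕ} : (tpow n a).V →ₗ[Kq] (Fin n → Kq) →ₗ[Kq] (tpow n (a + 1)).V :=
  TensorProduct.mk Kq (tpow n a).V (Fin n → Kq)

/-- Adding a tensor of degree two on the right of a tensor. -/
noncomputable def tsnoc2 {a : ℕ} : (tpow n a).V →ₗ[Kq] (vecSq n).V →ₗ[Kq] (tpow n (a + 2)).V :=
  (TensorProduct.mk Kq (tpow n a).V (vecSq n).V).compr₂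
    (TensorProduct.assoc Kq (tpow n a).V (vecRep n).V (vecRep n).V).symm.toLinearMap

lemma tsnoc2_tmul {a : ℕ} (x : (tpow n a).V) (v w : Fin n → Kq) :
    tsnoc2 x (v ⊗ₜ[Kq] w) = tsnoc (tsnoc x v) w := rfl

lemma wordVec_succ {a : ℕ} (w : Fin (a + 1) → Fin n) :
    wordVec w = tsnoc (wordVec (Fin.init w)) (bv (w (Fin.last a))) := rfl

lemma wordVec_snoc {a : ℕ} (w : Fin a → Fin n) (k : Fin n) :
    wordVec (Fin.snoc (α := fun _ => Fin n) w k) = tsnoc (wordVec w) (bv k) := by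
  rw [wordVec_succ, Fin.init_snoc, Fin.snoc_last]

lemma tsnoc_ext {M : Type*} [AddCommMonoid M] [Module Kq M] {a : ℕ}
    {f g : (tpow n (a + 1)).V →ₗ[Kq] M} (h : ∀ x v, f (tsnoc x v) = g (tsnoc x v)) : f = g :=
  TensorProduct.ext' h

lemma vec_ext {M : Type*} [AddCommMonoid M] [Module Kq M] {f g : (Fin n → Kq) →ₗ[Kq] M}
    (h : ∀ i, f (bv i) = g (bv i)) : f = g :=
  LinearMap.pi_ext' fun i => LinearMap.ext_ring (h i)

lemma tpow_ext {M : Type*} [AddCommMonoid M] [Module Kq M] :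
    ∀ {a : ℕ} {f g : (tpow n a).V →ₗ[Kq] M}, (∀ w : Fin a → Fin n, f (wordVec w) = g (wordVec w)) →
      f = g
  | 0, f, g, h => LinearMap.ext_ring (R := Kq) (f := f) (g := g) (h Fin.elim0)
  | a + 1, f, g, h => by
    have h1 : tsnoc.compr₂ f = tsnoc.compr₂ g := tpow_ext fun w => vec_ext fun i => by
      have := h (Fin.snoc (α := fun _ => Fin n) w i)
      rwa [wordVec_snoc] at this
    exact tsnoc_ext fun x v => LinearMap.congr_fun (LinearMap.congr_fun h1 x) v

lemma qPow_ext {s : Bool} {M : Type*} [AddCommMonoid M] [Module Kq M] {a : ℕ}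
    {f g : (qPow n s a).V →ₗ[Kq] M} (h : ∀ w : Fin a → Fin n, f (qVec s w) = g (qVec s w)) :
    f = g := by
  have h1 : f ∘ₗ (qProj s a).1 = g ∘ₗ (qProj s a).1 := tpow_ext h
  exact (LinearMap.cancel_right (qProj_surjective s a)).mp h1

lemma ideal_tsnoc (R : Submodule Kq (vecSq n).V) : ∀ {a : ℕ} {x : (tpow n a).V},
    x ∈ ideal n R a → ∀ v : Fin n → Kq, tsnoc x v ∈ ideal n R (a + 1)
  | 0, x, hx, v => by
    rw [(Submodule.mem_bot Kq).mp hx, map_zero]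
    exact Submodule.zero_mem _
  | a + 1, x, hx, v => Submodule.mem_sup_left (Submodule.apply_mem_map₂ _ hx Submodule.mem_top)

lemma ideal_tsnoc2 (R : Submodule Kq (vecSq n).V) {a : ℕ} (x : (tpow n a).V) {r : (vecSq n).V}
    (hr : r ∈ R) : tsnoc2 x r ∈ ideal n R (a + 2) :=
  Submodule.mem_sup_right ⟨_, Submodule.apply_mem_map₂ _ Submodule.mem_top hr, rfl⟩

lemma ideal_le {R : Submodule Kq (vecSq n).V} {a : ℕ} {Q : Submodule Kq (tpow n (a + 2)).V}
    (h1 : ∀ x ∈ ideal n R (a + 1), ∀ v : Fin n → Kq, tsnoc x v ∈ Q)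
    (h2 : ∀ (x : (tpow n a).V), ∀ r ∈ R, tsnoc2 x r ∈ Q) : ideal n R (a + 2) ≤ Q := by
  refine sup_le (Submodule.map₂_le.mpr fun x hx v _ => h1 x hx v) ?_
  refine Submodule.map_le_iff_le_comap.mpr ?_
  exact Submodule.map₂_le.mpr fun x _ r hr => h2 x r hr

/-- Right multiplication by a vector. -/
noncomputable def mulV (s : Bool) (n : ℕ) : (Fin n → Kq) →ₗ[Kq] Mdl (Fin n) →ₗ[Kq] Mdl (Fin n) :=
  Fintype.linearCombination Kq fun j => mulR s j

lemma mulV_bv (s : Bool) (j : Fin n) : mulV s n (bv j) = mulR s j := by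
  rw [mulV, bv, Fintype.linearCombination_apply_single, one_smul]

/-- The normal form of a tensor. -/
noncomputable def nft (s : Bool) : (a : ℕ) → (tpow n a).V →ₗ[Kq] Mdl (Fin n)
  | 0 => LinearMap.toSpanSingleton Kq _ (ee 0)
  | a + 1 => TensorProduct.lift ((mulV s n).flip ∘ₗ nft s a)

lemma nft_tsnoc (s : Bool) {a : ℕ} (x : (tpow n a).V) (v : Fin n → Kq) :
    nft s (a + 1) (tsnoc x v) = mulV s n v (nft s a x) := rfl

lemma mulR_mulR_of_lt (s : Bool) {i j : Fin n} (hij : i < j) :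
    mulR s i ∘ₗ mulR s j = cc s • (mulR s j ∘ₗ mulR s i) := by
  refine mdl_ext fun m => ?_
  simp only [LinearMap.comp_apply, LinearMap.smul_apply, mulR_ee, map_smul, smul_smul,
    Multiset.mem_cons, cntGt_cons, if_pos hij, if_neg hij.not_gt, hij.ne, hij.ne', false_or]
  rw [Multiset.cons_swap]
  congr 1
  split_ifs <;> simp [pow_succ] ; ring

lemma mulR_mulR_self (i : Fin n) : mulR false i ∘ₗ mulR false i = 0 := by
  refine mdl_ext fun m => ?_
  simp only [LinearMap.comp_apply, mulR_ee, map_smul, Multiset.mem_cons, true_or, and_self,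
    if_true, zero_smul, smul_zero, LinearMap.zero_apply]

lemma nft_rel (s : Bool) {a : ℕ} (x : (tpow n a).V) {r : (vecSq n).V} (hr : r ∈ qRel n s) :
    nft s (a + 2) (tsnoc2 x r) = 0 := by
  let L : (vecSq n).V →ₗ[Kq] Mdl (Fin n) := nft s (a + 2) ∘ₗ tsnoc2 x
  have hL : ∀ i j, L (bv i ⊗ₜ[Kq] bv j) = mulR s j (mulR s i (nft s a x)) := fun i j => by
    rw [← mulV_bv, ← mulV_bv]
    rfl
  have h0 := qpar_ne_zero
  suffices h : qRel n s ≤ LinearMap.ker L from h hr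
  cases s with
  | false =>
    refine Submodule.span_le.mpr ?_
    rintro _ (⟨i, rfl⟩ | ⟨i, j, hij, rfl⟩)
    · change L _ = 0
      rw [hL]
      exact LinearMap.congr_fun (mulR_mulR_self i) _
    · change L _ = 0
      rw [map_add, map_smul, hL, hL]
      have := LinearMap.congr_fun (mulR_mulR_of_lt false hij) (nft false a x)
      simp only [LinearMap.comp_apply, LinearMap.smul_apply] at this
      rw [this, ← add_smul]
      simp [cc, eps, qp]
  | true =>
    refine Submodule.span_le.mpr ?_
    rintro _ ⟨i, j, hij, rfl⟩
    change L _ = 0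
    rw [map_sub, map_smul, hL, hL]
    have := LinearMap.congr_fun (mulR_mulR_of_lt true hij) (nft true a x)
    simp only [LinearMap.comp_apply, LinearMap.smul_apply] at this
    rw [this, ← sub_smul]
    simp [cc, eps, qp]

lemma nft_ideal (s : Bool) : ∀ a : ℕ, ideal n (qRel n s) a ≤ LinearMap.ker (nft s a)
  | 0 => bot_le
  | 1 => bot_le
  | a + 2 => ideal_le
      (fun x hx v => by
        rw [LinearMap.mem_ker, nft_tsnoc, LinearMap.mem_ker.mp (nft_ideal s (a + 1) hx), map_zero])
      fun x r hr => nft_rel s x hr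

/-- The normal form of an element of a power. -/
noncomputable def nf (s : Bool) (a : ℕ) : (qPow n s a).V →ₗ[Kq] Mdl (Fin n) :=
  (ideal n (qRel n s) a).liftQ (nft s a) (nft_ideal s a)

lemma nf_qProj (s : Bool) {a : ℕ} (x : (tpow n a).V) :
    nf s a (AlgRep.lin (qProj s a) x) = nft s a x := rfl

lemma nft_wordVec_std {s : Bool} : ∀ {a : ℕ} {w : Fin a → Fin n}, Std s w →
    nft s a (wordVec w) = ee (cont w)
  | 0, w, _ => one_smul _ _
  | a + 1, w, hw => by
    obtain ⟨h1, h2⟩ := std_succ.mp hw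
    rw [wordVec_succ, nft_tsnoc, nft_wordVec_std h1, mulV_bv, mulR_ee_max (fun x hx => (h2 x hx).1),
      ← cont_succ]
    rintro ⟨hs, hm⟩
    exact (h2 _ hm).2 hs rfl

lemma nf_qVec {s : Bool} {a : ℕ} {w : Fin a → Fin n} (hw : Std s w) :
    nf s a (qVec s w) = ee (cont w) := nft_wordVec_std hw

/-- Right multiplication by a vector. -/
noncomputable def rmul (s : Bool) (a : ℕ) :
    (qPow n s a).V →ₗ[Kq] (Fin n → Kq) →ₗ[Kq] (qPow n s (a + 1)).V :=
  (ideal n (qRel n s) a).liftQ (tsnoc.compr₂ (qProj s (a + 1)).1)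
    fun x hx => LinearMap.ext fun v => (Submodule.Quotient.mk_eq_zero _).mpr (ideal_tsnoc _ hx v)

lemma rmul_qProj (s : Bool) {a : ℕ} (x : (tpow n a).V) (v : Fin n → Kq) :
    rmul s a (AlgRep.lin (qProj s a) x) v = AlgRep.lin (qProj s (a + 1)) (tsnoc x v) := rfl

lemma rmul_qVec (s : Bool) {a : ℕ} (w : Fin a → Fin n) (k : Fin n) :
    rmul s a (qVec s w) (bv k) = qVec s (Fin.snoc (α := fun _ => Fin n) w k) := by
  rw [← qProj_wordVec, ← qProj_wordVec, rmul_qProj, wordVec_snoc]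

lemma qVec_succ (s : Bool) {a : ℕ} (w : Fin (a + 1) → Fin n) :
    qVec s w = rmul s a (qVec s (Fin.init w)) (bv (w (Fin.last a))) := rfl

lemma rmul_rel (s : Bool) {a : ℕ} (x : (qPow n s a).V) {i j : Fin n} (hij : i < j) :
    rmul s (a + 1) (rmul s a x (bv j)) (bv i) =
      cc s • rmul s (a + 1) (rmul s a x (bv i)) (bv j) := by
  obtain ⟨x, rfl⟩ := qProj_surjective s a x
  simp only [rmul_qProj]
  rw [← map_smul]
  refine (Submodule.Quotient.eq _).mpr ?_
  have h0 := qpar_ne_zero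
  cases s with
  | true =>
    have h := ideal_tsnoc2 (symRel n) x
      (Submodule.neg_mem _ (Submodule.subset_span ⟨i, j, hij, rfl⟩))
    rw [neg_sub, map_sub, map_smul, tsnoc2_tmul, tsnoc2_tmul] at h
    rw [show cc true = qpar by simp [cc, eps, qp]]
    exact h
  | false =>
    have h := ideal_tsnoc2 (extRel n) x (Submodule.subset_span (Or.inr ⟨i, j, hij, rfl⟩))
    rw [map_add, map_smul, tsnoc2_tmul, tsnoc2_tmul] at h
    rw [show cc false = -qpar⁻¹ by simp [cc, eps, qp], neg_smul, sub_neg_eq_add,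
      add_comm (tsnoc _ _)]
    exact h

lemma rmul_self {a : ℕ} (x : (qPow n false a).V) (i : Fin n) :
    rmul false (a + 1) (rmul false a x (bv i)) (bv i) = 0 := by
  obtain ⟨x, rfl⟩ := qProj_surjective false a x
  exact (Submodule.Quotient.mk_eq_zero _).mpr
    (ideal_tsnoc2 (extRel n) x (Submodule.subset_span (Or.inl ⟨i, rfl⟩)))

lemma rmul_std (s : Bool) : ∀ {a : ℕ} {w : Fin a → Fin n} (_ : Std s w) (j : Fin n),
    rmul s a (qVec s w) (bv j) = 0 ∨ ∃ (c : Kq) (w' : Fin (a + 1) → Fin n), Std s w' ∧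
      cont w' = j ::ₘ cont w ∧ rmul s a (qVec s w) (bv j) = c • qVec s w'
  | 0, w, hw, j => Or.inr ⟨1, Fin.snoc (α := fun _ => Fin n) w j,
      std_snoc hw fun x hx => absurd hx (Multiset.notMem_zero x), cont_snoc _ _, by
        rw [rmul_qVec, one_smul]⟩
  | a + 1, w, hw, j => by
    obtain ⟨h1, h2⟩ := std_succ.mp hw
    by_cases hlt : j < w (Fin.last a)
    · rw [qVec_succ, rmul_rel s _ hlt]
      rcases rmul_std s h1 j with h | ⟨c, w', hw', hc, h⟩
      · left
        rw [h, map_zero, LinearMap.zero_apply, smul_zero]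
      · right
        refine ⟨cc s * c, Fin.snoc (α := fun _ => Fin n) w' (w (Fin.last a)), std_snoc hw' ?_, ?_, ?_⟩
        · intro x hx
          rw [hc, Multiset.mem_cons] at hx
          rcases hx with rfl | hx
          · exact ⟨hlt.le, fun _ => hlt.ne⟩
          · exact h2 x hx
        · rw [cont_snoc, hc, cont_succ w, Multiset.cons_swap]
        · rw [h, map_smul, LinearMap.smul_apply, rmul_qVec, smul_smul]
    · have hle : ∀ x ∈ cont w, x ≤ j := by
        intro x hx
        rw [cont_succ, Multiset.mem_cons] at hx
        rcases hx with rfl | hx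
        · exact not_lt.mp hlt
        · exact (h2 x hx).1.trans (not_lt.mp hlt)
      by_cases hj : s = false ∧ j ∈ cont w
      · left
        obtain ⟨rfl, hj⟩ := hj
        have : w (Fin.last a) = j := by
          rw [cont_succ, Multiset.mem_cons] at hj
          rcases hj with rfl | hj
          · rfl
          · exact le_antisymm (not_lt.mp hlt) (h2 j hj).1
        rw [qVec_succ, this, rmul_self]
      · right
        refine ⟨1, Fin.snoc (α := fun _ => Fin n) w j, std_snoc hw fun x hx => ⟨hle x hx, ?_⟩,
          cont_snoc _ _, by rw [rmul_qVec, one_smul]⟩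
        rintro hs rfl
        exact hj ⟨hs, hx⟩

lemma qVec_mem_span (s : Bool) : ∀ {a : ℕ} (w : Fin a → Fin n),
    qVec s w ∈ Submodule.span Kq {x | ∃ w' : Fin a → Fin n, Std s w' ∧ x = qVec s w'}
  | 0, w => Submodule.subset_span ⟨w, by cases s <;> exact fun i => i.elim0, rfl⟩
  | a + 1, w => by
    have h : Submodule.span Kq {x | ∃ w' : Fin a → Fin n, Std s w' ∧ x = qVec s w'} ≤
        (Submodule.span Kq {x | ∃ w' : Fin (a + 1) → Fin n, Std s w' ∧ x = qVec s w'}).comap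
          ((rmul s a).flip (bv (w (Fin.last a)))) := by
      rw [Submodule.span_le]
      rintro _ ⟨w', hw', rfl⟩
      change rmul s a (qVec s w') (bv _) ∈ Submodule.span Kq _
      rcases rmul_std s hw' (w (Fin.last a)) with h | ⟨c, w'', hw'', _, h⟩
      · rw [h]
        exact Submodule.zero_mem _
      · rw [h]
        exact Submodule.smul_mem _ _ (Submodule.subset_span ⟨w'', hw'', rfl⟩)
    exact h (qVec_mem_span s (Fin.init w))

lemma span_std (s : Bool) (a : ℕ) :
    Submodule.span Kq {x | ∃ w : Fin a → Fin n, Std s w ∧ x = qVec s w} = ⊤ := by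
  rw [eq_top_iff, ← LinearMap.range_eq_top.mpr (qProj_surjective (n := n) s a)]
  have h : (Submodule.span Kq {x | ∃ w : Fin a → Fin n, Std s w ∧ x = qVec s w}).mkQ ∘ₗ
      (qProj s a).1 = 0 :=
    tpow_ext fun w => (Submodule.Quotient.mk_eq_zero _).mpr (qVec_mem_span s w)
  rintro _ ⟨x, rfl⟩
  exact (Submodule.Quotient.mk_eq_zero _).mp (LinearMap.congr_fun h x)

lemma qPow_std_ext {s : Bool} {M : Type*} [AddCommMonoid M] [Module Kq M] {a : ℕ}
    {f g : (qPow n s a).V →ₗ[Kq] M}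
    (h : ∀ w : Fin a → Fin n, Std s w → f (qVec s w) = g (qVec s w)) : f = g := by
  refine LinearMap.ext_on (span_std s a) ?_
  rintro _ ⟨w, hw, rfl⟩
  exact h w hw

open scoped Classical in
/-- A power vector with given normal form. -/
noncomputable def unf (s : Bool) (a : ℕ) : Mdl (Fin n) →ₗ[Kq] (qPow n s a).V :=
  Finsupp.linearCombination Kq fun m =>
    if h : ∃ w : Fin a → Fin n, Std s w ∧ cont w = m then qVec s h.choose else 0

lemma cont_injective {s : Bool} : ∀ {a : ℕ} {w w' : Fin a → Fin n} (_ : Std s w) (_ : Std s w')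
    (_ : cont w = cont w'), w = w'
  | 0, w, w', _, _, _ => Subsingleton.elim _ _
  | a + 1, w, w', hw, hw', h => by
    obtain ⟨h1, h2⟩ := std_succ.mp hw
    obtain ⟨h1', h2'⟩ := std_succ.mp hw'
    have hmax : ∀ {u : Fin (a + 1) → Fin n}, (∀ x ∈ cont (Fin.init u), x ≤ u (Fin.last a) ∧
        (s = false → x ≠ u (Fin.last a))) → ∀ x ∈ cont u, x ≤ u (Fin.last a) := by
      intro u hu x hx
      rw [cont_succ, Multiset.mem_cons] at hx
      rcases hx with rfl | hx
      · exact le_rfl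
      · exact (hu x hx).1
    have hl : w (Fin.last a) = w' (Fin.last a) :=
      le_antisymm (hmax h2' _ (h ▸ mem_cont.mpr ⟨_, rfl⟩)) (hmax h2 _ (h ▸ mem_cont.mpr ⟨_, rfl⟩))
    rw [cont_succ, cont_succ w', hl, Multiset.cons_inj_right] at h
    have := cont_injective h1 h1' h
    rw [← Fin.snoc_init_self w, ← Fin.snoc_init_self w', this, hl]

lemma unf_ee_cont {s : Bool} {a : ℕ} {w : Fin a → Fin n} (hw : Std s w) :
    unf s a (ee (cont w)) = qVec s w := by
  have h : ∃ w' : Fin a → Fin n, Std s w' ∧ cont w' = cont w := ⟨w, hw, rfl⟩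
  rw [unf, ee, Finsupp.linearCombination_single, one_smul, dif_pos h,
    cont_injective h.choose_spec.1 hw h.choose_spec.2]

lemma unf_ee_of_card_ne {s : Bool} {a : ℕ} {m : Multiset (Fin n)} (hm : m.card ≠ a) :
    unf s a (ee m) = 0 := by
  rw [unf, ee, Finsupp.linearCombination_single, one_smul, dif_neg]
  rintro ⟨w, -, rfl⟩
  exact hm (card_cont w)

lemma unf_nf (s : Bool) (a : ℕ) : unf s a ∘ₗ nf (n := n) s a = LinearMap.id :=
  qPow_std_ext fun w hw => by
    rw [LinearMap.comp_apply, nf_qVec hw, unf_ee_cont hw, LinearMap.id_apply]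

lemma unf_nf_apply (s : Bool) (a : ℕ) (x : (qPow n s a).V) : unf s a (nf s a x) = x :=
  LinearMap.congr_fun (unf_nf s a) x

lemma nf_unf {s : Bool} {a : ℕ} {m : Multiset (Fin n)} (hm : Good s m) :
    nf s a (unf s a (ee m)) = if m.card = a then ee m else 0 := by
  split_ifs with h
  · obtain ⟨w, hw, rfl⟩ := exists_std hm h
    rw [unf_ee_cont hw, nf_qVec hw]
  · rw [unf_ee_of_card_ne h, map_zero]

end Powers

section Merge

variable {n : ℕ}

/-- Concatenation of tensors. -/
noncomputable def tmul (a : ℕ) : (b : ℕ) → (tpow n a ⊗ tpow n b ⟶ tpow n (a + b))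
  | 0 => (ρ_ (tpow n a)).hom
  | b + 1 => (α_ (tpow n a) (tpow n b) (vecRep n)).inv ≫ (tmul a b ▷ vecRep n)

/-- Concatenation of tensors, as a bilinear map. -/
noncomputable def tmulB (a b : ℕ) :
    (tpow n a).V →ₗ[Kq] (tpow n b).V →ₗ[Kq] (tpow n (a + b)).V :=
  (TensorProduct.mk Kq (tpow n a).V (tpow n b).V).compr₂ (tmul a b).1

lemma tmulB_zero (a : ℕ) (x : (tpow n a).V) (c : (tpow n 0).V) :
    tmulB a 0 x c = (show Kq from c) • x := rfl

lemma tmulB_succ (a b : ℕ) (x : (tpow n a).V) (y : (tpow n b).V) (v : Fin n → Kq) :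
    tmulB a (b + 1) x (tsnoc y v) = tsnoc (tmulB a b x y) v := rfl

lemma tmulB_tsnoc2 (a b : ℕ) (x : (tpow n a).V) (y : (tpow n b).V) (r : (vecSq n).V) :
    tmulB a (b + 2) x (tsnoc2 y r) = tsnoc2 (tmulB a b x y) r := by
  have h : tmulB a (b + 2) x ∘ₗ tsnoc2 y = tsnoc2 (tmulB a b x y) :=
    TensorProduct.ext' fun v w => rfl
  exact LinearMap.congr_fun h r

lemma append_succ {a b : ℕ} (v : Fin a → Fin n) (w : Fin (b + 1) → Fin n) :
    Fin.init (n := a + b) (α := fun _ => Fin n) (Fin.append v w : Fin (a + (b + 1)) → Fin n) = Fin.append v (Fin.init w) ∧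
      (Fin.append v w : Fin (a + (b + 1)) → Fin n) (Fin.last (a + b)) = w (Fin.last b) := by
  refine ⟨funext fun i => ?_, ?_⟩
  · induction i using Fin.addCases with
    | left i =>
      rw [Fin.append_left]
      exact Fin.append_left v w i
    | right i =>
      rw [Fin.append_right]
      exact Fin.append_right v w i.castSucc
  · exact Fin.append_right v w (Fin.last b)

lemma tmulB_wordVec {a : ℕ} : ∀ {b : ℕ} (v : Fin a → Fin n) (w : Fin b → Fin n),
    tmulB a b (wordVec v) (wordVec w) = wordVec (Fin.append v w)
  | 0, v, w => by
    rw [tmulB_zero]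
    refine (one_smul Kq _).trans (congrArg wordVec (funext fun i => ?_))
    exact (Fin.append_left v w i).symm
  | b + 1, v, w => by
    rw [wordVec_succ w, tmulB_succ, tmulB_wordVec]
    refine Eq.trans ?_ (wordVec_succ (a := a + b) (Fin.append v w : Fin (a + (b + 1)) → Fin n)).symm
    rw [(append_succ v w).1, (append_succ v w).2]

lemma tmulB_ideal_left (R : Submodule Kq (vecSq n).V) {a : ℕ} {x : (tpow n a).V}
    (hx : x ∈ ideal n R a) : ∀ {b : ℕ} (y : (tpow n b).V), tmulB a b x y ∈ ideal n R (a + b)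
  | 0, y => by
    rw [tmulB_zero]
    exact Submodule.smul_mem _ _ hx
  | b + 1, y => by
    have h : (ideal n R (a + (b + 1))).mkQ ∘ₗ tmulB a (b + 1) x = 0 := tsnoc_ext fun y v => by
      rw [LinearMap.comp_apply, tmulB_succ]
      exact (Submodule.Quotient.mk_eq_zero _).mpr (ideal_tsnoc R (tmulB_ideal_left R hx y) v)
    exact (Submodule.Quotient.mk_eq_zero _).mp (LinearMap.congr_fun h y)

lemma tmulB_ideal_right (R : Submodule Kq (vecSq n).V) {a : ℕ} (x : (tpow n a).V) :
    ∀ {b : ℕ}, ideal n R b ≤ (ideal n R (a + b)).comap (tmulB a b x)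
  | 0 => bot_le
  | 1 => bot_le
  | b + 2 => ideal_le
      (fun y hy v => by
        change tmulB a (b + 2) x (tsnoc y v) ∈ ideal n R (a + (b + 2))
        rw [tmulB_succ]
        exact ideal_tsnoc R (tmulB_ideal_right R x hy) v)
      fun y r hr => by
        change tmulB a (b + 2) x (tsnoc2 y r) ∈ ideal n R (a + (b + 2))
        rw [tmulB_tsnoc2]
        exact ideal_tsnoc2 R _ hr

/-- Multiplication as a bilinear map. -/
noncomputable def qMulB (s : Bool) (a b : ℕ) :
    (qPow n s a).V →ₗ[Kq] (qPow n s b).V →ₗ[Kq] (qPow n s (a + b)).V :=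
  ((ideal n (qRel n s) b).liftQ ((ideal n (qRel n s) a).liftQ
      ((tmulB a b).compr₂ (qProj s (a + b)).1)
      (fun x hx => LinearMap.ext fun y =>
        (Submodule.Quotient.mk_eq_zero _).mpr (tmulB_ideal_left _ hx y))).flip
    (fun y hy => by
      refine LinearMap.ext fun x => ?_
      obtain ⟨x, rfl⟩ := qProj_surjective s a x
      exact (Submodule.Quotient.mk_eq_zero _).mpr (tmulB_ideal_right _ x hy))).flip

lemma qMulB_qProj (s : Bool) (a b : ℕ) (x : (tpow n a).V) (y : (tpow n b).V) :
    qMulB s a b (AlgRep.lin (qProj s a) x) (AlgRep.lin (qProj s b) y) =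
      AlgRep.lin (qProj s (a + b)) (tmulB a b x y) := rfl

lemma qPow_tmul_ext {s : Bool} {M : Type*} [AddCommMonoid M] [Module Kq M] {a b : ℕ}
    {f g : (qPow n s a ⊗ qPow n s b : AlgRep Kq (Uq n)).V →ₗ[Kq] M}
    (h : f ∘ₗ (qProj s a ⊗ₘ qProj s b).1 = g ∘ₗ (qProj s a ⊗ₘ qProj s b).1) : f = g := by
  refine TensorProduct.ext' fun x y => ?_
  obtain ⟨x, rfl⟩ := qProj_surjective s a x
  obtain ⟨y, rfl⟩ := qProj_surjective s b y
  exact LinearMap.congr_fun h (x ⊗ₜ y)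

/-- The merge morphism. -/
noncomputable def qMul (s : Bool) (a b : ℕ) : qPow n s a ⊗ qPow n s b ⟶ qPow n s (a + b) :=
  ⟨TensorProduct.lift (qMulB s a b), fun u => by
    apply qPow_tmul_ext
    have h1 : TensorProduct.lift (qMulB s a b) ∘ₗ (qProj s a ⊗ₘ qProj s b).1 =
        (tmul (n := n) a b ≫ qProj s (a + b)).1 := TensorProduct.ext' fun x y => rfl
    rw [LinearMap.comp_assoc, ← (qProj s a ⊗ₘ qProj s b).2 u, ← LinearMap.comp_assoc, h1,
      LinearMap.comp_assoc, h1]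
    exact (tmul (n := n) a b ≫ qProj s (a + b)).2 u⟩

lemma qMulB_qVec (s : Bool) {a b : ℕ} (v : Fin a → Fin n) (w : Fin b → Fin n) :
    qMulB s a b (qVec s v) (qVec s w) = qVec s (Fin.append v w) := by
  rw [← qProj_wordVec, ← qProj_wordVec, ← qProj_wordVec, qMulB_qProj, tmulB_wordVec]

/-- The letter `k`, as an element of degree one. -/
noncomputable def qth (s : Bool) (k : Fin n) : (qPow n s 1).V := qVec s fun _ => k

lemma std_one (s : Bool) (w : Fin 1 → Fin n) : Std s w := by
  cases s
  · exact Subsingleton.strictMono w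
  · exact Subsingleton.monotone w

lemma nf_qth (s : Bool) (k : Fin n) : nf s 1 (qth s k) = ee {k} := nf_qVec (std_one s _)

lemma nf_qMulB_right (s : Bool) (a : ℕ) (x : (qPow n s a).V) (k : Fin n) :
    nf s (a + 1) (qMulB s a 1 x (qth s k)) = mulR s k (nf s a x) := by
  obtain ⟨x, rfl⟩ := qProj_surjective s a x
  rw [qth, ← qProj_wordVec, qMulB_qProj, nf_qProj, nf_qProj, wordVec_succ, tmulB_succ]
  refine (nft_tsnoc s _ _).trans ?_
  rw [mulV_bv]
  congr 2
  exact one_smul Kq x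

lemma mulR_ee_zero (s : Bool) (k : Fin n) : mulR s k (ee 0) = ee {k} := by
  rw [mulR_ee]; simp

lemma mulL_ee_zero (s : Bool) (k : Fin n) : mulL s k (ee 0) = ee {k} := by
  rw [mulL_ee]; simp

lemma mulV_mulL (s : Bool) (v : Fin n → Kq) (k : Fin n) (x : Mdl (Fin n)) :
    mulV s n v (mulL s k x) = mulL s k (mulV s n v x) := by
  have h : (mulV s n).flip (mulL s k x) = mulL s k ∘ₗ (mulV s n).flip x := vec_ext fun i => by
    change mulV s n (bv i) (mulL s k x) = mulL s k (mulV s n (bv i) x)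
    rw [mulV_bv]
    exact LinearMap.congr_fun (mulR_mulL_comm s k i) x
  exact LinearMap.congr_fun h v

/-- The unit of the tensor algebra. -/
noncomputable def tone : (tpow n 0).V := (1 : Kq)

lemma nft_tone (s : Bool) : nft s 0 (tone (n := n)) = ee 0 := one_smul _ _

lemma nft_tmulB_left (s : Bool) (k : Fin n) : ∀ (b : ℕ) (y : (tpow n b).V),
    nft s (1 + b) (tmulB 1 b (tsnoc tone (bv k)) y) = mulL s k (nft s b y)
  | 0, y => by
    have h : nft s (1 + 0) ∘ₗ tmulB 1 0 (tsnoc tone (bv k)) = mulL s k ∘ₗ nft s 0 := by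
      refine LinearMap.ext_ring (R := Kq) (f := nft s (1 + 0) ∘ₗ tmulB 1 0 (tsnoc tone (bv k)))
        (g := mulL s k ∘ₗ nft s 0) ?_
      change nft s (0 + 1) ((1 : Kq) • tsnoc tone (bv k)) = mulL s k (nft s 0 tone)
      rw [one_smul, nft_tsnoc, nft_tone, mulV_bv, mulR_ee_zero, mulL_ee_zero]
    exact LinearMap.congr_fun h y
  | b + 1, y => by
    have h : nft s (1 + (b + 1)) ∘ₗ tmulB 1 (b + 1) (tsnoc tone (bv k)) =
        mulL s k ∘ₗ nft s (b + 1) := tsnoc_ext fun y v => by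
      rw [LinearMap.comp_apply, LinearMap.comp_apply, tmulB_succ, nft_tsnoc]
      refine (nft_tsnoc s _ _).trans ?_
      exact (congrArg (mulV s n v) (nft_tmulB_left s k b y)).trans (mulV_mulL s v k _)
    exact LinearMap.congr_fun h y

lemma nf_qMulB_left (s : Bool) (b : ℕ) (y : (qPow n s b).V) (k : Fin n) :
    nf s (1 + b) (qMulB s 1 b (qth s k) y) = mulL s k (nf s b y) := by
  obtain ⟨y, rfl⟩ := qProj_surjective s b y
  rw [qth, ← qProj_wordVec, qMulB_qProj, nf_qProj, nf_qProj]
  exact nft_tmulB_left s k b y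

lemma qth_ext {s : Bool} {M : Type*} [AddCommMonoid M] [Module Kq M]
    {f g : (qPow n s 1).V →ₗ[Kq] M} (h : ∀ k, f (qth s k) = g (qth s k)) : f = g :=
  qPow_ext fun w => by
    rw [show w = fun _ => w 0 from funext fun i => by rw [Subsingleton.elim i 0]]
    exact h (w 0)

lemma qVec_succ' (s : Bool) {a : ℕ} (w : Fin (a + 1) → Fin n) :
    qVec s w = qMulB s a 1 (qVec s (Fin.init w)) (qth s (w (Fin.last a))) := by
  rw [qth, qMulB_qVec]
  congr 1
  funext i
  induction i using Fin.lastCases with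
  | last => exact (Fin.append_right (Fin.init w) (fun _ : Fin 1 => w (Fin.last a)) 0).symm
  | cast i => exact (Fin.append_left (Fin.init w) (fun _ : Fin 1 => w (Fin.last a)) i).symm

lemma qMul_thin_surjective (s : Bool) (a : ℕ) :
    Function.Surjective (AlgRep.lin (qMul (n := n) s a 1)) := by
  rw [← LinearMap.range_eq_top, eq_top_iff, ← span_std, Submodule.span_le]
  rintro _ ⟨w, -, rfl⟩
  exact ⟨qVec s (Fin.init w) ⊗ₜ qth s (w (Fin.last a)), (qVec_succ' s w).symm⟩

end Merge

section Split

variable {n : ℕ}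

/-- The split map. -/
noncomputable def qCom (s : Bool) (a b : ℕ) :
    (qPow n s (a + b)).V →ₗ[Kq] (qPow n s a ⊗ qPow n s b : AlgRep Kq (Uq n)).V :=
  TensorProduct.map (unf s a) (unf s b) ∘ₗ comulF s ∘ₗ nf s (a + b)

lemma qCom_apply (s : Bool) (a b : ℕ) (x : (qPow n s (a + b)).V) :
    qCom s a b x = TensorProduct.map (unf s a) (unf s b) (comulF s (nf s (a + b) x)) := rfl

lemma good_left {s : Bool} {a b : Multiset (Fin n)} (h : Good s (a + b)) : Good s a :=
  good_of_le h (Multiset.le_add_right a b)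

lemma good_right {s : Bool} {a b : Multiset (Fin n)} (h : Good s (a + b)) : Good s b :=
  good_of_le h (Multiset.le_add_left b a)

lemma map_unf_comulF (s : Bool) {a b : ℕ} {m : Multiset (Fin n)} (hm : m.card ≠ a + b) :
    TensorProduct.map (unf s a) (unf s b) (comulF s (ee m)) = 0 := by
  refine comulF_congr s (f := TensorProduct.map (unf s a) (unf s b)) (g := 0) ?_
  rintro x y rfl
  rw [TensorProduct.map_tmul, LinearMap.zero_apply]
  by_cases h : x.card = a
  · rw [unf_ee_of_card_ne (a := b) (m := y), tmul_zero]
    rintro rfl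
    exact hm (by rw [Multiset.card_add, h])
  · rw [unf_ee_of_card_ne h, zero_tmul]

lemma qCom_unf (s : Bool) {a b : ℕ} {m : Multiset (Fin n)} (hm : Good s m) :
    qCom s a b (unf s (a + b) (ee m)) =
      TensorProduct.map (unf s a) (unf s b) (comulF s (ee m)) := by
  rw [qCom_apply, nf_unf hm]
  split_ifs with h
  · rfl
  · rw [map_zero, map_zero, map_unf_comulF s h]

lemma comulF_coassoc_nf (s : Bool) {a : ℕ} (x : (qPow n s a).V) :
    TensorProduct.assoc Kq _ _ _ ((comulF s).rTensor _ (comulF s (nf s a x))) =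
      (comulF s).lTensor _ (comulF s (nf s a x)) := by
  refine LinearMap.congr_fun (f := (TensorProduct.assoc Kq _ _ _).toLinearMap ∘ₗ
    (comulF s).rTensor _ ∘ₗ comulF s ∘ₗ nf s a)
    (g := (comulF s).lTensor _ ∘ₗ comulF s ∘ₗ nf s a) (qPow_std_ext fun w hw => ?_) x
  simp only [LinearMap.comp_apply, nf_qVec hw]
  exact comulF_coassoc s (good_cont hw)

lemma qCom_left (s : Bool) (a b c : ℕ) (x : (qPow n s (a + b + c)).V) :
    TensorProduct.map (qCom s a b) LinearMap.id (qCom s (a + b) c x) =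
      TensorProduct.map (TensorProduct.map (unf s a) (unf s b)) (unf s c)
        ((comulF s).rTensor _ (comulF s (nf s (a + b + c) x))) := by
  refine LinearMap.congr_fun (f := TensorProduct.map (qCom s a b) LinearMap.id ∘ₗ qCom s (a + b) c)
    (g := TensorProduct.map (TensorProduct.map (unf s a) (unf s b)) (unf s c) ∘ₗ
      (comulF s).rTensor _ ∘ₗ comulF s ∘ₗ nf s (a + b + c)) (qPow_std_ext fun w hw => ?_) x
  simp only [LinearMap.comp_apply, qCom_apply s (a + b) c, nf_qVec hw]
  refine comulF_congr s (f := TensorProduct.map (qCom s a b) LinearMap.id ∘ₗ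
    TensorProduct.map (unf s (a + b)) (unf s c))
    (g := TensorProduct.map (TensorProduct.map (unf s a) (unf s b)) (unf s c) ∘ₗ
      (comulF s).rTensor _) ?_
  intro y z hyz
  simp only [LinearMap.comp_apply, TensorProduct.map_tmul, LinearMap.rTensor_tmul,
    LinearMap.id_apply]
  rw [qCom_unf s (good_left (hyz ▸ good_cont hw))]

lemma qCom_right (s : Bool) (a b c : ℕ) (x : (qPow n s (a + (b + c))).V) :
    TensorProduct.map LinearMap.id (qCom s b c) (qCom s a (b + c) x) =
      TensorProduct.map (unf s a) (TensorProduct.map (unf s b) (unf s c))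
        ((comulF s).lTensor _ (comulF s (nf s (a + (b + c)) x))) := by
  refine LinearMap.congr_fun (f := TensorProduct.map LinearMap.id (qCom s b c) ∘ₗ qCom s a (b + c))
    (g := TensorProduct.map (unf s a) (TensorProduct.map (unf s b) (unf s c)) ∘ₗ
      (comulF s).lTensor _ ∘ₗ comulF s ∘ₗ nf s (a + (b + c))) (qPow_std_ext fun w hw => ?_) x
  simp only [LinearMap.comp_apply, qCom_apply s a (b + c), nf_qVec hw]
  refine comulF_congr s (f := TensorProduct.map LinearMap.id (qCom s b c) ∘ₗ
    TensorProduct.map (unf s a) (unf s (b + c)))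
    (g := TensorProduct.map (unf s a) (TensorProduct.map (unf s b) (unf s c)) ∘ₗ
      (comulF s).lTensor _) ?_
  intro y z hyz
  simp only [LinearMap.comp_apply, TensorProduct.map_tmul, LinearMap.lTensor_tmul,
    LinearMap.id_apply]
  rw [qCom_unf s (good_right (hyz ▸ good_cont hw))]

/-- Splits are coassociative. -/
lemma qCom_coassoc (s : Bool) {a b c : ℕ} {x : (qPow n s (a + b + c)).V}
    {x' : (qPow n s (a + (b + c))).V} (h : nf s _ x = nf s _ x') :
    TensorProduct.assoc Kq _ _ _ (TensorProduct.map (qCom s a b) LinearMap.id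
      (qCom s (a + b) c x)) = TensorProduct.map LinearMap.id (qCom s b c) (qCom s a (b + c) x') := by
  rw [qCom_left, qCom_right, ← h, ← comulF_coassoc_nf, TensorProduct.map_map_assoc]

lemma coef2_good (s : Bool) (a : ℕ) (m : Multiset (Fin n)) :
    TensorProduct.map (unf s a) (unf s 1) (comulF s (ee m)) =
      ∑ i, unf s a (remR s i (ee m)) ⊗ₜ[Kq] qth s i := by
  have h := comulF_congr s (m := m) (f := TensorProduct.map (unf s a) (unf s 1))
    (g := ∑ i, (TensorProduct.mk Kq _ _).flip (qth s i) ∘ₗ unf s a ∘ₗ coef2 {i}) ?_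
  · rw [h, LinearMap.sum_apply]
    rfl
  intro x y hxy
  rw [LinearMap.sum_apply]
  simp only [LinearMap.comp_apply, LinearMap.flip_apply, TensorProduct.mk_apply,
    TensorProduct.map_tmul, coef2_tmul]
  by_cases hy : y.card = 1
  · obtain ⟨i, rfl⟩ := Multiset.card_eq_one.mp hy
    rw [Finset.sum_eq_single i]
    · rw [if_pos rfl, ← nf_qth s, unf_nf_apply]
    · intro j _ hj
      rw [if_neg (by simpa using hj.symm), map_zero, zero_tmul]
    · intro h
      exact absurd (Finset.mem_univ i) h
  · rw [unf_ee_of_card_ne hy, tmul_zero, Finset.sum_eq_zero]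
    intro i _
    rw [if_neg, map_zero, zero_tmul]
    rintro rfl
    exact hy rfl

lemma coef1_good (s : Bool) (b : ℕ) (m : Multiset (Fin n)) :
    TensorProduct.map (unf s 1) (unf s b) (comulF s (ee m)) =
      ∑ i, qth s i ⊗ₜ[Kq] unf s b (remL s i (ee m)) := by
  have h := comulF_congr s (m := m) (f := TensorProduct.map (unf s 1) (unf s b))
    (g := ∑ i, (TensorProduct.mk Kq _ _) (qth s i) ∘ₗ unf s b ∘ₗ coef1 {i}) ?_
  · rw [h, LinearMap.sum_apply]
    rfl
  intro x y hxy
  rw [LinearMap.sum_apply]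
  simp only [LinearMap.comp_apply, TensorProduct.mk_apply, TensorProduct.map_tmul, coef1_tmul]
  by_cases hx : x.card = 1
  · obtain ⟨i, rfl⟩ := Multiset.card_eq_one.mp hx
    rw [Finset.sum_eq_single i]
    · rw [if_pos rfl, ← nf_qth s, unf_nf_apply]
    · intro j _ hj
      rw [if_neg (by simpa using hj.symm), map_zero, tmul_zero]
    · intro h
      exact absurd (Finset.mem_univ i) h
  · rw [unf_ee_of_card_ne hx, zero_tmul, Finset.sum_eq_zero]
    intro i _
    rw [if_neg, map_zero, tmul_zero]
    rintro rfl
    exact hx rfl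

lemma qCom_thin_right (s : Bool) (a : ℕ) (x : (qPow n s (a + 1)).V) :
    qCom s a 1 x = ∑ i, unf s a (remR s i (nf s (a + 1) x)) ⊗ₜ[Kq] qth s i := by
  have h : qCom s a 1 = ∑ i, (TensorProduct.mk Kq _ _).flip (qth s i) ∘ₗ unf s a ∘ₗ remR s i ∘ₗ
      nf (n := n) s (a + 1) := qPow_std_ext fun w hw => by
    rw [qCom_apply, nf_qVec hw, coef2_good, LinearMap.sum_apply]
    simp only [LinearMap.comp_apply, LinearMap.flip_apply, TensorProduct.mk_apply, nf_qVec hw]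
  rw [h, LinearMap.sum_apply]
  rfl

lemma qCom_thin_left (s : Bool) (b : ℕ) (x : (qPow n s (1 + b)).V) :
    qCom s 1 b x = ∑ i, qth s i ⊗ₜ[Kq] unf s b (remL s i (nf s (1 + b) x)) := by
  have h : qCom s 1 b = ∑ i, (TensorProduct.mk Kq _ _) (qth s i) ∘ₗ unf s b ∘ₗ remL s i ∘ₗ
      nf (n := n) s (1 + b) := qPow_std_ext fun w hw => by
    rw [qCom_apply, nf_qVec hw, coef1_good, LinearMap.sum_apply]
    simp only [LinearMap.comp_apply, TensorProduct.mk_apply, nf_qVec hw]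
  rw [h, LinearMap.sum_apply]
  rfl

lemma nf_unf_remR (s : Bool) (a : ℕ) (x : (qPow n s (a + 1)).V) (i : Fin n) :
    nf s a (unf s a (remR s i (nf s (a + 1) x))) = remR s i (nf s (a + 1) x) := by
  refine LinearMap.congr_fun (f := nf s a ∘ₗ unf s a ∘ₗ remR s i ∘ₗ nf s (a + 1))
    (g := remR s i ∘ₗ nf s (a + 1)) (qPow_std_ext fun w hw => ?_) x
  simp only [LinearMap.comp_apply, nf_qVec hw]
  rw [remR_ee s i (good_cont hw), map_smul, map_smul,
    nf_unf (good_of_le (good_cont hw) (Multiset.erase_le _ _))]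
  by_cases hi : i ∈ cont w
  · rw [if_pos]
    rw [Multiset.card_erase_of_mem hi, card_cont]
    rfl
  · rw [rcoef, Multiset.count_eq_zero.mpr hi]
    simp [qnum_zero]

lemma nf_unf_remL (s : Bool) (b : ℕ) (x : (qPow n s (1 + b)).V) (i : Fin n) :
    nf s b (unf s b (remL s i (nf s (1 + b) x))) = remL s i (nf s (1 + b) x) := by
  refine LinearMap.congr_fun (f := nf s b ∘ₗ unf s b ∘ₗ remL s i ∘ₗ nf s (1 + b))
    (g := remL s i ∘ₗ nf s (1 + b)) (qPow_std_ext fun w hw => ?_) x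
  simp only [LinearMap.comp_apply, nf_qVec hw]
  rw [remL_ee s i (good_cont hw), map_smul, map_smul,
    nf_unf (good_of_le (good_cont hw) (Multiset.erase_le _ _))]
  by_cases hi : i ∈ cont w
  · rw [if_pos]
    rw [Multiset.card_erase_of_mem hi, card_cont, add_comm]
    rfl
  · rw [lcoef, Multiset.count_eq_zero.mpr hi]
    simp [qnum_zero]

lemma nf_injective (s : Bool) (a : ℕ) : Function.Injective (nf (n := n) s a) :=
  Function.LeftInverse.injective (unf_nf_apply s a)

lemma qMul_qCom_right (s : Bool) (a : ℕ) (x : (qPow n s (a + 1)).V) :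
    AlgRep.lin (qMul s a 1) (qCom s a 1 x) = qnum ((a + 1 : ℕ) : ℤ) • x := by
  refine LinearMap.congr_fun (f := (qMul s a 1).1 ∘ₗ qCom s a 1)
    (g := qnum ((a + 1 : ℕ) : ℤ) • LinearMap.id) (qPow_std_ext fun w hw => ?_) x
  apply nf_injective
  rw [LinearMap.comp_apply, qCom_thin_right, map_sum, map_sum]
  have h : ∀ i, nf s (a + 1) ((qMul s a 1).1
      (unf s a (remR s i (nf s (a + 1) (qVec s w))) ⊗ₜ[Kq] qth s i)) =
        mulR s i (remR s i (ee (cont w))) := fun i => by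
    refine (nf_qMulB_right s a _ i).trans ?_
    rw [nf_unf_remR, nf_qVec hw]
  rw [Finset.sum_congr rfl fun i _ => h i, sum_mulR_remR s (good_cont hw), card_cont,
    LinearMap.smul_apply, map_smul, LinearMap.id_apply, nf_qVec hw]

end Split

section ThinSwitch

variable {n : ℕ}

/-- The split after the merge of two thin strands, on the tensor square of the vector
representation. -/
noncomputable def muV (s : Bool) (n : ℕ) : (vecSq n).V →ₗ[Kq] (vecSq n).V :=
  TensorProduct.lift (Fintype.linearCombination Kq fun l => Fintype.linearCombination Kq fun j =>
    fmu s l j • (bv l ⊗ₜ[Kq] bv j) + (if l = j then 0 else eps s) • (bv j ⊗ₜ[Kq] bv l))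

lemma muV_bv (s : Bool) (l j : Fin n) : muV s n (bv l ⊗ₜ[Kq] bv j) =
    fmu s l j • (bv l ⊗ₜ[Kq] bv j) + (if l = j then 0 else eps s) • (bv j ⊗ₜ[Kq] bv l) := by
  have h : ∀ {M : Type} [AddCommGroup M] [Module Kq M] (f : Fin n → M) (i : Fin n),
      Fintype.linearCombination Kq f (bv i) = f i := fun f i =>
    (Fintype.linearCombination_apply_single Kq f i 1).trans (one_smul _ _)
  rw [muV, TensorProduct.lift.tmul, h, h]

lemma muV_qRel (s : Bool) {r : (vecSq n).V} (hr : r ∈ qRel n s) : muV s n r = 0 := by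
  have h0 := qpar_ne_zero
  suffices h : qRel n s ≤ LinearMap.ker (muV s n) from h hr
  cases s with
  | false =>
    refine Submodule.span_le.mpr ?_
    rintro _ (⟨i, rfl⟩ | ⟨i, j, hij, rfl⟩)
    · refine (muV_bv _ _ _).trans ?_
      simp [fmu]
    · change muV _ _ _ = 0
      rw [map_add, map_smul, muV_bv, muV_bv]
      simp only [fmu, hij, hij.not_gt, hij.ne, hij.ne', if_true, if_false, eps, qp]
      match_scalars <;> simp [h0]
  | true =>
    refine Submodule.span_le.mpr ?_
    rintro _ ⟨i, j, hij, rfl⟩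
    change muV _ _ _ = 0
    rw [map_sub, map_smul, muV_bv, muV_bv]
    simp only [fmu, hij, hij.not_gt, hij.ne, hij.ne', if_true, if_false, eps, qp]
    match_scalars <;> simp [h0]

lemma muV_qRel_not (s : Bool) {r : (vecSq n).V} (hr : r ∈ qRel n (!s)) :
    muV s n r = qnum 2 • r := by
  have h0 := qpar_ne_zero
  suffices h : qRel n (!s) ≤ LinearMap.eqLocus (muV s n) (qnum 2 • LinearMap.id) from h hr
  cases s with
  | true =>
    refine Submodule.span_le.mpr ?_
    rintro _ (⟨i, rfl⟩ | ⟨i, j, hij, rfl⟩)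
    · refine (muV_bv _ _ _).trans ?_
      simp [fmu]
    · refine LinearMap.mem_eqLocus.mpr ?_
      rw [map_add, map_smul, muV_bv, muV_bv, LinearMap.smul_apply, LinearMap.id_apply, qnum_two]
      simp only [fmu, hij, hij.not_gt, hij.ne, hij.ne', if_true, if_false, eps, qp]
      match_scalars <;> field_simp <;> ring
  | false =>
    refine Submodule.span_le.mpr ?_
    rintro _ ⟨i, j, hij, rfl⟩
    refine LinearMap.mem_eqLocus.mpr ?_
    rw [map_sub, map_smul, muV_bv, muV_bv, LinearMap.smul_apply, LinearMap.id_apply, qnum_two]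
    simp only [fmu, hij, hij.not_gt, hij.ne, hij.ne', if_true, if_false, eps, qp]
    match_scalars <;> simp <;> field_simp <;> ring

lemma extRel_sup_symRel : extRel n ⊔ symRel n = ⊤ := by
  have h0 := qpar_ne_zero
  have h2 : qnum 2 ≠ 0 := qnum_ne_zero (k := 2) two_ne_zero
  have key : ∀ i j : Fin n, i < j → bv i ⊗ₜ[Kq] bv j ∈ extRel n ⊔ symRel n ∧
      bv j ⊗ₜ[Kq] bv i ∈ extRel n ⊔ symRel n := by
    intro i j hij
    have m1 : qpar⁻¹ • (bv i ⊗ₜ[Kq] bv j) + bv j ⊗ₜ[Kq] bv i ∈ extRel n ⊔ symRel n :=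
      Submodule.mem_sup_left (Submodule.subset_span (Or.inr ⟨i, j, hij, rfl⟩))
    have m2 : qpar • (bv i ⊗ₜ[Kq] bv j) - bv j ⊗ₜ[Kq] bv i ∈ extRel n ⊔ symRel n :=
      Submodule.mem_sup_right (Submodule.subset_span ⟨i, j, hij, rfl⟩)
    have m3 : bv i ⊗ₜ[Kq] bv j ∈ extRel n ⊔ symRel n := by
      have := Submodule.smul_mem _ (qnum 2)⁻¹ (add_mem m1 m2)
      rwa [add_add_sub_cancel, ← add_smul, add_comm qpar⁻¹, ← qnum_two, smul_smul,
        inv_mul_cancel₀ h2, one_smul] at this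
    refine ⟨m3, ?_⟩
    have := sub_mem m1 (Submodule.smul_mem _ qpar⁻¹ m3)
    rwa [add_sub_cancel_left] at this
  have h : (extRel n ⊔ symRel n).mkQ = 0 := by
    refine TensorProduct.ext (vec_ext fun i => vec_ext fun j => ?_)
    refine (Submodule.Quotient.mk_eq_zero _).mpr ?_
    rcases lt_trichotomy i j with h | rfl | h
    · exact (key i j h).1
    · exact Submodule.mem_sup_left (Submodule.subset_span (Or.inl ⟨i, rfl⟩))
    · exact (key j i h).2
  rw [← Submodule.ker_mkQ (extRel n ⊔ symRel n), h, LinearMap.ker_zero]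

lemma qRel_sup (s : Bool) : qRel n s ⊔ qRel n (!s) = ⊤ := by
  cases s
  · exact extRel_sup_symRel
  · exact sup_comm (extRel n) (symRel n) ▸ extRel_sup_symRel

lemma muV_equivariant (s : Bool) (u : Uq n) :
    muV s n ∘ₗ (vecSq n).ρ u = (vecSq n).ρ u ∘ₗ muV s n := by
  have h : qRel n s ⊔ qRel n (!s) ≤
      LinearMap.ker (muV s n ∘ₗ (vecSq n).ρ u - (vecSq n).ρ u ∘ₗ muV s n) := by
    refine sup_le (fun r hr => ?_) fun r hr => ?_
    · rw [LinearMap.mem_ker, LinearMap.sub_apply, LinearMap.comp_apply, LinearMap.comp_apply,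
        muV_qRel s hr, muV_qRel s (qRel_stable s u hr), map_zero, sub_zero]
    · rw [LinearMap.mem_ker, LinearMap.sub_apply, LinearMap.comp_apply, LinearMap.comp_apply,
        muV_qRel_not s hr, muV_qRel_not s (qRel_stable (!s) u hr), map_smul, sub_self]
  rw [qRel_sup] at h
  exact sub_eq_zero.mp (LinearMap.ext fun x => h (Submodule.mem_top (x := x)))

/-- The split after the merge of two thin strands. -/
noncomputable def muM (s : Bool) (n : ℕ) : vecSq n ⟶ vecSq n := ⟨muV s n, muV_equivariant s⟩

/-- The identification of the vector representation with the power of degree one. -/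
noncomputable def thin (s : Bool) (n : ℕ) : vecRep n ⟶ qPow n s 1 :=
  (λ_ (vecRep n)).inv ≫ qProj s 1

lemma thin_bv (s : Bool) (k : Fin n) : AlgRep.lin (thin s n) (bv k) = qth s k := rfl

lemma thin_surjective (s : Bool) (n : ℕ) : Function.Surjective (AlgRep.lin (thin s n)) := by
  rw [← LinearMap.range_eq_top, eq_top_iff, ← span_std, Submodule.span_le]
  rintro _ ⟨w, -, rfl⟩
  refine ⟨bv (w 0), (thin_bv s _).trans (congrArg (qVec s) (funext fun i => ?_))⟩
  rw [Subsingleton.elim i 0]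

lemma fmu_smul_qth (s : Bool) (l j : Fin n) : qCom s 1 1 (qMulB s 1 1 (qth s l) (qth s j)) =
    fmu s l j • (qth s l ⊗ₜ[Kq] qth s j) +
      (if l = j then 0 else eps s) • (qth s j ⊗ₜ[Kq] qth s l) := by
  have hg : Good s ({l} : Multiset (Fin n)) := fun _ => Multiset.nodup_singleton l
  have hr : ∀ i, remR s i (ee ({l} : Multiset (Fin n))) = if i = l then ee 0 else 0 := by
    intro i
    rw [remR_ee s i hg]
    split_ifs with h
    · subst h
      rw [rcoef, ← Multiset.cons_zero, cntLt_cons, cntGt_cons]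
      simp [qnum_one]
    · rw [rcoef, Multiset.count_singleton, if_neg h]
      simp [qnum_zero]
  have hu : ∀ i, unf s 1 (ee ({i} : Multiset (Fin n))) = qth s i := fun i => by
    rw [← nf_qth s, unf_nf_apply]
  rw [qCom_thin_right, nf_qMulB_right, nf_qth]
  have h : ∀ i, unf s 1 (remR s i (mulR s j (ee ({l} : Multiset (Fin n))))) ⊗ₜ[Kq] qth s i =
      (if i = j then fmu s l j • (qth s l ⊗ₜ[Kq] qth s j) else 0) +
      (if i = l then (if l = j then 0 else eps s) • (qth s j ⊗ₜ[Kq] qth s l) else 0) := by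
    intro i
    by_cases hij : i = j
    · subst hij
      rw [if_pos rfl, remR_mulR_self s i hg (Multiset.singleton_ne_zero l)]
      simp only [hr, Multiset.card_singleton, Nat.cast_one, sub_self, qnum_zero, zero_smul, sub_zero]
      rw [Finset.sum_eq_single l]
      · rw [if_pos rfl, mulR_ee_zero, map_smul, hu, smul_tmul']
        by_cases hil : i = l
        · subst hil; simp
        · simp [hil]
      · intro b _ hb
        rw [if_neg hb, map_zero, smul_zero]
      · intro h
        exact absurd (Finset.mem_univ _) h
    · rw [remR_mulR_of_ne s hij hg, hr, if_neg hij, zero_add]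
      by_cases hil : i = l
      · subst hil
        rw [if_pos rfl, if_pos rfl, if_neg hij, mulR_ee_zero, map_smul, hu, smul_tmul']
      · rw [if_neg hil, if_neg hil, map_zero, smul_zero, map_zero, zero_tmul]
  rw [Finset.sum_congr rfl fun i _ => h i, Finset.sum_add_distrib]
  simp

lemma qCom_qMul_thin (s : Bool) : (qCom s 1 1 ∘ₗ (qMul s 1 1).1) ∘ₗ (thin s n ⊗ₘ thin s n).1 =
    (thin s n ⊗ₘ thin s n).1 ∘ₗ muV s n := by
  refine TensorProduct.ext (vec_ext fun l => vec_ext fun j => ?_)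
  change qCom s 1 1 (qMulB s 1 1 (qth s l) (qth s j)) =
    (thin s n ⊗ₘ thin s n).1 (muV s n (bv l ⊗ₜ[Kq] bv j))
  rw [fmu_smul_qth, muV_bv, map_add, map_smul, map_smul]
  rfl

/-- Equivariance of a linear map. -/
def Equivar {M N : AlgRep Kq (Uq n)} (f : M.V →ₗ[Kq] N.V) : Prop := ∀ u, f ∘ₗ M.ρ u = N.ρ u ∘ₗ f

lemma Equivar.of_surjective {M N L : AlgRep Kq (Uq n)} {p : M ⟶ N}
    (hp : Function.Surjective (AlgRep.lin p)) {f : N.V →ₗ[Kq] L.V}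
    (h : Equivar (M := M) (N := L) (f ∘ₗ p.1)) : Equivar (M := N) (N := L) f := by
  intro u
  refine (LinearMap.cancel_right hp).mp ?_
  rw [LinearMap.comp_assoc, ← p.2 u, ← LinearMap.comp_assoc, h u, LinearMap.comp_assoc]

lemma Equivar.of_injective {M N L : AlgRep Kq (Uq n)} {p : N ⟶ L}
    (hp : Function.Injective (AlgRep.lin p)) {f : M.V →ₗ[Kq] N.V}
    (h : Equivar (M := M) (N := L) (p.1 ∘ₗ f)) : Equivar (M := M) (N := N) f := by
  intro u
  refine (LinearMap.cancel_left hp).mp ?_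
  rw [← LinearMap.comp_assoc]
  refine (h u).trans ?_
  rw [← LinearMap.comp_assoc]
  exact congrArg (· ∘ₗ f) (p.2 u).symm

lemma map_thin_surjective (s : Bool) :
    Function.Surjective (AlgRep.lin (thin s n ⊗ₘ thin s n)) :=
  TensorProduct.map_surjective (thin_surjective s n) (thin_surjective s n)

lemma qCom_one_one_equivar (s : Bool) :
    Equivar (M := qPow n s (1 + 1)) (N := qPow n s 1 ⊗ qPow n s 1) (qCom s 1 1) := by
  refine Equivar.of_surjective (p := qMul s 1 1) (qMul_thin_surjective s 1) ?_
  refine Equivar.of_surjective (map_thin_surjective s) ?_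
  rw [qCom_qMul_thin]
  exact (muM s n ≫ (thin s n ⊗ₘ thin s n)).2

/-- The split morphism of a pair of thin strands. -/
noncomputable def qComOne (s : Bool) (n : ℕ) : qPow n s (1 + 1) ⟶ qPow n s 1 ⊗ qPow n s 1 :=
  ⟨qCom s 1 1, qCom_one_one_equivar s⟩

/-- The composition of a merge and a split of a thin strand on the right, in terms of the opposite
composition. -/
lemma qCom_qMul_right (s : Bool) (a : ℕ) (x : (qPow n s (a + 1)).V) (y : (qPow n s 1).V) :
    qCom s (a + 1) 1 (qMulB s (a + 1) 1 x y) =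
      TensorProduct.map (qMul s a 1).1 LinearMap.id
        ((TensorProduct.assoc Kq _ _ _).symm
          (TensorProduct.map LinearMap.id (qCom s 1 1 ∘ₗ (qMul s 1 1).1)
            (TensorProduct.assoc Kq _ _ _ (qCom s a 1 x ⊗ₜ y)))) -
        qnum a • (x ⊗ₜ[Kq] y) := by
  let f : (qPow n s 1).V →ₗ[Kq] (qPow n s (a + 1)).V →ₗ[Kq]
      (qPow n s (a + 1) ⊗ qPow n s 1 : AlgRep Kq (Uq n)).V :=
    ((qMulB s (a + 1) 1).compr₂ (qCom s (a + 1) 1)).flip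
  let L : (qPow n s (a + 1)).V ⊗[Kq] (qPow n s 1).V →ₗ[Kq]
      (qPow n s (a + 1)).V ⊗[Kq] (qPow n s 1).V :=
    TensorProduct.map (qMul s a 1).1 LinearMap.id ∘ₗ
      (TensorProduct.assoc Kq _ _ _).symm.toLinearMap ∘ₗ
      TensorProduct.map LinearMap.id (qCom s 1 1 ∘ₗ (qMul s 1 1).1) ∘ₗ
      (TensorProduct.assoc Kq _ _ _).toLinearMap ∘ₗ
      TensorProduct.map (qCom s a 1) LinearMap.id - (qnum a • LinearMap.id)
  let g : (qPow n s 1).V →ₗ[Kq] (qPow n s (a + 1)).V →ₗ[Kq]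
      (qPow n s (a + 1) ⊗ qPow n s 1 : AlgRep Kq (Uq n)).V :=
    ((TensorProduct.mk Kq (qPow n s (a + 1)).V (qPow n s 1).V).compr₂ L).flip
  suffices h : f = g from LinearMap.congr_fun (LinearMap.congr_fun h y) x
  refine qth_ext fun j => qPow_std_ext fun w hw => ?_
  change qCom s (a + 1) 1 (qMulB s (a + 1) 1 (qVec s w) (qth s j)) =
    TensorProduct.map (qMul s a 1).1 LinearMap.id
        ((TensorProduct.assoc Kq _ _ _).symm
          (TensorProduct.map LinearMap.id (qCom s 1 1 ∘ₗ (qMul s 1 1).1)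
            (TensorProduct.assoc Kq _ _ _ (qCom s a 1 (qVec s w) ⊗ₜ qth s j)))) -
        qnum a • (qVec s w ⊗ₜ[Kq] qth s j)
  set U : Fin n → (qPow n s a).V := fun i => unf s a (remR s i (nf s (a + 1) (qVec s w))) with hU
  have hgood := good_cont hw
  have hUm : ∀ i j, unf s (a + 1) (mulR s j (remR s i (ee (cont w)))) =
      qMulB s a 1 (U i) (qth s j) := by
    intro i j
    rw [← nf_qVec hw, ← nf_unf_remR, ← nf_qMulB_right, unf_nf_apply]
  have hne : cont w ≠ 0 := by
    intro h
    have := card_cont w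
    rw [h] at this
    simp at this
  have h1 : ∀ i, unf s (a + 1) (remR s i (mulR s j (ee (cont w)))) ⊗ₜ[Kq] qth s i =
      (if i = j then ((∑ l, fmu s l j • qMulB s a 1 (U l) (qth s l)) - qnum a • qVec s w) ⊗ₜ[Kq]
        qth s j else 0) +
      (if i = j then 0 else eps s) • (qMulB s a 1 (U i) (qth s j) ⊗ₜ[Kq] qth s i) := by
    intro i
    by_cases hij : i = j
    · subst hij
      rw [if_pos rfl, if_pos rfl, zero_smul, add_zero, remR_mulR_self s i hgood hne, map_sub,
        map_sum, map_smul, unf_ee_cont hw, card_cont]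
      simp only [map_smul, hUm]
      congr 4
      push_cast
      ring_nf
    · rw [if_neg hij, if_neg hij, zero_add, remR_mulR_of_ne s hij hgood, map_smul, hUm,
        smul_tmul']
  have h2 : ∀ l, TensorProduct.map (qMul s a 1).1 LinearMap.id
        ((TensorProduct.assoc Kq _ _ _).symm
          (TensorProduct.map LinearMap.id (qCom s 1 1 ∘ₗ (qMul s 1 1).1)
            (TensorProduct.assoc Kq _ _ _ ((U l ⊗ₜ[Kq] qth s l) ⊗ₜ qth s j)))) =
      fmu s l j • (qMulB s a 1 (U l) (qth s l) ⊗ₜ[Kq] qth s j) +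
      (if l = j then 0 else eps s) • (qMulB s a 1 (U l) (qth s j) ⊗ₜ[Kq] qth s l) := by
    intro l
    rw [TensorProduct.assoc_tmul, TensorProduct.map_tmul]
    have := fmu_smul_qth s l j
    rw [LinearMap.comp_apply]
    erw [this]
    simp only [tmul_add, tmul_smul, map_add, map_smul, LinearMap.id_apply]
    rfl
  rw [qCom_thin_right, nf_qMulB_right, nf_qVec hw, Finset.sum_congr rfl fun i _ => h1 i,
    Finset.sum_add_distrib, Finset.sum_ite_eq' Finset.univ j, if_pos (Finset.mem_univ j),
    qCom_thin_right, TensorProduct.sum_tmul, map_sum, map_sum, map_sum, map_sum,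
    Finset.sum_congr rfl fun i _ => h2 i, Finset.sum_add_distrib, TensorProduct.sub_tmul,
    TensorProduct.sum_tmul]
  simp only [smul_tmul']
  abel

lemma qCom_thin_equivar (s : Bool) : ∀ a : ℕ,
    Equivar (M := qPow n s (a + 1 + 1)) (N := qPow n s (a + 1) ⊗ qPow n s 1) (qCom s (a + 1) 1)
  | 0 => qCom_one_one_equivar s
  | a + 1 => by
    refine Equivar.of_surjective (p := qMul s (a + 1 + 1) 1) (qMul_thin_surjective s _) ?_
    let D : qPow n s (a + 1 + 1) ⟶ qPow n s (a + 1) ⊗ qPow n s 1 := ⟨_, qCom_thin_equivar s a⟩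
    have h : qCom s (a + 1 + 1) 1 ∘ₗ (qMul s (a + 1 + 1) 1).1 =
        ((D ▷ qPow n s 1) ≫ (α_ _ _ _).hom ≫ (qPow n s (a + 1) ◁ (qMul s 1 1 ≫ qComOne s n)) ≫
          (α_ _ _ _).inv ≫ (qMul s (a + 1) 1 ▷ qPow n s 1) - qnum ((a + 1 : ℕ) : ℤ) • 𝟙 _).1 :=
      TensorProduct.ext' fun x y => qCom_qMul_right s (a + 1) x y
    rw [h]
    exact Subtype.property _

/-- The split of a thin strand on the right is injective. -/
lemma qCom_thin_injective (s : Bool) (a : ℕ) : Function.Injective (qCom (n := n) s a 1) := by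
  intro x y h
  have := congrArg (AlgRep.lin (qMul s a 1)) h
  rw [qMul_qCom_right, qMul_qCom_right] at this
  exact smul_right_injective _ (qnum_ne_zero (Nat.succ_ne_zero a)) this

lemma qCom_equivar (s : Bool) (a : ℕ) : ∀ b : ℕ,
    Equivar (M := qPow n s (a + 1 + (b + 1))) (N := qPow n s (a + 1) ⊗ qPow n s (b + 1))
      (qCom s (a + 1) (b + 1))
  | 0 => qCom_thin_equivar s a
  | b + 1 => by
    let D : qPow n s (b + 1 + 1) ⟶ qPow n s (b + 1) ⊗ qPow n s 1 := ⟨_, qCom_thin_equivar s b⟩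
    have hD : Function.Injective (AlgRep.lin (qPow n s (a + 1) ◁ D)) :=
      Module.Flat.lTensor_preserves_injective_linearMap (M := (qPow n s (a + 1)).V) _
        (qCom_thin_injective s (b + 1))
    refine Equivar.of_injective hD ?_
    let D1 : qPow n s (a + 1 + (b + 1) + 1) ⟶ qPow n s (a + 1 + (b + 1)) ⊗ qPow n s 1 :=
      ⟨_, qCom_thin_equivar s (a + 1 + b)⟩
    let D2 : qPow n s (a + 1 + (b + 1)) ⟶ qPow n s (a + 1) ⊗ qPow n s (b + 1) :=
      ⟨_, qCom_equivar s a b⟩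
    have h : (qPow n s (a + 1) ◁ D).1 ∘ₗ qCom s (a + 1) (b + 1 + 1) =
        (D1 ≫ (D2 ▷ qPow n s 1) ≫ (α_ _ _ _).hom).1 := LinearMap.ext fun x =>
      (qCom_coassoc s (a := a + 1) (b := b + 1) (c := 1) (x := x) (x' := x) rfl).symm
    rw [h]
    exact Subtype.property _

/-- The split morphism. -/
noncomputable def qSplit (s : Bool) (a b : ℕ+) :
    qPow n s (a + b : ℕ) ⟶ qPow n s a ⊗ qPow n s b :=
  ⟨qCom s a b, by
    obtain ⟨a, rfl⟩ : ∃ k : ℕ, a = k.succPNat := ⟨a.natPred, (PNat.succPNat_natPred a).symm⟩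
    obtain ⟨b, rfl⟩ : ∃ k : ℕ, b = k.succPNat := ⟨b.natPred, (PNat.succPNat_natPred b).symm⟩
    exact qCom_equivar s a b⟩

end ThinSwitch

section SplitFormula

variable {n : ℕ}

/-- The factor of a pair of positions `u ∈ A`, `v ∉ A` in the coefficients of a split. -/
noncomputable def kap (s : Bool) {N : ℕ} (w : Fin N → Fin n) (u v : Fin N) : Kq :=
  if u < v then qp s else if w u = w v then qpar else eps s

/-- The letters at the positions where `χ` takes the value `b`. -/
def contOn {N : ℕ} (w : Fin N → Fin n) (χ : Fin N → Bool) (b : Bool) : Multiset (Fin n) :=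
  ∑ i, if χ i = b then {w i} else 0

/-- The coefficient of a split of the letters. -/
noncomputable def kapOn (s : Bool) {N : ℕ} (w : Fin N → Fin n) (χ : Fin N → Bool) : Kq :=
  ∏ u, ∏ v, if χ u = true ∧ χ v = false then kap s w u v else 1

lemma sum_singleton_map {N : ℕ} (w : Fin N → Fin n) (S : Finset (Fin N)) :
    ∑ i ∈ S, ({w i} : Multiset (Fin n)) = S.val.map w := by
  induction S using Finset.induction_on with
  | empty => rfl
  | insert a S ha ih =>
    rw [Finset.sum_insert ha, ih, Finset.insert_val_of_notMem ha, Multiset.map_cons,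
      Multiset.singleton_add]

lemma contOn_add {N : ℕ} (w : Fin N → Fin n) (χ : Fin N → Bool) :
    contOn w χ true + contOn w χ false = cont w := by
  rw [contOn, contOn, ← Finset.sum_add_distrib, cont]
  rw [Finset.sum_congr rfl (g := fun i => ({w i} : Multiset (Fin n))) fun i _ => by
    cases χ i <;> simp]
  rw [sum_singleton_map]

lemma ccoef_sum (s : Bool) (k : Fin n) {N : ℕ} (f : Fin N → Multiset (Fin n)) :
    ccoef s k (∑ i, f i) = ∏ i, ccoef s k (f i) := by
  have h : ∀ S : Finset (Fin N), ccoef s k (∑ i ∈ S, f i) = ∏ i ∈ S, ccoef s k (f i) := by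
    intro S
    induction S using Finset.induction_on with
    | empty => simp [ccoef]
    | insert a S ha ih => rw [Finset.sum_insert ha, Finset.prod_insert ha, ccoef_add, ih]
  exact h Finset.univ

lemma qp_pow_card (s : Bool) {N : ℕ} (w : Fin N → Fin n) (χ : Fin N → Bool) :
    qp s ^ (contOn w χ true).card = ∏ i, if χ i = true then qp s else 1 := by
  rw [contOn, Multiset.card_sum, ← Finset.prod_pow_eq_pow_sum]
  refine Finset.prod_congr rfl fun i _ => ?_
  split_ifs <;> simp

lemma comulF_cont {s : Bool} : ∀ {N : ℕ} {w : Fin N → Fin n} (_ : Std s w),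
    comulF s (ee (cont w)) =
      ∑ χ : Fin N → Bool, kapOn s w χ • (ee (contOn w χ true) ⊗ₜ[Kq] ee (contOn w χ false))
  | 0, w, _ => by
    rw [cont_zero, comulF_zero, Fintype.sum_unique]
    simp [kapOn, contOn]
  | N + 1, w, hw => by
    obtain ⟨h1, h2⟩ := std_succ.mp hw
    rw [cont_succ, comulF_cons s (fun x hx => (h2 x hx).1), comulF_cont h1, map_sum]
    have hmul : ∀ (χ : Fin N → Bool) (b : Bool),
        mulR s (w (Fin.last N)) (ee (contOn (Fin.init w) χ b)) =
          ee (w (Fin.last N) ::ₘ contOn (Fin.init w) χ b) := by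
      intro χ b
      have hle : ∀ x ∈ contOn (Fin.init w) χ b, x ∈ cont (Fin.init w) := by
        intro x hx
        rw [← contOn_add (Fin.init w) χ, Multiset.mem_add]
        cases b
        · exact Or.inr hx
        · exact Or.inl hx
      exact mulR_ee_max (fun x hx => (h2 x (hle x hx)).1) fun h => (h2 _ (hle _ h.2)).2 h.1 rfl
    have hc : ∀ (χ : Fin N → Bool) (b b' : Bool), contOn w (Fin.snoc (α := fun _ => Bool) χ b') b =
        (if b' = b then {w (Fin.last N)} else 0) + contOn (Fin.init w) χ b := by
      intro χ b b'
      rw [contOn, Fin.sum_univ_castSucc, add_comm]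
      simp only [Fin.snoc_castSucc, Fin.snoc_last]
      rfl
    have hk : ∀ (χ : Fin N → Bool), kapOn s w (Fin.snoc (α := fun _ => Bool) χ false) =
        kapOn s (Fin.init w) χ * qp s ^ (contOn (Fin.init w) χ true).card := by
      intro χ
      rw [kapOn, Fin.prod_univ_castSucc]
      simp only [Fin.snoc_last, Fin.snoc_castSucc, Fin.prod_univ_castSucc, Bool.false_eq_true,
        false_and, if_false, Finset.prod_const_one, mul_one, Finset.prod_mul_distrib, and_true]
      rw [qp_pow_card]
      congr 1
      refine Finset.prod_congr rfl fun i _ => ?_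
      rw [kap, if_pos (Fin.castSucc_lt_last i)]
    have hk' : ∀ (χ : Fin N → Bool), kapOn s w (Fin.snoc (α := fun _ => Bool) χ true) =
        kapOn s (Fin.init w) χ * ccoef s (w (Fin.last N)) (contOn (Fin.init w) χ false) := by
      intro χ
      rw [kapOn, Fin.prod_univ_castSucc]
      simp only [Fin.snoc_last, Fin.snoc_castSucc, Fin.prod_univ_castSucc, Bool.true_eq_false,
        and_false, if_false, Finset.prod_const_one, mul_one, true_and]
      rw [contOn, ccoef_sum]
      congr 1
      refine Finset.prod_congr rfl fun i _ => ?_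
      rw [kap, if_neg (Fin.castSucc_lt_last i).not_gt]
      by_cases hi : χ i = false
      · rw [if_pos hi, if_pos hi, ccoef, Multiset.map_singleton, Multiset.prod_singleton]
        by_cases h : w (Fin.last N) = w i.castSucc
        · rw [if_pos h, if_pos (show Fin.init w i = w (Fin.last N) from h.symm)]
        · rw [if_neg h, if_neg (show Fin.init w i ≠ w (Fin.last N) from fun h' => h h'.symm)]
      · rw [if_neg hi, if_neg hi, ccoef, Multiset.map_zero, Multiset.prod_zero]
    rw [← (Fin.snocEquiv fun _ => Bool).sum_comp, Fintype.sum_prod_type, Fintype.sum_bool,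
      ← Finset.sum_add_distrib]
    refine Finset.sum_congr rfl fun χ _ => ?_
    rw [map_smul, stepT_tmul, hmul, hmul]
    change _ = kapOn s w (Fin.snoc (α := fun _ => Bool) χ true) •
        (ee (contOn w (Fin.snoc (α := fun _ => Bool) χ true) true) ⊗ₜ[Kq]
          ee (contOn w (Fin.snoc (α := fun _ => Bool) χ true) false)) +
      kapOn s w (Fin.snoc (α := fun _ => Bool) χ false) •
        (ee (contOn w (Fin.snoc (α := fun _ => Bool) χ false) true) ⊗ₜ[Kq]
          ee (contOn w (Fin.snoc (α := fun _ => Bool) χ false) false))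
    rw [hk, hk', hc, hc, hc, hc, if_pos rfl, if_pos rfl, if_neg (by simp), if_neg (by simp),
      zero_add, zero_add, Multiset.singleton_add, Multiset.singleton_add, smul_add, smul_smul,
      smul_smul, add_comm]

/-- The coefficients of the splits of the symmetric and exterior powers. -/
noncomputable def qCoef (s : Bool) (a b : ℕ) (w : Fin (a + b) → Fin n)
    (A : Finset (Fin (a + b))) : Kq :=
  match s with
  | false => (-1) ^ (invPairs A).card * qpar ^ ((a : ℤ) * b - (invPairs A).card)
  | true => qpar ^ (((invPairs A).card : ℤ) - a * b +
      ((invPairs A).filter fun p => w p.1 = w p.2).card)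

lemma prod_kap {s : Bool} {a b : ℕ} {w : Fin (a + b) → Fin n} (hw : Std s w)
    {A : Finset (Fin (a + b))} (hA : A.card = a) :
    ∏ u ∈ A, ∏ v ∈ Aᶜ, kap s w u v = qCoef s a b w A := by
  have h0 := qpar_ne_zero
  rw [← Finset.prod_product', ← Finset.prod_filter_mul_prod_filter_not _ fun p => p.2 < p.1]
  have hcard : (invPairs A).card + ((A ×ˢ Aᶜ).filter fun p => ¬ p.2 < p.1).card = a * b := by
    rw [invPairs, Finset.card_filter_add_card_filter_not, Finset.card_product, hA, card_compl' hA]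
  have h1 : ∏ p ∈ (A ×ˢ Aᶜ).filter (fun p => ¬ p.2 < p.1), kap s w p.1 p.2 =
      qp s ^ ((A ×ˢ Aᶜ).filter fun p => ¬ p.2 < p.1).card := by
    rw [Finset.prod_congr rfl (g := fun _ => qp s), Finset.prod_const]
    intro p hp
    rw [Finset.mem_filter, Finset.mem_product, Finset.mem_compl] at hp
    rw [kap, if_pos]
    refine lt_of_le_of_ne (not_lt.mp hp.2) ?_
    intro h
    exact hp.1.2 (h ▸ hp.1.1)
  have h2 : ∏ p ∈ (A ×ˢ Aᶜ).filter (fun p => p.2 < p.1), kap s w p.1 p.2 =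
      ∏ p ∈ invPairs A, if w p.1 = w p.2 then qpar else eps s := by
    refine Finset.prod_congr rfl fun p hp => ?_
    rw [kap, if_neg (Finset.mem_filter.mp hp).2.not_gt]
  rw [h1, h2]
  cases s with
  | false =>
    have h3 : ∏ p ∈ invPairs A, (if w p.1 = w p.2 then qpar else eps false) =
        (-1) ^ (invPairs A).card := by
      rw [Finset.prod_congr rfl (g := fun _ => (-1 : Kq)), Finset.prod_const]
      intro p hp
      have hp' := (Finset.mem_filter.mp hp).2
      rw [if_neg fun h => hp'.ne' (StrictMono.injective hw h)]
      rfl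
    rw [h3, qCoef]
    congr 1
    rw [← zpow_natCast]
    simp only [qp, Bool.false_eq_true, if_false]
    congr 1
    have : ((invPairs A).card : ℤ) + ((A ×ˢ Aᶜ).filter fun p => ¬ p.2 < p.1).card = a * b := by
      exact_mod_cast hcard
    linarith
  | true =>
    rw [Finset.prod_ite, Finset.prod_const, qCoef]
    simp only [eps, if_true, Finset.prod_const_one, mul_one, qp]
    rw [inv_pow, ← zpow_natCast, ← zpow_natCast, ← zpow_neg, ← zpow_add₀ h0]
    congr 1
    have : ((invPairs A).card : ℤ) + ((A ×ˢ Aᶜ).filter fun p => ¬ p.2 < p.1).card = a * b := by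
      exact_mod_cast hcard
    linarith

lemma std_pick {s : Bool} {N a : ℕ} {w : Fin N → Fin n} (hw : Std s w) (A : Finset (Fin N))
    (h : A.card = a) : Std s (pick w A h) := by
  cases s
  · exact StrictMono.comp hw (A.orderEmbOfFin h).strictMono
  · exact Monotone.comp hw (A.orderEmbOfFin h).monotone

lemma cont_pick {N a : ℕ} (w : Fin N → Fin n) (A : Finset (Fin N)) (h : A.card = a) :
    cont (pick w A h) = A.val.map w := by
  rw [cont, pick, ← Multiset.map_map]
  congr 1
  have := congrArg Finset.val (Finset.map_orderEmbOfFin_univ A h)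
  exact this

/-- The indicator function of a set of positions. -/
def setEquiv (N : ℕ) : Finset (Fin N) ≃ (Fin N → Bool) where
  toFun A := fun i => decide (i ∈ A)
  invFun χ := Finset.univ.filter fun i => χ i = true
  left_inv A := by ext; simp
  right_inv χ := by funext i; simp

lemma contOn_set {N : ℕ} (w : Fin N → Fin n) (A : Finset (Fin N)) :
    contOn w (setEquiv N A) true = A.val.map w ∧ contOn w (setEquiv N A) false = Aᶜ.val.map w := by
  have h : ∀ B : Finset (Fin N), (∑ i, if i ∈ B then ({w i} : Multiset (Fin n)) else 0) =
      B.val.map w := fun B => by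
    rw [← Finset.sum_filter, Finset.filter_mem_eq_inter, Finset.univ_inter]
    exact sum_singleton_map w B
  refine ⟨(Finset.sum_congr rfl fun i _ => ?_).trans (h A),
    (Finset.sum_congr rfl fun i _ => ?_).trans (h Aᶜ)⟩
  · simp [setEquiv]
  · simp [setEquiv]

lemma kapOn_set (s : Bool) {N : ℕ} (w : Fin N → Fin n) (A : Finset (Fin N)) :
    kapOn s w (setEquiv N A) = ∏ u ∈ A, ∏ v ∈ Aᶜ, kap s w u v := by
  rw [kapOn, ← Finset.prod_subset (Finset.subset_univ A)]
  · refine Finset.prod_congr rfl fun u hu => ?_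
    rw [← Finset.prod_subset (Finset.subset_univ Aᶜ)]
    · refine Finset.prod_congr rfl fun v hv => ?_
      rw [Finset.mem_compl] at hv
      rw [if_pos]
      simp [setEquiv, hu, hv]
    · intro v _ hv
      rw [Finset.mem_compl, not_not] at hv
      rw [if_neg]
      simp [setEquiv, hv]
  · intro u _ hu
    refine Finset.prod_eq_one fun v _ => ?_
    rw [if_neg]
    simp [setEquiv, hu]

lemma qCom_qVec {s : Bool} {a b : ℕ} {w : Fin (a + b) → Fin n} (hw : Std s w) :
    qCom s a b (qVec s w) = ∑ A : {A : Finset (Fin (a + b)) // A.card = a}, qCoef s a b w A.1 •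
      (qVec s (pick w A.1 A.2) ⊗ₜ[Kq] qVec s (pick w A.1ᶜ (card_compl' A.2))) := by
  rw [qCom_apply, nf_qVec hw, comulF_cont hw, map_sum, ← (setEquiv _).sum_comp,
    ← Finset.sum_filter_add_sum_filter_not _ fun A => A.card = a]
  have hz : ∑ A ∈ Finset.univ.filter (fun A : Finset (Fin (a + b)) => ¬ A.card = a),
      TensorProduct.map (unf s a) (unf s b) (kapOn s w (setEquiv _ A) •
        (ee (contOn w (setEquiv _ A) true) ⊗ₜ[Kq] ee (contOn w (setEquiv _ A) false))) = 0 := by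
    refine Finset.sum_eq_zero fun A hA => ?_
    rw [map_smul, TensorProduct.map_tmul, (contOn_set w A).1,
      unf_ee_of_card_ne (a := a) (m := A.val.map w), zero_tmul, smul_zero]
    rw [Multiset.card_map]
    exact (Finset.mem_filter.mp hA).2
  rw [hz, add_zero]
  have hsub : ∀ f : Finset (Fin (a + b)) → (qPow n s a ⊗ qPow n s b : AlgRep Kq (Uq n)).V,
      ∑ A ∈ Finset.univ.filter (fun A : Finset (Fin (a + b)) => A.card = a), f A =
        ∑ A : {A : Finset (Fin (a + b)) // A.card = a}, f A.1 := fun f =>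
    Finset.sum_subtype _ (fun A => by simp) f
  refine (hsub _).trans ?_
  refine Finset.sum_congr rfl fun A _ => ?_
  rw [map_smul, TensorProduct.map_tmul, (contOn_set w A.1).1, (contOn_set w A.1).2, kapOn_set,
    prod_kap hw A.2, ← cont_pick w A.1 A.2, ← cont_pick w A.1ᶜ (card_compl' A.2),
    unf_ee_cont (std_pick hw _ _), unf_ee_cont (std_pick hw _ _)]

end SplitFormula

namespace AlgRep

section Bilinear

variable {k : Type} [Field k] {A : Type} [Ring A] [Bialgebra k A]

lemma add_tensor {M M' N N' : AlgRep k A} (f f' : M ⟶ M') (g : N ⟶ N') :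
    (f + f') ⊗ₘ g = f ⊗ₘ g + f' ⊗ₘ g :=
  hom_ext (TensorProduct.ext' fun x y => TensorProduct.add_tmul _ _ _)

lemma tensor_add {M M' N N' : AlgRep k A} (f : M ⟶ M') (g g' : N ⟶ N') :
    f ⊗ₘ (g + g') = f ⊗ₘ g + f ⊗ₘ g' :=
  hom_ext (TensorProduct.ext' fun x y => TensorProduct.tmul_add _ _ _)

lemma smul_tensor {M M' N N' : AlgRep k A} (c : k) (f : M ⟶ M') (g : N ⟶ N') :
    (c • f) ⊗ₘ g = c • (f ⊗ₘ g) :=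
  hom_ext (TensorProduct.ext' fun x y => (TensorProduct.smul_tmul' _ _ _).symm)

lemma tensor_smul {M M' N N' : AlgRep k A} (c : k) (f : M ⟶ M') (g : N ⟶ N') :
    f ⊗ₘ (c • g) = c • (f ⊗ₘ g) :=
  hom_ext (TensorProduct.ext' fun x y => TensorProduct.tmul_smul _ _ _)

end Bilinear

end AlgRep

lemma LinFunctorOn.ext_map {C : Type} [Category.{0} C] [Preadditive C] [Linear Kq C]
    {D : Type 1} [Category.{0} D] [Preadditive D] [Linear Kq D] {obj : C → D}
    {F G : LinFunctorOn obj} (h : ∀ (X Y : C) (f : X ⟶ Y), F.map f = G.map f) : F = G := by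
  obtain ⟨F, hF, hF'⟩ := F
  obtain ⟨G, hG, hG'⟩ := G
  have : @F = @G := by
    funext X Y
    exact LinearMap.ext fun f => h X Y f
  subst this
  rfl

lemma LinFunctorOn.map_zero_hom {C : Type} [Category.{0} C] [Preadditive C] [Linear Kq C]
    {D : Type 1} [Category.{0} D] [Preadditive D] [Linear Kq D] {obj : C → D}
    (F : LinFunctorOn obj) (X Y : C) : F.map (0 : X ⟶ Y) = 0 := map_zero _

section Evaluation

variable {n : ℕ} (P : ℕ → AlgRep Kq (Uq n))

/-- The identification of the values of equal objects. -/
noncomputable def seqCast {X Y : List ℕ+} (h : X = Y) : seqObj P X ⟶ seqObj P Y := eqToHom (congrArg _ h)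

lemma seqCast_comp {X Y Z : List ℕ+} (h : X = Y) (h' : Y = Z) :
    seqCast P h ≫ seqCast P h' = seqCast P (h.trans h') := by
  subst h h'
  exact Category.id_comp _

lemma seqCast_cons (a : ℕ+) {X Y : List ℕ+} (h : X = Y) :
    seqCast P (congrArg (a :: ·) h) = P a ◁ seqCast P h := by
  subst h
  exact (MonoidalCategory.whiskerLeft_id _ _).symm

lemma seqMu_cons (a : ℕ+) (X Y : List ℕ+) : (seqMu P (a :: X) Y).hom =
    (P a ◁ (seqMu P X Y).hom) ≫ (α_ (P a) (seqObj P X) (seqObj P Y)).inv := rfl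

lemma seqMu_nil_left (Y : List ℕ+) : (seqMu P [] Y).hom = (λ_ (seqObj P Y)).inv := rfl

lemma seqMu_assoc : ∀ X Y Z : List ℕ+,
    (seqMu P (X ++ Y) Z).hom ≫ ((seqMu P X Y).hom ▷ seqObj P Z) ≫ (α_ _ _ _).hom =
      seqCast P (List.append_assoc X Y Z) ≫ (seqMu P X (Y ++ Z)).hom ≫
        (seqObj P X ◁ (seqMu P Y Z).hom)
  | [], Y, Z => by
    rw [show seqCast P (List.append_assoc [] Y Z) = 𝟙 _ from rfl, Category.id_comp,
      seqMu_nil_left, seqMu_nil_left]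
    change (seqMu P Y Z).hom ≫ _ = _
    monoidal
  | a :: X, Y, Z => by
    have ih := seqMu_assoc X Y Z
    have hc : seqCast P (List.append_assoc (a :: X) Y Z) =
        P a ◁ seqCast P (List.append_assoc X Y Z) := seqCast_cons P a _
    rw [hc, seqMu_cons, seqMu_cons]
    change (P a ◁ (seqMu P (X ++ Y) Z).hom ≫ (α_ (P a) (seqObj P (X ++ Y)) (seqObj P Z)).inv) ≫
      ((P a ◁ (seqMu P X Y).hom ≫ (α_ (P a) (seqObj P X) (seqObj P Y)).inv) ▷ seqObj P Z) ≫
        (α_ (P a ⊗ seqObj P X) (seqObj P Y) (seqObj P Z)).hom =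
      P a ◁ seqCast P _ ≫ (P a ◁ (seqMu P X (Y ++ Z)).hom ≫
        (α_ (P a) (seqObj P X) (seqObj P (Y ++ Z))).inv) ≫
        ((P a ⊗ seqObj P X) ◁ (seqMu P Y Z).hom)
    have e1 : (P a ◁ (seqMu P (X ++ Y) Z).hom ≫ (α_ (P a) (seqObj P (X ++ Y)) (seqObj P Z)).inv) ≫
      ((P a ◁ (seqMu P X Y).hom ≫ (α_ (P a) (seqObj P X) (seqObj P Y)).inv) ▷ seqObj P Z) ≫
        (α_ (P a ⊗ seqObj P X) (seqObj P Y) (seqObj P Z)).hom =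
      P a ◁ ((seqMu P (X ++ Y) Z).hom ≫ ((seqMu P X Y).hom ▷ seqObj P Z) ≫ (α_ _ _ _).hom) ≫
        (α_ (P a) (seqObj P X) (seqObj P Y ⊗ seqObj P Z)).inv := by monoidal
    rw [e1, ih]
    monoidal

lemma seqMu_nil_right : ∀ X : List ℕ+,
    (seqMu P X []).hom ≫ (ρ_ (seqObj P X)).hom = seqCast P (List.append_nil X)
  | [] => by
    rw [seqMu_nil_left]
    change (λ_ (𝟙_ _)).inv ≫ (ρ_ (𝟙_ _)).hom = 𝟙 _
    monoidal
  | a :: X => by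
    have ih := seqMu_nil_right X
    have hc : seqCast P (List.append_nil (a :: X)) =
        P a ◁ seqCast P (List.append_nil X) := seqCast_cons P a _
    rw [hc, ← ih, seqMu_cons]
    change (P a ◁ (seqMu P X []).hom ≫ (α_ (P a) (seqObj P X) (𝟙_ _)).inv) ≫
      (ρ_ (P a ⊗ seqObj P X)).hom = P a ◁ ((seqMu P X []).hom ≫ (ρ_ (seqObj P X)).hom)
    monoidal

/-- The tensor product of morphisms between the values of sequences. -/
noncomputable def seqTens {X Y X' Y' : List ℕ+} (f : seqObj P X ⟶ seqObj P Y)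
    (g : seqObj P X' ⟶ seqObj P Y') : seqObj P (X ++ X') ⟶ seqObj P (Y ++ Y') :=
  (seqMu P X X').hom ≫ (f ⊗ₘ g) ≫ (seqMu P Y Y').inv

lemma seqTens_id (X Y : List ℕ+) : seqTens P (𝟙 (seqObj P X)) (𝟙 (seqObj P Y)) = 𝟙 _ := by
  rw [seqTens, MonoidalCategory.id_tensorHom_id, Category.id_comp, Iso.hom_inv_id]

lemma seqTens_comp {X Y Z X' Y' Z' : List ℕ+} (f : seqObj P X ⟶ seqObj P Y)
    (g : seqObj P Y ⟶ seqObj P Z) (f' : seqObj P X' ⟶ seqObj P Y')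
    (g' : seqObj P Y' ⟶ seqObj P Z') :
    seqTens P (f ≫ g) (f' ≫ g') = seqTens P f f' ≫ seqTens P g g' := by
  simp only [seqTens, Category.assoc, Iso.inv_hom_id_assoc]
  rw [← MonoidalCategory.tensorHom_comp_tensorHom, Category.assoc]

lemma seqTens_mu {X Y X' Y' : List ℕ+} (f : seqObj P X ⟶ seqObj P Y)
    (g : seqObj P X' ⟶ seqObj P Y') :
    seqTens P f g ≫ (seqMu P Y Y').hom = (seqMu P X X').hom ≫ (f ⊗ₘ g) := by
  simp [seqTens]

lemma seqTens_assoc {X Y X' Y' X'' Y'' : List ℕ+} (f : seqObj P X ⟶ seqObj P Y)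
    (g : seqObj P X' ⟶ seqObj P Y') (h : seqObj P X'' ⟶ seqObj P Y'') :
    seqTens P (seqTens P f g) h ≫ seqCast P (List.append_assoc Y Y' Y'') =
      seqCast P (List.append_assoc X X' X'') ≫ seqTens P f (seqTens P g h) := by
  have hm : ∀ Z : AlgRep Kq (Uq n), ∀ p q : Z ⟶ seqObj P (Y ++ (Y' ++ Y'')),
      p ≫ (seqMu P Y (Y' ++ Y'')).hom ≫ (seqObj P Y ◁ (seqMu P Y' Y'').hom) =
        q ≫ (seqMu P Y (Y' ++ Y'')).hom ≫ (seqObj P Y ◁ (seqMu P Y' Y'').hom) → p = q := by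
    intro Z p q hpq
    exact (cancel_mono _).mp hpq
  apply hm
  rw [Category.assoc, ← seqMu_assoc, ← Category.assoc (seqTens P (seqTens P f g) h), seqTens_mu,
    Category.assoc, Category.assoc, ← Category.assoc (seqTens P f _), seqTens_mu]
  have e1 : (seqTens P f g ⊗ₘ h) ≫ ((seqMu P Y Y').hom ▷ seqObj P Y'') =
      ((seqMu P X X').hom ▷ seqObj P X'') ≫ ((f ⊗ₘ g) ⊗ₘ h) := by
    rw [← MonoidalCategory.tensorHom_id, ← MonoidalCategory.tensorHom_id,
      MonoidalCategory.tensorHom_comp_tensorHom, MonoidalCategory.tensorHom_comp_tensorHom,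
      seqTens_mu, Category.comp_id, Category.id_comp]
  have e2 : (f ⊗ₘ seqTens P g h) ≫ (seqObj P Y ◁ (seqMu P Y' Y'').hom) =
      (seqObj P X ◁ (seqMu P X' X'').hom) ≫ (f ⊗ₘ (g ⊗ₘ h)) := by
    rw [← MonoidalCategory.id_tensorHom, ← MonoidalCategory.id_tensorHom,
      MonoidalCategory.tensorHom_comp_tensorHom, MonoidalCategory.tensorHom_comp_tensorHom,
      seqTens_mu, Category.comp_id, Category.id_comp]
  rw [← Category.assoc (seqTens P f g ⊗ₘ h), e1, Category.assoc, Category.assoc, e2,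
    MonoidalCategory.associator_naturality]
  have := seqMu_assoc P X X' X''
  rw [← Category.assoc (seqCast P _), ← Category.assoc (seqCast P _ ≫ _), Category.assoc (seqCast P _),
    ← this]
  simp only [Category.assoc]

lemma unit_seqTens {X Y : List ℕ+} (f : seqObj P X ⟶ seqObj P Y) :
    seqTens P (𝟙 (seqObj P [])) f = f := by
  change (λ_ (seqObj P X)).inv ≫ (𝟙 (𝟙_ _) ⊗ₘ f) ≫ (λ_ (seqObj P Y)).hom = f
  simp

lemma seqTens_unit {X Y : List ℕ+} (f : seqObj P X ⟶ seqObj P Y) :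
    seqTens P f (𝟙 (seqObj P [])) ≫ seqCast P (List.append_nil Y) =
      seqCast P (List.append_nil X) ≫ f := by
  rw [← seqMu_nil_right, ← seqMu_nil_right]
  refine (Category.assoc (seqTens P f (𝟙 (seqObj P []))) (seqMu P Y []).hom
    (ρ_ (seqObj P Y)).hom).symm.trans ?_
  rw [seqTens_mu]
  change ((seqMu P X []).hom ≫ (f ⊗ₘ 𝟙 (𝟙_ _))) ≫ (ρ_ (seqObj P Y)).hom = _
  have e : (f ⊗ₘ 𝟙 (𝟙_ (AlgRep Kq (Uq n)))) ≫ (ρ_ (seqObj P Y)).hom =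
    (ρ_ (seqObj P X)).hom ≫ f := by simp
  refine (Category.assoc _ _ _).trans ?_
  refine (congrArg ((seqMu P X []).hom ≫ ·) e).trans ?_
  exact (Category.assoc (seqMu P X []).hom (ρ_ (seqObj P X)).hom f).symm

variable (M : ∀ a b : ℕ+, P a ⊗ P b ⟶ P (a + b : ℕ))
  (D : ∀ a b : ℕ+, P (a + b : ℕ) ⟶ P a ⊗ P b)

/-- The merge of the values of sequences. -/
noncomputable def seqMerge (a b : ℕ+) : seqObj P [a, b] ⟶ seqObj P [a + b] :=
  (α_ (P a) (P b) (𝟙_ _)).inv ≫ (M a b ▷ 𝟙_ _)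

/-- The split of the values of sequences. -/
noncomputable def seqSplit (a b : ℕ+) : seqObj P [a + b] ⟶ seqObj P [a, b] :=
  (D a b ▷ 𝟙_ _) ≫ (α_ (P a) (P b) (𝟙_ _)).hom

/-- The value of a formal expression. -/
noncomputable def evWeb : {X Y : List ℕ+} → WebTm X Y → (seqObj P X ⟶ seqObj P Y)
  | _, _, .cast h => seqCast P h
  | _, _, .merge a b => seqMerge P M a b
  | _, _, .split a b => seqSplit P D a b
  | _, _, .comp f g => evWeb f ≫ evWeb g
  | _, _, .tens f g => seqTens P (evWeb f) (evWeb g)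
  | _, _, .zero => 0
  | _, _, .add f g => evWeb f + evWeb g
  | _, _, .smul c f => c • evWeb f

/-- The values of merges and splits satisfy the web relations. -/
structure WebRelations : Prop where
  merge_assoc (a b c : ℕ+) :
    (seqTens P (X := [a, b]) (X' := [c]) (seqMerge P M a b) (𝟙 (seqObj P [c])) ≫
      seqMerge P M (a + b) c) ≫ seqCast P (congrArg (fun x => [x]) (_root_.add_assoc a b c)) =
    seqTens P (X := [a]) (X' := [b, c]) (𝟙 (seqObj P [a])) (seqMerge P M b c) ≫
      seqMerge P M a (b + c)
  split_coassoc (a b c : ℕ+) :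
    seqCast P (congrArg (fun x => [x]) (_root_.add_assoc a b c).symm) ≫ seqSplit P D (a + b) c ≫
      seqTens P (Y := [a, b]) (Y' := [c]) (seqSplit P D a b) (𝟙 (seqObj P [c])) =
    seqSplit P D a (b + c) ≫
      seqTens P (Y := [a]) (Y' := [b, c]) (𝟙 (seqObj P [a])) (seqSplit P D b c)
  square (a b : ℕ) :
    evWeb P M D (WebTm.rungR a (1 + b)) ≫ evWeb P M D (WebTm.rungL a (1 + b)) =
      evWeb P M D (WebTm.rungL (a + 1) b) ≫ evWeb P M D (WebTm.rungR (a + 1) b) +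
        qnum ((a + 1 : ℤ) - (1 + b)) • 𝟙 _
  square_left (a : ℕ) :
    evWeb P M D (WebTm.rungR a 0) ≫ evWeb P M D (WebTm.rungL a 0) =
      qnum ((a + 1 : ℤ) - 0) • 𝟙 _
  square_right (b : ℕ) :
    0 = evWeb P M D (WebTm.rungL 0 b) ≫ evWeb P M D (WebTm.rungR 0 b) +
      qnum ((0 : ℤ) - (1 + b)) • 𝟙 _

variable {P M D}

lemma evWeb_sound (hR : WebRelations P M D) {X Y : List ℕ+} {f g : WebTm X Y}
    (h : WebTm.Rel f g) : evWeb P M D f = evWeb P M D g := by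
  induction h with
  | refl => rfl
  | symm _ ih => exact ih.symm
  | trans _ _ ih ih' => exact ih.trans ih'
  | comp _ _ ih ih' => exact congrArg₂ (· ≫ ·) ih ih'
  | tens _ _ ih ih' => exact congrArg₂ (seqTens P) ih ih'
  | add _ _ ih ih' => exact congrArg₂ (· + ·) ih ih'
  | smul c _ ih => exact congrArg (c • ·) ih
  | add_assoc => exact _root_.add_assoc _ _ _
  | add_comm => exact _root_.add_comm _ _
  | add_zero => exact _root_.add_zero _
  | zero_smul => exact _root_.zero_smul _ _
  | one_smul => exact _root_.one_smul _ _
  | mul_smul => exact SemigroupAction.mul_smul _ _ _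
  | add_smul => exact _root_.add_smul _ _ _
  | smul_add => exact _root_.smul_add _ _ _
  | id_comp => exact Category.id_comp _
  | comp_id => exact Category.comp_id _
  | assoc => exact Category.assoc _ _ _
  | add_comp => exact Preadditive.add_comp _ _ _ _ _ _
  | comp_add => exact Preadditive.comp_add _ _ _ _ _ _
  | smul_comp => exact Linear.smul_comp _ _ _ _ _ _
  | comp_smul => exact Linear.comp_smul _ _ _ _ _ _
  | tens_id => exact seqTens_id P _ _
  | tens_comp => exact seqTens_comp P _ _ _ _
  | add_tens =>
    simp only [evWeb, seqTens, AlgRep.add_tensor, Preadditive.add_comp, Preadditive.comp_add]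
  | tens_add =>
    simp only [evWeb, seqTens, AlgRep.tensor_add, Preadditive.add_comp, Preadditive.comp_add]
  | smul_tens =>
    simp only [evWeb, seqTens, AlgRep.smul_tensor, Linear.smul_comp, Linear.comp_smul]
  | tens_smul =>
    simp only [evWeb, seqTens, AlgRep.tensor_smul, Linear.smul_comp, Linear.comp_smul]
  | tens_assoc => exact seqTens_assoc P _ _ _
  | unit_tens => exact unit_seqTens P _
  | tens_unit => exact seqTens_unit P _
  | merge_assoc a b c => exact hR.merge_assoc a b c
  | split_coassoc a b c => exact hR.split_coassoc a b c
  | square a b => exact hR.square a b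
  | square_left a => exact hR.square_left a
  | square_right b => exact hR.square_right b

/-- The type A functor given by merges and splits which satisfy the web relations. -/
noncomputable def webFunctor (hR : WebRelations P M D) :
    LinFunctorOn (C := WebA) (seqObj P) where
  map {X Y} :=
    { toFun := fun f => Quotient.lift (evWeb P M D) (fun _ _ h => evWeb_sound hR h) f
      map_add' := by
        rintro ⟨f⟩ ⟨g⟩
        rfl
      map_smul' := by
        rintro c ⟨f⟩
        rfl }
  map_id X := rfl
  map_comp := by
    rintro X Y Z ⟨f⟩ ⟨g⟩
    rfl

lemma webFunctor_tens (hR : WebRelations P M D) {X Y X' Y' : WebA} (f : X ⟶ Y) (g : X' ⟶ Y') :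
    (webFunctor hR).map (f ⊗ₘ g) =
      (seqMu P X X').hom ≫ ((webFunctor hR).map f ⊗ₘ (webFunctor hR).map g) ≫
        (seqMu P Y Y').inv := by
  obtain ⟨f, rfl⟩ := WHom.mk_surj f
  obtain ⟨g, rfl⟩ := WHom.mk_surj g
  rfl

lemma webA_functor_ext {F G : LinFunctorOn (C := WebA) (seqObj P)}
    (hF : ∀ {X Y X' Y' : WebA} (f : X ⟶ Y) (g : X' ⟶ Y'), F.map (f ⊗ₘ g) =
      (seqMu P X X').hom ≫ (F.map f ⊗ₘ F.map g) ≫ (seqMu P Y Y').inv)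
    (hG : ∀ {X Y X' Y' : WebA} (f : X ⟶ Y) (g : X' ⟶ Y'), G.map (f ⊗ₘ g) =
      (seqMu P X X').hom ≫ (G.map f ⊗ₘ G.map g) ≫ (seqMu P Y Y').inv)
    (hm : ∀ a b : ℕ+, F.map (X := ([a, b] : List ℕ+)) (Y := ([a + b] : List ℕ+)) (WHom.merge a b) =
      G.map (X := ([a, b] : List ℕ+)) (Y := ([a + b] : List ℕ+)) (WHom.merge a b))
    (hs : ∀ a b : ℕ+, F.map (X := ([a + b] : List ℕ+)) (Y := ([a, b] : List ℕ+)) (WHom.split a b) =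
      G.map (X := ([a + b] : List ℕ+)) (Y := ([a, b] : List ℕ+)) (WHom.split a b)) : F = G := by
  have key : ∀ {X Y : List ℕ+} (t : WebTm X Y),
      F.map (X := (X : WebA)) (Y := (Y : WebA)) (WHom.mk t) =
        G.map (X := (X : WebA)) (Y := (Y : WebA)) (WHom.mk t) := by
    intro X Y t
    induction t with
    | cast h =>
      subst h
      exact (F.map_id _).trans (G.map_id _).symm
    | merge a b => exact hm a b
    | split a b => exact hs a b
    | @comp X Y Z f g ihf ihg =>
      have e : ∀ H : LinFunctorOn (C := WebA) (seqObj P),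
          H.map (X := (X : WebA)) (Y := (Z : WebA)) (WHom.mk (WebTm.comp f g)) =
          H.map (X := (X : WebA)) (Y := (Y : WebA)) (WHom.mk f) ≫
            H.map (X := (Y : WebA)) (Y := (Z : WebA)) (WHom.mk g) := 
          fun H => H.map_comp (X := (X : WebA)) (Y := (Y : WebA)) (Z := (Z : WebA))
            (WHom.mk f) (WHom.mk g)
      rw [e, e, ihf, ihg]
    | @tens X Y X' Y' f g ihf ihg =>
      refine (hF (X := X) (Y := Y) (X' := X') (Y' := Y') (WHom.mk f) (WHom.mk g)).trans ?_
      rw [ihf, ihg]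
      exact (hG (X := X) (Y := Y) (X' := X') (Y' := Y') (WHom.mk f) (WHom.mk g)).symm
    | @zero X Y =>
      have e : ∀ H : LinFunctorOn (C := WebA) (seqObj P),
          H.map (X := (X : WebA)) (Y := (Y : WebA)) (WHom.mk WebTm.zero) = 0 :=
        fun H => H.map_zero_hom X Y
      rw [e, e]
    | add f g ihf ihg =>
      refine (map_add F.map (WHom.mk f) (WHom.mk g)).trans ?_
      rw [ihf, ihg]
      exact (map_add G.map (WHom.mk f) (WHom.mk g)).symm
    | smul c f ihf =>
      refine (map_smul F.map c (WHom.mk f)).trans ?_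
      rw [ihf]
      exact (map_smul G.map c (WHom.mk f)).symm
  refine LinFunctorOn.ext_map fun X Y f => ?_
  obtain ⟨t, rfl⟩ := WHom.mk_surj f
  exact key t

end Evaluation

section Strands

variable {n : ℕ} (s : Bool)

/-- The identification of the value of a sequence of length one. -/
noncomputable def unvec (P : ℕ → AlgRep Kq (Uq n)) (a : ℕ+) : (seqObj P [a]).V →ₗ[Kq] (P a).V :=
  (TensorProduct.rid Kq (P a).V).toLinearMap

lemma unvec_vec1 (P : ℕ → AlgRep Kq (Uq n)) (a : ℕ+) (x : (P a).V) : unvec P a (vec1 P x) = x :=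
  one_smul Kq x

/-- The normal form on the values of sequences with at most one strand. -/
noncomputable def js : (X : List ℕ+) → (seqObj (qPow n s) X).V →ₗ[Kq] Mdl (Fin n)
  | [] => (LinearMap.toSpanSingleton Kq (Mdl (Fin n)) (ee 0) : Kq →ₗ[Kq] Mdl (Fin n))
  | [a] => nf s a ∘ₗ unvec (qPow n s) a
  | _ :: _ :: _ => 0

lemma js_cast {X Y : List ℕ+} (h : X = Y) (x : (seqObj (qPow n s) X).V) :
    js s Y (AlgRep.lin (seqCast (qPow n s) h) x) = js s X x := by
  subst h
  rfl

lemma js_single (a : ℕ+) (x : (qPow n s a).V) : js s [a] (vec1 (qPow n s) x) = nf s a x := by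
  change nf s a (unvec (qPow n s) a (vec1 (qPow n s) x)) = _
  rw [unvec_vec1]

variable {M N L M' N' : Type} [AddCommGroup M] [Module Kq M] [AddCommGroup N] [Module Kq N]
  [AddCommGroup L] [Module Kq L] [AddCommGroup M'] [Module Kq M'] [AddCommGroup N'] [Module Kq N']

section Box

variable (P : ℕ → AlgRep Kq (Uq n))

/-- The tensor product of linear maps on the values of sequences. -/
noncomputable def box {X Y : List ℕ+} (φ : (seqObj P X).V →ₗ[Kq] M) (ψ : (seqObj P Y).V →ₗ[Kq] N) :
    (seqObj P (X ++ Y)).V →ₗ[Kq] M ⊗[Kq] N :=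
  TensorProduct.map φ ψ ∘ₗ (seqMu P X Y).hom.1

lemma box_seqTens {X Y X' Y' : List ℕ+} {f : seqObj P X ⟶ seqObj P Y}
    {g : seqObj P X' ⟶ seqObj P Y'} {φ : (seqObj P X).V →ₗ[Kq] M} {ψ : (seqObj P X').V →ₗ[Kq] N}
    {φ' : (seqObj P Y).V →ₗ[Kq] M'} {ψ' : (seqObj P Y').V →ₗ[Kq] N'} {F : M →ₗ[Kq] M'}
    {G : N →ₗ[Kq] N'} (hf : ∀ x, φ' (AlgRep.lin f x) = F (φ x))
    (hg : ∀ x, ψ' (AlgRep.lin g x) = G (ψ x)) (x : (seqObj P (X ++ X')).V) :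
    box P φ' ψ' (AlgRep.lin (seqTens P f g) x) = TensorProduct.map F G (box P φ ψ x) := by
  have h := LinearMap.congr_fun (congrArg AlgRep.lin (seqTens_mu P f g)) x
  refine (congrArg (TensorProduct.map φ' ψ') h).trans ?_
  change (TensorProduct.map φ' ψ' ∘ₗ TensorProduct.map f.1 g.1) ((seqMu P X X').hom.1 x) =
    (TensorProduct.map F G ∘ₗ TensorProduct.map φ ψ) ((seqMu P X X').hom.1 x)
  rw [← TensorProduct.map_comp, ← TensorProduct.map_comp,
    show φ' ∘ₗ f.1 = F ∘ₗ φ from LinearMap.ext hf, show ψ' ∘ₗ g.1 = G ∘ₗ ψ from LinearMap.ext hg]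

lemma box_id_tens {X X' Y' : List ℕ+} {g : seqObj P X' ⟶ seqObj P Y'}
    (φ : (seqObj P X).V →ₗ[Kq] M) {ψ : (seqObj P X').V →ₗ[Kq] N}
    {ψ' : (seqObj P Y').V →ₗ[Kq] N'} {G : N →ₗ[Kq] N'}
    (hg : ∀ x, ψ' (AlgRep.lin g x) = G (ψ x)) (x : (seqObj P (X ++ X')).V) :
    box P φ ψ' (AlgRep.lin (seqTens P (𝟙 (seqObj P X)) g) x) =
      TensorProduct.map LinearMap.id G (box P φ ψ x) :=
  box_seqTens P (f := 𝟙 (seqObj P X)) (φ := φ) (F := LinearMap.id) (fun _ => rfl) hg x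

lemma box_tens_id {X Y X' : List ℕ+} {f : seqObj P X ⟶ seqObj P Y}
    {φ : (seqObj P X).V →ₗ[Kq] M} (ψ : (seqObj P X').V →ₗ[Kq] N)
    {φ' : (seqObj P Y).V →ₗ[Kq] M'} {F : M →ₗ[Kq] M'}
    (hf : ∀ x, φ' (AlgRep.lin f x) = F (φ x)) (x : (seqObj P (X ++ X')).V) :
    box P φ' ψ (AlgRep.lin (seqTens P f (𝟙 (seqObj P X'))) x) =
      TensorProduct.map F LinearMap.id (box P φ ψ x) :=
  box_seqTens P (g := 𝟙 (seqObj P X')) (ψ := ψ) (G := LinearMap.id) hf (fun _ => rfl) x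

lemma box_assoc {X Y Z : List ℕ+} (φ : (seqObj P X).V →ₗ[Kq] M) (ψ : (seqObj P Y).V →ₗ[Kq] N)
    (χ : (seqObj P Z).V →ₗ[Kq] L) (x : (seqObj P ((X ++ Y) ++ Z)).V) :
    box P φ (box P ψ χ) (AlgRep.lin (seqCast P (List.append_assoc X Y Z)) x) =
      TensorProduct.assoc Kq _ _ _ (box P (box P φ ψ) χ x) := by
  have h := LinearMap.congr_fun (congrArg AlgRep.lin (seqMu_assoc P X Y Z)) x
  have e1 : ∀ y : (seqObj P X ⊗ seqObj P (Y ++ Z) : AlgRep Kq (Uq n)).V,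
      TensorProduct.map φ (box P ψ χ) y = TensorProduct.map φ (TensorProduct.map ψ χ)
        (AlgRep.lin (seqObj P X ◁ (seqMu P Y Z).hom) y) := fun y =>
    LinearMap.congr_fun (f := TensorProduct.map φ (box P ψ χ))
      (g := TensorProduct.map φ (TensorProduct.map ψ χ) ∘ₗ (seqObj P X ◁ (seqMu P Y Z).hom).1)
      (TensorProduct.ext' fun _ _ => rfl) y
  have e2 : ∀ y : (seqObj P (X ++ Y) ⊗ seqObj P Z : AlgRep Kq (Uq n)).V,
      TensorProduct.assoc Kq _ _ _ (TensorProduct.map (box P φ ψ) χ y) =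
        TensorProduct.map φ (TensorProduct.map ψ χ)
        (AlgRep.lin (((seqMu P X Y).hom ▷ seqObj P Z) ≫ (α_ _ _ _).hom) y) := fun y => by
    have e3 : ∀ z : ((seqObj P X ⊗ seqObj P Y) ⊗ seqObj P Z : AlgRep Kq (Uq n)).V,
      TensorProduct.assoc Kq _ _ _ (TensorProduct.map (TensorProduct.map φ ψ) χ z) =
        TensorProduct.map φ (TensorProduct.map ψ χ) (AlgRep.lin (α_ _ _ _).hom z) :=
      LinearMap.congr_fun (f := (TensorProduct.assoc Kq _ _ _).toLinearMap ∘ₗ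
          TensorProduct.map (TensorProduct.map φ ψ) χ)
        (g := TensorProduct.map φ (TensorProduct.map ψ χ) ∘ₗ
          (α_ (seqObj P X) (seqObj P Y) (seqObj P Z)).hom.1)
        (TensorProduct.ext_threefold fun _ _ _ => rfl)
    refine Eq.trans ?_ (e3 (AlgRep.lin ((seqMu P X Y).hom ▷ seqObj P Z) y))
    refine congrArg _ (LinearMap.congr_fun (f := TensorProduct.map (box P φ ψ) χ)
      (g := TensorProduct.map (TensorProduct.map φ ψ) χ ∘ₗ ((seqMu P X Y).hom ▷ seqObj P Z).1)
      (TensorProduct.ext' fun _ _ => rfl) y)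
  refine (e1 _).trans (Eq.trans ?_ (e2 _).symm)
  exact congrArg (TensorProduct.map φ (TensorProduct.map ψ χ)) h.symm

lemma box_assoc_symm {X Y Z : List ℕ+} (φ : (seqObj P X).V →ₗ[Kq] M)
    (ψ : (seqObj P Y).V →ₗ[Kq] N) (χ : (seqObj P Z).V →ₗ[Kq] L)
    (x : (seqObj P (X ++ (Y ++ Z))).V) :
    box P (box P φ ψ) χ (AlgRep.lin (seqCast P (List.append_assoc X Y Z).symm) x) =
      (TensorProduct.assoc Kq _ _ _).symm (box P φ (box P ψ χ) x) := by
  rw [LinearEquiv.eq_symm_apply, ← box_assoc]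
  have h := seqCast_comp P (List.append_assoc X Y Z).symm (List.append_assoc X Y Z)
  exact congrArg (box P φ (box P ψ χ)) (LinearMap.congr_fun (congrArg AlgRep.lin h) x)

lemma seq1_ext {a : ℕ+} {f g : (seqObj P [a]).V →ₗ[Kq] M}
    (h : ∀ x : (P a).V, f (vec1 P x) = g (vec1 P x)) : f = g :=
  TensorProduct.ext (LinearMap.ext fun x => LinearMap.ext_ring (h x))

lemma seq2_ext {a b : ℕ+} {f g : (seqObj P [a, b]).V →ₗ[Kq] M}
    (h : ∀ (x : (P a).V) (y : (P b).V), f (vec2 P x y) = g (vec2 P x y)) : f = g :=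
  TensorProduct.ext (LinearMap.ext fun x => seq1_ext P (h x))

lemma box_vec2 {a b : ℕ+} (φ : (seqObj P [a]).V →ₗ[Kq] M) (ψ : (seqObj P [b]).V →ₗ[Kq] N)
    (x : (P a).V) (y : (P b).V) :
    box P (X := [a]) (Y := [b]) φ ψ (vec2 P x y) = φ (vec1 P x) ⊗ₜ ψ (vec1 P y) := rfl

end Box

/-- Absorption of a letter from the left. -/
noncomputable def mopL : Mdl (Fin n) ⊗[Kq] Mdl (Fin n) →ₗ[Kq] Mdl (Fin n) :=
  ∑ j, mulL s j ∘ₗ coef1 {j}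

/-- Absorption of a letter from the right. -/
noncomputable def mopR : Mdl (Fin n) ⊗[Kq] Mdl (Fin n) →ₗ[Kq] Mdl (Fin n) :=
  ∑ j, mulR s j ∘ₗ coef2 {j}

/-- Emission of a letter to the right. -/
noncomputable def sopR : Mdl (Fin n) →ₗ[Kq] Mdl (Fin n) ⊗[Kq] Mdl (Fin n) :=
  ∑ i, (TensorProduct.mk Kq (Mdl (Fin n)) (Mdl (Fin n))).flip (ee {i}) ∘ₗ remR s i

/-- Emission of a letter to the left. -/
noncomputable def sopL : Mdl (Fin n) →ₗ[Kq] Mdl (Fin n) ⊗[Kq] Mdl (Fin n) :=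
  ∑ i, TensorProduct.mk Kq (Mdl (Fin n)) (Mdl (Fin n)) (ee {i}) ∘ₗ remL s i

lemma mopL_tmul (i : Fin n) (y : Mdl (Fin n)) : mopL s (ee {i} ⊗ₜ y) = mulL s i y := by
  rw [mopL, LinearMap.sum_apply, Finset.sum_eq_single i]
  · rw [LinearMap.comp_apply, coef1_tmul, if_pos rfl]
  · intro j _ h
    rw [LinearMap.comp_apply, coef1_tmul, if_neg (by simpa using h.symm), map_zero]
  · intro h
    exact absurd (Finset.mem_univ i) h

lemma mopR_tmul (i : Fin n) (y : Mdl (Fin n)) : mopR s (y ⊗ₜ ee {i}) = mulR s i y := by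
  rw [mopR, LinearMap.sum_apply, Finset.sum_eq_single i]
  · rw [LinearMap.comp_apply, coef2_tmul, if_pos rfl]
  · intro j _ h
    rw [LinearMap.comp_apply, coef2_tmul, if_neg (by simpa using h.symm), map_zero]
  · intro h
    exact absurd (Finset.mem_univ i) h

lemma sopR_apply (y : Mdl (Fin n)) : sopR s y = ∑ i, remR s i y ⊗ₜ ee {i} := by
  rw [sopR, LinearMap.sum_apply]
  rfl

lemma sopL_apply (y : Mdl (Fin n)) : sopL s y = ∑ i, ee {i} ⊗ₜ remL s i y := by
  rw [sopL, LinearMap.sum_apply]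
  rfl

lemma good_singleton (s : Bool) (i : Fin n) : Good s ({i} : Multiset (Fin n)) :=
  fun _ => Multiset.nodup_singleton i

lemma remR_ee_singleton (i k : Fin n) : remR s i (ee {k}) = if i = k then ee 0 else 0 := by
  rw [remR_ee s i (good_singleton s k), rcoef]
  split_ifs with h
  · subst h
    have h0 : ∀ p : Fin n → Prop, [DecidablePred p] → ¬ p i → Multiset.countP p {i} = 0 :=
      fun p _ hp => Multiset.countP_eq_zero.mpr fun x hx => by
        rwa [Multiset.mem_singleton.mp hx]
    simp [cntLt, cntGt, qnum_one, h0]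
  · rw [Multiset.count_singleton, if_neg h]
    simp [qnum_zero]

lemma remL_ee_singleton (i k : Fin n) : remL s i (ee {k}) = if i = k then ee 0 else 0 := by
  rw [remL_ee s i (good_singleton s k), lcoef]
  split_ifs with h
  · subst h
    have h0 : ∀ p : Fin n → Prop, [DecidablePred p] → ¬ p i → Multiset.countP p {i} = 0 :=
      fun p _ hp => Multiset.countP_eq_zero.mpr fun x hx => by
        rwa [Multiset.mem_singleton.mp hx]
    simp [cntLt, cntGt, qnum_one, h0]
  · rw [Multiset.count_singleton, if_neg h]
    simp [qnum_zero]

lemma sopR_singleton (k : Fin n) : sopR s (ee {k}) = ee 0 ⊗ₜ ee {k} := by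
  rw [sopR_apply, Finset.sum_eq_single k]
  · rw [remR_ee_singleton, if_pos rfl]
  · intro j _ h
    rw [remR_ee_singleton, if_neg h, zero_tmul]
  · intro h
    exact absurd (Finset.mem_univ k) h

lemma sopL_singleton (k : Fin n) : sopL s (ee {k}) = ee {k} ⊗ₜ ee 0 := by
  rw [sopL_apply, Finset.sum_eq_single k]
  · rw [remL_ee_singleton, if_pos rfl]
  · intro j _ h
    rw [remL_ee_singleton, if_neg h, tmul_zero]
  · intro h
    exact absurd (Finset.mem_univ k) h

lemma nf_qMulB_thin_left (b : ℕ) (z : (qPow n s 1).V) (y : (qPow n s b).V) :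
    nf s (1 + b) (qMulB s 1 b z y) = mopL s (nf s 1 z ⊗ₜ nf s b y) := by
  refine LinearMap.congr_fun (f := nf s (1 + b) ∘ₗ (qMulB s 1 b).flip y)
    (g := mopL s ∘ₗ (TensorProduct.mk Kq _ _).flip (nf s b y) ∘ₗ nf s 1) (qth_ext fun k => ?_) z
  simp only [LinearMap.comp_apply, LinearMap.flip_apply, TensorProduct.mk_apply, nf_qth,
    mopL_tmul]
  exact nf_qMulB_left s b y k

lemma nf_qMulB_thin_right (a : ℕ) (z : (qPow n s a).V) (y : (qPow n s 1).V) :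
    nf s (a + 1) (qMulB s a 1 z y) = mopR s (nf s a z ⊗ₜ nf s 1 y) := by
  refine LinearMap.congr_fun (f := nf s (a + 1) ∘ₗ qMulB s a 1 z)
    (g := mopR s ∘ₗ (TensorProduct.mk Kq _ _) (nf s a z) ∘ₗ nf s 1) (qth_ext fun k => ?_) y
  simp only [LinearMap.comp_apply, TensorProduct.mk_apply, nf_qth, mopR_tmul]
  exact nf_qMulB_right s a z k

lemma nf_qCom_thin_right (a : ℕ) (z : (qPow n s (a + 1)).V) :
    TensorProduct.map (nf s a) (nf s 1) (qCom s a 1 z) = sopR s (nf s (a + 1) z) := by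
  rw [qCom_thin_right, map_sum, sopR_apply]
  refine Finset.sum_congr rfl fun i _ => ?_
  rw [TensorProduct.map_tmul, nf_unf_remR, nf_qth]

lemma nf_qCom_thin_left (b : ℕ) (z : (qPow n s (1 + b)).V) :
    TensorProduct.map (nf s 1) (nf s b) (qCom s 1 b z) = sopL s (nf s (1 + b) z) := by
  rw [qCom_thin_left, map_sum, sopL_apply]
  refine Finset.sum_congr rfl fun i _ => ?_
  rw [TensorProduct.map_tmul, nf_unf_remL, nf_qth]

open WebTm (strand nmerge nsplit rungR rungL)

/-- The evaluation of type A webs by merges and splits of quantum powers. -/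
noncomputable abbrev evQ {X Y : List ℕ+} (t : WebTm X Y) :
    seqObj (qPow n s) X ⟶ seqObj (qPow n s) Y :=
  evWeb (qPow n s) (fun a b => qMul s a b) (fun a b => qSplit s a b) t

/-- The normal form on a pair of strands. -/
noncomputable def jj (X Y : List ℕ+) :
    (seqObj (qPow n s) (X ++ Y)).V →ₗ[Kq] Mdl (Fin n) ⊗[Kq] Mdl (Fin n) :=
  box (qPow n s) (js s X) (js s Y)

lemma jj_vec2 (a b : ℕ+) (x : (qPow n s a).V) (y : (qPow n s b).V) :
    jj s [a] [b] (vec2 (qPow n s) x y) = nf s a x ⊗ₜ nf s b y := by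
  refine (box_vec2 (qPow n s) (js s [a]) (js s [b]) x y).trans ?_
  rw [js_single, js_single]

lemma jj_nil_left (a : ℕ+) (x : (qPow n s a).V) :
    jj s [] [a] (vec1 (qPow n s) x) = ee 0 ⊗ₜ nf s a x := by
  change ((1 : Kq) • ee (0 : Multiset (Fin n))) ⊗ₜ[Kq] js s [a] (vec1 (qPow n s) x) = _
  rw [js_single, one_smul]

lemma jj_nil_right (a : ℕ+) (x : (qPow n s a).V) :
    jj s [a] [] (vec1 (qPow n s) x) = nf s a x ⊗ₜ ee 0 := by
  change js s [a] (vec1 (qPow n s) x) ⊗ₜ[Kq] ((1 : Kq) • ee (0 : Multiset (Fin n))) = _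
  rw [js_single, one_smul]

lemma js_nmerge_left : ∀ (b : ℕ) (x : (seqObj (qPow n s) (strand 1 ++ strand b)).V),
    js s (strand (1 + b)) (AlgRep.lin (evQ s (nmerge 1 b)) x) =
      mopL s (jj s (strand 1) (strand b) x)
  | 0, x => by
    have key : js (n := n) s [1] = mopL s ∘ₗ jj s [1] [] := ?_
    · exact LinearMap.congr_fun key x
    refine seq1_ext (qPow n s) (a := 1) fun y => ?_
    rw [LinearMap.comp_apply, jj_nil_right, js_single]
    refine LinearMap.congr_fun (f := nf s 1) (g := mopL s ∘ₗ
      (TensorProduct.mk Kq _ _).flip (ee 0) ∘ₗ nf s 1) (qth_ext fun k => ?_) y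
    simp only [LinearMap.comp_apply, LinearMap.flip_apply, TensorProduct.mk_apply, nf_qth,
      mopL_tmul, mulL_ee_zero]
  | b + 1, x => by
    let a1 : ℕ+ := Nat.succPNat 0
    let b1 : ℕ+ := Nat.succPNat b
    have h : [a1 + b1] = strand (1 + (b + 1)) :=
      congrArg (fun x => [x]) (PNat.eq (by simp [a1, b1, Nat.add_comm]))
    refine (js_cast s h (AlgRep.lin (seqMerge (qPow n s) (fun a b => qMul s a b) a1 b1) x)).trans ?_
    have key : js (n := n) s [a1 + b1] ∘ₗ (seqMerge (qPow n s) (fun a b => qMul s a b) a1 b1).1 =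
      mopL s ∘ₗ jj s [a1] [b1] := ?_
    · exact LinearMap.congr_fun key x
    refine seq2_ext (qPow n s) (a := a1) (b := b1) fun z y => ?_
    rw [LinearMap.comp_apply, LinearMap.comp_apply, jj_vec2]
    refine (js_single s (a1 + b1) (qMulB s a1 b1 z y)).trans ?_
    exact nf_qMulB_thin_left s (b + 1) z y

lemma js_nmerge_right : ∀ (a : ℕ) (x : (seqObj (qPow n s) (strand a ++ strand 1)).V),
    js s (strand (a + 1)) (AlgRep.lin (evQ s (nmerge a 1)) x) =
      mopR s (jj s (strand a) (strand 1) x)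
  | 0, x => by
    have key : js (n := n) s [1] = mopR s ∘ₗ jj s [] [1] := ?_
    · exact LinearMap.congr_fun key x
    refine seq1_ext (qPow n s) (a := 1) fun y => ?_
    rw [LinearMap.comp_apply, jj_nil_left, js_single]
    refine LinearMap.congr_fun (f := nf s 1) (g := mopR s ∘ₗ
      (TensorProduct.mk Kq _ _) (ee 0) ∘ₗ nf s 1) (qth_ext fun k => ?_) y
    simp only [LinearMap.comp_apply, TensorProduct.mk_apply, nf_qth,
      mopR_tmul, mulR_ee_zero]
  | a + 1, x => by
    let b1 : ℕ+ := Nat.succPNat 0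
    let a1 : ℕ+ := Nat.succPNat a
    have h : [a1 + b1] = strand (a + 1 + 1) :=
      congrArg (fun x => [x]) (PNat.eq (by simp [a1, b1, Nat.add_comm]))
    refine (js_cast s h (AlgRep.lin (seqMerge (qPow n s) (fun a b => qMul s a b) a1 b1) x)).trans ?_
    have key : js (n := n) s [a1 + b1] ∘ₗ (seqMerge (qPow n s) (fun a b => qMul s a b) a1 b1).1 =
      mopR s ∘ₗ jj s [a1] [b1] := ?_
    · exact LinearMap.congr_fun key x
    refine seq2_ext (qPow n s) (a := a1) (b := b1) fun z y => ?_
    rw [LinearMap.comp_apply, LinearMap.comp_apply, jj_vec2]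
    refine (js_single s (a1 + b1) (qMulB s a1 b1 z y)).trans ?_
    exact nf_qMulB_thin_right s (a + 1) z y

lemma jj_seqSplit (a b : ℕ+) (x : (seqObj (qPow n s) [a + b]).V) :
    jj s [a] [b] (AlgRep.lin (seqSplit (qPow n s) (fun a b => qSplit s a b) a b) x) =
      TensorProduct.map (nf s a) (nf s b)
        (qCom s a b (unvec (qPow n s) (a + b) x)) := by
  have key : jj s [a] [b] ∘ₗ (seqSplit (qPow n s) (fun a b => qSplit s a b) a b).1 =
    TensorProduct.map (nf s a) (nf s b) ∘ₗ qCom s a b ∘ₗ unvec (qPow n s) (a + b) := ?_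
  · exact LinearMap.congr_fun key x
  refine seq1_ext (M := Mdl (Fin n) ⊗[Kq] Mdl (Fin n)) (qPow n s) (a := a + b) fun y => ?_
  have h : ∀ t : (qPow n s a ⊗ qPow n s b : AlgRep Kq (Uq n)).V,
      jj s [a] [b] (AlgRep.lin (α_ (qPow n s a) (qPow n s b) (𝟙_ _)).hom (t ⊗ₜ (1 : Kq))) =
        TensorProduct.map (nf s a) (nf s b) t := by
    intro t
    refine LinearMap.congr_fun (f := (jj s [a] [b] ∘ₗ
      (α_ (qPow n s a) (qPow n s b) (𝟙_ _)).hom.1) ∘ₗ (TensorProduct.mk Kq _ Kq).flip 1)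
      (g := TensorProduct.map (nf s a) (nf s b)) (TensorProduct.ext' fun x y => ?_) t
    exact jj_vec2 s a b x y
  refine (h _).trans ?_
  exact congrArg (fun t => TensorProduct.map (nf s a) (nf s b) (qCom s a b t))
    (unvec_vec1 (qPow n s) (a + b) y).symm

lemma jj_nsplit_right : ∀ (a : ℕ) (x : (seqObj (qPow n s) (strand (a + 1))).V),
    jj s (strand a) (strand 1) (AlgRep.lin (evQ s (nsplit a 1)) x) =
      sopR s (js s (strand (a + 1)) x)
  | 0, x => by
    have key : jj (n := n) s [] [1] = sopR s ∘ₗ js s [1] := ?_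
    · exact LinearMap.congr_fun key x
    refine seq1_ext (M := Mdl (Fin n) ⊗[Kq] Mdl (Fin n)) (qPow n s) (a := 1) fun y => ?_
    rw [LinearMap.comp_apply, jj_nil_left, js_single]
    refine LinearMap.congr_fun (f := (TensorProduct.mk Kq _ _) (ee 0) ∘ₗ nf s 1)
      (g := sopR s ∘ₗ nf s 1) (qth_ext fun k => ?_) y
    simp only [LinearMap.comp_apply, TensorProduct.mk_apply, nf_qth, sopR_singleton]
  | a + 1, x => by
    let b1 : ℕ+ := Nat.succPNat 0
    let a1 : ℕ+ := Nat.succPNat a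
    have h : strand (a + 1 + 1) = [a1 + b1] := congrArg (fun x => [x]) (PNat.eq (by simp [a1, b1, Nat.add_comm]))
    refine Eq.trans ?_ (congrArg (sopR s) (js_cast s h x))
    refine (jj_seqSplit s a1 b1 (AlgRep.lin (seqCast (qPow n s) h) x)).trans ?_
    exact nf_qCom_thin_right s (a + 1) _

lemma jj_nsplit_left : ∀ (b : ℕ) (x : (seqObj (qPow n s) (strand (1 + b))).V),
    jj s (strand 1) (strand b) (AlgRep.lin (evQ s (nsplit 1 b)) x) =
      sopL s (js s (strand (1 + b)) x)
  | 0, x => by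
    have key : jj (n := n) s [1] [] = sopL s ∘ₗ js s [1] := ?_
    · exact LinearMap.congr_fun key x
    refine seq1_ext (M := Mdl (Fin n) ⊗[Kq] Mdl (Fin n)) (qPow n s) (a := 1) fun y => ?_
    rw [LinearMap.comp_apply, jj_nil_right, js_single]
    refine LinearMap.congr_fun (f := (TensorProduct.mk Kq _ _).flip (ee 0) ∘ₗ nf s 1)
      (g := sopL s ∘ₗ nf s 1) (qth_ext fun k => ?_) y
    simp only [LinearMap.comp_apply, LinearMap.flip_apply, TensorProduct.mk_apply, nf_qth,
      sopL_singleton]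
  | b + 1, x => by
    let a1 : ℕ+ := Nat.succPNat 0
    let b1 : ℕ+ := Nat.succPNat b
    have h : strand (1 + (b + 1)) = [a1 + b1] :=
      congrArg (fun x => [x]) (PNat.eq (by simp [a1, b1, Nat.add_comm]))
    refine Eq.trans ?_ (congrArg (sopL s) (js_cast s h x))
    refine (jj_seqSplit s a1 b1 (AlgRep.lin (seqCast (qPow n s) h) x)).trans ?_
    exact nf_qCom_thin_left s (b + 1) _

/-- The transfer of a letter to the right. -/
noncomputable def opR : Mdl (Fin n) ⊗[Kq] Mdl (Fin n) →ₗ[Kq] Mdl (Fin n) ⊗[Kq] Mdl (Fin n) :=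
  TensorProduct.map LinearMap.id (mopL s) ∘ₗ (TensorProduct.assoc Kq _ _ _).toLinearMap ∘ₗ
    TensorProduct.map (sopR s) LinearMap.id

/-- The transfer of a letter to the left. -/
noncomputable def opL : Mdl (Fin n) ⊗[Kq] Mdl (Fin n) →ₗ[Kq] Mdl (Fin n) ⊗[Kq] Mdl (Fin n) :=
  TensorProduct.map (mopR s) LinearMap.id ∘ₗ (TensorProduct.assoc Kq _ _ _).symm.toLinearMap ∘ₗ
    TensorProduct.map LinearMap.id (sopL s)

lemma opR_tmul (x y : Mdl (Fin n)) : opR s (x ⊗ₜ y) = ∑ i, remR s i x ⊗ₜ mulL s i y := by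
  simp only [opR, LinearMap.comp_apply, TensorProduct.map_tmul, sopR_apply, sum_tmul, map_sum,
    LinearEquiv.coe_coe, TensorProduct.assoc_tmul, mopL_tmul, LinearMap.id_apply]

lemma opL_tmul (x y : Mdl (Fin n)) : opL s (x ⊗ₜ y) = ∑ i, mulR s i x ⊗ₜ remL s i y := by
  simp only [opL, LinearMap.comp_apply, TensorProduct.map_tmul, sopL_apply, tmul_sum, map_sum,
    LinearEquiv.coe_coe, TensorProduct.assoc_symm_tmul, mopR_tmul, LinearMap.id_apply]

lemma jj_rungR (a b : ℕ) (x : (seqObj (qPow n s) (strand (a + 1) ++ strand b)).V) :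
    jj s (strand a) (strand (1 + b)) (AlgRep.lin (evQ s (rungR a b)) x) =
      opR s (jj s (strand (a + 1)) (strand b) x) := by
  have h1 := box_id_tens (N := Mdl (Fin n) ⊗[Kq] Mdl (Fin n)) (N' := Mdl (Fin n)) (qPow n s)
    (js s (strand a)) (js_nmerge_left (n := n) s b)
  have h2 := box_tens_id (M' := Mdl (Fin n) ⊗[Kq] Mdl (Fin n)) (M := Mdl (Fin n)) (qPow n s)
    (js s (strand b)) (jj_nsplit_right (n := n) s a)
  refine (h1 _).trans ?_
  refine congrArg (TensorProduct.map LinearMap.id (mopL s)) ?_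
  refine (box_assoc (qPow n s) (js s (strand a)) (js s (strand 1)) (js s (strand b)) _).trans ?_
  exact congrArg (TensorProduct.assoc Kq _ _ _) (h2 x)

lemma jj_rungL (a b : ℕ) (x : (seqObj (qPow n s) (strand a ++ strand (1 + b))).V) :
    jj s (strand (a + 1)) (strand b) (AlgRep.lin (evQ s (rungL a b)) x) =
      opL s (jj s (strand a) (strand (1 + b)) x) := by
  have h1 := box_tens_id (M := Mdl (Fin n) ⊗[Kq] Mdl (Fin n)) (M' := Mdl (Fin n)) (qPow n s)
    (js s (strand b)) (js_nmerge_right (n := n) s a)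
  have h2 := box_id_tens (N' := Mdl (Fin n) ⊗[Kq] Mdl (Fin n)) (N := Mdl (Fin n)) (qPow n s)
    (js s (strand a)) (jj_nsplit_left (n := n) s b)
  refine (h1 _).trans ?_
  refine congrArg (TensorProduct.map (mopR s) LinearMap.id) ?_
  refine (box_assoc_symm (qPow n s) (js s (strand a)) (js s (strand 1)) (js s (strand b)) _).trans ?_
  exact congrArg (TensorProduct.assoc Kq _ _ _).symm (h2 x)

end Strands

section GammaA

variable {n : ℕ} (s : Bool)

open WebTm (strand nmerge nsplit rungR rungL)

lemma unvec_injective (P : ℕ → AlgRep Kq (Uq n)) (a : ℕ+) : Function.Injective (unvec P a) :=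
  (TensorProduct.rid Kq (P a).V).injective

lemma js_injective : ∀ a : ℕ, Function.Injective (js (n := n) s (strand a))
  | 0 => smul_left_injective Kq (Finsupp.single_ne_zero.mpr one_ne_zero)
  | a + 1 => (nf_injective s _).comp (unvec_injective _ _)

lemma jj_injective (a b : ℕ) : Function.Injective (jj (n := n) s (strand a) (strand b)) := by
  refine (TensorProduct.map_injective_of_flat_flat _ _ (js_injective s a)
    (js_injective s b)).comp ?_
  have h := congrArg AlgRep.lin (seqMu (qPow n s) (strand a) (strand b)).hom_inv_id
  exact Function.LeftInverse.injective (LinearMap.congr_fun h)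

/-- The span of the basis vectors of degree `a` which occur in the model. -/
noncomputable def mdlDeg (n a : ℕ) : Submodule Kq (Mdl (Fin n)) :=
  Submodule.span Kq {x | ∃ m : Multiset (Fin n), Good s m ∧ m.card = a ∧ x = ee m}

lemma nf_mem (a : ℕ) (x : (qPow n s a).V) : nf s a x ∈ mdlDeg s n a := by
  have h : (⊤ : Submodule Kq (qPow n s a).V) ≤ (mdlDeg s n a).comap (nf s a) := by
    rw [← span_std, Submodule.span_le]
    rintro _ ⟨w, hw, rfl⟩
    change nf s a (qVec s w) ∈ mdlDeg s n a
    rw [nf_qVec hw]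
    exact Submodule.subset_span ⟨_, good_cont hw, card_cont w, rfl⟩
  exact h trivial

lemma js_mem : ∀ (a : ℕ) (x : (seqObj (qPow n s) (strand a)).V),
    js s (strand a) x ∈ mdlDeg s n a
  | 0, x => Submodule.smul_mem _ _ (Submodule.subset_span
      ⟨0, fun _ => Multiset.nodup_zero, rfl, rfl⟩)
  | a + 1, x => nf_mem s _ _

lemma jj_congr {M : Type} [AddCommGroup M] [Module Kq M] {a b : ℕ}
    {f g : Mdl (Fin n) ⊗[Kq] Mdl (Fin n) →ₗ[Kq] M}
    (h : ∀ m m', Good s m → Good s m' → m.card = a → m'.card = b →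
      f (ee m ⊗ₜ ee m') = g (ee m ⊗ₜ ee m'))
    (x : (seqObj (qPow n s) (strand a ++ strand b)).V) :
    f (jj s (strand a) (strand b) x) = g (jj s (strand a) (strand b) x) := by
  have key : f ∘ₗ TensorProduct.map (js s (strand a)) (js s (strand b)) =
      g ∘ₗ TensorProduct.map (js s (strand a)) (js s (strand b)) := by
    refine TensorProduct.ext' fun y z => ?_
    have h1 : ∀ u ∈ mdlDeg s n a, ∀ v ∈ mdlDeg s n b, f (u ⊗ₜ v) = g (u ⊗ₜ v) := by
      intro u hu v hv
      refine LinearMap.eqOn_span (f := f ∘ₗ (TensorProduct.mk Kq _ _).flip v)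
        (g := g ∘ₗ (TensorProduct.mk Kq _ _).flip v) ?_ hu
      rintro _ ⟨m, hm, hm', rfl⟩
      refine LinearMap.eqOn_span (f := f ∘ₗ TensorProduct.mk Kq _ _ (ee m))
        (g := g ∘ₗ TensorProduct.mk Kq _ _ (ee m)) ?_ hv
      rintro _ ⟨m', hn, hn', rfl⟩
      exact h m m' hm hn hm' hn'
    exact h1 _ (js_mem s a y) _ (js_mem s b z)
  exact LinearMap.congr_fun key _

lemma opL_opR (m m' : Multiset (Fin n)) : opL s (opR s (ee m ⊗ₜ ee m')) =
    ∑ i, ∑ j, mulR s j (remR s i (ee m)) ⊗ₜ remL s j (mulL s i (ee m')) := by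
  rw [opR_tmul, map_sum]
  exact Finset.sum_congr rfl fun i _ => opL_tmul _ _ _

lemma opR_opL (m m' : Multiset (Fin n)) : opR s (opL s (ee m ⊗ₜ ee m')) =
    ∑ i, ∑ j, remR s i (mulR s j (ee m)) ⊗ₜ mulL s i (remL s j (ee m')) := by
  rw [opL_tmul, map_sum, Finset.sum_comm]
  exact Finset.sum_congr rfl fun i _ => opR_tmul _ _ _

lemma add_right_cancel_module {M : Type*} [AddCommMonoid M] [Module Kq M] {x y z : M}
    (h : x + z = y + z) : x = y := by
  have hz : z + (-1 : Kq) • z = 0 := by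
    nth_rw 1 [← one_smul Kq z]
    rw [← _root_.add_smul, add_neg_cancel, zero_smul]
  have := congrArg (· + (-1 : Kq) • z) h
  simpa only [_root_.add_assoc, hz, _root_.add_zero] using this

/-- The square switch in the model. -/
lemma opL_opR_comm {m m' : Multiset (Fin n)} (hm : Good s m) (hm' : Good s m') (h0 : m ≠ 0)
    (h0' : m' ≠ 0) : opL s (opR s (ee m ⊗ₜ ee m')) = opR s (opL s (ee m ⊗ₜ ee m')) +
      (qnum ((m.card : ℤ) - 1) * qnum m'.card - qnum m.card * qnum ((m'.card : ℤ) - 1)) •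
        (ee m ⊗ₜ ee m') := by
  let T : Fin n → Fin n → Mdl (Fin n) ⊗[Kq] Mdl (Fin n) := fun i l =>
    fmu s i l • (mulR s i (remR s i (ee m)) ⊗ₜ mulL s l (remL s l (ee m')))
  let O : Mdl (Fin n) ⊗[Kq] Mdl (Fin n) := ∑ i, ∑ j ∈ Finset.univ.erase i,
    eps s • (mulR s j (remR s i (ee m)) ⊗ₜ mulL s i (remL s j (ee m')))
  have d1 : ∀ i, mulR s i (remR s i (ee m)) ⊗ₜ[Kq] remL s i (mulL s i (ee m')) +
      qnum ((m'.card : ℤ) - 1) • (mulR s i (remR s i (ee m)) ⊗ₜ ee m') = ∑ l, T i l := by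
    intro i
    rw [← tmul_smul, ← tmul_add, remL_mulL_self s i hm' h0', sub_add_cancel, tmul_sum]
    simp only [tmul_smul, T]
  have d2 : ∀ i, remR s i (mulR s i (ee m)) ⊗ₜ[Kq] mulL s i (remL s i (ee m')) +
      qnum ((m.card : ℤ) - 1) • (ee m ⊗ₜ mulL s i (remL s i (ee m'))) = ∑ l, T l i := by
    intro i
    rw [smul_tmul', ← add_tmul, remR_mulR_self s i hm h0, sub_add_cancel, sum_tmul]
    simp only [smul_tmul', T]
  have e1 : opL s (opR s (ee m ⊗ₜ ee m')) = ∑ i, mulR s i (remR s i (ee m)) ⊗ₜ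
      remL s i (mulL s i (ee m')) + O := by
    rw [opL_opR, ← Finset.sum_add_distrib]
    refine Finset.sum_congr rfl fun i _ => ?_
    rw [← Finset.add_sum_erase _ _ (Finset.mem_univ i)]
    refine congrArg _ (Finset.sum_congr rfl fun j hj => ?_)
    rw [remL_mulL_of_ne s (Finset.ne_of_mem_erase hj) hm', tmul_smul]
  have e2 : opR s (opL s (ee m ⊗ₜ ee m')) = ∑ i, remR s i (mulR s i (ee m)) ⊗ₜ
      mulL s i (remL s i (ee m')) + O := by
    rw [opR_opL, ← Finset.sum_add_distrib]
    refine Finset.sum_congr rfl fun i _ => ?_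
    rw [← Finset.add_sum_erase _ _ (Finset.mem_univ i)]
    refine congrArg _ (Finset.sum_congr rfl fun j hj => ?_)
    rw [remR_mulR_of_ne s (Finset.ne_of_mem_erase hj).symm hm, smul_tmul']
  have f1 : opL s (opR s (ee m ⊗ₜ ee m')) +
      (qnum m.card * qnum ((m'.card : ℤ) - 1)) • (ee m ⊗ₜ[Kq] ee m') = ∑ i, ∑ l, T i l + O := by
    rw [← Finset.sum_congr rfl fun i _ => d1 i, Finset.sum_add_distrib, ← Finset.smul_sum,
      ← sum_tmul, sum_mulR_remR s hm, ← smul_tmul', smul_smul, e1, mul_comm (qnum m.card),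
      add_right_comm]
  have f2 : opR s (opL s (ee m ⊗ₜ ee m')) +
      (qnum ((m.card : ℤ) - 1) * qnum m'.card) • (ee m ⊗ₜ[Kq] ee m') = ∑ i, ∑ l, T i l + O := by
    rw [Finset.sum_comm, ← Finset.sum_congr rfl fun i _ => d2 i, Finset.sum_add_distrib,
      ← Finset.smul_sum, ← tmul_sum, sum_mulL_remL s hm', tmul_smul, smul_smul, e2,
      add_right_comm]
  refine add_right_cancel_module (z := (qnum m.card * qnum ((m'.card : ℤ) - 1)) •
    (ee m ⊗ₜ[Kq] ee m')) ?_
  rw [f1, _root_.add_assoc, ← _root_.add_smul, sub_add_cancel, f2]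

lemma qnum_sub_eq (a b : ℤ) :
    qnum (a - 1) * qnum b - qnum a * qnum (b - 1) = qnum (a - b) := by
  have h0 := qpar_ne_zero
  have h := qpar_sub_ne_zero
  have h1 : qpar ^ a ≠ 0 := zpow_ne_zero _ h0
  have h2 : qpar ^ b ≠ 0 := zpow_ne_zero _ h0
  have h3 : qpar ^ 2 - 1 ≠ 0 := qpar_sq_sub_ne_zero
  simp only [qnum, zpow_neg, zpow_sub₀ h0, zpow_one]
  field_simp
  ring

lemma evQ_square (a b : ℕ) :
    evQ (n := n) s (rungR a (1 + b)) ≫ evQ s (rungL a (1 + b)) =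
      evQ s (rungL (a + 1) b) ≫ evQ s (rungR (a + 1) b) +
        qnum ((a + 1 : ℤ) - (1 + b)) • 𝟙 _ := by
  refine AlgRep.hom_ext (LinearMap.ext fun x => jj_injective s (a + 1) (1 + b) ?_)
  refine (jj_rungL s a (1 + b) _).trans ?_
  refine (congrArg (opL s) (jj_rungR s a (1 + b) x)).trans ?_
  refine Eq.trans ?_ (map_add (jj s (strand (a + 1)) (strand (1 + b))) _ _).symm
  have e1 := (jj_rungR s (a + 1) b _).trans (congrArg (opR s) (jj_rungL s (a + 1) b x))
  have e2 := map_smul (jj s (strand (a + 1)) (strand (1 + b))) (qnum ((a + 1 : ℤ) - (1 + b))) x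
  refine Eq.trans ?_ (congrArg₂ (· + ·) e1 e2).symm
  refine jj_congr s (M := Mdl (Fin n) ⊗[Kq] Mdl (Fin n)) (f := opL s ∘ₗ opR s) (g := opR s ∘ₗ opL s +
    qnum ((a + 1 : ℤ) - (1 + b)) • LinearMap.id) (fun m m' hm hm' hc hc' => ?_) x
  refine (opL_opR_comm s hm hm' ?_ ?_).trans ?_
  · rintro rfl
    simp at hc
  · rintro rfl
    simp at hc'
    omega
  · rw [qnum_sub_eq, hc, hc']
    push_cast
    rfl

lemma evQ_square_left (a : ℕ) :
    evQ (n := n) s (rungR a 0) ≫ evQ s (rungL a 0) = qnum ((a + 1 : ℤ) - 0) • 𝟙 _ := by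
  refine AlgRep.hom_ext (LinearMap.ext fun x => jj_injective s (a + 1) 0 ?_)
  refine (jj_rungL s a 0 _).trans ?_
  refine (congrArg (opL s) (jj_rungR s a 0 x)).trans ?_
  refine Eq.trans ?_
    (map_smul (jj s (strand (a + 1)) (strand 0)) (qnum ((a + 1 : ℤ) - 0)) x).symm
  refine jj_congr s (M := Mdl (Fin n) ⊗[Kq] Mdl (Fin n)) (f := opL s ∘ₗ opR s) (g := qnum ((a + 1 : ℤ) - 0) • LinearMap.id)
    (fun m m' hm hm' hc hc' => ?_) x
  obtain rfl := Multiset.card_eq_zero.mp hc'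
  rw [LinearMap.comp_apply, opL_opR]
  have h : ∀ i, ∑ j, mulR s j (remR s i (ee m)) ⊗ₜ[Kq] remL s j (mulL s i (ee 0)) =
      mulR s i (remR s i (ee m)) ⊗ₜ ee 0 := fun i => by
    rw [Finset.sum_eq_single i]
    · rw [mulL_ee_zero, remL_ee_singleton, if_pos rfl]
    · intro j _ hj
      rw [mulL_ee_zero, remL_ee_singleton, if_neg hj, tmul_zero]
    · intro h
      exact absurd (Finset.mem_univ i) h
  rw [Finset.sum_congr rfl fun i _ => h i, ← sum_tmul, sum_mulR_remR s hm, hc, ← smul_tmul',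
    LinearMap.smul_apply, LinearMap.id_apply, sub_zero]
  push_cast
  rfl

lemma evQ_square_right (b : ℕ) :
    0 = evQ (n := n) s (rungL 0 b) ≫ evQ s (rungR 0 b) + qnum ((0 : ℤ) - (1 + b)) • 𝟙 _ := by
  refine AlgRep.hom_ext (LinearMap.ext fun x => jj_injective s 0 (1 + b) ?_)
  refine (map_zero (jj s (strand 0) (strand (1 + b)))).trans ?_
  refine Eq.trans ?_ (map_add (jj s (strand 0) (strand (1 + b))) _ _).symm
  have e1 := (jj_rungR s 0 b _).trans (congrArg (opR s) (jj_rungL s 0 b x))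
  have e2 := map_smul (jj s (strand 0) (strand (1 + b))) (qnum ((0 : ℤ) - (1 + b))) x
  refine Eq.trans ?_ (congrArg₂ (· + ·) e1 e2).symm
  refine jj_congr s (M := Mdl (Fin n) ⊗[Kq] Mdl (Fin n)) (f := 0) (g := opR s ∘ₗ opL s + qnum ((0 : ℤ) - (1 + b)) • LinearMap.id)
    (fun m m' hm hm' hc hc' => ?_) x
  obtain rfl := Multiset.card_eq_zero.mp hc
  rw [LinearMap.add_apply, LinearMap.comp_apply, opR_opL, Finset.sum_comm]
  have h : ∀ j, ∑ i, remR s i (mulR s j (ee 0)) ⊗ₜ[Kq] mulL s i (remL s j (ee m')) =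
      ee 0 ⊗ₜ mulL s j (remL s j (ee m')) := fun j => by
    rw [Finset.sum_eq_single j]
    · rw [mulR_ee_zero, remR_ee_singleton, if_pos rfl]
    · intro i _ hi
      rw [mulR_ee_zero, remR_ee_singleton, if_neg hi, zero_tmul]
    · intro h
      exact absurd (Finset.mem_univ j) h
  rw [Finset.sum_congr rfl fun j _ => h j, ← tmul_sum, sum_mulL_remL s hm', hc', tmul_smul,
    LinearMap.smul_apply, LinearMap.id_apply, ← add_smul, zero_sub, qnum_neg]
  push_cast
  rw [add_neg_cancel, zero_smul, LinearMap.zero_apply]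

lemma nf_qVec_cast {a b : ℕ} (h : a = b) {w : Fin a → Fin n} {w' : Fin b → Fin n}
    (hw : w = w' ∘ Fin.cast h) : nf s a (qVec s w) = nf s b (qVec s w') := by
  subst h
  rw [hw]
  rfl

/-- Merges are associative. -/
lemma qMulB_assoc {a b c : ℕ} (x : (qPow n s a).V) (y : (qPow n s b).V) (z : (qPow n s c).V) :
    nf s (a + b + c) (qMulB s (a + b) c (qMulB s a b x y) z) =
      nf s (a + (b + c)) (qMulB s a (b + c) x (qMulB s b c y z)) := by
  have h1 : ∀ (u : Fin a → Fin n) (v : Fin b → Fin n) (z : (qPow n s c).V),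
      nf s (a + b + c) (qMulB s (a + b) c (qMulB s a b (qVec s u) (qVec s v)) z) =
        nf s (a + (b + c)) (qMulB s a (b + c) (qVec s u) (qMulB s b c (qVec s v) z)) := by
    intro u v z
    refine LinearMap.congr_fun (f := nf s (a + b + c) ∘ₗ
      qMulB s (a + b) c (qMulB s a b (qVec s u) (qVec s v))) (g := nf s (a + (b + c)) ∘ₗ
        qMulB s a (b + c) (qVec s u) ∘ₗ qMulB s b c (qVec s v)) (qPow_ext fun w => ?_) z
    simp only [LinearMap.comp_apply, qMulB_qVec]
    exact nf_qVec_cast s (Nat.add_assoc a b c) (Fin.append_assoc u v w)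
  have h2 : ∀ (u : Fin a → Fin n) (y : (qPow n s b).V) (z : (qPow n s c).V),
      nf s (a + b + c) (qMulB s (a + b) c (qMulB s a b (qVec s u) y) z) =
        nf s (a + (b + c)) (qMulB s a (b + c) (qVec s u) (qMulB s b c y z)) := by
    intro u y z
    exact LinearMap.congr_fun (f := nf s (a + b + c) ∘ₗ
      (qMulB s (a + b) c).flip z ∘ₗ qMulB s a b (qVec s u)) (g := nf s (a + (b + c)) ∘ₗ
        qMulB s a (b + c) (qVec s u) ∘ₗ (qMulB s b c).flip z) (qPow_ext fun v => h1 u v z) y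
  exact LinearMap.congr_fun (f := nf s (a + b + c) ∘ₗ
    (qMulB s (a + b) c).flip z ∘ₗ (qMulB s a b).flip y) (g := nf s (a + (b + c)) ∘ₗ
      (qMulB s a (b + c)).flip (qMulB s b c y z)) (qPow_ext fun u => h2 u y z) x

end GammaA

section GammaAExists

variable {n : ℕ} (s : Bool)

lemma seq3_ext (P : ℕ → AlgRep Kq (Uq n)) {M : Type} [AddCommGroup M] [Module Kq M] {a b c : ℕ+}
    {f g : (seqObj P [a, b, c]).V →ₗ[Kq] M}
    (h : ∀ (x : (P a).V) (y : (P b).V) (z : (P c).V),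
      f (x ⊗ₜ[Kq] vec2 P y z) = g (x ⊗ₜ[Kq] vec2 P y z)) : f = g :=
  TensorProduct.ext (LinearMap.ext fun x => seq2_ext P (h x))

lemma vec1_unvec (P : ℕ → AlgRep Kq (Uq n)) (a : ℕ+) (x : (seqObj P [a]).V) :
    vec1 P (unvec P a x) = x :=
  unvec_injective P a (unvec_vec1 P a _)

lemma seqMu_inv_single (P : ℕ → AlgRep Kq (Uq n)) (a : ℕ+) (Y : List ℕ+) (x : (P a).V)
    (y : (seqObj P Y).V) : AlgRep.lin (seqMu P [a] Y).inv (vec1 P x ⊗ₜ y) = x ⊗ₜ[Kq] y :=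
  congrArg (x ⊗ₜ[Kq] ·) (one_smul Kq y)

lemma seqMu_inv_pair (P : ℕ → AlgRep Kq (Uq n)) (a b : ℕ+) (Y : List ℕ+) (x : (P a).V)
    (y : (P b).V) (z : (seqObj P Y).V) :
    AlgRep.lin (seqMu P [a, b] Y).inv (vec2 P x y ⊗ₜ z) =
      (x ⊗ₜ[Kq] (y ⊗ₜ[Kq] z : (seqObj P (b :: Y)).V) : (seqObj P (a :: b :: Y)).V) :=
  congrArg (fun t => (x ⊗ₜ[Kq] (y ⊗ₜ[Kq] t : (seqObj P (b :: Y)).V) : (seqObj P (a :: b :: Y)).V))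
    (one_smul Kq z)

lemma qMul_merge_assoc (a b c : ℕ+) :
    (seqTens (qPow n s) (X := [a, b]) (X' := [c])
      (seqMerge (qPow n s) (fun a b => qMul s a b) a b) (𝟙 (seqObj (qPow n s) [c])) ≫
        seqMerge (qPow n s) (fun a b => qMul s a b) (a + b) c) ≫
          seqCast (qPow n s) (congrArg (fun x => [x]) (_root_.add_assoc a b c)) =
    seqTens (qPow n s) (X := [a]) (X' := [b, c]) (𝟙 (seqObj (qPow n s) [a]))
      (seqMerge (qPow n s) (fun a b => qMul s a b) b c) ≫
        seqMerge (qPow n s) (fun a b => qMul s a b) a (b + c) := by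
  refine AlgRep.hom_ext (seq3_ext (qPow n s) fun x y z => ?_)
  have hinj : Function.Injective (js (n := n) s [a + (b + c)]) :=
    (nf_injective s _).comp (unvec_injective _ _)
  apply hinj
  refine (js_cast s _ _).trans ?_
  refine (congrArg (fun t => js s [a + b + c] (AlgRep.lin (seqMerge (qPow n s)
    (fun a b => qMul s a b) (a + b) c) t)) (seqMu_inv_single (qPow n s) (a + b) [c]
      (qMulB s a b x y) (vec1 (qPow n s) z))).trans ?_
  refine (js_single s (a + b + c) (qMulB s (a + b : ℕ) c (qMulB s a b x y) z)).trans ?_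
  refine (qMulB_assoc s x y z).trans ?_
  refine (js_single s (a + (b + c)) (qMulB s a (b + c : ℕ) x (qMulB s b c y z))).symm.trans ?_
  exact (congrArg (fun t => js s [a + (b + c)] (AlgRep.lin (seqMerge (qPow n s)
    (fun a b => qMul s a b) a (b + c)) t)) (seqMu_inv_single (qPow n s) a [b + c]
      x (vec1 (qPow n s) (a := b + c) (qMulB s b c y z)))).symm

/-- The identification of a triple tensor product with the value of a sequence. -/
noncomputable def trip (P : ℕ → AlgRep Kq (Uq n)) (a b c : ℕ+) :
    (P a ⊗ (P b ⊗ P c) : AlgRep Kq (Uq n)).V →ₗ[Kq] (seqObj P [a, b, c]).V :=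
  (P a ◁ (P b ◁ (ρ_ (P c)).inv)).1

/-- The identification of a tensor product with the value of a sequence. -/
noncomputable def duo (P : ℕ → AlgRep Kq (Uq n)) (a b : ℕ+) :
    (P a ⊗ P b : AlgRep Kq (Uq n)).V →ₗ[Kq] (seqObj P [a, b]).V :=
  (P a ◁ (ρ_ (P b)).inv).1

lemma seqSplit_vec1 (P : ℕ → AlgRep Kq (Uq n)) (D : ∀ a b : ℕ+, P (a + b : ℕ) ⟶ P a ⊗ P b)
    (a b : ℕ+) (x : (P (a + b : ℕ)).V) :
    AlgRep.lin (seqSplit P D a b) (vec1 P (a := a + b) x) = duo P a b (AlgRep.lin (D a b) x) := by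
  have h : ∀ t : (P a ⊗ P b : AlgRep Kq (Uq n)).V,
      AlgRep.lin (α_ (P a) (P b) (𝟙_ _)).hom (t ⊗ₜ (1 : Kq)) = duo P a b t := fun t =>
    LinearMap.congr_fun (f := (α_ (P a) (P b) (𝟙_ _)).hom.1 ∘ₗ
      (TensorProduct.mk Kq _ Kq).flip 1) (g := duo P a b) (TensorProduct.ext' fun x y => rfl) t
  exact h _

lemma seqTens_split_left (P : ℕ → AlgRep Kq (Uq n))
    (D : ∀ a b : ℕ+, P (a + b : ℕ) ⟶ P a ⊗ P b) (a b c : ℕ+)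
    (t : (P (a + b : ℕ) ⊗ P c : AlgRep Kq (Uq n)).V) :
    AlgRep.lin (seqTens P (X := [a + b]) (Y := [a, b]) (Y' := [c]) (seqSplit P D a b)
      (𝟙 (seqObj P [c]))) (duo P (a + b) c t) =
        trip P a b c (TensorProduct.assoc Kq _ _ _ (TensorProduct.map (D a b).1 LinearMap.id t)) := by
  refine LinearMap.congr_fun (f := (seqTens P (X := [a + b]) (Y := [a, b]) (Y' := [c])
    (seqSplit P D a b) (𝟙 (seqObj P [c]))).1 ∘ₗ duo P (a + b) c)
    (g := trip P a b c ∘ₗ (TensorProduct.assoc Kq _ _ _).toLinearMap ∘ₗ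
      TensorProduct.map (D a b).1 LinearMap.id) (TensorProduct.ext' fun x z => ?_) t
  have h : ∀ u : (P a ⊗ P b : AlgRep Kq (Uq n)).V,
      AlgRep.lin (seqMu P [a, b] [c]).inv (duo P a b u ⊗ₜ vec1 P z) =
        trip P a b c (TensorProduct.assoc Kq _ _ _ (u ⊗ₜ z)) := fun u =>
    LinearMap.congr_fun (f := (seqMu P [a, b] [c]).inv.1 ∘ₗ
        (TensorProduct.mk Kq _ _).flip (vec1 P z) ∘ₗ duo P a b)
      (g := trip P a b c ∘ₗ (TensorProduct.assoc Kq _ _ _).toLinearMap ∘ₗ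
        (TensorProduct.mk Kq _ _).flip z) (TensorProduct.ext' fun x y =>
          seqMu_inv_pair P a b [c] x y (vec1 P z)) u
  refine Eq.trans ?_ (h _)
  exact congrArg (fun u => AlgRep.lin (seqMu P [a, b] [c]).inv (u ⊗ₜ vec1 P z))
    (seqSplit_vec1 P D a b x)

lemma seqTens_split_right (P : ℕ → AlgRep Kq (Uq n))
    (D : ∀ a b : ℕ+, P (a + b : ℕ) ⟶ P a ⊗ P b) (a b c : ℕ+)
    (t : (P a ⊗ P (b + c : ℕ) : AlgRep Kq (Uq n)).V) :
    AlgRep.lin (seqTens P (X := [a]) (Y := [a]) (X' := [b + c]) (Y' := [b, c])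
      (𝟙 (seqObj P [a])) (seqSplit P D b c)) (duo P a (b + c) t) =
        trip P a b c (TensorProduct.map LinearMap.id (D b c).1 t) := by
  refine LinearMap.congr_fun (f := (seqTens P (X := [a]) (Y := [a]) (X' := [b + c]) (Y' := [b, c])
    (𝟙 (seqObj P [a])) (seqSplit P D b c)).1 ∘ₗ duo P a (b + c))
    (g := trip P a b c ∘ₗ TensorProduct.map LinearMap.id (D b c).1)
    (TensorProduct.ext' fun x z => ?_) t
  have h : ∀ u : (P b ⊗ P c : AlgRep Kq (Uq n)).V,
      AlgRep.lin (seqMu P [a] [b, c]).inv (vec1 P x ⊗ₜ duo P b c u) =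
        trip P a b c (x ⊗ₜ u) := fun u =>
    LinearMap.congr_fun (f := (seqMu P [a] [b, c]).inv.1 ∘ₗ
        (TensorProduct.mk Kq _ _) (vec1 P x) ∘ₗ duo P b c)
      (g := trip P a b c ∘ₗ (TensorProduct.mk Kq _ _) x)
      (TensorProduct.ext' fun y z => seqMu_inv_single P a [b, c] x (vec2 P y z)) u
  refine Eq.trans ?_ (h _)
  exact congrArg (fun u => AlgRep.lin (seqMu P [a] [b, c]).inv (vec1 P x ⊗ₜ u))
    (seqSplit_vec1 P D b c z)

lemma qSplit_coassoc (a b c : ℕ+) :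
    seqCast (qPow n s) (congrArg (fun x => [x]) (_root_.add_assoc a b c).symm) ≫
      seqSplit (qPow n s) (fun a b => qSplit s a b) (a + b) c ≫
      seqTens (qPow n s) (Y := [a, b]) (Y' := [c])
        (seqSplit (qPow n s) (fun a b => qSplit s a b) a b) (𝟙 (seqObj (qPow n s) [c])) =
    seqSplit (qPow n s) (fun a b => qSplit s a b) a (b + c) ≫
      seqTens (qPow n s) (Y := [a]) (Y' := [b, c]) (𝟙 (seqObj (qPow n s) [a]))
        (seqSplit (qPow n s) (fun a b => qSplit s a b) b c) := by
  refine AlgRep.hom_ext (seq1_ext (qPow n s) (a := a + (b + c)) fun x => ?_)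
  let D : ∀ a b : ℕ+, qPow n s (a + b : ℕ) ⟶ qPow n s a ⊗ qPow n s b := fun a b => qSplit s a b
  have hc : ([a + (b + c)] : List ℕ+) = [a + b + c] :=
    congrArg (fun x => [x]) (_root_.add_assoc a b c).symm
  obtain ⟨u, hu⟩ : ∃ u : (qPow n s (a + b + c : ℕ)).V,
      AlgRep.lin (seqCast (qPow n s) hc) (vec1 (qPow n s) x) =
        vec1 (qPow n s) (a := a + b + c) u := ⟨_, (vec1_unvec _ (a + b + c) _).symm⟩
  have hn : nf s (a + b + c) u = nf s (a + (b + c)) x := by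
    refine (js_single s (a + b + c) u).symm.trans ?_
    refine (congrArg (js s [a + b + c]) hu.symm).trans ?_
    exact (js_cast s hc _).trans (js_single s (a + (b + c)) x)
  refine (congrArg (fun t => AlgRep.lin (seqTens (qPow n s) (X := [a + b]) (Y := [a, b])
    (Y' := [c]) (seqSplit (qPow n s) D a b) (𝟙 (seqObj (qPow n s) [c])))
      (AlgRep.lin (seqSplit (qPow n s) D (a + b) c) t)) hu).trans ?_
  refine (congrArg (AlgRep.lin (seqTens (qPow n s) (X := [a + b]) (Y := [a, b])
    (Y' := [c]) (seqSplit (qPow n s) D a b) (𝟙 (seqObj (qPow n s) [c]))))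
      (seqSplit_vec1 (qPow n s) D (a + b) c u)).trans ?_
  refine (seqTens_split_left (qPow n s) D a b c _).trans ?_
  refine Eq.trans ?_ (congrArg (AlgRep.lin (seqTens (qPow n s) (X := [a]) (Y := [a])
    (X' := [b + c]) (Y' := [b, c]) (𝟙 (seqObj (qPow n s) [a])) (seqSplit (qPow n s) D b c)))
      (seqSplit_vec1 (qPow n s) D a (b + c) x)).symm
  refine Eq.trans ?_ (seqTens_split_right (qPow n s) D a b c _).symm
  exact congrArg (trip (qPow n s) a b c) (qCom_coassoc s hn)

/-- The merges and splits of quantum powers satisfy the web relations. -/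
lemma qPow_webRelations :
    WebRelations (qPow n s) (fun a b => qMul s a b) (fun a b => qSplit s a b) where
  merge_assoc := qMul_merge_assoc s
  split_coassoc := qSplit_coassoc s
  square := evQ_square s
  square_left := evQ_square_left s
  square_right := evQ_square_right s

lemma duo_qCom {a b : ℕ+} {w : Fin (a + b : ℕ) → Fin n} (hw : Std s w) :
    duo (qPow n s) a b (qCom s a b (qVec s w)) =
      ∑ A : {A : Finset (Fin (a + b : ℕ)) // A.card = a}, qCoef s a b w A.1 •
        vec2 (qPow n s) (a := a) (b := b) (qVec s (pick w A.1 A.2))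
          (qVec s (pick w A.1ᶜ (card_compl' A.2))) := by
  rw [qCom_qVec hw, map_sum]
  exact Finset.sum_congr rfl fun A _ => map_smul _ _ _

/-- The functor given by the merges and splits of quantum powers is a presentation functor. -/
lemma isGammaA_webFunctor : IsGammaA (qPow n s) (fun w => qVec s w) (fun w => Std s w)
    (fun a b w A => qCoef s a b w A) (webFunctor (qPow_webRelations s)) where
  tens f g := webFunctor_tens _ f g
  merge a b v w := congrArg (vec1 (qPow n s) (a := a + b)) (qMulB_qVec s v w)
  split a b w hw := (seqSplit_vec1 (qPow n s) (fun a b => qSplit s a b) a b (qVec s w)).trans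
    (duo_qCom s hw)

/-- The type A presentation functor exists and is unique. -/
lemma gammaA_exists_unique : ∃! F, IsGammaA (qPow n s) (fun w => qVec s w) (fun w => Std s w)
    (fun a b w A => qCoef s a b w A) F := by
  refine ⟨webFunctor (qPow_webRelations s), isGammaA_webFunctor s, ?_⟩
  · intro F hF
    refine webA_functor_ext hF.tens (webFunctor_tens _) (fun a b => ?_) fun a b => ?_
    · refine AlgRep.hom_ext (seq2_ext (qPow n s) (a := a) (b := b) fun x y => ?_)
      have key : ∀ (v : Fin a → Fin n) (w : Fin b → Fin n),
          AlgRep.lin (F.map (X := ([a, b] : List ℕ+)) (Y := ([a + b] : List ℕ+))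
            (WHom.merge a b)) (vec2 (qPow n s) (qVec s v) (qVec s w)) =
          AlgRep.lin (seqMerge (qPow n s) (fun a b => qMul s a b) a b)
            (vec2 (qPow n s) (qVec s v) (qVec s w)) := fun v w =>
        (hF.merge a b v w).trans
          (congrArg (vec1 (qPow n s) (a := a + b)) (qMulB_qVec s v w)).symm
      let V2 : (qPow n s a).V →ₗ[Kq] (qPow n s b).V →ₗ[Kq] (seqObj (qPow n s) [a, b]).V :=
        (TensorProduct.mk Kq _ _).compr₂ (duo (qPow n s) a b)
      have key2 : V2.compr₂ (F.map (X := ([a, b] : List ℕ+)) (Y := ([a + b] : List ℕ+))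
            (WHom.merge a b)).1 =
          V2.compr₂ (seqMerge (qPow n s) (fun a b => qMul s a b) a b).1 :=
        qPow_ext fun v => qPow_ext fun w => key v w
      exact LinearMap.congr_fun (LinearMap.congr_fun key2 x) y
    · refine AlgRep.hom_ext (seq1_ext (qPow n s) (a := a + b) fun x => ?_)
      let V1 : (qPow n s (a + b : ℕ)).V →ₗ[Kq] (seqObj (qPow n s) [a + b]).V :=
        (ρ_ (qPow n s (a + b : ℕ))).inv.1
      have key : (F.map (X := ([a + b] : List ℕ+)) (Y := ([a, b] : List ℕ+))
            (WHom.split a b)).1 ∘ₗ V1 =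
          (seqSplit (qPow n s) (fun a b => qSplit s a b) a b).1 ∘ₗ V1 :=
        qPow_std_ext fun w hw => (hF.split a b w hw).trans
          ((seqSplit_vec1 (qPow n s) (fun a b => qSplit s a b) a b (qVec s w)).trans
            (duo_qCom s hw)).symm
      exact LinearMap.congr_fun key x

lemma gammaAExt_exists_unique (n : ℕ) : ∃! F, IsGammaAExt n F := gammaA_exists_unique false

lemma gammaASym_exists_unique (n : ℕ) : ∃! F, IsGammaASym n F := gammaA_exists_unique true

end GammaAExists

section ActFunctor

variable {n : ℕ}

section LinearTensor

variable (P : ℕ → AlgRep Kq (Uq n))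

lemma seqMu_hom_inv (X Y : List ℕ+) (x : (seqObj P (X ++ Y)).V) :
    AlgRep.lin (seqMu P X Y).inv (AlgRep.lin (seqMu P X Y).hom x) = x :=
  LinearMap.congr_fun (congrArg AlgRep.lin (seqMu P X Y).hom_inv_id) x

lemma seqMu_inv_hom (X Y : List ℕ+) (x : (seqObj P X ⊗ seqObj P Y : AlgRep Kq (Uq n)).V) :
    AlgRep.lin (seqMu P X Y).hom (AlgRep.lin (seqMu P X Y).inv x) = x :=
  LinearMap.congr_fun (congrArg AlgRep.lin (seqMu P X Y).inv_hom_id) x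

/-- The tensor product of linear maps between the values of sequences. -/
noncomputable def lten {X Y X' Y' : List ℕ+} (f : (seqObj P X).V →ₗ[Kq] (seqObj P Y).V)
    (g : (seqObj P X').V →ₗ[Kq] (seqObj P Y').V) :
    (seqObj P (X ++ X')).V →ₗ[Kq] (seqObj P (Y ++ Y')).V :=
  (seqMu P Y Y').inv.1 ∘ₗ TensorProduct.map f g ∘ₗ (seqMu P X X').hom.1

variable {M N L : Type} [AddCommGroup M] [Module Kq M] [AddCommGroup N] [Module Kq N]
  [AddCommGroup L] [Module Kq L]

lemma box_lten {X Y X' Y' : List ℕ+} (f : (seqObj P X).V →ₗ[Kq] (seqObj P Y).V)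
    (g : (seqObj P X').V →ₗ[Kq] (seqObj P Y').V) (φ : (seqObj P Y).V →ₗ[Kq] M)
    (ψ : (seqObj P Y').V →ₗ[Kq] N) : box P φ ψ ∘ₗ lten P f g = box P (φ ∘ₗ f) (ψ ∘ₗ g) := by
  refine LinearMap.ext fun x => ?_
  refine (congrArg (TensorProduct.map φ ψ) (seqMu_inv_hom P Y Y' _)).trans ?_
  rw [box, TensorProduct.map_comp]
  rfl

lemma map_comp_box {X Y : List ℕ+} {M' N' : Type} [AddCommGroup M'] [Module Kq M']
    [AddCommGroup N'] [Module Kq N'] (F : M →ₗ[Kq] M') (G : N →ₗ[Kq] N')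
    (φ : (seqObj P X).V →ₗ[Kq] M) (ψ : (seqObj P Y).V →ₗ[Kq] N) :
    TensorProduct.map F G ∘ₗ box P φ ψ = box P (F ∘ₗ φ) (G ∘ₗ ψ) := by
  rw [box, box, TensorProduct.map_comp, LinearMap.comp_assoc]

lemma box_id_injective (X Y : List ℕ+) :
    Function.Injective (box P (X := X) (Y := Y) LinearMap.id LinearMap.id) := by
  intro x y h
  rw [box, TensorProduct.map_id] at h
  have := congrArg (AlgRep.lin (seqMu P X Y).inv) h
  exact (seqMu_hom_inv P X Y x).symm.trans (this.trans (seqMu_hom_inv P X Y y))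

lemma box_right_injective (X Y Z : List ℕ+) : Function.Injective
    (box P (X := X) (Y := Y ++ Z) LinearMap.id
      (box P (X := Y) (Y := Z) LinearMap.id LinearMap.id)) := by
  have h : TensorProduct.map LinearMap.id
        (box P (X := Y) (Y := Z) LinearMap.id LinearMap.id) ∘ₗ
        box P (X := X) (Y := Y ++ Z) LinearMap.id LinearMap.id =
      box P (X := X) (Y := Y ++ Z) LinearMap.id
        (box P (X := Y) (Y := Z) LinearMap.id LinearMap.id) := by
    rw [map_comp_box, LinearMap.comp_id, LinearMap.comp_id]
  rw [← h]
  have h1 : Function.Injective (TensorProduct.map (LinearMap.id : (seqObj P X).V →ₗ[Kq] _)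
      (box P (X := Y) (Y := Z) LinearMap.id LinearMap.id)) :=
    TensorProduct.map_injective_of_flat_flat _ _ Function.injective_id (box_id_injective P Y Z)
  intro x y hxy
  exact box_id_injective P X (Y ++ Z) (h1 hxy)

lemma lten_assoc {X Y X' Y' X'' Y'' : List ℕ+} (f : (seqObj P X).V →ₗ[Kq] (seqObj P Y).V)
    (g : (seqObj P X').V →ₗ[Kq] (seqObj P Y').V) (h : (seqObj P X'').V →ₗ[Kq] (seqObj P Y'').V) :
    (seqCast P (List.append_assoc Y Y' Y'')).1 ∘ₗ lten P (lten P f g) h =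
      lten P f (lten P g h) ∘ₗ (seqCast P (List.append_assoc X X' X'')).1 := by
  refine LinearMap.ext fun x => box_right_injective P Y Y' Y'' ?_
  refine (box_assoc P LinearMap.id LinearMap.id LinearMap.id _).trans ?_
  have e1 : box P (box P LinearMap.id LinearMap.id) LinearMap.id ∘ₗ lten P (lten P f g) h =
      box P (box P f g) h := by
    rw [box_lten, box_lten]
    rfl
  have e2 : box P LinearMap.id (box P LinearMap.id LinearMap.id) ∘ₗ lten P f (lten P g h) =
      box P f (box P g h) := by
    rw [box_lten, box_lten]
    rfl
  refine (congrArg (TensorProduct.assoc Kq _ _ _) (LinearMap.congr_fun e1 x)).trans ?_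
  refine Eq.trans ?_ (LinearMap.congr_fun e2 _).symm
  exact (box_assoc P f g h x).symm

lemma lten_comp {X Y Z X' Y' Z' : List ℕ+} (f : (seqObj P X).V →ₗ[Kq] (seqObj P Y).V)
    (g : (seqObj P X').V →ₗ[Kq] (seqObj P Y').V) (f' : (seqObj P Y).V →ₗ[Kq] (seqObj P Z).V)
    (g' : (seqObj P Y').V →ₗ[Kq] (seqObj P Z').V) :
    lten P (f' ∘ₗ f) (g' ∘ₗ g) = lten P f' g' ∘ₗ lten P f g := by
  refine LinearMap.ext fun x => ?_
  have e : ∀ y, TensorProduct.map (f' ∘ₗ f) (g' ∘ₗ g) y =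
      TensorProduct.map f' g' (TensorProduct.map f g y) := fun y =>
    LinearMap.congr_fun (TensorProduct.map_comp f' g' f g) y
  refine (congrArg (seqMu P Z Z').inv.1 (e _)).trans ?_
  exact congrArg (fun y => (seqMu P Z Z').inv.1 (TensorProduct.map f' g' y))
    (seqMu_inv_hom P Y Y' _).symm

lemma lten_add_left {X Y X' Y' : List ℕ+} (f f' : (seqObj P X).V →ₗ[Kq] (seqObj P Y).V)
    (g : (seqObj P X').V →ₗ[Kq] (seqObj P Y').V) :
    lten P (f + f') g = lten P f g + lten P f' g := by
  rw [lten, TensorProduct.map_add_left, LinearMap.add_comp, LinearMap.comp_add]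
  rfl

lemma lten_add_right {X Y X' Y' : List ℕ+} (f : (seqObj P X).V →ₗ[Kq] (seqObj P Y).V)
    (g g' : (seqObj P X').V →ₗ[Kq] (seqObj P Y').V) :
    lten P f (g + g') = lten P f g + lten P f g' := by
  rw [lten, TensorProduct.map_add_right, LinearMap.add_comp, LinearMap.comp_add]
  rfl

lemma lten_smul_left {X Y X' Y' : List ℕ+} (c : Kq) (f : (seqObj P X).V →ₗ[Kq] (seqObj P Y).V)
    (g : (seqObj P X').V →ₗ[Kq] (seqObj P Y').V) : lten P (c • f) g = c • lten P f g := by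
  rw [lten, TensorProduct.map_smul_left, LinearMap.smul_comp, LinearMap.comp_smul]
  rfl

lemma lten_smul_right {X Y X' Y' : List ℕ+} (c : Kq) (f : (seqObj P X).V →ₗ[Kq] (seqObj P Y).V)
    (g : (seqObj P X').V →ₗ[Kq] (seqObj P Y').V) : lten P f (c • g) = c • lten P f g := by
  rw [lten, TensorProduct.map_smul_right, LinearMap.smul_comp, LinearMap.comp_smul]
  rfl

lemma unit_lten {X Y : List ℕ+} (f : (seqObj P X).V →ₗ[Kq] (seqObj P Y).V) :
    lten P (X := []) (Y := []) LinearMap.id f = f :=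
  LinearMap.ext fun x => one_smul Kq (f x)

end LinearTensor

variable {P : ℕ → AlgRep Kq (Uq n)} {G : List ℕ+ → List ℕ+ → Type}
  {R : {X Y : List ℕ+} → ActTm G X Y → ActTm G X Y → Prop}

/-- The value of a formal expression, for given values of the generators. -/
noncomputable def evAct (FA : LinFunctorOn (C := WebA) (seqObj P))
    (γ : {X Y : List ℕ+} → G X Y → (seqRes P X ⟶ seqRes P Y)) :
    {X Y : List ℕ+} → ActTm G X Y → (seqRes P X ⟶ seqRes P Y)
  | _, _, .gen g => γ g
  | X, Y, .onUnit f => (resSp n).map (FA.map (X := (X : WebA)) (Y := (Y : WebA)) f)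
  | _, _, .act (X := X) (Y := Y) (X' := X') (Y' := Y') f t =>
    (seqNu P X X').hom ≫ (FA.map (X := (X : WebA)) (Y := (Y : WebA)) f ⊙ₗₘ evAct FA γ t) ≫
      (seqNu P Y Y').inv
  | _, _, .comp s t => evAct FA γ s ≫ evAct FA γ t
  | _, _, .zero => 0
  | _, _, .add s t => evAct FA γ s + evAct FA γ t
  | _, _, .smul c t => c • evAct FA γ t

variable {FA : LinFunctorOn (C := WebA) (seqObj P)}
  {γ : {X Y : List ℕ+} → G X Y → (seqRes P X ⟶ seqRes P Y)}

lemma evAct_act {X Y X' Y' : List ℕ+} (f : WHom X Y) (t : ActTm G X' Y') :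
    (evAct FA γ (ActTm.act f t)).1 =
      lten P (FA.map (X := (X : WebA)) (Y := (Y : WebA)) f).1 (evAct FA γ t).1 := rfl

lemma LinFunctorOn.map_cast (FA : LinFunctorOn (C := WebA) (seqObj P)) {X Y : List ℕ+}
    (h : X = Y) : FA.map (X := (X : WebA)) (Y := (Y : WebA)) (WHom.cast h) = seqCast P h := by
  subst h
  exact FA.map_id _

lemma LinFunctorOn.lin_map_cast {X Y : List ℕ+} (h : X = Y) :
    (FA.map (X := (X : WebA)) (Y := (Y : WebA)) (WHom.cast h)).1 = (seqCast P h).1 :=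
  congrArg AlgRep.lin (FA.map_cast h)

variable (FA γ)

lemma evAct_act_congr {X Y X' Y' : List ℕ+} (f : WHom X Y) {s t : ActTm G X' Y'}
    (h : evAct FA γ s = evAct FA γ t) :
    (evAct FA γ (ActTm.act f s)).1 = (evAct FA γ (ActTm.act f t)).1 := by
  rw [evAct_act, evAct_act, h]

lemma evAct_act_comp {X Y Z X' Y' Z' : List ℕ+} (f : WHom X Y) (g : WHom Y Z)
    (s : ActTm G X' Y') (t : ActTm G Y' Z') :
    (evAct FA γ (ActTm.act (WHom.comp f g) (ActTm.comp s t))).1 =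
      (evAct FA γ (ActTm.comp (ActTm.act f s) (ActTm.act g t))).1 := by
  have h := congrArg AlgRep.lin (FA.map_comp (X := X) (Y := Y) (Z := Z) f g)
  refine (congrArg (fun u => lten P u (evAct FA γ (ActTm.comp s t)).1) h).trans ?_
  exact lten_comp P _ (evAct FA γ s).1 _ (evAct FA γ t).1

lemma evAct_add_act {X Y X' Y' : List ℕ+} (f g : WHom X Y) (t : ActTm G X' Y') :
    (evAct FA γ (ActTm.act (f + g) t)).1 =
      (evAct FA γ (ActTm.add (ActTm.act f t) (ActTm.act g t))).1 := by
  have h := congrArg AlgRep.lin (map_add (FA.map (X := (X : WebA)) (Y := (Y : WebA))) f g)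
  exact (congrArg (fun u => lten P u (evAct FA γ t).1) h).trans (lten_add_left P _ _ _)

lemma evAct_smul_act {X Y X' Y' : List ℕ+} (c : Kq) (f : WHom X Y) (t : ActTm G X' Y') :
    (evAct FA γ (ActTm.act (c • f) t)).1 = (evAct FA γ (ActTm.smul c (ActTm.act f t))).1 := by
  have h := congrArg AlgRep.lin (map_smul (FA.map (X := (X : WebA)) (Y := (Y : WebA))) c f)
  exact (congrArg (fun u => lten P u (evAct FA γ t).1) h).trans (lten_smul_left P c _ _)

lemma evAct_tens_act
    (hFA : ∀ {X Y X' Y' : WebA} (f : X ⟶ Y) (g : X' ⟶ Y'), FA.map (f ⊗ₘ g) =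
      (seqMu P X X').hom ≫ (FA.map f ⊗ₘ FA.map g) ≫ (seqMu P Y Y').inv)
    {X Y X' Y' X'' Y'' : List ℕ+} (f : WHom X Y) (g : WHom X' Y') (t : ActTm G X'' Y'') :
    (evAct FA γ (ActTm.comp (ActTm.act (WHom.tens f g) t)
        (ActTm.onUnit (WHom.cast (List.append_assoc Y Y' Y''))))).1 =
      (evAct FA γ (ActTm.comp (ActTm.onUnit (WHom.cast (List.append_assoc X X' X'')))
        (ActTm.act f (ActTm.act g t)))).1 := by
  have h1 := congrArg (fun u => lten P (AlgRep.lin u) (evAct FA γ t).1)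
    (hFA (X := X) (Y := Y) (X' := X') (Y' := Y') f g)
  have c1 := FA.lin_map_cast (List.append_assoc Y Y' Y'')
  have c2 := FA.lin_map_cast (List.append_assoc X X' X'')
  have e := lten_assoc P (FA.map (X := (X : WebA)) (Y := (Y : WebA)) f).1
    (FA.map (X := (X' : WebA)) (Y := (Y' : WebA)) g).1 (evAct FA γ t).1
  refine (congrArg₂ (fun u v => u ∘ₗ v) c1 h1).trans (e.trans ?_)
  exact congrArg (fun u => lten P (FA.map (X := (X : WebA)) (Y := (Y : WebA)) f).1
        (lten P (FA.map (X := (X' : WebA)) (Y := (Y' : WebA)) g).1 (evAct FA γ t).1) ∘ₗ u) c2.symm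

lemma evAct_unit_act {X Y : List ℕ+} (t : ActTm G X Y) :
    (evAct FA γ (ActTm.act (WHom.one []) t)).1 = (evAct FA γ t).1 := by
  have h := congrArg AlgRep.lin (FA.map_id ([] : List ℕ+))
  exact (congrArg (fun u => lten P u (evAct FA γ t).1) h).trans (unit_lten P _)

variable {FA γ}

set_option maxHeartbeats 1000000 in
lemma evAct_sound
    (hFA : ∀ {X Y X' Y' : WebA} (f : X ⟶ Y) (g : X' ⟶ Y'), FA.map (f ⊗ₘ g) =
      (seqMu P X X').hom ≫ (FA.map f ⊗ₘ FA.map g) ≫ (seqMu P Y Y').inv)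
    (hR : ∀ {X Y : List ℕ+} {s t : ActTm G X Y}, R s t → evAct FA γ s = evAct FA γ t)
    {X Y : List ℕ+} {s t : ActTm G X Y} (h : ActTm.Rel R s t) :
    evAct FA γ s = evAct FA γ t := by
  induction h with
  | of h => exact hR h
  | refl => rfl
  | symm _ ih => exact ih.symm
  | trans _ _ ih ih' => exact ih.trans ih'
  | comp _ _ ih ih' => exact congrArg₂ (· ≫ ·) ih ih'
  | act f _ ih =>
    exact AlgRep.hom_ext (evAct_act_congr FA γ f ih)
  | add _ _ ih ih' => exact congrArg₂ (· + ·) ih ih'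
  | smul c _ ih => exact congrArg (c • ·) ih
  | add_assoc => exact _root_.add_assoc _ _ _
  | add_comm => exact _root_.add_comm _ _
  | add_zero => exact _root_.add_zero _
  | zero_smul => exact _root_.zero_smul _ _
  | one_smul => exact _root_.one_smul _ _
  | mul_smul => exact SemigroupAction.mul_smul _ _ _
  | add_smul => exact _root_.add_smul _ _ _
  | smul_add => exact _root_.smul_add _ _ _
  | @id_comp X Y s =>
    have h := congrArg (resSp n).map (FA.map_id X)
    exact (congrArg (· ≫ evAct FA γ s) h).trans (Category.id_comp _)
  | @comp_id X Y s =>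
    have h := congrArg (resSp n).map (FA.map_id Y)
    exact (congrArg (evAct FA γ s ≫ ·) h).trans (Category.comp_id _)
  | assoc => exact Category.assoc _ _ _
  | add_comp => exact Preadditive.add_comp _ _ _ _ _ _
  | comp_add => exact Preadditive.comp_add _ _ _ _ _ _
  | smul_comp => exact Linear.smul_comp _ _ _ _ _ _
  | comp_smul => exact Linear.comp_smul _ _ _ _ _ _
  | @onUnit_comp X Y Z f g =>
    exact congrArg (resSp n).map (FA.map_comp (X := X) (Y := Y) (Z := Z) f g)
  | @onUnit_add X Y f g =>
    have h := congrArg AlgRep.lin (map_add (FA.map (X := (X : WebA)) (Y := (Y : WebA))) f g)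
    exact AlgRep.hom_ext h
  | @onUnit_smul X Y c f =>
    have h := congrArg AlgRep.lin (map_smul (FA.map (X := (X : WebA)) (Y := (Y : WebA))) c f)
    exact AlgRep.hom_ext h
  | @act_onUnit X Y X' Y' f g =>
    exact AlgRep.hom_ext (congrArg AlgRep.lin
      (hFA (X := X) (Y := Y) (X' := X') (Y' := Y') f g)).symm
  | act_comp f g s t => exact AlgRep.hom_ext (evAct_act_comp FA γ f g s t)
  | add_act f g t => exact AlgRep.hom_ext (evAct_add_act FA γ f g t)
  | act_add f s t => exact AlgRep.hom_ext (lten_add_right P _ _ _)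
  | smul_act c f t => exact AlgRep.hom_ext (evAct_smul_act FA γ c f t)
  | act_smul c f t => exact AlgRep.hom_ext (lten_smul_right P c _ _)
  | tens_act f g t => exact AlgRep.hom_ext (evAct_tens_act FA γ hFA f g t)
  | unit_act t => exact AlgRep.hom_ext (evAct_unit_act FA γ t)

/-- The functor given by values of the generators which satisfy the relations. -/
noncomputable def actFunctor
    (hFA : ∀ {X Y X' Y' : WebA} (f : X ⟶ Y) (g : X' ⟶ Y'), FA.map (f ⊗ₘ g) =
      (seqMu P X X').hom ≫ (FA.map f ⊗ₘ FA.map g) ≫ (seqMu P Y Y').inv)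
    (hR : ∀ {X Y : List ℕ+} {s t : ActTm G X Y}, R s t → evAct FA γ s = evAct FA γ t) :
    LinFunctorOn (C := ActWeb G R) (seqRes P) where
  map {X Y} :=
    { toFun := fun f => Quotient.lift (evAct FA γ) (fun _ _ h => evAct_sound hFA hR h) f
      map_add' := by
        rintro ⟨f⟩ ⟨g⟩
        rfl
      map_smul' := by
        rintro c ⟨f⟩
        rfl }
  map_id X := congrArg (resSp n).map (FA.map_id X)
  map_comp := by
    rintro X Y Z ⟨f⟩ ⟨g⟩
    rfl

lemma actFunctor_isExtension
    (hFA : ∀ {X Y X' Y' : WebA} (f : X ⟶ Y) (g : X' ⟶ Y'), FA.map (f ⊗ₘ g) =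
      (seqMu P X X').hom ≫ (FA.map f ⊗ₘ FA.map g) ≫ (seqMu P Y Y').inv)
    (hR : ∀ {X Y : List ℕ+} {s t : ActTm G X Y}, R s t → evAct FA γ s = evAct FA γ t) :
    IsExtension P FA (actFunctor hFA hR : LinFunctorOn (C := ActWeb G R) (seqRes P)) where
  onUnit f := rfl
  act f t := by
    obtain ⟨t, rfl⟩ := AHom.mk_surj t
    rfl

lemma actWeb_functor_ext {F F' : LinFunctorOn (C := ActWeb G R) (seqRes P)}
    (hF : IsExtension P FA F) (hF' : IsExtension P FA F')
    (hg : ∀ {X Y : List ℕ+} (g : G X Y),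
      F.map (X := (X : List ℕ+)) (Y := (Y : List ℕ+)) (AHom.gen g) =
        F'.map (X := (X : List ℕ+)) (Y := (Y : List ℕ+)) (AHom.gen g)) : F = F' := by
  have key : ∀ {X Y : List ℕ+} (t : ActTm G X Y),
      F.map (X := (X : List ℕ+)) (Y := (Y : List ℕ+)) (AHom.mk t) =
        F'.map (X := (X : List ℕ+)) (Y := (Y : List ℕ+)) (AHom.mk t) := by
    intro X Y t
    induction t with
    | gen g => exact hg g
    | @onUnit X Y f =>
      exact (hF.onUnit (X := X) (Y := Y) f).trans (hF'.onUnit (X := X) (Y := Y) f).symm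
    | @act X Y X' Y' f t ih =>
      refine (hF.act (X := X) (Y := Y) (X' := X') (Y' := Y') f (AHom.mk t)).trans ?_
      rw [ih]
      exact (hF'.act (X := X) (Y := Y) (X' := X') (Y' := Y') f (AHom.mk t)).symm
    | @comp X Y Z s t ihs iht =>
      have e : ∀ H : LinFunctorOn (C := ActWeb G R) (seqRes P),
          H.map (X := (X : List ℕ+)) (Y := (Z : List ℕ+)) (AHom.mk (ActTm.comp s t)) =
          H.map (X := (X : List ℕ+)) (Y := (Y : List ℕ+)) (AHom.mk s) ≫
            H.map (X := (Y : List ℕ+)) (Y := (Z : List ℕ+)) (AHom.mk t) :=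
          fun H => H.map_comp (X := (X : List ℕ+)) (Y := (Y : List ℕ+)) (Z := (Z : List ℕ+))
            (AHom.mk s) (AHom.mk t)
      rw [e, e, ihs, iht]
    | @zero X Y =>
      have e : ∀ H : LinFunctorOn (C := ActWeb G R) (seqRes P),
          H.map (X := (X : List ℕ+)) (Y := (Y : List ℕ+)) (AHom.mk ActTm.zero) = 0 :=
        fun H => H.map_zero_hom X Y
      rw [e, e]
    | add s t ihs iht =>
      refine (map_add F.map (AHom.mk s) (AHom.mk t)).trans ?_
      rw [ihs, iht]
      exact (map_add F'.map (AHom.mk s) (AHom.mk t)).symm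
    | smul c t ih =>
      refine (map_smul F.map c (AHom.mk t)).trans ?_
      rw [ih]
      exact (map_smul F'.map c (AHom.mk t)).symm
  refine LinFunctorOn.ext_map fun X Y f => ?_
  obtain ⟨t, rfl⟩ := AHom.mk_surj f
  exact key t

end ActFunctor

section DirectSums

namespace AlgRep

variable {k : Type} [Field k] {A : Type} [Ring A] [Algebra k A] {J : Type} [Fintype J]

/-- The projection to a direct summand. -/
noncomputable def proj (f : J → AlgRep k A) (j : J) : dsum f ⟶ f j :=
  ⟨LinearMap.proj j, fun _ => rfl⟩

open scoped Classical in
lemma lin_incl_apply (f : J → AlgRep k A) (j : J) (x : (f j).V) :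
    lin (incl f j) x = (Pi.single j x : ∀ j, (f j).V) := rfl

lemma incl_proj_self (f : J → AlgRep k A) (j : J) : incl f j ≫ proj f j = 𝟙 (f j) := by
  classical
  refine hom_ext (LinearMap.ext fun x => ?_)
  exact (congrFun (lin_incl_apply f j x) j).trans
    (Pi.single_eq_same (M := fun j => (f j).V) j x)

lemma incl_proj_of_ne (f : J → AlgRep k A) {i j : J} (h : i ≠ j) : incl f i ≫ proj f j = 0 := by
  classical
  refine hom_ext (LinearMap.ext fun x => ?_)
  refine (congrFun (lin_incl_apply f i x) j).trans ?_
  exact Pi.single_eq_of_ne (M := fun j => (f j).V) h.symm x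

lemma dsum_hom_ext {f : J → AlgRep k A} {X : AlgRep k A} {φ ψ : dsum f ⟶ X}
    (h : ∀ j, incl f j ≫ φ = incl f j ≫ ψ) : φ = ψ := by
  classical
  refine hom_ext (LinearMap.pi_ext' fun j => ?_)
  exact congrArg lin (h j)

/-- The morphism out of a direct sum with given components. -/
noncomputable def desc {f : J → AlgRep k A} {X : AlgRep k A} (φ : ∀ j, f j ⟶ X) : dsum f ⟶ X :=
  ∑ j, proj f j ≫ φ j

lemma incl_desc {f : J → AlgRep k A} {X : AlgRep k A} (φ : ∀ j, f j ⟶ X) (j : J) :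
    incl f j ≫ desc φ = φ j := by
  classical
  rw [desc, Preadditive.comp_sum, Finset.sum_eq_single j]
  · rw [← Category.assoc, incl_proj_self, Category.id_comp]
  · intro i _ h
    rw [← Category.assoc, incl_proj_of_ne f h.symm, Limits.zero_comp]
  · exact fun h => absurd (Finset.mem_univ j) h

lemma incl_matrix {I : Type} [Fintype I] {f : I → AlgRep k A} {g : J → AlgRep k A}
    (m : ∀ i j, f i ⟶ g j) (i : I) : incl f i ≫ matrix m = ∑ j, m i j ≫ incl g j := by
  classical
  refine hom_ext (LinearMap.ext fun x => funext fun j => ?_)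
  refine (matrix_apply m _ j).trans ?_
  have e : lin (∑ j, m i j ≫ incl g j) x = ∑ j, lin (incl g j) (lin (m i j) x) := by
    rw [lin_sum, LinearMap.sum_apply]
    rfl
  refine Eq.trans ?_ (congrFun e j).symm
  have e' : (∑ j, lin (incl g j) (lin (m i j) x) : (dsum g).V) j =
      ∑ l, (lin (incl g l) (lin (m i l) x) : ∀ j, (g j).V) j :=
    Finset.sum_apply j Finset.univ fun l => (lin (incl g l) (lin (m i l) x) : ∀ j, (g j).V)
  refine Eq.trans ?_ e'.symm
  rw [Finset.sum_eq_single i, Finset.sum_eq_single j]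
  · have h1 := LinearMap.congr_fun (congrArg lin (incl_proj_self f i)) x
    have h2 := LinearMap.congr_fun (congrArg lin (incl_proj_self g j)) (lin (m i j) x)
    exact (congrArg (lin (m i j)) h1).trans h2.symm
  · intro l _ h
    exact LinearMap.congr_fun (congrArg lin (incl_proj_of_ne g h)) (lin (m i l) x)
  · exact fun h => absurd (Finset.mem_univ j) h
  · intro l _ h
    have h1 := LinearMap.congr_fun (congrArg lin (incl_proj_of_ne f h.symm)) x
    exact (congrArg (lin (m l j)) h1).trans (map_zero _)
  · exact fun h => absurd (Finset.mem_univ i) h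


end AlgRep

namespace AlgRep

variable {k : Type} [Field k] {A : Type} [Ring A] [Bialgebra k A] {B : Type} [Ring B]
  [Algebra k B] [LeftComoduleAlgebra k A B] {I J : Type} [Fintype I] [Fintype J]

lemma actionHom_add_left {X Y : AlgRep k A} {X' Y' : AlgRep k B} (f g : X ⟶ Y) (t : X' ⟶ Y') :
    (f + g) ⊙ₗₘ t = f ⊙ₗₘ t + g ⊙ₗₘ t :=
  hom_ext (TensorProduct.map_add_left (lin f) (lin g) (lin t))

lemma actionHom_add_right {X Y : AlgRep k A} {X' Y' : AlgRep k B} (f : X ⟶ Y) (s t : X' ⟶ Y') :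
    f ⊙ₗₘ (s + t) = f ⊙ₗₘ s + f ⊙ₗₘ t :=
  hom_ext (TensorProduct.map_add_right (lin f) (lin s) (lin t))

lemma zero_actionHom {X Y : AlgRep k A} {X' Y' : AlgRep k B} (t : X' ⟶ Y') :
    (0 : X ⟶ Y) ⊙ₗₘ t = 0 :=
  hom_ext (TensorProduct.map_zero_left (lin t))

lemma actionHom_zero {X Y : AlgRep k A} {X' Y' : AlgRep k B} (f : X ⟶ Y) :
    f ⊙ₗₘ (0 : X' ⟶ Y') = 0 :=
  hom_ext (TensorProduct.map_zero_right (lin f))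

lemma actionHom_sum {X Y : AlgRep k A} {X' Y' : AlgRep k B} (f : I → (X ⟶ Y))
    (t : J → (X' ⟶ Y')) :
    (∑ i, f i) ⊙ₗₘ (∑ j, t j) = ∑ p : I × J, f p.1 ⊙ₗₘ t p.2 := by
  let L : (X ⟶ Y) →+ (X' ⟶ Y') →+ (X ⊙ₗ X' ⟶ Y ⊙ₗ Y') :=
    AddMonoidHom.mk' (fun f => AddMonoidHom.mk' (fun t => f ⊙ₗₘ t)
      fun s t => actionHom_add_right f s t) fun f g => by
        ext1 t
        exact actionHom_add_left f g t
  change L (∑ i, f i) (∑ j, t j) = _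
  rw [map_sum L, AddMonoidHom.finsetSum_apply, Fintype.sum_prod_type]
  exact Finset.sum_congr rfl fun i _ => map_sum _ _ _

lemma dsum_act_hom_ext {f : I → AlgRep k A} {g : J → AlgRep k B} {X : AlgRep k B}
    {φ ψ : dsum f ⊙ₗ dsum g ⟶ X}
    (h : ∀ i j, (incl f i ⊙ₗₘ incl g j) ≫ φ = (incl f i ⊙ₗₘ incl g j) ≫ ψ) : φ = ψ := by
  classical
  refine hom_ext (TensorProduct.ext (LinearMap.pi_ext' fun i => LinearMap.ext fun x =>
    LinearMap.pi_ext' fun j => LinearMap.ext fun y => ?_))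
  exact LinearMap.congr_fun (congrArg lin (h i j)) (x ⊗ₜ y)

/-- The morphism out of a product of direct sums with given components. -/
noncomputable def actDesc {f : I → AlgRep k A} {g : J → AlgRep k B} {X : AlgRep k B}
    (φ : ∀ i j, f i ⊙ₗ g j ⟶ X) : dsum f ⊙ₗ dsum g ⟶ X :=
  ∑ p : I × J, (proj f p.1 ⊙ₗₘ proj g p.2) ≫ φ p.1 p.2

lemma incl_actDesc {f : I → AlgRep k A} {g : J → AlgRep k B} {X : AlgRep k B}
    (φ : ∀ i j, f i ⊙ₗ g j ⟶ X) (i : I) (j : J) :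
    (incl f i ⊙ₗₘ incl g j) ≫ actDesc φ = φ i j := by
  classical
  rw [actDesc, Preadditive.comp_sum, Finset.sum_eq_single (i, j)]
  · rw [← Category.assoc, ← MonoidalLeftAction.actionHom_comp, incl_proj_self, incl_proj_self,
      MonoidalLeftAction.id_actionHom, MonoidalLeftAction.actionHomRight_id, Category.id_comp]
  · rintro ⟨i', j'⟩ _ h
    rw [← Category.assoc, ← MonoidalLeftAction.actionHom_comp]
    by_cases hi : i = i'
    · have hj : j ≠ j' := fun hj => h (by rw [hi, hj])
      rw [incl_proj_of_ne g hj, actionHom_zero, Limits.zero_comp]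
    · rw [incl_proj_of_ne f hi, zero_actionHom, Limits.zero_comp]
  · exact fun h => absurd (Finset.mem_univ _) h

end AlgRep

end DirectSums

section Square

variable {n : ℕ} {P : ℕ → AlgRep Kq (Uq n)} {G : List ℕ+ → List ℕ+ → Type}
  {R : {X Y : List ℕ+} → ActTm G X Y → ActTm G X Y → Prop}
  (FA : LinFunctorOn (C := WebA) (seqObj P)) (F : LinFunctorOn (C := ActWeb G R) (seqRes P))

variable {FA F} in
lemma actThenF_hom_ext {M : Mat_ WebA} {N : Mat_ (ActWeb G R)} {Z : AlgRep Kq (Uqsp n)}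
    {φ ψ : (actThenF P F).obj (M, N) ⟶ Z}
    (h : ∀ i j, actThenFIncl P F M N i j ≫ φ = actThenFIncl P F M N i j ≫ ψ) : φ = ψ :=
  AlgRep.dsum_hom_ext fun p => h p.1 p.2

variable {FA F} in
lemma fThenAct_hom_ext {M : Mat_ WebA} {N : Mat_ (ActWeb G R)} {Z : AlgRep Kq (Uqsp n)}
    {φ ψ : (fThenAct P FA F).obj (M, N) ⟶ Z}
    (h : ∀ i j, fThenActIncl P FA F M N i j ≫ φ = fThenActIncl P FA F M N i j ≫ ψ) : φ = ψ :=
  AlgRep.dsum_act_hom_ext (f := fun i => seqObj P (M.X i)) (g := fun j => seqRes P (N.X j)) h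

/-- The canonical morphism on the additive closures. -/
noncomputable def squareHom (M : Mat_ WebA) (N : Mat_ (ActWeb G R)) :
    (actThenF P F).obj (M, N) ⟶ (fThenAct P FA F).obj (M, N) :=
  AlgRep.desc (f := fun p : M.ι × N.ι => seqRes P (List.append (M.X p.1) (N.X p.2)))
    fun p => (seqNu P (M.X p.1) (N.X p.2)).hom ≫ fThenActIncl P FA F M N p.1 p.2

/-- The inverse of the canonical morphism on the additive closures. -/
noncomputable def squareInv (M : Mat_ WebA) (N : Mat_ (ActWeb G R)) :
    (fThenAct P FA F).obj (M, N) ⟶ (actThenF P F).obj (M, N) :=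
  AlgRep.actDesc (f := fun i => seqObj P (M.X i)) (g := fun j => seqRes P (N.X j))
    fun i j => (seqNu P (M.X i) (N.X j)).inv ≫ actThenFIncl P F M N i j

lemma incl_squareHom (M : Mat_ WebA) (N : Mat_ (ActWeb G R)) (i : M.ι) (j : N.ι) :
    actThenFIncl P F M N i j ≫ squareHom FA F M N =
      (seqNu P (M.X i) (N.X j)).hom ≫ fThenActIncl P FA F M N i j :=
  AlgRep.incl_desc (f := fun p : M.ι × N.ι => seqRes P (List.append (M.X p.1) (N.X p.2))) _ (i, j)

lemma incl_squareInv (M : Mat_ WebA) (N : Mat_ (ActWeb G R)) (i : M.ι) (j : N.ι) :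
    fThenActIncl P FA F M N i j ≫ squareInv FA F M N =
      (seqNu P (M.X i) (N.X j)).inv ≫ actThenFIncl P F M N i j :=
  AlgRep.incl_actDesc (f := fun i => seqObj P (M.X i)) (g := fun j => seqRes P (N.X j)) _ i j

/-- The canonical isomorphism on the additive closures. -/
noncomputable def squareIso (M : Mat_ WebA) (N : Mat_ (ActWeb G R)) :
    (actThenF P F).obj (M, N) ≅ (fThenAct P FA F).obj (M, N) where
  hom := squareHom FA F M N
  inv := squareInv FA F M N
  hom_inv_id := actThenF_hom_ext fun i j => by
    rw [← Category.assoc, incl_squareHom, Category.assoc, incl_squareInv, Category.comp_id]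
    exact Iso.hom_inv_id_assoc _ _
  inv_hom_id := fThenAct_hom_ext fun i j => by
    rw [← Category.assoc, incl_squareInv, Category.assoc, incl_squareHom, Category.comp_id]
    exact Iso.inv_hom_id_assoc _ _

lemma actThenFIncl_map {M M' : Mat_ WebA} {N N' : Mat_ (ActWeb G R)} (f : M ⟶ M') (g : N ⟶ N')
    (i : M.ι) (j : N.ι) :
    actThenFIncl P F M N i j ≫ (actThenF P F).map (X := (M, N)) (Y := (M', N')) (f, g) =
      ∑ p : M'.ι × N'.ι, F.map (f i p.1 ⊙ₗₘ g j p.2) ≫ actThenFIncl P F M' N' p.1 p.2 :=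
  AlgRep.incl_matrix (fun (p : M.ι × N.ι) (q : M'.ι × N'.ι) => F.map (f p.1 q.1 ⊙ₗₘ g p.2 q.2)) (i, j)

lemma fThenActIncl_map {M M' : Mat_ WebA} {N N' : Mat_ (ActWeb G R)} (f : M ⟶ M') (g : N ⟶ N')
    (i : M.ι) (j : N.ι) :
    fThenActIncl P FA F M N i j ≫ (fThenAct P FA F).map (X := (M, N)) (Y := (M', N')) (f, g) =
      ∑ p : M'.ι × N'.ι, (FA.map (f i p.1) ⊙ₗₘ F.map (g j p.2)) ≫
        fThenActIncl P FA F M' N' p.1 p.2 := by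
  have h : (fThenAct P FA F).map (X := (M, N)) (Y := (M', N')) (f, g) =
      AlgRep.matrix (fun i j => FA.map (f i j)) ⊙ₗₘ AlgRep.matrix (fun i j => F.map (g i j)) :=
    (MonoidalLeftAction.actionHom_def _ _).symm
  rw [h]
  refine (MonoidalLeftAction.actionHom_comp _ _ _ _).symm.trans ?_
  have e1 := AlgRep.incl_matrix (fun i j => FA.map (f i j)) i
  have e2 := AlgRep.incl_matrix (fun i j => F.map (g i j)) j
  refine (congrArg₂ (· ⊙ₗₘ ·) e1 e2).trans ?_
  refine (AlgRep.actionHom_sum _ _).trans ?_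
  exact Finset.sum_congr rfl fun p _ => MonoidalLeftAction.actionHom_comp _ _ _ _

variable {FA F}

lemma squareHom_naturality (h : IsExtension P FA F) {M M' : Mat_ WebA}
    {N N' : Mat_ (ActWeb G R)} (f : M ⟶ M') (g : N ⟶ N') :
    (actThenF P F).map (X := (M, N)) (Y := (M', N')) (f, g) ≫ squareHom FA F M' N' =
      squareHom FA F M N ≫ (fThenAct P FA F).map (X := (M, N)) (Y := (M', N')) (f, g) := by
  refine actThenF_hom_ext fun i j => ?_
  rw [← Category.assoc, ← Category.assoc, actThenFIncl_map, incl_squareHom, Category.assoc,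
    fThenActIncl_map, Preadditive.sum_comp, Preadditive.comp_sum]
  refine Finset.sum_congr rfl fun q _ => ?_
  rw [Category.assoc, incl_squareHom, h.act, Category.assoc, Category.assoc]
  exact congrArg (fun u => (seqNu P (M.X i) (N.X j)).hom ≫ (_ ≫ u))
    (Iso.inv_hom_id_assoc (seqNu P (M'.X q.1) (N'.X q.2)) _)

lemma IsExtension.commutes (h : IsExtension P FA F) : Commutes P FA F := by
  refine ⟨NatIso.ofComponents (fun MN => squareIso FA F MN.1 MN.2) ?_,
    fun M N i j => incl_squareHom FA F M N i j⟩
  rintro ⟨M, N⟩ ⟨M', N'⟩ ⟨f, g⟩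
  exact squareHom_naturality h f g

end Square

section FormScalars

/-- The partner of an index: `2 k` and `2 k + 1` are partners. -/
def mate (i : ℕ) : ℕ := if Even i then i + 1 else i - 1

lemma mate_even (k : ℕ) : mate (2 * k) = 2 * k + 1 := if_pos (even_two_mul k)

lemma mate_odd (k : ℕ) : mate (2 * k + 1) = 2 * k := by
  rw [mate, if_neg (by simp [Nat.even_add_one])]
  rfl

lemma mate_mate (i : ℕ) : mate (mate i) = i := by
  rcases Nat.even_or_odd' i with ⟨k, rfl | rfl⟩
  · rw [mate_even, mate_odd]
  · rw [mate_odd, mate_even]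

lemma mate_lt {m i : ℕ} (h : i < 2 * m) : mate i < 2 * m := by
  rcases Nat.even_or_odd' i with ⟨k, rfl | rfl⟩
  · rw [mate_even]; omega
  · rw [mate_odd]; omega

lemma mate_ne (i : ℕ) : mate i ≠ i := by
  rcases Nat.even_or_odd' i with ⟨k, rfl | rfl⟩
  · rw [mate_even]; omega
  · rw [mate_odd]; omega

/-- The coefficients of the cup. -/
noncomputable def kappa (i : ℕ) : Kq :=
  if Even i then qpar * qpar ^ (-(i / 2 : ℕ) : ℤ) else -qpar ^ (-(i / 2 : ℕ) : ℤ)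

/-- The coefficients of the cap. -/
noncomputable def lam (n i : ℕ) : Kq :=
  if Even i then qpar ^ ((n : ℤ) - 3 * (i / 2 : ℕ) - 2) else -qpar ^ ((n : ℤ) - 3 * (i / 2 : ℕ) - 3)

/-- The products of the coefficients of the cup and of the cap, up to a sign and a power of `q`. -/
noncomputable def gpow (n k : ℕ) : Kq := qpar ^ ((n : ℤ) - 2 - 4 * k)

lemma kappa_even (k : ℕ) : kappa (2 * k) = qpar * qpar ^ (-(k : ℤ)) := by
  rw [kappa, if_pos (even_two_mul k), Nat.mul_div_cancel_left k two_pos]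

lemma kappa_odd (k : ℕ) : kappa (2 * k + 1) = -qpar ^ (-(k : ℤ)) := by
  rw [kappa, if_neg (by simp [Nat.even_add_one]), show (2 * k + 1) / 2 = k by omega]

lemma lam_even (n k : ℕ) : lam n (2 * k) = qpar ^ ((n : ℤ) - 3 * k - 2) := by
  rw [lam, if_pos (even_two_mul k), Nat.mul_div_cancel_left k two_pos]

lemma lam_odd (n k : ℕ) : lam n (2 * k + 1) = -qpar ^ ((n : ℤ) - 3 * k - 3) := by
  rw [lam, if_neg (by simp [Nat.even_add_one]), show (2 * k + 1) / 2 = k by omega]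

lemma kappa_mate (k : ℕ) : kappa (2 * k) = -qpar * kappa (2 * k + 1) := by
  rw [kappa_even, kappa_odd]; ring

lemma lam_mate (n k : ℕ) : lam n (2 * k) = -qpar * lam n (2 * k + 1) := by
  rw [lam_even, lam_odd, neg_mul_neg, ← zpow_one_add₀ qpar_ne_zero]
  congr 1; ring

lemma kappa_lam_even (n k : ℕ) : kappa (2 * k) * lam n (2 * k) = qpar * gpow n k := by
  rw [kappa_even, lam_even, gpow, mul_assoc, ← zpow_add₀ qpar_ne_zero]
  congr 2; ring

lemma kappa_lam_odd (n k : ℕ) : kappa (2 * k + 1) * lam n (2 * k + 1) = qpar⁻¹ * gpow n k := by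
  rw [kappa_odd, lam_odd, gpow, neg_mul_neg, ← zpow_add₀ qpar_ne_zero, ← zpow_neg_one,
    ← zpow_add₀ qpar_ne_zero]
  congr 1; ring

lemma kappa_lam_even_odd (n k : ℕ) : kappa (2 * k) * lam n (2 * k + 1) = -gpow n k := by
  have h := kappa_lam_even n k
  rw [lam_mate] at h
  have h0 := qpar_ne_zero
  apply mul_left_cancel₀ h0
  linear_combination -h

lemma kappa_lam_odd_even (n k : ℕ) : kappa (2 * k + 1) * lam n (2 * k) = -gpow n k := by
  have h := kappa_lam_even n k
  rw [kappa_mate] at h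
  have h0 := qpar_ne_zero
  apply mul_left_cancel₀ h0
  linear_combination -h

lemma gpow_succ (n k : ℕ) : gpow n (k + 1) = (qpar ^ 4)⁻¹ * gpow n k := by
  rw [gpow, gpow, ← zpow_natCast, ← zpow_neg, ← zpow_add₀ qpar_ne_zero]
  congr 1; push_cast; ring

lemma sum_range_two_mul {M : Type*} [AddCommMonoid M] (F : ℕ → M) (m : ℕ) :
    ∑ i ∈ Finset.range (2 * m), F i = ∑ k ∈ Finset.range m, (F (2 * k) + F (2 * k + 1)) := by
  induction m with
  | zero => simp
  | succ m ih =>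
    rw [show 2 * (m + 1) = 2 * m + 1 + 1 by ring, Finset.sum_range_succ, Finset.sum_range_succ, ih,
      Finset.sum_range_succ (fun k => F (2 * k) + F (2 * k + 1)), _root_.add_assoc]

/-- Telescoping over pairs of indices. -/
lemma sum_pairs {F H C : ℕ → Kq}
    (h : ∀ k, (qpar - qpar⁻¹) * (F (2 * k) + F (2 * k + 1)) =
      H k - H (k + 1) + (qpar - qpar⁻¹) * C k) (m : ℕ) :
    ∑ i ∈ Finset.range (2 * m), F i =
      (H 0 - H m) / (qpar - qpar⁻¹) + ∑ k ∈ Finset.range m, C k := by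
  have h0 := qpar_sub_ne_zero
  rw [sum_range_two_mul]
  induction m with
  | zero => simp
  | succ m ih =>
    rw [Finset.sum_range_succ, Finset.sum_range_succ, ih]
    apply mul_left_cancel₀ h0
    rw [mul_add, h]
    generalize qpar - qpar⁻¹ = D at *
    field_simp
    ring

/-- The weight of the pairs with an index at least `2 k`, relative to the index `b`. -/
noncomputable def pairWt (k b : ℕ) : Kq := if 2 * k ≤ b then qpar⁻¹ else qpar

lemma pairWt_zero (b : ℕ) : pairWt 0 b = qpar⁻¹ := if_pos (Nat.zero_le _)

lemma pairWt_top {m b : ℕ} (h : b < 2 * m) : pairWt m b = qpar := if_neg (by omega)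

lemma gpow_zero (n : ℕ) : gpow n 0 = qpar ^ n * (qpar ^ 2)⁻¹ := by
  rw [gpow, ← zpow_natCast, ← zpow_natCast, ← zpow_neg, ← zpow_add₀ qpar_ne_zero]
  congr 1; push_cast; ring

lemma gpow_half (m : ℕ) : gpow (2 * m) m = (qpar ^ (2 * m))⁻¹ * (qpar ^ 2)⁻¹ := by
  rw [gpow, ← zpow_natCast, ← zpow_natCast, ← zpow_neg, ← zpow_neg, ← zpow_add₀ qpar_ne_zero]
  congr 1; push_cast; ring

lemma qnum_sub_nat (n j : ℕ) : qnum ((n : ℤ) - j) =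
    (qpar ^ n * (qpar ^ j)⁻¹ - (qpar ^ n)⁻¹ * qpar ^ j) / (qpar - qpar⁻¹) := by
  rw [qnum, neg_sub, zpow_sub₀ qpar_ne_zero, zpow_sub₀ qpar_ne_zero, zpow_natCast, zpow_natCast]
  ring

lemma fmu_self (a : ℕ) : fmu false a a = 0 := by simp [fmu]

lemma fmu_lt {a b : ℕ} (h : a < b) : fmu false a b = qpar := by simp [fmu, h, qp]

lemma fmu_gt {a b : ℕ} (h : b < a) : fmu false a b = qpar⁻¹ := by simp [fmu, h, h.not_gt, qp]

lemma sum_kappa_lam (m : ℕ) :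
    ∑ i ∈ Finset.range (2 * m), kappa i * lam (2 * m) i = qnum (2 * m : ℕ) := by
  have h0 := qpar_ne_zero
  have h1 := qpar_sub_ne_zero
  rw [sum_pairs (H := fun k => qpar ^ 2 * gpow (2 * m) k) (C := fun _ => 0)]
  · have := qnum_sub_nat (2 * m) 0
    rw [Nat.cast_zero, sub_zero] at this
    rw [this, gpow_zero, gpow_half, Finset.sum_const_zero]
    field_simp
    ring
  · intro k
    simp only [kappa_lam_even, kappa_lam_odd, gpow_succ]
    field_simp
    ring

lemma sum_kappa_lam_fmu {m b : ℕ} (hb : b < 2 * m) :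
    ∑ i ∈ Finset.range (2 * m), kappa i * lam (2 * m) i * fmu false b i =
      qnum ((2 * m : ℕ) - (1 : ℕ)) := by
  have h0 := qpar_ne_zero
  have h1 := qpar_sub_ne_zero
  rw [sum_pairs (H := fun k => pairWt k b * qpar ^ 2 * gpow (2 * m) k) (C := fun _ => 0)]
  · rw [qnum_sub_nat, gpow_zero, gpow_half, Finset.sum_const_zero, pairWt_zero, pairWt_top hb]
    field_simp
    ring
  · intro k
    simp only [kappa_lam_even, kappa_lam_odd, gpow_succ]
    rcases lt_trichotomy b (2 * k) with h | h | h
    · rw [fmu_lt h, fmu_lt (by omega), pairWt, pairWt, if_neg (by omega), if_neg (by omega)]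
      field_simp
      ring
    · rw [h, fmu_self, fmu_lt (by omega), pairWt, pairWt, if_pos le_rfl, if_neg (by omega)]
      field_simp
      ring
    · rcases lt_or_eq_of_le (Nat.succ_le_of_lt h) with h' | h'
      · rw [fmu_gt h, fmu_gt h', pairWt, pairWt, if_pos (by omega), if_pos (by omega)]
        field_simp
        ring
      · rw [← h', fmu_self, fmu_gt (by omega), pairWt, pairWt, if_pos (by omega),
          if_neg (by omega)]
        field_simp
        ring

/-- The possible positions of an index relative to a pair, and the values of the coefficients. -/
lemma pair_cases (b k : ℕ) :
    (b ≠ 2 * k ∧ b ≠ 2 * k + 1 ∧ b / 2 ≠ k ∧ fmu false b (2 * k) = qpar ∧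
      fmu false b (2 * k + 1) = qpar ∧ pairWt k b = qpar ∧ pairWt (k + 1) b = qpar) ∨
    (b ≠ 2 * k ∧ b ≠ 2 * k + 1 ∧ b / 2 ≠ k ∧ fmu false b (2 * k) = qpar⁻¹ ∧
      fmu false b (2 * k + 1) = qpar⁻¹ ∧ pairWt k b = qpar⁻¹ ∧ pairWt (k + 1) b = qpar⁻¹) ∨
    (b = 2 * k ∧ b ≠ 2 * k + 1 ∧ b / 2 = k ∧ fmu false b (2 * k) = 0 ∧
      fmu false b (2 * k + 1) = qpar ∧ pairWt k b = qpar⁻¹ ∧ pairWt (k + 1) b = qpar) ∨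
    (b ≠ 2 * k ∧ b = 2 * k + 1 ∧ b / 2 = k ∧ fmu false b (2 * k) = qpar⁻¹ ∧
      fmu false b (2 * k + 1) = 0 ∧ pairWt k b = qpar⁻¹ ∧ pairWt (k + 1) b = qpar) := by
  rcases lt_trichotomy b (2 * k) with h | h | h
  · refine Or.inl ⟨h.ne, by omega, by omega, fmu_lt h, fmu_lt (by omega), if_neg (by omega),
      if_neg (by omega)⟩
  · refine Or.inr (Or.inr (Or.inl ⟨h, by omega, by omega, ?_, ?_, ?_, ?_⟩))
    · rw [h, fmu_self]
    · exact fmu_lt (by omega)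
    · exact if_pos (by omega)
    · exact if_neg (by omega)
  · rcases lt_or_eq_of_le (Nat.succ_le_of_lt h) with h' | h'
    · refine Or.inr (Or.inl ⟨h.ne', by omega, by omega, fmu_gt h, fmu_gt h', ?_, ?_⟩)
      · exact if_pos (by omega)
      · exact if_pos (by omega)
    · refine Or.inr (Or.inr (Or.inr ⟨h.ne', by omega, by omega, fmu_gt h, ?_, ?_, ?_⟩))
      · rw [← h', fmu_self]
      · exact if_pos (by omega)
      · exact if_neg (by omega)

lemma sum_ite_range {m b : ℕ} (hb : b < 2 * m) (x : ℕ → Kq) :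
    ∑ k ∈ Finset.range m, (if b / 2 = k then x k else 0) = x (b / 2) := by
  rw [Finset.sum_ite_eq, if_pos (Finset.mem_range.mpr (by omega))]

lemma sum_two_strands {m b c : ℕ} (hb : b < 2 * m) (hc : c < 2 * m) :
    ∑ i ∈ Finset.range (2 * m), (kappa i * lam (2 * m) i * (fmu false b i * fmu false i (mate i) *
        fmu false c i) - kappa i * lam (2 * m) (mate i) * (fmu false b i * fmu false c (mate i))) =
      qnum 2 * qnum ((2 * m : ℕ) - (2 : ℕ)) +
        if c / 2 = b / 2 then gpow (2 * m) (b / 2) else 0 := by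
  have h0 := qpar_ne_zero
  have h1 := qpar_sub_ne_zero
  rw [← sum_ite_range hb (fun k => if c / 2 = k then gpow (2 * m) k else 0)]
  rw [sum_pairs (H := fun k => qnum 2 * (pairWt k b * pairWt k c * qpar ^ 2 * gpow (2 * m) k))
    (C := fun k => if b / 2 = k then if c / 2 = k then gpow (2 * m) k else 0 else 0)]
  · congr 1
    rw [qnum_sub_nat, gpow_zero, gpow_half, pairWt_zero, pairWt_zero, pairWt_top hb, pairWt_top hc]
    field_simp
  · intro k
    simp only [mate_even, mate_odd, kappa_lam_even, kappa_lam_odd, kappa_lam_even_odd,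
      kappa_lam_odd_even, gpow_succ, qnum_two, fmu_lt (Nat.lt_succ_self _),
      fmu_gt (Nat.lt_succ_self _)]
    rcases pair_cases b k with ⟨-, -, e0, e1, e2, e3, e4⟩ | ⟨-, -, e0, e1, e2, e3, e4⟩ |
      ⟨-, -, e0, e1, e2, e3, e4⟩ | ⟨-, -, e0, e1, e2, e3, e4⟩ <;>
    rcases pair_cases c k with ⟨-, -, f0, f1, f2, f3, f4⟩ | ⟨-, -, f0, f1, f2, f3, f4⟩ |
      ⟨-, -, f0, f1, f2, f3, f4⟩ | ⟨-, -, f0, f1, f2, f3, f4⟩ <;>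
    simp only [e0, f0, e1, e2, e3, e4, f1, f2, f3, f4, if_true, if_false] <;>
    field_simp <;> ring

lemma sum_one_strand {m a b : ℕ} (ha : a < 2 * m) (hb : b < 2 * m) :
    ∑ i ∈ Finset.range (2 * m), (if b = i then 0 else kappa i * lam (2 * m) i *
        (fmu false a i * fmu false b (mate i))) =
      qnum ((2 * m : ℕ) - (2 : ℕ)) - fmu false a b * gpow (2 * m) (b / 2) +
        if b = mate a then kappa a * lam (2 * m) a else 0 := by
  have h0 := qpar_ne_zero
  have h1 := qpar_sub_ne_zero
  have hC : -(fmu false a b * gpow (2 * m) (b / 2)) +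
      (if b = mate a then kappa a * lam (2 * m) a else 0) =
      ∑ k ∈ Finset.range m, if b / 2 = k then (-(fmu false a b * gpow (2 * m) k) +
        if b = mate a then kappa a * lam (2 * m) a else 0) else 0 :=
    (sum_ite_range hb (fun k => -(fmu false a b * gpow (2 * m) k) +
        if b = mate a then kappa a * lam (2 * m) a else 0)).symm
  rw [sub_eq_add_neg, _root_.add_assoc, hC]
  rw [sum_pairs (H := fun k => pairWt k a * pairWt k b * qpar ^ 2 * gpow (2 * m) k)
    (C := fun k => if b / 2 = k then (-(fmu false a b * gpow (2 * m) k) +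
        if b = mate a then kappa a * lam (2 * m) a else 0) else 0)]
  · congr 1
    rw [qnum_sub_nat, gpow_zero, gpow_half, pairWt_zero, pairWt_zero, pairWt_top hb, pairWt_top ha]
    field_simp
  · intro k
    have hm : ∀ x, x = mate a ↔ a = mate x := fun x =>
      ⟨fun h => by rw [h, mate_mate], fun h => by rw [h, mate_mate]⟩
    simp only [mate_even, mate_odd, kappa_lam_even, kappa_lam_odd, gpow_succ, hm]
    rcases pair_cases b k with ⟨b1, b2, e0, e1, e2, e3, e4⟩ | ⟨b1, b2, e0, e1, e2, e3, e4⟩ |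
      ⟨b1, b2, e0, e1, e2, e3, e4⟩ | ⟨b1, b2, e0, e1, e2, e3, e4⟩
    · rcases pair_cases a k with ⟨a1, a2, f0, f1, f2, f3, f4⟩ | ⟨a1, a2, f0, f1, f2, f3, f4⟩ |
        ⟨a1, a2, f0, f1, f2, f3, f4⟩ | ⟨a1, a2, f0, f1, f2, f3, f4⟩ <;>
      simp only [b1, b2, e0, e1, e2, e3, e4, f1, f2, f3, f4, if_true, if_false] <;>
      field_simp <;> ring
    · rcases pair_cases a k with ⟨a1, a2, f0, f1, f2, f3, f4⟩ | ⟨a1, a2, f0, f1, f2, f3, f4⟩ |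
        ⟨a1, a2, f0, f1, f2, f3, f4⟩ | ⟨a1, a2, f0, f1, f2, f3, f4⟩ <;>
      simp only [b1, b2, e0, e1, e2, e3, e4, f1, f2, f3, f4, if_true, if_false] <;>
      field_simp <;> ring
    · subst b1
      simp only [if_true, mate_even, if_neg b2, e0]
      rcases pair_cases a k with ⟨a1, a2, f0, f1, f2, f3, f4⟩ | ⟨a1, a2, f0, f1, f2, f3, f4⟩ |
        ⟨a1, a2, f0, f1, f2, f3, f4⟩ | ⟨a1, a2, f0, f1, f2, f3, f4⟩
      · simp only [a2, e1, e2, e3, e4, f1, f2, f3, f4, if_true, if_false]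
        field_simp
        ring
      · simp only [a2, e1, e2, e3, e4, f1, f2, f3, f4, if_true, if_false]
        field_simp
        ring
      · simp only [a2, e1, e2, e3, e4, f1, f2, f3, f4, if_true, if_false]
        field_simp
        ring
      · subst a2
        simp only [kappa_lam_odd, e1, e2, e3, e4, f1, f2, f3, f4, if_true, if_false]
        field_simp
        ring
    · subst b2
      simp only [if_true, mate_odd, if_neg b1, e0]
      rcases pair_cases a k with ⟨a1, a2, f0, f1, f2, f3, f4⟩ | ⟨a1, a2, f0, f1, f2, f3, f4⟩ |
        ⟨a1, a2, f0, f1, f2, f3, f4⟩ | ⟨a1, a2, f0, f1, f2, f3, f4⟩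
      · simp only [a1, e1, e2, e3, e4, f1, f2, f3, f4, if_true, if_false]
        field_simp
        ring
      · simp only [a1, e1, e2, e3, e4, f1, f2, f3, f4, if_true, if_false]
        field_simp
        ring
      · subst a1
        simp only [kappa_lam_even, e1, e2, e3, e4, f1, f2, f3, f4, if_true, if_false]
        field_simp
        ring
      · simp only [a1, e1, e2, e3, e4, f1, f2, f3, f4, if_true, if_false]
        field_simp
        ring

lemma mate_eq_iff {a b : ℕ} : b = mate a ↔ a = mate b :=
  ⟨fun h => by rw [h, mate_mate], fun h => by rw [h, mate_mate]⟩

lemma fmu_mate (a : ℕ) : (fmu false a (mate a) = qpar ∧ fmu false (mate a) a = qpar⁻¹) ∨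
    (fmu false a (mate a) = qpar⁻¹ ∧ fmu false (mate a) a = qpar) := by
  rcases Nat.even_or_odd' a with ⟨k, rfl | rfl⟩
  · rw [mate_even]
    exact Or.inl ⟨fmu_lt (by omega), fmu_gt (by omega)⟩
  · rw [mate_odd]
    exact Or.inr ⟨fmu_gt (by omega), fmu_lt (by omega)⟩

lemma mate_div (a : ℕ) : mate a / 2 = a / 2 := by
  rcases Nat.even_or_odd' a with ⟨k, rfl | rfl⟩
  · rw [mate_even]; omega
  · rw [mate_odd]; omega

lemma eq_or_eq_mate {a c : ℕ} (h : a / 2 = c / 2) : c = a ∨ c = mate a := by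
  rcases Nat.even_or_odd' a with ⟨k, rfl | rfl⟩
  · rw [mate_even]; omega
  · rw [mate_odd]; omega

lemma fmu_mate_left {a c : ℕ} (h : a / 2 ≠ c / 2) : fmu false (mate a) c = fmu false a c := by
  have h1 := mate_div a
  rcases lt_or_gt_of_ne h with h' | h'
  · rw [fmu_lt (a := mate a) (by omega), fmu_lt (by omega)]
  · rw [fmu_gt (a := mate a) (by omega), fmu_gt (by omega)]

lemma fmu_mate_right {a c : ℕ} (h : a / 2 ≠ c / 2) : fmu false a (mate c) = fmu false a c := by
  have h1 := mate_div c
  rcases lt_or_gt_of_ne h with h' | h'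
  · rw [fmu_lt (b := mate c) (by omega), fmu_lt (by omega)]
  · rw [fmu_gt (b := mate c) (by omega), fmu_gt (by omega)]

/-- The bilinear form which pairs an index with its partner. -/
noncomputable def mform (θ : ℕ → Kq) (a b : ℕ) : Kq := if b = mate a then θ a else 0

lemma mform_mate (θ : ℕ → Kq) (a : ℕ) : mform θ a (mate a) = θ a := if_pos rfl

lemma mform_mate_left (θ : ℕ → Kq) (a : ℕ) : mform θ (mate a) a = θ (mate a) :=
  if_pos (mate_mate a).symm

lemma mform_of_ne (θ : ℕ → Kq) {a b : ℕ} (h : b ≠ mate a) : mform θ a b = 0 := if_neg h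

/-- The off-diagonal coefficients of `μ` for exterior powers. -/
noncomputable def xmu (a b : ℕ) : Kq := if a = b then 0 else -1

lemma xmu_self (a : ℕ) : xmu a a = 0 := if_pos rfl

lemma xmu_of_ne {a b : ℕ} (h : a ≠ b) : xmu a b = -1 := if_neg h

/-- The value of the square of the form on `v_a ⊗ μ (v_b ⊗ v_c) ⊗ v_d`. -/
noncomputable def qform (θ : ℕ → Kq) (a b c d : ℕ) : Kq :=
  fmu false b c * (mform θ a b * mform θ c d) + xmu b c * (mform θ a c * mform θ b d)

variable {θ : ℕ → Kq}

lemma theta_mate (hθ : ∀ k, θ (2 * k) = -qpar * θ (2 * k + 1)) (a : ℕ) :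
    θ (mate a) = -fmu false (mate a) a * θ a := by
  have h0 := qpar_ne_zero
  rcases Nat.even_or_odd' a with ⟨k, rfl | rfl⟩
  · rw [mate_even, fmu_gt (by omega), hθ]
    field_simp
  · rw [mate_odd, fmu_lt (by omega), hθ]

lemma mform_mu (hθ : ∀ k, θ (2 * k) = -qpar * θ (2 * k + 1)) (a b : ℕ) :
    fmu false a b * mform θ a b + xmu a b * mform θ b a = qnum 2 * mform θ a b := by
  have h0 := qpar_ne_zero
  by_cases h : b = mate a
  · subst h
    rw [mform_mate, mform_mate_left, xmu_of_ne (mate_ne a).symm, theta_mate hθ, qnum_two]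
    rcases fmu_mate a with ⟨h1, h2⟩ | ⟨h1, h2⟩ <;> rw [h1, h2] <;> ring
  · rw [mform_of_ne θ h, mform_of_ne θ (fun h' => h (mate_eq_iff.mp h'))]
    ring

lemma qform_slide (hθ : ∀ k, θ (2 * k) = -qpar * θ (2 * k + 1)) (a b c d : ℕ) :
    fmu false a b * qform θ a b c d + xmu a b * qform θ b a c d =
      fmu false c d * qform θ a b c d + xmu c d * qform θ a b d c := by
  have h0 := qpar_ne_zero
  have hm := mate_ne
  have hd := mate_div
  by_cases hab : b = mate a ∧ d = mate c
  · obtain ⟨rfl, rfl⟩ := hab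
    by_cases hac : a / 2 = c / 2
    · rcases eq_or_eq_mate hac with rfl | rfl
      · simp only [qform, mform_mate, mform_mate_left, fmu_self, xmu_self,
          mform_of_ne θ (hm _).symm, theta_mate hθ]
        rcases fmu_mate c with ⟨h1, h2⟩ | ⟨h1, h2⟩ <;> rw [h1, h2] <;> field_simp
      · simp only [mate_mate, qform, mform_mate, mform_mate_left, fmu_self, xmu_self,
          xmu_of_ne (hm _), xmu_of_ne (hm _).symm, mform_of_ne θ (hm _).symm, theta_mate hθ]
        rcases fmu_mate a with ⟨h1, h2⟩ | ⟨h1, h2⟩ <;> rw [h1, h2] <;> field_simp <;> ring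
    · have n1 : mform θ a c = 0 := mform_of_ne θ fun h => hac (by rw [h, hd])
      have n2 : mform θ (mate a) c = 0 := mform_of_ne θ fun h => hac (by rw [h, mate_mate])
      have n3 : mform θ a (mate c) = 0 := mform_of_ne θ fun h => hac (by rw [← hd c, h, hd])
      simp only [qform, n1, n2, n3, mform_mate, mform_mate_left, xmu_of_ne (hm _).symm,
        theta_mate hθ, fmu_mate_left hac, fmu_mate_right hac,
        fmu_mate_left (fun h => hac (h.trans (hd c)) : a / 2 ≠ mate c / 2)]
      rcases fmu_mate a with ⟨h1, h2⟩ | ⟨h1, h2⟩ <;>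
        rcases fmu_mate c with ⟨h3, h4⟩ | ⟨h3, h4⟩ <;> rw [h1, h2, h3, h4] <;> ring
  have z1 : mform θ a b * mform θ c d = 0 := by
    by_cases h : b = mate a
    · rw [mform_of_ne θ (fun h' => hab ⟨h, h'⟩ : d ≠ mate c), mul_zero]
    · rw [mform_of_ne θ h, zero_mul]
  have z1' : mform θ b a * mform θ c d = 0 := by
    by_cases h : b = mate a
    · rw [mform_of_ne θ (fun h' => hab ⟨h, h'⟩ : d ≠ mate c), mul_zero]
    · rw [mform_of_ne θ (fun h' => h (mate_eq_iff.mp h')), zero_mul]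
  have z1'' : mform θ a b * mform θ d c = 0 := by
    by_cases h : b = mate a
    · rw [mform_of_ne θ (fun h' => hab ⟨h, mate_eq_iff.mp h'⟩ : c ≠ mate d), mul_zero]
    · rw [mform_of_ne θ h, zero_mul]
  simp only [qform, z1, z1', z1'', mul_zero, zero_add]
  by_cases hc : c = mate a ∧ d = mate b
  · obtain ⟨rfl, rfl⟩ := hc
    by_cases hb : a / 2 = b / 2
    · rcases eq_or_eq_mate hb with rfl | rfl
      · simp only [fmu_self, xmu_self]
      · exact absurd ⟨rfl, rfl⟩ hab
    · have n1 : mform θ a (mate b) = 0 := mform_of_ne θ fun h => hb (by rw [← hd a, ← h, hd])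
      rw [n1, fmu_mate_left (by rwa [hd]), fmu_mate_right hb]
      ring
  have z2 : mform θ a c * mform θ b d = 0 := by
    by_cases h : c = mate a
    · rw [mform_of_ne θ (fun h' => hc ⟨h, h'⟩ : d ≠ mate b), mul_zero]
    · rw [mform_of_ne θ h, zero_mul]
  rw [z2, mul_zero, mul_zero, mul_zero, zero_add, zero_add]
  by_cases hda : d = mate a ∧ c = mate b
  · obtain ⟨rfl, rfl⟩ := hda
    have hb : a ≠ b := by
      rintro rfl
      exact hc ⟨rfl, rfl⟩
    have hb' : mate b ≠ mate a := fun h => hb (by rw [← mate_mate a, ← h, mate_mate])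
    have h1 : a ≠ mate b := fun h => hab ⟨mate_eq_iff.mp h, by rw [← h]⟩
    rw [xmu_of_ne hb, xmu_of_ne hb', xmu_of_ne h1, xmu_of_ne (fun h => h1 (mate_eq_iff.mp h))]
    ring
  · by_cases h : d = mate a
    · rw [mform_of_ne θ (fun h' => hda ⟨h, h'⟩ : c ≠ mate b)]
      ring
    · rw [mform_of_ne θ h]
      ring

end FormScalars

section Trace

variable {m : ℕ}

/-- The partner of an index. -/
def pt (i : Fin (2 * m)) : Fin (2 * m) := ⟨mate i, mate_lt i.2⟩

lemma pt_val (i : Fin (2 * m)) : (pt i : ℕ) = mate i := rfl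

lemma pt_pt (i : Fin (2 * m)) : pt (pt i) = i := Fin.ext (mate_mate i)

lemma pt_ne (i : Fin (2 * m)) : pt i ≠ i := fun h => mate_ne i (congrArg Fin.val h)

lemma sum_fin_eq_range {M : Type*} [AddCommMonoid M] {n : ℕ} (f : ℕ → M) :
    ∑ i : Fin n, f i = ∑ i ∈ Finset.range n, f i := Fin.sum_univ_eq_sum_range f n

lemma xmu_mul_mform_mate (θ : ℕ → Kq) (b i : ℕ) : xmu b i * mform θ b (mate i) = 0 := by
  by_cases h : b = i
  · rw [h, xmu_self, zero_mul]
  · rw [mform_of_ne θ fun h' => h (by rw [← mate_mate b, ← h', mate_mate]), mul_zero]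

lemma xmu_mate_mul_mform (θ : ℕ → Kq) (b i : ℕ) : xmu b (mate i) * mform θ b i = 0 := by
  have := xmu_mul_mform_mate θ b (mate i)
  rwa [mate_mate] at this

lemma xmu_mul_mform_mate' (θ : ℕ → Kq) (b i : ℕ) : xmu b i * mform θ (mate i) b = 0 := by
  by_cases h : b = i
  · rw [h, xmu_self, zero_mul]
  · rw [mform_of_ne θ fun h' => h (by rw [h', mate_mate]), mul_zero]

lemma xmu_mate_mul_mform' (θ : ℕ → Kq) (b i : ℕ) : xmu b (mate i) * mform θ i b = 0 := by
  have := xmu_mul_mform_mate' θ b (mate i)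
  rwa [mate_mate] at this

lemma xmu_comm (a b : ℕ) : xmu a b = xmu b a := by
  simp only [xmu, eq_comm]

lemma xmu_sq (a b : ℕ) : xmu a b * xmu a b = -xmu a b := by
  simp only [xmu]
  split_ifs <;> simp

/-- Linear maps which act on given vectors like the endomorphism `μ`, the cup and the cap act on
words of length `0`, `2` and `4`. -/
structure Strands (m : ℕ) (M0 M2 M4 : Type) [AddCommGroup M0] [Module Kq M0]
    [AddCommGroup M2] [Module Kq M2] [AddCommGroup M4] [Module Kq M4] where
  t0 : M0
  t2 : Fin (2 * m) → Fin (2 * m) → M2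
  t4 : Fin (2 * m) → Fin (2 * m) → Fin (2 * m) → Fin (2 * m) → M4
  μ : M2 →ₗ[Kq] M2
  μ₁ : M4 →ₗ[Kq] M4
  μ₂ : M4 →ₗ[Kq] M4
  μ₃ : M4 →ₗ[Kq] M4
  C₂ : M2 →ₗ[Kq] M0
  C₄ : M4 →ₗ[Kq] M2
  D₂ : M0 →ₗ[Kq] M2
  D₄ : M2 →ₗ[Kq] M4
  ext0 : ∀ {N : Type} [AddCommGroup N] [Module Kq N] {f g : M0 →ₗ[Kq] N}, f t0 = g t0 → f = g
  ext2 : ∀ {N : Type} [AddCommGroup N] [Module Kq N] {f g : M2 →ₗ[Kq] N},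
    (∀ a b, f (t2 a b) = g (t2 a b)) → f = g
  ext4 : ∀ {N : Type} [AddCommGroup N] [Module Kq N] {f g : M4 →ₗ[Kq] N},
    (∀ a b c d, f (t4 a b c d) = g (t4 a b c d)) → f = g
  hμ : ∀ a b, μ (t2 a b) = fmu false a.1 b.1 • t2 a b + xmu a b • t2 b a
  h1 : ∀ a b c d, μ₁ (t4 a b c d) = fmu false a.1 b.1 • t4 a b c d + xmu a b • t4 b a c d
  h2 : ∀ a b c d, μ₂ (t4 a b c d) = fmu false b.1 c.1 • t4 a b c d + xmu b c • t4 a c b d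
  h3 : ∀ a b c d, μ₃ (t4 a b c d) = fmu false c.1 d.1 • t4 a b c d + xmu c d • t4 a b d c
  hC₂ : ∀ a b, C₂ (t2 a b) = mform (lam (2 * m)) a b • t0
  hC₄ : ∀ a b c d, C₄ (t4 a b c d) = mform (lam (2 * m)) c d • t2 a b
  hD₂ : D₂ t0 = ∑ i : Fin (2 * m), kappa i.1 • t2 i (pt i)
  hD₄ : ∀ a b, D₄ (t2 a b) = ∑ i : Fin (2 * m), kappa i.1 • t4 a b i (pt i)

namespace Strands

variable {M0 M2 M4 : Type} [AddCommGroup M0] [Module Kq M0] [AddCommGroup M2] [Module Kq M2]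
  [AddCommGroup M4] [Module Kq M4] (S : Strands m M0 M2 M4)

lemma trace_summand
    (a b i : Fin (2 * m)) :
    S.C₄ (S.μ₂ (S.μ₁ (S.μ₃ (S.μ₂ (S.t4 a b i (pt i)))))) =
      (fmu false a.1 b.1 * (fmu false b.1 i.1 * fmu false i.1 (mate i) * fmu false b.1 i.1 *
          lam (2 * m) i - fmu false b.1 i.1 * fmu false b.1 (mate i) * lam (2 * m) (mate i)) +
        (if b.1 = i.1 then 0 else fmu false a.1 i.1 * fmu false b.1 (mate i) * lam (2 * m) i)) •
          S.t2 a b +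
      (xmu a b * (fmu false b.1 i.1 * fmu false i.1 (mate i) * fmu false a.1 i.1 *
          lam (2 * m) i - fmu false b.1 i.1 * fmu false a.1 (mate i) * lam (2 * m) (mate i))) •
          S.t2 b a +
      (xmu a i * xmu a (mate i) * xmu b i * xmu b (mate i) * mform (lam (2 * m)) a b) •
        S.t2 i (pt i) := by
  set Λ := mform (lam (2 * m)) with hΛ
  have k1 : Λ i (mate i) = lam (2 * m) i := mform_mate _ _
  have k2 : Λ (mate i) i = lam (2 * m) (mate i) := mform_mate_left _ _
  have k3 : xmu i (mate i) = -1 := xmu_of_ne (mate_ne i).symm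
  have hx : (if b.1 = i.1 then 0 else fmu false a.1 i.1 * fmu false b.1 (mate i) *
      lam (2 * m) i) = -xmu b i * (fmu false a.1 i.1 * fmu false b.1 (mate i) * lam (2 * m) i) := by
    rw [xmu]
    split_ifs <;> ring
  have v1 := xmu_mul_mform_mate (lam (2 * m)) b i
  have v2 := xmu_mate_mul_mform (lam (2 * m)) b i
  have v3 := xmu_mul_mform_mate' (lam (2 * m)) b i
  have v4 := xmu_mate_mul_mform' (lam (2 * m)) b i
  have u1 := xmu_mul_mform_mate (lam (2 * m)) a i
  have u2 := xmu_mate_mul_mform (lam (2 * m)) a i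
  have w := xmu_sq b i
  rw [← hΛ] at v1 v2 v3 v4 u1 u2
  rw [hx]
  simp only [S.h1, S.h2, S.h3, S.hC₄, ← hΛ, map_add, map_smul, pt_val, k1, k2, k3, xmu_comm i b, xmu_comm (mate i) b,
    xmu_comm i a]
  match_scalars
  · linear_combination (lam (2 * m) i * fmu false b.1 (mate i) * fmu false a.1 i) * w
  · linear_combination (fmu false b.1 i.1 * fmu false i.1 (mate i) * fmu false a.1 b.1 +
      fmu false b.1 (mate i) * fmu false a.1 i.1 * fmu false i.1 b.1) * v1 +
      (fmu false i.1 (mate i) * fmu false a.1 i.1 * xmu b (mate i)) * v3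
  · ring
  · linear_combination (fmu false b.1 i.1 * fmu false i.1 (mate i) * xmu a b) * u1
  · linear_combination -(fmu false b.1 i.1 * fmu false a.1 b.1) * v2 -
      (xmu b i * fmu false a.1 i.1) * v4
  · linear_combination -(fmu false b.1 i.1 * xmu a b) * u2
  · linear_combination (fmu false b.1 (mate i) * xmu a i * fmu false a.1 b.1) * v1 +
      (xmu a i * xmu b (mate i) * fmu false a.1 (mate i)) * v3
  · linear_combination (xmu b i * fmu false b.1 (mate i) * xmu a b) * u1
  · ring

lemma sum_cup_without (a b : Fin (2 * m)) (f : Fin (2 * m) → M2) :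
    ∑ i : Fin (2 * m), kappa i.1 • (xmu a i * xmu a (mate i) * xmu b i * xmu b (mate i) *
      mform (lam (2 * m)) a b) • f i =
    mform (lam (2 * m)) a b • (∑ i : Fin (2 * m), kappa i.1 • f i - kappa a • f a - kappa (pt a) • f (pt a)) := by
  by_cases h : b = pt a
  · subst h
    have e : ∀ i : Fin (2 * m), kappa i • (xmu a i * xmu a (mate i) * xmu (pt a) i *
        xmu (pt a) (mate i) * mform (lam (2 * m)) a (pt a)) • f i =
        mform (lam (2 * m)) a (pt a) • (kappa i • f i - (if i = a then kappa i • f i else 0) -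
          (if i = pt a then kappa i • f i else 0)) := by
      intro i
      by_cases h1 : i = a
      · subst h1
        rw [xmu_self, if_pos rfl, if_neg (pt_ne i).symm]
        module
      by_cases h2 : i = pt a
      · subst h2
        rw [xmu_self, if_pos rfl, if_neg (pt_ne a)]
        module
      have n1 : a.1 ≠ i := fun h => h1 (Fin.ext h.symm)
      have n2 : mate a ≠ i := fun h => h2 (Fin.ext h.symm)
      have n3 : a.1 ≠ mate i := fun h => n2 (mate_eq_iff.mp h).symm
      have n4 : mate a ≠ mate i := fun h => n1 (by rw [← mate_mate a, h, mate_mate])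
      rw [pt_val, xmu_of_ne n1, xmu_of_ne n2, xmu_of_ne n3, xmu_of_ne n4, if_neg h1, if_neg h2]
      module
    rw [Finset.sum_congr rfl fun i _ => e i, ← Finset.smul_sum, Finset.sum_sub_distrib,
      Finset.sum_sub_distrib, Finset.sum_ite_eq', Finset.sum_ite_eq', if_pos (Finset.mem_univ _),
      if_pos (Finset.mem_univ _)]
  · have : mform (lam (2 * m)) a b = 0 := mform_of_ne _ fun h' => h (Fin.ext h')
    simp [this]

lemma trace_two : S.C₄ ∘ₗ S.μ₂ ∘ₗ S.μ₁ ∘ₗ S.μ₃ ∘ₗ S.μ₂ ∘ₗ S.D₄ = S.D₂ ∘ₗ S.C₂ +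
    (qnum 2 * qnum ((2 * m : ℕ) - (2 : ℕ))) • S.μ + qnum ((2 * m : ℕ) - (2 : ℕ)) • LinearMap.id := by
  refine S.ext2 fun a b => ?_
  have hL : (S.C₄ ∘ₗ S.μ₂ ∘ₗ S.μ₁ ∘ₗ S.μ₃ ∘ₗ S.μ₂ ∘ₗ S.D₄) (S.t2 a b) =
      S.C₄ (S.μ₂ (S.μ₁ (S.μ₃ (S.μ₂ (S.D₄ (S.t2 a b)))))) := rfl
  have hR : (S.D₂ ∘ₗ S.C₂ + (qnum 2 * qnum ((2 * m : ℕ) - (2 : ℕ))) • S.μ +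
      qnum ((2 * m : ℕ) - (2 : ℕ)) • LinearMap.id : M2 →ₗ[Kq] M2) (S.t2 a b) = S.D₂ (S.C₂ (S.t2 a b)) +
      (qnum 2 * qnum ((2 * m : ℕ) - (2 : ℕ))) • S.μ (S.t2 a b) +
      qnum ((2 * m : ℕ) - (2 : ℕ)) • S.t2 a b := rfl
  rw [hL, hR, S.hD₄, S.hC₂, map_smul, S.hD₂, S.hμ]
  simp only [map_sum, map_smul, S.trace_summand, smul_add, Finset.sum_add_distrib]
  rw [sum_cup_without]
  have s1 := sum_two_strands b.2 b.2
  have s2 := sum_two_strands b.2 a.2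
  have s3 := sum_one_strand a.2 b.2
  rw [← sum_fin_eq_range] at s1 s2 s3
  rw [if_pos rfl] at s1
  have e1 : ∑ i : Fin (2 * m), kappa i • (fmu false a.1 b.1 * (fmu false b.1 i.1 *
      fmu false i.1 (mate i) * fmu false b.1 i.1 *
          lam (2 * m) i - fmu false b.1 i.1 * fmu false b.1 (mate i) * lam (2 * m) (mate i)) +
        (if b.1 = i.1 then 0 else fmu false a.1 i.1 * fmu false b.1 (mate i) * lam (2 * m) i)) •
          S.t2 a b = (fmu false a.1 b.1 * (qnum 2 * qnum ((2 * m : ℕ) - (2 : ℕ)) +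
            gpow (2 * m) (b / 2)) + (qnum ((2 * m : ℕ) - (2 : ℕ)) -
            fmu false a.1 b.1 * gpow (2 * m) (b / 2) +
            if b.1 = mate a then kappa a * lam (2 * m) a else 0)) • S.t2 a b := by
    rw [← s1, ← s3, Finset.mul_sum, ← Finset.sum_add_distrib, Finset.sum_smul]
    refine Finset.sum_congr rfl fun i _ => ?_
    rw [smul_smul]
    congr 1
    split_ifs <;> ring
  have e2 : ∑ i : Fin (2 * m), kappa i • (xmu a b * (fmu false b.1 i.1 * fmu false i.1 (mate i) *
      fmu false a.1 i.1 *
          lam (2 * m) i - fmu false b.1 i.1 * fmu false a.1 (mate i) * lam (2 * m) (mate i))) •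
          S.t2 b a = (xmu a b * (qnum 2 * qnum ((2 * m : ℕ) - (2 : ℕ)) +
        if a.1 / 2 = b / 2 then gpow (2 * m) (b / 2) else 0)) • S.t2 b a := by
    rw [← s2, Finset.mul_sum, Finset.sum_smul]
    refine Finset.sum_congr rfl fun i _ => ?_
    rw [smul_smul]
    congr 1
    ring
  rw [e1, e2]
  by_cases hab : b = pt a
  · subst hab
    have k : kappa (mate a) * lam (2 * m) a = -gpow (2 * m) (a / 2) := by
      rcases Nat.even_or_odd' a.1 with ⟨k, hk | hk⟩
      · rw [hk, mate_even, kappa_lam_odd_even, Nat.mul_div_cancel_left k two_pos]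
      · rw [hk, mate_odd, kappa_lam_even_odd, show (2 * k + 1) / 2 = k by omega]
    rw [pt_val, mform_mate, if_pos rfl, mate_div, if_pos rfl, xmu_of_ne (mate_ne a).symm, pt_pt]
    match_scalars
    · ring
    · linear_combination -k
    · ring
  · have n : b.1 ≠ mate a := fun h => hab (Fin.ext h)
    rw [mform_of_ne _ n, if_neg n]
    by_cases h2 : a = b
    · subst h2
      rw [xmu_self]
      module
    · have n' : a.1 / 2 ≠ b / 2 := fun h => (eq_or_eq_mate h).elim (fun h => h2 (Fin.ext h.symm)) n
      rw [if_neg n']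
      module

lemma loop_two : S.C₂ ∘ₗ S.D₂ = qnum (2 * m : ℕ) • LinearMap.id := by
  refine S.ext0 ?_
  change S.C₂ (S.D₂ S.t0) = qnum (2 * m : ℕ) • S.t0
  have h := sum_kappa_lam m
  rw [← sum_fin_eq_range] at h
  rw [S.hD₂, ← h, map_sum, Finset.sum_smul]
  refine Finset.sum_congr rfl fun i _ => ?_
  rw [map_smul, S.hC₂, pt_val, mform_mate, smul_smul]

lemma C₂_μ : S.C₂ ∘ₗ S.μ = qnum 2 • S.C₂ := by
  refine S.ext2 fun a b => ?_
  change S.C₂ (S.μ (S.t2 a b)) = qnum 2 • S.C₂ (S.t2 a b)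
  rw [S.hμ, map_add, map_smul, map_smul, S.hC₂, S.hC₂, smul_smul, smul_smul, smul_smul, ← add_smul,
    mform_mu (lam_mate (2 * m))]

lemma kappa_fmu (i : Fin (2 * m)) :
    kappa i * fmu false i.1 (mate i) - kappa (mate i) = qnum 2 * kappa i := by
  have h := mform_mu kappa_mate i.1 (mate i.1)
  rw [mform_mate, mform_mate_left, xmu_of_ne (mate_ne _).symm] at h
  linear_combination h

lemma sum_pt {M : Type*} [AddCommMonoid M] (f : Fin (2 * m) → M) : ∑ i, f (pt i) = ∑ i, f i :=
  Fintype.sum_equiv ⟨pt, pt, pt_pt, pt_pt⟩ _ _ fun _ => rfl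

lemma sum_kappa_μ {M : Type*} [AddCommGroup M] [Module Kq M] (f : Fin (2 * m) → Fin (2 * m) → M) :
    ∑ i : Fin (2 * m), kappa i.1 • (fmu false i.1 (pt i).1 • f i (pt i) +
      xmu i (pt i) • f (pt i) i) = qnum 2 • ∑ i : Fin (2 * m), kappa i.1 • f i (pt i) := by
  have h : ∀ i : Fin (2 * m), kappa i.1 • (fmu false i.1 (pt i).1 • f i (pt i) +
      xmu i (pt i) • f (pt i) i) = (kappa i.1 * fmu false i.1 (mate i)) • f i (pt i) -
        kappa i.1 • f (pt i) i := by
    intro i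
    rw [pt_val, xmu_of_ne (mate_ne _).symm]
    module
  rw [Finset.sum_congr rfl fun i _ => h i, Finset.sum_sub_distrib,
    ← sum_pt (fun i : Fin (2 * m) => kappa i.1 • f (pt i) i), ← Finset.sum_sub_distrib,
    Finset.smul_sum]
  refine Finset.sum_congr rfl fun i _ => ?_
  rw [pt_pt, pt_val, ← sub_smul, kappa_fmu, smul_smul]

lemma μ_D₂ : S.μ ∘ₗ S.D₂ = qnum 2 • S.D₂ := by
  refine S.ext0 ?_
  change S.μ (S.D₂ S.t0) = qnum 2 • S.D₂ S.t0
  rw [S.hD₂, ← sum_kappa_μ, map_sum]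
  refine Finset.sum_congr rfl fun i _ => ?_
  rw [map_smul, S.hμ]

lemma μ₃_D₄ (x : M2) : S.μ₃ (S.D₄ x) = qnum 2 • S.D₄ x := by
  suffices h : S.μ₃ ∘ₗ S.D₄ = qnum 2 • S.D₄ from LinearMap.congr_fun h x
  refine S.ext2 fun a b => ?_
  change S.μ₃ (S.D₄ (S.t2 a b)) = qnum 2 • S.D₄ (S.t2 a b)
  rw [S.hD₄, ← sum_kappa_μ, map_sum]
  refine Finset.sum_congr rfl fun i _ => ?_
  rw [map_smul, S.h3]

lemma C₄_μ₃ (x : M4) : S.C₄ (S.μ₃ x) = qnum 2 • S.C₄ x := by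
  suffices h : S.C₄ ∘ₗ S.μ₃ = qnum 2 • S.C₄ from LinearMap.congr_fun h x
  refine S.ext4 fun a b c d => ?_
  change S.C₄ (S.μ₃ (S.t4 a b c d)) = qnum 2 • S.C₄ (S.t4 a b c d)
  rw [S.h3, map_add, map_smul, map_smul, S.hC₄, S.hC₄, smul_smul, smul_smul, smul_smul, ← add_smul,
    mform_mu (lam_mate (2 * m))]

lemma C₄_μ₁ (x : M4) : S.C₄ (S.μ₁ x) = S.μ (S.C₄ x) := by
  suffices h : S.C₄ ∘ₗ S.μ₁ = S.μ ∘ₗ S.C₄ from LinearMap.congr_fun h x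
  refine S.ext4 fun a b c d => ?_
  change S.C₄ (S.μ₁ (S.t4 a b c d)) = S.μ (S.C₄ (S.t4 a b c d))
  rw [S.h1, map_add, map_smul, map_smul, S.hC₄, S.hC₄, map_smul, S.hμ]
  module

lemma μ₁_D₄ (x : M2) : S.μ₁ (S.D₄ x) = S.D₄ (S.μ x) := by
  suffices h : S.μ₁ ∘ₗ S.D₄ = S.D₄ ∘ₗ S.μ from LinearMap.congr_fun h x
  refine S.ext2 fun a b => ?_
  change S.μ₁ (S.D₄ (S.t2 a b)) = S.D₄ (S.μ (S.t2 a b))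
  rw [S.hD₄, S.hμ, map_add, map_smul, map_smul, S.hD₄, S.hD₄, map_sum, Finset.smul_sum,
    Finset.smul_sum, ← Finset.sum_add_distrib]
  refine Finset.sum_congr rfl fun i _ => ?_
  rw [map_smul, S.h1]
  module

lemma C₄_D₄ (x : M2) : S.C₄ (S.D₄ x) = qnum (2 * m : ℕ) • x := by
  suffices h : S.C₄ ∘ₗ S.D₄ = qnum (2 * m : ℕ) • LinearMap.id from LinearMap.congr_fun h x
  refine S.ext2 fun a b => ?_
  change S.C₄ (S.D₄ (S.t2 a b)) = qnum (2 * m : ℕ) • S.t2 a b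
  have h := sum_kappa_lam m
  rw [← sum_fin_eq_range] at h
  rw [S.hD₄, ← h, map_sum, Finset.sum_smul]
  refine Finset.sum_congr rfl fun i _ => ?_
  rw [map_smul, S.hC₄, pt_val, mform_mate, smul_smul]

lemma C₄_μ₂_D₄ (x : M2) : S.C₄ (S.μ₂ (S.D₄ x)) = qnum ((2 * m : ℕ) - (1 : ℕ)) • x := by
  suffices h : S.C₄ ∘ₗ S.μ₂ ∘ₗ S.D₄ = qnum ((2 * m : ℕ) - (1 : ℕ)) • LinearMap.id from
    LinearMap.congr_fun h x
  refine S.ext2 fun a b => ?_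
  change S.C₄ (S.μ₂ (S.D₄ (S.t2 a b))) = qnum ((2 * m : ℕ) - (1 : ℕ)) • S.t2 a b
  have h := sum_kappa_lam_fmu b.2
  rw [← sum_fin_eq_range] at h
  rw [S.hD₄, ← h, map_sum, map_sum, Finset.sum_smul]
  refine Finset.sum_congr rfl fun i _ => ?_
  rw [map_smul, map_smul, S.h2, map_add, map_smul, map_smul, S.hC₄, S.hC₄, pt_val, mform_mate,
    smul_smul (xmu b i), xmu_mul_mform_mate]
  module

lemma fmu_sq (a b : ℕ) : fmu false a b * fmu false a b + xmu a b * xmu a b =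
    qnum 2 * fmu false a b := by
  have h0 := qpar_ne_zero
  rw [qnum_two]
  rcases lt_trichotomy a b with h | h | h
  · rw [fmu_lt h, xmu_of_ne h.ne]
    field_simp
  · rw [h, fmu_self, xmu_self]; ring
  · rw [fmu_gt h, xmu_of_ne h.ne']
    field_simp
    ring

lemma fmu_xmu (a b : ℕ) : fmu false a b * xmu a b + xmu a b * fmu false b a =
    qnum 2 * xmu a b := by
  rw [qnum_two]
  rcases lt_trichotomy a b with h | h | h
  · rw [fmu_lt h, fmu_gt h]; ring
  · rw [h, fmu_self, xmu_self]; ring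
  · rw [fmu_gt h, fmu_lt h]; ring

lemma μ_μ (x : M2) : S.μ (S.μ x) = qnum 2 • S.μ x := by
  suffices h : S.μ ∘ₗ S.μ = qnum 2 • S.μ from LinearMap.congr_fun h x
  refine S.ext2 fun a b => ?_
  change S.μ (S.μ (S.t2 a b)) = qnum 2 • S.μ (S.t2 a b)
  simp only [S.hμ, map_add, map_smul]
  have h1 := fmu_sq a b
  have h2 := fmu_xmu a b
  have h3 := xmu_comm b a
  match_scalars
  · rw [h3]; linear_combination h1
  · linear_combination h2

lemma μ₂_μ₂ (x : M4) : S.μ₂ (S.μ₂ x) = qnum 2 • S.μ₂ x := by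
  suffices h : S.μ₂ ∘ₗ S.μ₂ = qnum 2 • S.μ₂ from LinearMap.congr_fun h x
  refine S.ext4 fun a b c d => ?_
  change S.μ₂ (S.μ₂ (S.t4 a b c d)) = qnum 2 • S.μ₂ (S.t4 a b c d)
  simp only [S.h2, map_add, map_smul]
  have h1 := fmu_sq b c
  have h2 := fmu_xmu b c
  have h3 := xmu_comm c b
  match_scalars
  · rw [h3]; linear_combination h1
  · linear_combination h2

/-- The braid relation, for the action on words with three letters. -/
lemma braid_aux {M : Type*} [AddCommGroup M] [Module Kq M]
    (T : Fin (2 * m) → Fin (2 * m) → Fin (2 * m) → M) (f g : M →ₗ[Kq] M)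
    (hf : ∀ a b c, f (T a b c) = fmu false a.1 b.1 • T a b c + xmu a b • T b a c)
    (hg : ∀ a b c, g (T a b c) = fmu false b.1 c.1 • T a b c + xmu b c • T a c b)
    (a b c : Fin (2 * m)) :
    g (f (g (T a b c))) + f (T a b c) = f (g (f (T a b c))) + g (T a b c) := by
  have h0 := qpar_ne_zero
  have lt : ∀ {x y : Fin (2 * m)}, x < y → fmu false x.1 y.1 = qpar := fun h => fmu_lt h
  have gt : ∀ {x y : Fin (2 * m)}, y < x → fmu false x.1 y.1 = qpar⁻¹ := fun h => fmu_gt h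
  have ne : ∀ {x y : Fin (2 * m)}, x < y → xmu x y = -1 := fun h => xmu_of_ne (ne_of_lt h)
  have ne' : ∀ {x y : Fin (2 * m)}, y < x → xmu x y = -1 := fun h => xmu_of_ne (ne_of_gt h)
  simp only [hf, hg, map_add, map_smul]
  rcases lt_trichotomy a b with h1 | rfl | h1
  · rcases lt_trichotomy b c with h2 | rfl | h2
    · have h3 := h1.trans h2
      simp only [lt h1, lt h2, lt h3, gt h1, gt h2, gt h3, ne h1, ne h2, ne h3, ne' h1, ne' h2,
        ne' h3]
      match_scalars <;> field_simp
    · simp only [lt h1, gt h1, ne h1, ne' h1, fmu_self, xmu_self]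
      match_scalars <;> field_simp <;> ring
    · rcases lt_trichotomy a c with h3 | rfl | h3
      · simp only [lt h1, lt h2, lt h3, gt h1, gt h2, gt h3, ne h1, ne h2, ne h3, ne' h1, ne' h2,
          ne' h3]
        match_scalars <;> field_simp <;> ring
      · simp only [lt h1, gt h1, ne h1, ne' h1, fmu_self, xmu_self]
        match_scalars <;> field_simp <;> ring
      · simp only [lt h1, lt h2, lt h3, gt h1, gt h2, gt h3, ne h1, ne h2, ne h3, ne' h1, ne' h2,
          ne' h3]
        match_scalars <;> field_simp <;> ring
  · rcases lt_trichotomy a c with h2 | rfl | h2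
    · simp only [lt h2, gt h2, ne h2, ne' h2, fmu_self, xmu_self]
      match_scalars <;> field_simp <;> ring
    · simp only [fmu_self, xmu_self]
    · simp only [lt h2, gt h2, ne h2, ne' h2, fmu_self, xmu_self]
      match_scalars <;> field_simp <;> ring
  · rcases lt_trichotomy b c with h2 | rfl | h2
    · rcases lt_trichotomy a c with h3 | rfl | h3
      · simp only [lt h1, lt h2, lt h3, gt h1, gt h2, gt h3, ne h1, ne h2, ne h3, ne' h1, ne' h2,
          ne' h3]
        match_scalars <;> field_simp <;> ring
      · simp only [lt h1, gt h1, ne h1, ne' h1, fmu_self, xmu_self]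
        match_scalars <;> field_simp <;> ring
      · simp only [lt h1, lt h2, lt h3, gt h1, gt h2, gt h3, ne h1, ne h2, ne h3, ne' h1, ne' h2,
          ne' h3]
        match_scalars <;> field_simp <;> ring
    · simp only [lt h1, gt h1, ne h1, ne' h1, fmu_self, xmu_self]
      match_scalars <;> field_simp <;> ring
    · have h3 := h2.trans h1
      simp only [lt h1, lt h2, lt h3, gt h1, gt h2, gt h3, ne h1, ne h2, ne h3, ne' h1, ne' h2,
        ne' h3]
      match_scalars <;> field_simp

lemma braid_left (x : M4) :
    S.μ₂ (S.μ₁ (S.μ₂ x)) = S.μ₁ (S.μ₂ (S.μ₁ x)) + S.μ₂ x - S.μ₁ x := by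
  suffices h : S.μ₂ ∘ₗ S.μ₁ ∘ₗ S.μ₂ + S.μ₁ = S.μ₁ ∘ₗ S.μ₂ ∘ₗ S.μ₁ + S.μ₂ from
    eq_sub_of_add_eq (LinearMap.congr_fun h x)
  exact S.ext4 fun a b c d => braid_aux (fun a b c => S.t4 a b c d) S.μ₁ S.μ₂
    (fun a b c => S.h1 a b c d) (fun a b c => S.h2 a b c d) a b c

lemma braid_right (x : M4) :
    S.μ₂ (S.μ₃ (S.μ₂ x)) = S.μ₃ (S.μ₂ (S.μ₃ x)) + S.μ₂ x - S.μ₃ x := by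
  suffices h : S.μ₃ ∘ₗ S.μ₂ ∘ₗ S.μ₃ + S.μ₂ = S.μ₂ ∘ₗ S.μ₃ ∘ₗ S.μ₂ + S.μ₃ from
    eq_sub_of_add_eq (LinearMap.congr_fun h.symm x)
  exact S.ext4 fun a b c d => braid_aux (fun b c d => S.t4 a b c d) S.μ₂ S.μ₃
    (fun b c d => S.h2 a b c d) (fun b c d => S.h3 a b c d) b c d

end Strands

end Trace

section Skein

variable {m : ℕ}

lemma qnum_nat_cast (n : ℕ) : qnum (n : ℕ) = (qpar ^ n - (qpar ^ n)⁻¹) / (qpar - qpar⁻¹) := by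
  have := qnum_sub_nat n 0
  rw [Nat.cast_zero, sub_zero] at this
  rw [this, pow_zero, inv_one, mul_one, mul_one]

lemma zqnum_zero (z : Kq) (d : ℕ) : zqnum z d 0 = (z - z⁻¹) / (qpar ^ d - (qpar ^ d)⁻¹) := by
  simp [zqnum]

lemma zqnum_neg (z : Kq) (d j : ℕ) : zqnum z d (-j) =
    (z * ((qpar ^ d) ^ j)⁻¹ - z⁻¹ * (qpar ^ d) ^ j) / (qpar ^ d - (qpar ^ d)⁻¹) := by
  rw [zqnum, neg_neg, zpow_neg, zpow_natCast]

lemma qpar_sq_sub_inv : qpar ^ 2 - (qpar ^ 2)⁻¹ = (qpar - qpar⁻¹) * qnum 2 := by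
  have h0 := qpar_ne_zero
  rw [qnum_two]
  field_simp
  ring

lemma qnum_two_ne_zero : qnum 2 ≠ 0 := qnum_ne_zero two_ne_zero

namespace Strands

variable {M0 M2 M4 : Type} [AddCommGroup M0] [Module Kq M0] [AddCommGroup M2] [Module Kq M2]
  [AddCommGroup M4] [Module Kq M4] (S : Strands m M0 M2 M4)

lemma lasso_apply (x : M2) {y z w : M4} (hw : w = qpar⁻¹ • S.D₄ x - S.μ₂ (S.D₄ x))
    (hz : z = qnum 2 • w - S.μ₃ w) (hy : y = qnum 2 • z - S.μ₁ z) :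
    S.C₄ (qpar • y - S.μ₂ y) = S.D₂ (S.C₂ x) + zqnum (-(qpar ^ (2 * m))⁻¹) 1 (-2) • x := by
  have h0 := qpar_ne_zero
  have h1 := qpar_sub_ne_zero
  have W : S.C₄ (S.μ₂ (S.μ₁ (S.μ₃ (S.μ₂ (S.D₄ x))))) = S.D₂ (S.C₂ x) +
      (qnum 2 * qnum ((2 * m : ℕ) - (2 : ℕ))) • S.μ x + qnum ((2 * m : ℕ) - (2 : ℕ)) • x :=
    LinearMap.congr_fun S.trace_two x
  have e2 : zqnum (-(qpar ^ (2 * m))⁻¹) 1 (-2) = (qpar ^ (2 * m) * qpar ^ 2 -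
      (qpar ^ (2 * m))⁻¹ * (qpar ^ 2)⁻¹) / (qpar - qpar⁻¹) := by
    have := zqnum_neg (-(qpar ^ (2 * m))⁻¹) 1 2
    rw [pow_one, inv_neg, inv_inv] at this
    rw [show (-2 : ℤ) = -((2 : ℕ) : ℤ) from rfl, this]
    ring
  rw [hy, hz, hw]
  simp only [map_sub, map_smul, smul_sub, S.μ₃_D₄, S.C₄_μ₃, S.μ₁_D₄, S.C₄_μ₁, S.C₄_D₄, S.C₄_μ₂_D₄,
    S.μ₂_μ₂, S.braid_left, S.braid_right, S.μ_μ, map_add, smul_add, W]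
  rw [e2]
  simp only [qnum_nat_cast, qnum_sub_nat, qnum_two]
  match_scalars
  · field_simp
    ring
  · field_simp
    ring
  · ring

variable (c e : Kq)

lemma slide_cap (x : M4) : S.C₂ (S.C₄ (c • (c • x + e • S.μ₁ x) + e • S.μ₂ (c • x + e • S.μ₁ x))) =
    S.C₂ (S.C₄ (c • (c • x + e • S.μ₃ x) + e • S.μ₂ (c • x + e • S.μ₃ x))) := by
  have h : S.C₂ ∘ₗ S.C₄ ∘ₗ S.μ₂ ∘ₗ S.μ₁ = S.C₂ ∘ₗ S.C₄ ∘ₗ S.μ₂ ∘ₗ S.μ₃ := by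
    refine S.ext4 fun a b c d => ?_
    have key : ∀ a b c d, S.C₂ (S.C₄ (S.μ₂ (S.t4 a b c d))) =
        qform (lam (2 * m)) a b c d • S.t0 := by
      intro a b c d
      rw [S.h2, map_add, map_smul, map_smul, S.hC₄, S.hC₄, map_add, map_smul, map_smul, map_smul,
        map_smul, S.hC₂, S.hC₂, qform]
      module
    change S.C₂ (S.C₄ (S.μ₂ (S.μ₁ (S.t4 a b c d)))) = S.C₂ (S.C₄ (S.μ₂ (S.μ₃ (S.t4 a b c d))))
    rw [S.h1, S.h3]
    simp only [map_add, map_smul, key, smul_smul, ← add_smul]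
    rw [qform_slide (lam_mate (2 * m))]
  have h' : S.C₂ (S.C₄ (S.μ₂ (S.μ₁ x))) = S.C₂ (S.C₄ (S.μ₂ (S.μ₃ x))) := LinearMap.congr_fun h x
  have h2 : S.C₂ (S.μ (S.C₄ x)) = qnum 2 • S.C₂ (S.C₄ x) := LinearMap.congr_fun S.C₂_μ (S.C₄ x)
  simp only [map_add, map_smul, S.C₄_μ₁, S.C₄_μ₃, h', h2]

/-- The vector with given coordinates. -/
noncomputable def vec (Θ : ℕ → ℕ → ℕ → ℕ → Kq) : M4 :=
  ∑ a : Fin (2 * m), ∑ b : Fin (2 * m), ∑ c : Fin (2 * m), ∑ d : Fin (2 * m),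
    Θ a b c d • S.t4 a b c d

lemma vec_add (Θ Θ' : ℕ → ℕ → ℕ → ℕ → Kq) :
    S.vec (fun a b c d => Θ a b c d + Θ' a b c d) = S.vec Θ + S.vec Θ' := by
  simp only [vec, add_smul, Finset.sum_add_distrib]

lemma μ₁_vec (Θ : ℕ → ℕ → ℕ → ℕ → Kq) : S.μ₁ (S.vec Θ) =
    S.vec fun a b c d => fmu false a b * Θ a b c d + xmu a b * Θ b a c d := by
  rw [vec_add]
  have h : S.vec (fun a b c d => xmu a b * Θ b a c d) =
      ∑ a : Fin (2 * m), ∑ b : Fin (2 * m), ∑ c : Fin (2 * m), ∑ d : Fin (2 * m),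
        (xmu b a * Θ a b c d) • S.t4 b a c d := by rw [vec, Finset.sum_comm]
  rw [h]
  simp only [vec, map_sum, map_smul, S.h1, smul_add, Finset.sum_add_distrib, smul_smul]
  congr 1
  · simp only [mul_comm]
  · simp only [mul_comm, xmu_comm]

lemma μ₂_vec (Θ : ℕ → ℕ → ℕ → ℕ → Kq) : S.μ₂ (S.vec Θ) =
    S.vec fun a b c d => fmu false b c * Θ a b c d + xmu b c * Θ a c b d := by
  rw [vec_add]
  have h : S.vec (fun a b c d => xmu b c * Θ a c b d) =
      ∑ a : Fin (2 * m), ∑ b : Fin (2 * m), ∑ c : Fin (2 * m), ∑ d : Fin (2 * m),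
        (xmu c b * Θ a b c d) • S.t4 a c b d := by
    rw [vec]
    exact Finset.sum_congr rfl fun a _ => Finset.sum_comm
  rw [h]
  simp only [vec, map_sum, map_smul, S.h2, smul_add, Finset.sum_add_distrib, smul_smul]
  congr 1
  · simp only [mul_comm]
  · simp only [mul_comm, xmu_comm]

lemma μ₃_vec (Θ : ℕ → ℕ → ℕ → ℕ → Kq) : S.μ₃ (S.vec Θ) =
    S.vec fun a b c d => fmu false c d * Θ a b c d + xmu c d * Θ a b d c := by
  rw [vec_add]
  have h : S.vec (fun a b c d => xmu c d * Θ a b d c) =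
      ∑ a : Fin (2 * m), ∑ b : Fin (2 * m), ∑ c : Fin (2 * m), ∑ d : Fin (2 * m),
        (xmu d c * Θ a b c d) • S.t4 a b d c := by
    rw [vec]
    exact Finset.sum_congr rfl fun a _ => Finset.sum_congr rfl fun b _ => Finset.sum_comm
  rw [h]
  simp only [vec, map_sum, map_smul, S.h3, smul_add, Finset.sum_add_distrib, smul_smul]
  congr 1
  · simp only [mul_comm]
  · simp only [mul_comm, xmu_comm]

lemma sum_mform {M : Type*} [AddCommGroup M] [Module Kq M] (θ : ℕ → Kq) (a : Fin (2 * m))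
    (f : Fin (2 * m) → M) : ∑ b : Fin (2 * m), mform θ a b • f b = θ a • f (pt a) := by
  rw [Finset.sum_eq_single (pt a)]
  · rw [pt_val, mform_mate]
  · intro b _ h
    rw [mform_of_ne θ fun h' => h (Fin.ext h'), zero_smul]
  · exact fun h => absurd (Finset.mem_univ _) h

lemma D₄_D₂ : S.D₄ (S.D₂ S.t0) = S.vec fun a b c d => mform kappa a b * mform kappa c d := by
  rw [vec, S.hD₂, map_sum]
  refine Finset.sum_congr rfl fun a _ => ?_
  rw [map_smul, S.hD₄]
  simp only [mul_smul, ← Finset.smul_sum, sum_mform]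

lemma slide_cup (x : M0) :
    c • (c • S.D₄ (S.D₂ x) + e • S.μ₂ (S.D₄ (S.D₂ x))) +
      e • S.μ₁ (c • S.D₄ (S.D₂ x) + e • S.μ₂ (S.D₄ (S.D₂ x))) =
    c • (c • S.D₄ (S.D₂ x) + e • S.μ₂ (S.D₄ (S.D₂ x))) +
      e • S.μ₃ (c • S.D₄ (S.D₂ x) + e • S.μ₂ (S.D₄ (S.D₂ x))) := by
  have h : S.μ₁ ∘ₗ S.μ₂ ∘ₗ S.D₄ ∘ₗ S.D₂ = S.μ₃ ∘ₗ S.μ₂ ∘ₗ S.D₄ ∘ₗ S.D₂ := by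
    refine S.ext0 ?_
    change S.μ₁ (S.μ₂ (S.D₄ (S.D₂ S.t0))) = S.μ₃ (S.μ₂ (S.D₄ (S.D₂ S.t0)))
    have h2 : S.μ₂ (S.D₄ (S.D₂ S.t0)) = S.vec (qform kappa) := by
      rw [D₄_D₂, μ₂_vec]
      rfl
    rw [h2, μ₁_vec, μ₃_vec]
    congr 1
    funext a b c d
    exact qform_slide kappa_mate a b c d
  have h' : S.μ₁ (S.μ₂ (S.D₄ (S.D₂ x))) = S.μ₃ (S.μ₂ (S.D₄ (S.D₂ x))) := LinearMap.congr_fun h x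
  have h2 : S.μ (S.D₂ x) = qnum 2 • S.D₂ x := LinearMap.congr_fun S.μ_D₂ x
  simp only [map_add, map_smul, S.μ₁_D₄, S.μ₃_D₄, h', h2]

end Strands

end Skein

section Equivariance

open UqGen (lo hi hroot Nbr)

variable {n : ℕ}

section Cubic

variable {ρ : Uq n →ₐ[Kq] Module.End Kq (Fin n → Kq)}

lemma ite_bv_E (hE : ∀ i j, ρ (Uq.E i) (bv j) = if j = hi i then bv (lo i) else 0)
    (c : Prop) [Decidable c] (j : Fin (n - 1)) (b : Fin n) :
    ρ (Uq.E j) (if c then bv b else 0) = if c ∧ b = hi j then bv (lo j) else 0 := by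
  split_ifs with h1 h2 h2
  · rw [hE, if_pos h2.2]
  · rw [hE, if_neg fun h => h2 ⟨h1, h⟩]
  · exact absurd h2.1 h1
  · exact map_zero _

lemma ite_bv_qh (hq : ∀ h j, ρ (Uq.qh h) (bv j) = qpar ^ h j • bv j)
    (c : Prop) [Decidable c] (h : Fin n → ℤ) (b : Fin n) :
    ρ (Uq.qh h) (if c then bv b else 0) = if c then qpar ^ h b • bv b else 0 := by
  split_ifs with h1
  · rw [hq]
  · exact map_zero _

lemma cubic_bv (hE : ∀ i j, ρ (Uq.E i) (bv j) = if j = hi i then bv (lo i) else 0)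
    {l i r : Fin (n - 1)} (hl : l.1 + 1 = i.1) (hr : i.1 + 1 = r.1) (a : Fin n) :
    ρ (Uq.T l i r) (bv a) = if a = hi r then -qpar⁻¹ • bv (lo l) else 0 := by
  have e1 : lo r = hi i := Fin.ext hr.symm
  have e2 : lo i = hi l := Fin.ext hl.symm
  have n1 : hi l ≠ hi r := by simp only [lo, hi, ne_eq, Fin.mk.injEq]; omega
  have n2 : lo l ≠ hi i := by simp only [lo, hi, ne_eq, Fin.mk.injEq]; omega
  have n3 : hi i ≠ hi l := by simp only [lo, hi, ne_eq, Fin.mk.injEq]; omega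
  rw [Uq.T]
  simp only [map_add, map_sub, map_smul, map_mul, LinearMap.add_apply, LinearMap.sub_apply,
    LinearMap.smul_apply, Module.End.mul_apply, hE, ite_bv_E hE, n1, n2, n3, e1, e2, and_false,
    if_false, and_true]
  split_ifs <;> simp

lemma commutator_bv (hE : ∀ i j, ρ (Uq.E i) (bv j) = if j = hi i then bv (lo i) else 0)
    {j i : Fin (n - 1)} (a : Fin n) :
    ρ (Uq.E j * Uq.E i - qpar⁻¹ • (Uq.E i * Uq.E j)) (bv a) =
      (if a = hi i ∧ lo i = hi j then bv (lo j) else 0) -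
        qpar⁻¹ • (if a = hi j ∧ lo j = hi i then bv (lo i) else 0) := by
  simp only [map_sub, map_smul, map_mul, LinearMap.sub_apply,
    LinearMap.smul_apply, Module.End.mul_apply, hE, ite_bv_E hE]

lemma outer_cubic (hE : ∀ i j, ρ (Uq.E i) (bv j) = if j = hi i then bv (lo i) else 0)
    (hq : ∀ h j, ρ (Uq.qh h) (bv j) = qpar ^ h j • bv j)
    {l i r : Fin (n - 1)} (hl : l.1 + 1 = i.1) (hr : i.1 + 1 = r.1) (a b : Fin n) :
    outer ρ ρ (Uq.comulHom (Uq.T l i r)) (bv a ⊗ₜ[Kq] bv b) =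
      (if a = hi r then (-qpar⁻¹ * qpar ^ (hroot i b + (hroot l b + hroot r b))) •
        (bv (lo l) ⊗ₜ[Kq] bv b) else 0) +
      (if a = hi r ∧ b = lo i then (-qpar⁻¹ * (qpar - qpar⁻¹)) • (bv (lo i) ⊗ₜ[Kq] bv (lo l))
        else 0) +
      (if a = hi i ∧ b = hi r then ((qpar - qpar⁻¹) * qpar⁻¹) • (bv (lo l) ⊗ₜ[Kq] bv (hi i))
        else 0) +
      (if b = hi r then -qpar⁻¹ • (bv a ⊗ₜ[Kq] bv (lo l)) else 0) := by
  have nl : Nbr i l := Or.inr hl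
  have nr : Nbr i r := Or.inl hr
  have nlr : ¬ Nbr l r := by simp only [Nbr]; omega
  have ne : l ≠ r := by intro h; rw [h] at hl; omega
  have e1 : lo r = hi i := Fin.ext hr.symm
  have e2 : hi l = lo i := Fin.ext hl
  have n1 : lo i ≠ hi r := by simp only [lo, hi, ne_eq, Fin.mk.injEq]; omega
  have n2 : lo l ≠ hi i := by simp only [lo, hi, ne_eq, Fin.mk.injEq]; omega
  have n3 : hi i ≠ lo i := by simp only [lo, hi, ne_eq, Fin.mk.injEq]; omega
  have w1 : hroot i (lo l) + hroot r (lo l) = 0 := by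
    simp only [hroot, Pi.sub_apply, Pi.single_apply, lo, hi, Fin.mk.injEq]; split_ifs <;> omega
  have w2 : hroot i (hi i) + hroot l (hi i) = -1 := by
    simp only [hroot, Pi.sub_apply, Pi.single_apply, lo, hi, Fin.mk.injEq]; split_ifs <;> omega
  rw [Uq.comul_T nl nr nlr ne]
  simp only [Uq.qh_mul, ← mul_assoc]
  simp only [map_add, map_smul, LinearMap.add_apply, LinearMap.smul_apply, outer_tmul,
    TensorProduct.map_tmul, cubic_bv hE hl hr, commutator_bv hE, map_one, Module.End.one_apply, map_mul,
    Module.End.mul_apply, hE, hq, ite_bv_qh hq, ite_bv_E hE, e1, e2, n1, n2, n3, n3.symm,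
    and_false, if_false, and_true, if_true, map_zero, tmul_zero, smul_zero, add_zero,
    Pi.add_apply, w1, w2, zpow_zero, one_smul, zero_sub, sub_zero, zpow_neg_one, _root_.add_assoc]
  have n4 : hi r ≠ hi i := by simp only [hi, ne_eq, Fin.mk.injEq]; omega
  have s1 : ∀ (c : Kq) (x y : Fin n → Kq), (c • x) ⊗ₜ[Kq] y = c • (x ⊗ₜ[Kq] y) := fun _ _ _ => rfl
  by_cases h1 : a = hi r
  · subst h1
    by_cases h3 : b = hi r
    · subst h3
      simp only [n1.symm, n4, if_true, if_false, and_false, false_and, true_and, s1, tmul_smul,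
        smul_zero, neg_zero, add_zero, zero_add, tmul_neg, neg_tmul, zero_tmul, tmul_zero]
      module
    · by_cases h4 : b = lo i
      · subst h4
        simp only [n1, n4, if_true, if_false, and_false, false_and, true_and, s1, tmul_smul,
        smul_zero, neg_zero, add_zero, zero_add, tmul_neg, neg_tmul, zero_tmul, tmul_zero]
        module
      · simp only [h3, h4, n4, if_true, if_false, and_false, false_and, true_and, s1, tmul_smul,
        smul_zero, neg_zero, add_zero, zero_add, tmul_neg, neg_tmul, zero_tmul, tmul_zero]
        module
  · by_cases h3 : b = hi r
    · subst h3
      by_cases h2 : a = hi i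
      · subst h2
        simp only [h1, if_true, if_false, and_false, false_and, true_and, s1, tmul_smul,
        smul_zero, neg_zero, add_zero, zero_add, tmul_neg, neg_tmul, zero_tmul, tmul_zero]
        module
      · simp only [h1, h2, if_true, if_false, and_false, false_and, true_and, s1, tmul_smul,
        smul_zero, neg_zero, add_zero, zero_add, tmul_neg, neg_tmul, zero_tmul, tmul_zero]
    · simp only [h1, h3, if_false, and_false, false_and, smul_zero, zero_tmul, tmul_zero,
        add_zero, neg_zero]

end Cubic

lemma vecSq_T {l i r : Fin (n - 1)} (hl : l.1 + 1 = i.1) (hr : i.1 + 1 = r.1) (a b : Fin n) :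
    (vecSq n).ρ (Uq.T l i r) (bv a ⊗ₜ[Kq] bv b) =
      (if a = hi r then (-qpar⁻¹ * qpar ^ (hroot i b + (hroot l b + hroot r b))) •
        (bv (lo l) ⊗ₜ[Kq] bv b) else 0) +
      (if a = hi r ∧ b = lo i then (-qpar⁻¹ * (qpar - qpar⁻¹)) • (bv (lo i) ⊗ₜ[Kq] bv (lo l))
        else 0) +
      (if a = hi i ∧ b = hi r then ((qpar - qpar⁻¹) * qpar⁻¹) • (bv (lo l) ⊗ₜ[Kq] bv (hi i))
        else 0) +
      (if b = hi r then -qpar⁻¹ • (bv a ⊗ₜ[Kq] bv (lo l)) else 0) :=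
  outer_cubic vecRep_E vecRep_qh hl hr a b

/-- The bilinear form on the vector representation which gives the cap. -/
noncomputable def capV (n : ℕ) : (vecSq n).V →ₗ[Kq] Kq :=
  TensorProduct.lift (Matrix.toBilin' fun i j : Fin n => mform (lam n) i j)

lemma capV_bv (a b : Fin n) : capV n (bv a ⊗ₜ[Kq] bv b) = mform (lam n) a b := by
  rw [capV, TensorProduct.lift.tmul]
  exact Matrix.toBilin'_single _ _ _

section Invariance

variable {σ : Uq n →ₐ[Kq] Module.End Kq ((Fin n → Kq) ⊗[Kq] (Fin n → Kq))}
  {C : (Fin n → Kq) ⊗[Kq] (Fin n → Kq) →ₗ[Kq] Kq}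

lemma apply_ite_zero {M N : Type*} [AddCommGroup M] [Module Kq M] [AddCommGroup N] [Module Kq N]
    (f : M →ₗ[Kq] N) (c : Prop) [Decidable c] (x : M) :
    f (if c then x else 0) = if c then f x else 0 := by
  split_ifs <;> simp

lemma cap_B (hC : ∀ a b, C (bv a ⊗ₜ[Kq] bv b) = mform (lam n) a b)
    (hq : ∀ h i j, σ (Uq.qh h) (bv i ⊗ₜ[Kq] bv j) =
      (qpar ^ h i * qpar ^ h j) • (bv i ⊗ₜ[Kq] bv j))
    (hF : ∀ k i j, σ (Uq.F k) (bv i ⊗ₜ[Kq] bv j) =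
      (if i = lo k then bv (hi k) ⊗ₜ[Kq] bv j else 0) +
      (if j = lo k then qpar ^ (-hroot k i) • (bv i ⊗ₜ[Kq] bv (hi k)) else 0))
    {l i r : Fin (n - 1)}
    (hT : ∀ a b, σ (Uq.T l i r) (bv a ⊗ₜ[Kq] bv b) =
      (if a = hi r then (-qpar⁻¹ * qpar ^ (hroot i b + (hroot l b + hroot r b))) •
        (bv (lo l) ⊗ₜ[Kq] bv b) else 0) +
      (if a = hi r ∧ b = lo i then (-qpar⁻¹ * (qpar - qpar⁻¹)) • (bv (lo i) ⊗ₜ[Kq] bv (lo l))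
        else 0) +
      (if a = hi i ∧ b = hi r then ((qpar - qpar⁻¹) * qpar⁻¹) • (bv (lo l) ⊗ₜ[Kq] bv (hi i))
        else 0) +
      (if b = hi r then -qpar⁻¹ • (bv a ⊗ₜ[Kq] bv (lo l)) else 0))
    (ho : Odd i.1) (hl : l.1 + 1 = i.1) (hr : i.1 + 1 = r.1) (a b : Fin n) :
    C (σ (Uq.B l i r) (bv a ⊗ₜ[Kq] bv b)) = 0 := by
  have h0 := qpar_ne_zero
  obtain ⟨k, hk⟩ := ho
  have x0 : (lo l : ℕ) = 2 * k := by simp only [lo]; omega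
  have x1 : (lo i : ℕ) = 2 * k + 1 := by simp only [lo]; omega
  have x2 : (hi i : ℕ) = 2 * (k + 1) := by simp only [hi]; omega
  have x3 : (hi r : ℕ) = 2 * (k + 1) + 1 := by simp only [hi]; omega
  have n1 : lo i ≠ hi r := by rw [ne_eq, Fin.ext_iff]; omega
  have n2 : hi i ≠ hi r := by rw [ne_eq, Fin.ext_iff]; omega
  have n3 : lo i ≠ hi i := by rw [ne_eq, Fin.ext_iff]; omega
  have n4 : lo l ≠ hi i := by rw [ne_eq, Fin.ext_iff]; omega
  have n5 : lo l ≠ lo i := by rw [ne_eq, Fin.ext_iff]; omega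
  have n6 : lo l ≠ hi r := by rw [ne_eq, Fin.ext_iff]; omega
  have m1 : ∀ b : Fin n, mform (lam n) (hi i) b = if b = hi r then lam n (2 * (k + 1)) else 0 := by
    intro b
    simp only [mform, x2, mate_even, Fin.ext_iff, x3]
  have m2 : ∀ b : Fin n, mform (lam n) b (hi i) =
      if b = hi r then lam n (2 * (k + 1) + 1) else 0 := by
    intro b
    by_cases h : b = hi r
    · rw [h, if_pos rfl, x2, x3, ← mate_even, mform_mate_left]
    · rw [if_neg h, mform_of_ne _ fun h' => h ?_]
      rw [Fin.ext_iff, x3, ← mate_even, ← x2, h', mate_mate]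
  have m3 : ∀ b : Fin n, mform (lam n) (lo l) b = if b = lo i then lam n (2 * k) else 0 := by
    intro b
    simp only [mform, x0, mate_even, Fin.ext_iff, x1]
  have m4 : ∀ b : Fin n, mform (lam n) b (lo l) = if b = lo i then lam n (2 * k + 1) else 0 := by
    intro b
    by_cases h : b = lo i
    · rw [h, if_pos rfl, x0, x1, ← mate_even, mform_mate_left]
    · rw [if_neg h, mform_of_ne _ fun h' => h ?_]
      rw [Fin.ext_iff, x1, ← mate_even, ← x0, h', mate_mate]
  have w1 : hroot i (lo i) = 1 := by simp [hroot, lo_ne_hi]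
  have w2 : hroot i (lo l) = 0 := by simp [hroot, n4, n5]
  have w3 : hroot i (hi r) = 0 := by simp [hroot, n1.symm, n2.symm]
  have w4 : hroot l (lo i) = -1 := by
    have : lo i = hi l := by rw [Fin.ext_iff, x1]; simp only [hi]; omega
    rw [this]; simp [hroot, (lo_ne_hi l).symm]
  have w5 : hroot r (lo i) = 0 := by
    have : lo i ≠ lo r := by rw [ne_eq, Fin.ext_iff, x1]; simp only [lo]; omega
    simp [hroot, this, n1]
  have l1 : lam n (2 * k) = -qpar * lam n (2 * k + 1) := lam_mate n k
  have l2 : lam n (2 * (k + 1)) = -qpar * lam n (2 * (k + 1) + 1) := lam_mate n (k + 1)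
  have l3 : lam n (2 * (k + 1) + 1) = qpar⁻¹ ^ 3 * lam n (2 * k + 1) := by
    rw [lam_odd, lam_odd, ← zpow_natCast, inv_zpow', mul_neg, ← zpow_add₀ h0]
    congr 2; push_cast; ring
  rw [Uq.B, map_sub, map_mul, LinearMap.sub_apply, Module.End.mul_apply, hF, hT]
  simp only [map_sub, map_add, apply_ite_zero, map_smul, hq, hC, m1, m2, m3, m4, smul_eq_mul,
    Pi.neg_apply]
  by_cases h1 : a = lo i
  · subst h1
    by_cases h2 : b = hi r
    · subst h2
      simp only [n1, n1.symm, n3, if_true, if_false, false_and, w1, w2, l2, l3, add_zero, zero_add,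
        neg_zero, zpow_zero, zpow_neg_one]
      field_simp
      ring
    · simp only [h2, n1, if_false, false_and, and_false, ite_self, mul_zero, add_zero, sub_zero]
  · by_cases h2 : a = hi r
    · subst h2
      by_cases h3 : b = lo i
      · subst h3
        simp only [n1, n1.symm, n2.symm, if_true, if_false, and_self, false_and, w1, w2, w3, w4, w5, l1, l3,
          add_zero, add_neg_cancel, zero_add, neg_zero, zpow_zero, zpow_neg_one]
        field_simp
        ring
      · by_cases h4 : b = hi r
        · subst h4
          simp [n1.symm, n2.symm]
        · simp [h3, h4, n1.symm, n2.symm]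
    · simp [h1, h2, n3.symm, n6]

lemma cap_EF (hC : ∀ a b, C (bv a ⊗ₜ[Kq] bv b) = mform (lam n) a b)
    (hE : ∀ k i j, σ (Uq.E k) (bv i ⊗ₜ[Kq] bv j) =
      (if i = hi k then qpar ^ hroot k j • (bv (lo k) ⊗ₜ[Kq] bv j) else 0) +
      (if j = hi k then bv i ⊗ₜ[Kq] bv (lo k) else 0))
    (hF : ∀ k i j, σ (Uq.F k) (bv i ⊗ₜ[Kq] bv j) =
      (if i = lo k then bv (hi k) ⊗ₜ[Kq] bv j else 0) +
      (if j = lo k then qpar ^ (-hroot k i) • (bv i ⊗ₜ[Kq] bv (hi k)) else 0))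
    {i : Fin (n - 1)} (he : Even i.1) (a b : Fin n) :
    C (σ (Uq.E i) (bv a ⊗ₜ[Kq] bv b)) = 0 ∧ C (σ (Uq.F i) (bv a ⊗ₜ[Kq] bv b)) = 0 := by
  have h0 := qpar_ne_zero
  obtain ⟨k, hk⟩ := he
  have x0 : (lo i : ℕ) = 2 * k := by simp only [lo]; omega
  have x1 : (hi i : ℕ) = 2 * k + 1 := by simp only [hi]; omega
  have n1 : lo i ≠ hi i := lo_ne_hi i
  have l1 : lam n (2 * k) = -qpar * lam n (2 * k + 1) := lam_mate n k
  have m1 : ∀ b : Fin n, mform (lam n) (lo i) b = if b = hi i then lam n (2 * k) else 0 := by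
    intro b
    simp only [mform, x0, mate_even, Fin.ext_iff, x1]
  have m2 : ∀ b : Fin n, mform (lam n) (hi i) b = if b = lo i then lam n (2 * k + 1) else 0 := by
    intro b
    simp only [mform, x1, mate_odd, Fin.ext_iff, x0]
  have m3 : ∀ b : Fin n, mform (lam n) b (lo i) = if b = hi i then lam n (2 * k + 1) else 0 := by
    intro b
    by_cases h : b = hi i
    · rw [h, if_pos rfl, x0, x1, ← mate_even, mform_mate_left]
    · rw [if_neg h, mform_of_ne _ fun h' => h ?_]
      rw [Fin.ext_iff, x1, ← mate_even, ← x0, h', mate_mate]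
  have m4 : ∀ b : Fin n, mform (lam n) b (hi i) = if b = lo i then lam n (2 * k) else 0 := by
    intro b
    by_cases h : b = lo i
    · rw [h, if_pos rfl, x0, x1, ← mate_even, mform_mate]
    · rw [if_neg h, mform_of_ne _ fun h' => h ?_]
      rw [Fin.ext_iff, x0, ← mate_odd, ← x1, h', mate_mate]
  have w1 : hroot i (lo i) = 1 := by simp [hroot, lo_ne_hi]
  have w2 : hroot i (hi i) = -1 := by simp [hroot, (lo_ne_hi i).symm]
  rw [hE, hF]
  simp only [map_add, apply_ite_zero, map_smul, hC, m1, m2, m3, m4, smul_eq_mul]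
  constructor
  · by_cases h1 : a = hi i
    · by_cases h2 : b = hi i
      · simp only [h1, h2, if_true, w2, l1, zpow_neg_one]
        field_simp
        ring
      · simp [h2]
    · simp [h1]
  · by_cases h1 : a = lo i
    · by_cases h2 : b = lo i
      · simp only [h1, h2, if_true, w1, l1, zpow_neg_one]
        field_simp
        ring
      · simp [h2]
    · simp [h1]

lemma mform_qh (θ : ℕ → Kq) (h : Fin n → ℤ) (a b : Fin n) (hh : ∀ a b : Fin n, (b : ℕ) = mate a → h a + h b = 0) :
    (qpar ^ h a * qpar ^ h b) * mform θ a b = mform θ a b := by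
  by_cases e : (b : ℕ) = mate a
  · rw [← zpow_add₀ qpar_ne_zero, hh a b e, zpow_zero, one_mul]
  · rw [mform_of_ne _ e, mul_zero]

lemma hroot_mate {i : Fin (n - 1)} (he : Even i.1) (a b : Fin n) (h : (b : ℕ) = mate a) :
    hroot i a + hroot i b = 0 := by
  obtain ⟨k, hk⟩ := he
  have ha : (a : ℕ) = mate b := by rw [h, mate_mate]
  rcases Nat.even_or_odd' a.1 with ⟨c, hc | hc⟩
  · rw [hc, mate_even] at h
    simp only [hroot, Pi.sub_apply, Pi.single_apply, lo, hi, Fin.ext_iff, hc, h]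
    split_ifs <;> omega
  · rw [hc, mate_odd] at h
    simp only [hroot, Pi.sub_apply, Pi.single_apply, lo, hi, Fin.ext_iff, hc, h]
    split_ifs <;> omega

end Invariance

/-- The cup, as a vector in the tensor square of the vector representation. -/
noncomputable def cupV (m : ℕ) : (vecSq (2 * m)).V :=
  ∑ i : Fin (2 * m), kappa i.1 • (bv i ⊗ₜ[Kq] bv (pt i))

lemma capV_gen {x : Uq n} (hx : SpGen n x) (v : (vecSq n).V) :
    capV n ((vecSq n).ρ x v) = Uq.counitHom x * capV n v := by
  suffices h : capV n ∘ₗ (vecSq n).ρ x = Uq.counitHom x • capV n from LinearMap.congr_fun h v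
  have ext : ∀ {f g : (Fin n → Kq) ⊗[Kq] (Fin n → Kq) →ₗ[Kq] Kq},
      (∀ a b, f (bv a ⊗ₜ[Kq] bv b) = g (bv a ⊗ₜ[Kq] bv b)) → f = g := by
    intro f g h
    apply TensorProduct.ext
    exact vec_ext fun a => vec_ext fun b => h a b
  refine ext fun a b => ?_
  change capV n ((vecSq n).ρ x (bv a ⊗ₜ[Kq] bv b)) = Uq.counitHom x * capV n (bv a ⊗ₜ[Kq] bv b)
  cases hx with
  | E i he =>
    rw [Uq.counitHom_gen, Uq.counitGen, zero_mul]
    exact (cap_EF capV_bv vecSq_E vecSq_F he a b).1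
  | F i he =>
    rw [Uq.counitHom_gen, Uq.counitGen, zero_mul]
    exact (cap_EF capV_bv vecSq_E vecSq_F he a b).2
  | K i he =>
    rw [Uq.counitHom_gen, Uq.counitGen, one_mul, vecSq_qh, map_smul, capV_bv]
    exact mform_qh _ _ a b (hroot_mate he)
  | Kinv i he =>
    rw [Uq.counitHom_gen, Uq.counitGen, one_mul, vecSq_qh, map_smul, capV_bv]
    refine mform_qh _ _ a b fun a b h => ?_
    have := hroot_mate he a b h
    simp only [Pi.neg_apply]
    omega
  | B l i r ho hl hr =>
    have hz : Uq.counitHom (Uq.B l i r) = 0 := by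
      rw [Uq.B, Uq.T]
      simp only [map_sub, map_add, map_mul, map_smul, Uq.counitHom_gen, Uq.counitGen]
      simp
    rw [hz, zero_mul]
    exact cap_B capV_bv vecSq_qh vecSq_F (vecSq_T hl hr) ho hl hr a b

section CupInvariance

variable {m : ℕ} {σ : Uq (2 * m) →ₐ[Kq] Module.End Kq ((Fin (2 * m) → Kq) ⊗[Kq] (Fin (2 * m) → Kq))}

lemma pt_eq_iff {a b : Fin (2 * m)} : pt a = b ↔ a = pt b :=
  ⟨fun h => by rw [← h, pt_pt], fun h => by rw [h, pt_pt]⟩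

lemma counit_B {l i r : Fin (n - 1)} : Uq.counitHom (Uq.B l i r) = 0 := by
  rw [Uq.B, Uq.T]
  simp only [map_sub, map_add, map_mul, map_smul, Uq.counitHom_gen, Uq.counitGen]
  simp

lemma cup_B
    (hq : ∀ h i j, σ (Uq.qh h) (bv i ⊗ₜ[Kq] bv j) =
      (qpar ^ h i * qpar ^ h j) • (bv i ⊗ₜ[Kq] bv j))
    (hF : ∀ k i j, σ (Uq.F k) (bv i ⊗ₜ[Kq] bv j) =
      (if i = lo k then bv (hi k) ⊗ₜ[Kq] bv j else 0) +
      (if j = lo k then qpar ^ (-hroot k i) • (bv i ⊗ₜ[Kq] bv (hi k)) else 0))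
    {l i r : Fin (2 * m - 1)}
    (hT : ∀ a b, σ (Uq.T l i r) (bv a ⊗ₜ[Kq] bv b) =
      (if a = hi r then (-qpar⁻¹ * qpar ^ (hroot i b + (hroot l b + hroot r b))) •
        (bv (lo l) ⊗ₜ[Kq] bv b) else 0) +
      (if a = hi r ∧ b = lo i then (-qpar⁻¹ * (qpar - qpar⁻¹)) • (bv (lo i) ⊗ₜ[Kq] bv (lo l))
        else 0) +
      (if a = hi i ∧ b = hi r then ((qpar - qpar⁻¹) * qpar⁻¹) • (bv (lo l) ⊗ₜ[Kq] bv (hi i))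
        else 0) +
      (if b = hi r then -qpar⁻¹ • (bv a ⊗ₜ[Kq] bv (lo l)) else 0))
    (ho : Odd i.1) (hl : l.1 + 1 = i.1) (hr : i.1 + 1 = r.1) :
    σ (Uq.B l i r) (∑ a : Fin (2 * m), kappa a.1 • (bv a ⊗ₜ[Kq] bv (pt a))) = 0 := by
  have h0 := qpar_ne_zero
  obtain ⟨k, hk⟩ := ho
  have x0 : (lo l : ℕ) = 2 * k := by simp only [lo]; omega
  have x1 : (lo i : ℕ) = 2 * k + 1 := by simp only [lo]; omega
  have x2 : (hi i : ℕ) = 2 * (k + 1) := by simp only [hi]; omega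
  have x3 : (hi r : ℕ) = 2 * (k + 1) + 1 := by simp only [hi]; omega
  have p1 : pt (lo i) = lo l := by rw [Fin.ext_iff, pt_val, x1, mate_odd, x0]
  have p2 : pt (hi r) = hi i := by rw [Fin.ext_iff, pt_val, x3, mate_odd, x2]
  have p3 : ∀ a : Fin (2 * m), (a = hi r ∧ a = lo l) = False := by
    intro a
    simp only [Fin.ext_iff, eq_iff_iff, iff_false]
    omega
  have w2 : hroot i (lo l) = 0 := by
    simp only [hroot, Pi.sub_apply, Pi.single_apply, Fin.ext_iff, x0, x1, x2]
    split_ifs <;> omega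
  have w3 : hroot i (hi i) = -1 := by
    simp only [hroot, Pi.sub_apply, Pi.single_apply, Fin.ext_iff, x0, x1, x2]
    split_ifs <;> omega
  have w4 : hroot l (hi i) = 0 := by
    simp only [hroot, Pi.sub_apply, Pi.single_apply, Fin.ext_iff, lo, hi]
    split_ifs <;> omega
  have w5 : hroot r (hi i) = 1 := by
    simp only [hroot, Pi.sub_apply, Pi.single_apply, Fin.ext_iff, lo, hi]
    split_ifs <;> omega
  have c1 : kappa (2 * k) = -qpar * kappa (2 * k + 1) := kappa_mate k
  have c2 : kappa (2 * (k + 1)) = -qpar * kappa (2 * (k + 1) + 1) := kappa_mate (k + 1)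
  have c3 : kappa (2 * (k + 1) + 1) = qpar⁻¹ * kappa (2 * k + 1) := by
    rw [kappa_odd, kappa_odd, mul_neg, ← zpow_neg_one, ← zpow_add₀ h0]
    congr 2; push_cast; ring
  rw [Uq.B, map_sub, map_mul, LinearMap.sub_apply, Module.End.mul_apply]
  simp only [map_sum, map_smul, hF, hT, smul_add, Finset.sum_add_distrib, smul_ite, smul_zero,
    pt_eq_iff, Finset.sum_ite_eq', Finset.mem_univ, if_true, p1, p2, p3, if_false, pt_pt, and_self,
    Finset.sum_const_zero, add_zero, map_add, hq, w2, w3, w4, w5, x0, x1, x2, x3, c1, c2, c3,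
    Pi.neg_apply, neg_zero, zpow_zero, one_smul, neg_neg, zpow_one, neg_add_cancel, zero_add,
    apply_ite_zero]
  match_scalars <;> field_simp
  all_goals ring

lemma cup_EF
    (hE : ∀ k i j, σ (Uq.E k) (bv i ⊗ₜ[Kq] bv j) =
      (if i = hi k then qpar ^ hroot k j • (bv (lo k) ⊗ₜ[Kq] bv j) else 0) +
      (if j = hi k then bv i ⊗ₜ[Kq] bv (lo k) else 0))
    (hF : ∀ k i j, σ (Uq.F k) (bv i ⊗ₜ[Kq] bv j) =
      (if i = lo k then bv (hi k) ⊗ₜ[Kq] bv j else 0) +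
      (if j = lo k then qpar ^ (-hroot k i) • (bv i ⊗ₜ[Kq] bv (hi k)) else 0))
    {i : Fin (2 * m - 1)} (he : Even i.1) :
    σ (Uq.E i) (∑ a : Fin (2 * m), kappa a.1 • (bv a ⊗ₜ[Kq] bv (pt a))) = 0 ∧
      σ (Uq.F i) (∑ a : Fin (2 * m), kappa a.1 • (bv a ⊗ₜ[Kq] bv (pt a))) = 0 := by
  have h0 := qpar_ne_zero
  obtain ⟨k, hk⟩ := he
  have x0 : (lo i : ℕ) = 2 * k := by simp only [lo]; omega
  have x1 : (hi i : ℕ) = 2 * k + 1 := by simp only [hi]; omega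
  have p1 : pt (hi i) = lo i := by rw [Fin.ext_iff, pt_val, x1, mate_odd, x0]
  have p2 : pt (lo i) = hi i := by rw [← p1, pt_pt]
  have c1 : kappa (2 * k) = -qpar * kappa (2 * k + 1) := kappa_mate k
  have w1 : hroot i (lo i) = 1 := by simp [hroot, lo_ne_hi]
  have w2 : hroot i (hi i) = -1 := by simp [hroot, (lo_ne_hi i).symm]
  constructor <;>
  simp only [map_sum, map_smul, hE, hF, smul_add, Finset.sum_add_distrib, smul_ite, smul_zero,
    pt_eq_iff, Finset.sum_ite_eq', Finset.mem_univ, if_true, p1, p2, pt_pt, w1, w2, x0, x1, c1,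
    neg_neg, zpow_one, zpow_neg_one] <;>
  match_scalars <;> field_simp <;> ring

lemma cup_qh
    (hq : ∀ h i j, σ (Uq.qh h) (bv i ⊗ₜ[Kq] bv j) =
      (qpar ^ h i * qpar ^ h j) • (bv i ⊗ₜ[Kq] bv j))
    (h : Fin (2 * m) → ℤ) (hh : ∀ a b : Fin (2 * m), (b : ℕ) = mate a → h a + h b = 0) :
    σ (Uq.qh h) (∑ a : Fin (2 * m), kappa a.1 • (bv a ⊗ₜ[Kq] bv (pt a))) =
      ∑ a : Fin (2 * m), kappa a.1 • (bv a ⊗ₜ[Kq] bv (pt a)) := by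
  rw [map_sum]
  refine Finset.sum_congr rfl fun a _ => ?_
  rw [map_smul, hq, ← zpow_add₀ qpar_ne_zero, hh a (pt a) rfl, zpow_zero, one_smul]

lemma cupV_gen {x : Uq (2 * m)} (hx : SpGen (2 * m) x) :
    (vecSq (2 * m)).ρ x (cupV m) = Uq.counitHom x • cupV m := by
  cases hx with
  | E i he =>
    rw [Uq.counitHom_gen, Uq.counitGen, zero_smul]
    exact (cup_EF vecSq_E vecSq_F he).1
  | F i he =>
    rw [Uq.counitHom_gen, Uq.counitGen, zero_smul]
    exact (cup_EF vecSq_E vecSq_F he).2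
  | K i he =>
    rw [Uq.counitHom_gen, Uq.counitGen, one_smul]
    exact cup_qh vecSq_qh _ (hroot_mate he)
  | Kinv i he =>
    rw [Uq.counitHom_gen, Uq.counitGen, one_smul]
    refine cup_qh vecSq_qh _ fun a b h => ?_
    have := hroot_mate he a b h
    simp only [Pi.neg_apply]
    omega
  | B l i r ho hl hr =>
    rw [counit_B, zero_smul]
    exact cup_B vecSq_qh vecSq_F (vecSq_T hl hr) ho hl hr

end CupInvariance

lemma capV_sp (x : Uqsp n) (v : (vecSq n).V) :
    capV n ((vecSq n).ρ x.1 v) = Uq.counitHom x.1 * capV n v := by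
  obtain ⟨x, hx⟩ := x
  change capV n ((vecSq n).ρ x v) = Uq.counitHom x * capV n v
  induction hx using Algebra.adjoin_induction generalizing v with
  | mem x hx => exact capV_gen hx v
  | algebraMap r =>
    rw [AlgHom.commutes, AlgHom.commutes, Module.algebraMap_end_apply, map_smul]
    rfl
  | add x y _ _ hx hy =>
    rw [map_add, map_add, LinearMap.add_apply, map_add, hx, hy, add_mul]
  | mul x y _ _ hx hy =>
    rw [map_mul, map_mul, Module.End.mul_apply, hx, hy, mul_assoc]

lemma cupV_sp {m : ℕ} (x : Uqsp (2 * m)) :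
    (vecSq (2 * m)).ρ x.1 (cupV m) = Uq.counitHom x.1 • cupV m := by
  obtain ⟨x, hx⟩ := x
  change (vecSq (2 * m)).ρ x (cupV m) = Uq.counitHom x • cupV m
  induction hx using Algebra.adjoin_induction with
  | mem x hx => exact cupV_gen hx
  | algebraMap r =>
    rw [AlgHom.commutes, AlgHom.commutes, Module.algebraMap_end_apply]
    rfl
  | add x y _ _ hx hy =>
    rw [map_add, map_add, LinearMap.add_apply, hx, hy, add_smul]
  | mul x y _ _ hx hy =>
    rw [map_mul, map_mul, Module.End.mul_apply, hy, map_smul, hx, smul_smul,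
      mul_comm (Uq.counitHom y)]

end Equivariance

section ThinStrands

variable {n : ℕ}

section Words

variable (P : ℕ → AlgRep Kq (Uq n))

lemma lten_single {Y X' Y' : List ℕ+} {a : ℕ+} (f : (seqObj P [a]).V →ₗ[Kq] (seqObj P Y).V)
    (g : (seqObj P X').V →ₗ[Kq] (seqObj P Y').V) (x : (P a).V) (z : (seqObj P X').V) :
    lten P (X := [a]) f g (x ⊗ₜ[Kq] z : (seqObj P (a :: X')).V) =
      AlgRep.lin (seqMu P Y Y').inv (f (vec1 P x) ⊗ₜ g z) := by
  have h : AlgRep.lin (seqMu P [a] X').hom (x ⊗ₜ[Kq] z : (seqObj P (a :: X')).V) = vec1 P x ⊗ₜ z :=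
    (congrArg (AlgRep.lin (seqMu P [a] X').hom) (seqMu_inv_single P a X' x z)).symm.trans
      (seqMu_inv_hom P [a] X' _)
  exact congrArg (fun t => AlgRep.lin (seqMu P Y Y').inv (TensorProduct.map f g t)) h

lemma lten_pair {Y X' Y' : List ℕ+} {a b : ℕ+} (f : (seqObj P [a, b]).V →ₗ[Kq] (seqObj P Y).V)
    (g : (seqObj P X').V →ₗ[Kq] (seqObj P Y').V) (x : (P a).V) (y : (P b).V)
    (z : (seqObj P X').V) :
    lten P (X := [a, b]) f g (x ⊗ₜ[Kq] (y ⊗ₜ[Kq] z : (seqObj P (b :: X')).V) :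
        (seqObj P (a :: b :: X')).V) =
      AlgRep.lin (seqMu P Y Y').inv (f (vec2 P x y) ⊗ₜ g z) := by
  have h : AlgRep.lin (seqMu P [a, b] X').hom (x ⊗ₜ[Kq] (y ⊗ₜ[Kq] z : (seqObj P (b :: X')).V) :
        (seqObj P (a :: b :: X')).V) = vec2 P x y ⊗ₜ z :=
    (congrArg (AlgRep.lin (seqMu P [a, b] X').hom) (seqMu_inv_pair P a b X' x y z)).symm.trans
      (seqMu_inv_hom P [a, b] X' _)
  exact congrArg (fun t => AlgRep.lin (seqMu P Y Y').inv (TensorProduct.map f g t)) h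

end Words

variable (s : Bool)

/-- The linear map which identifies the power of degree one with the vector representation. -/
noncomputable def unthinV (n : ℕ) : (qPow n s 1).V →ₗ[Kq] (Fin n → Kq) :=
  LinearMap.pi (fun i => Finsupp.lapply ({i} : Multiset (Fin n))) ∘ₗ nf s 1

lemma unthinV_qth (i : Fin n) : unthinV s n (qth s i) = bv i := by
  rw [unthinV, LinearMap.comp_apply, nf_qth]
  funext k
  change (Finsupp.single ({i} : Multiset (Fin n)) (1 : Kq)) {k} = _
  rw [bv, Finsupp.single_apply, Pi.single_apply]
  simp only [Multiset.singleton_inj, eq_comm]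

lemma unthinV_thin (v : Fin n → Kq) : unthinV s n (AlgRep.lin (thin s n) v) = v := by
  have h : unthinV s n ∘ₗ AlgRep.lin (thin s n) = LinearMap.id := vec_ext fun i => unthinV_qth s i
  exact LinearMap.congr_fun h v

/-- The identification of the power of degree one with the vector representation. -/
noncomputable def unthin (n : ℕ) : qPow n s 1 ⟶ vecRep n :=
  ⟨unthinV s n, fun u => by
    refine LinearMap.ext fun x => ?_
    obtain ⟨v, rfl⟩ := thin_surjective s n x
    have h := LinearMap.congr_fun ((thin s n).2 u) v
    refine (congrArg (unthinV s n) h.symm).trans ((unthinV_thin s _).trans ?_)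
    exact congrArg ((vecRep n).ρ u) (unthinV_thin s v).symm⟩

/-- The identification of two thin strands with the tensor square of the vector representation. -/
noncomputable def toSq (n : ℕ) : seqObj (qPow n s) [1, 1] ⟶ vecSq n :=
  unthin s n ⊗ₘ ((ρ_ (qPow n s 1)).hom ≫ unthin s n)

/-- The inverse of `toSq`. -/
noncomputable def ofSq (n : ℕ) : vecSq n ⟶ seqObj (qPow n s) [1, 1] :=
  thin s n ⊗ₘ (thin s n ≫ (ρ_ (qPow n s 1)).inv)

/-- The product of two basis vectors. -/
noncomputable def tv (i j : Fin n) : (seqObj (qPow n s) [1, 1]).V :=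
  vec2 (qPow n s) (a := 1) (b := 1) (qth s i) (qth s j)

lemma toSq_tv (i j : Fin n) : AlgRep.lin (toSq s n) (tv s i j) = bv i ⊗ₜ[Kq] bv j := by
  have h : AlgRep.lin (ρ_ (qPow n s 1)).hom (vec1 (qPow n s) (a := 1) (qth s j)) = qth s j :=
    one_smul Kq (qth s j)
  have h2 : AlgRep.lin (unthin s n) (AlgRep.lin (ρ_ (qPow n s 1)).hom
      (vec1 (qPow n s) (a := 1) (qth s j))) = bv j :=
    (congrArg (AlgRep.lin (unthin s n)) h).trans (unthinV_qth s j)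
  exact congrArg₂ (fun x y => x ⊗ₜ[Kq] y) (unthinV_qth s i) h2

/-- The value of the cap. -/
noncomputable def capS (n : ℕ) : seqRes (qPow n s) [1, 1] ⟶ seqRes (qPow n s) [] :=
  ⟨capV n ∘ₗ (toSq s n).1, fun x => by
    refine LinearMap.ext fun v => ?_
    have h := LinearMap.congr_fun ((toSq s n).2 x.1) v
    exact (congrArg (capV n) h).trans (capV_sp x _)⟩

lemma capS_tv (i j : Fin n) :
    AlgRep.lin (capS s n) (tv s i j) = mform (lam n) i j • unitVec (qPow n s) := by
  refine (congrArg (capV n) (toSq_tv s i j)).trans ((capV_bv i j).trans ?_)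
  exact (mul_one _).symm

/-- The value of the cup. -/
noncomputable def cupS (m : ℕ) : seqRes (qPow (2 * m) s) [] ⟶ seqRes (qPow (2 * m) s) [1, 1] :=
  ⟨LinearMap.toSpanSingleton Kq (seqObj (qPow (2 * m) s) [1, 1]).V
    (AlgRep.lin (ofSq s (2 * m)) (cupV m)), fun x => by
    refine LinearMap.ext_ring ?_
    have h := LinearMap.congr_fun ((ofSq s (2 * m)).2 x.1) (cupV m)
    have h2 := congrArg (AlgRep.lin (ofSq s (2 * m))) (cupV_sp x)
    have h3 : (seqObj (qPow (2 * m) s) [1, 1]).ρ x.1 (AlgRep.lin (ofSq s (2 * m)) (cupV m)) =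
      Uq.counitHom x.1 • AlgRep.lin (ofSq s (2 * m)) (cupV m) :=
        h.symm.trans (h2.trans (map_smul _ _ _))
    refine Eq.trans ?_ ((congrArg ((seqObj (qPow (2 * m) s) [1, 1]).ρ x.1)
      (one_smul Kq (AlgRep.lin (ofSq s (2 * m)) (cupV m)))).trans h3).symm
    change (Uq.counitHom x.1 * 1 : Kq) • AlgRep.lin (ofSq s (2 * m)) (cupV m) = _
    rw [mul_one]⟩

lemma cupS_unitVec (m : ℕ) : AlgRep.lin (cupS s m) (unitVec (qPow (2 * m) s)) =
    ∑ i : Fin (2 * m), kappa i.1 • tv s i (pt i) := by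
  refine (one_smul Kq _).trans ?_
  rw [cupV, map_sum]
  exact Finset.sum_congr rfl fun i _ => map_smul _ _ _

end ThinStrands
section Words

variable {n : ℕ} (s : Bool)

/-- The coefficient of the identity in the expression of the common endomorphism of pairs of
strands by the merge followed by the split. -/
noncomputable def cS : Kq := if s then qnum 2 else 0

/-- The coefficient of the merge followed by the split in the expression of the common
endomorphism of pairs of strands. -/
noncomputable def eS : Kq := if s then -1 else 1

lemma cS_fmu (a b : Fin n) : cS s + eS s * fmu s a b = fmu false a.1 b.1 := by
  cases s
  · simp [cS, eS, fmu]
  · have h := qpar_ne_zero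
    rcases lt_trichotomy a b with h | h | h
    · rw [fmu_lt (show a.1 < b.1 from h)]
      simp [cS, eS, fmu, h, qp, qnum_two]
    · rw [h, fmu_self]
      simp [cS, eS, fmu]
    · rw [fmu_gt (show b.1 < a.1 from h)]
      simp [cS, eS, fmu, h, h.not_gt, qp, qnum_two]

lemma eS_swap (a b : Fin n) : eS s * (if a = b then 0 else eps s) = xmu a b := by
  by_cases h : a = b
  · rw [if_pos h, h, xmu_self, mul_zero]
  · rw [if_neg h, xmu_of_ne fun h' => h (Fin.ext h')]
    cases s <;> simp [eS, eps]

/-- The tensor product with a basis vector from the left. -/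
noncomputable def qc {X : List ℕ+} (i : Fin n) :
    (seqObj (qPow n s) X).V →ₗ[Kq] (seqObj (qPow n s) (1 :: X)).V :=
  TensorProduct.mk Kq (qPow n s 1).V (seqObj (qPow n s) X).V (qth s i)

lemma qc_ext {X : List ℕ+} {N : Type} [AddCommGroup N] [Module Kq N]
    {f g : (seqObj (qPow n s) (1 :: X)).V →ₗ[Kq] N}
    (h : ∀ i z, f (qc s i z) = g (qc s i z)) : f = g := by
  refine TensorProduct.ext (qth_ext fun i => LinearMap.ext fun z => h i z)

lemma unit_ext {N : Type} [AddCommGroup N] [Module Kq N]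
    {f g : (seqObj (qPow n s) []).V →ₗ[Kq] N}
    (h : f (unitVec (qPow n s)) = g (unitVec (qPow n s))) : f = g :=
  LinearMap.ext_ring h

variable {X X' Y' : List ℕ+}

lemma lten_one_qc (g : (seqObj (qPow n s) X').V →ₗ[Kq] (seqObj (qPow n s) Y').V) (i : Fin n)
    (z : (seqObj (qPow n s) X').V) :
    lten (qPow n s) (X := [1]) (Y := [1]) LinearMap.id g (qc s i z) = qc s i (g z) :=
  (lten_single (qPow n s) (a := 1) (Y := [1]) LinearMap.id g (qth s i) z).trans
    (seqMu_inv_single (qPow n s) 1 Y' (qth s i) (g z))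

lemma lten_two_qc (g : (seqObj (qPow n s) X').V →ₗ[Kq] (seqObj (qPow n s) Y').V) (i j : Fin n)
    (z : (seqObj (qPow n s) X').V) :
    lten (qPow n s) (X := [1, 1]) (Y := [1, 1]) LinearMap.id g (qc s i (qc s j z)) =
      qc s i (qc s j (g z)) :=
  (lten_pair (qPow n s) (a := 1) (b := 1) (Y := [1, 1]) LinearMap.id g (qth s i) (qth s j)
    z).trans (seqMu_inv_pair (qPow n s) 1 1 Y' (qth s i) (qth s j) (g z))

/-- The merge of two thin strands. -/
noncomputable def mmL (n : ℕ) : (seqObj (qPow n s) [1, 1]).V →ₗ[Kq] (seqObj (qPow n s) [2]).V :=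
  (seqMerge (qPow n s) (fun a b => qMul s a b) 1 1).1

/-- The split into two thin strands. -/
noncomputable def ddL (n : ℕ) : (seqObj (qPow n s) [2]).V →ₗ[Kq] (seqObj (qPow n s) [1, 1]).V :=
  (seqSplit (qPow n s) (fun a b => qSplit s a b) 1 1).1

/-- The merge of two thin strands, followed by the split. -/
noncomputable def msL (n : ℕ) : (seqObj (qPow n s) [1, 1]).V →ₗ[Kq] (seqObj (qPow n s) [1, 1]).V :=
  ddL s n ∘ₗ mmL s n

lemma msL_vec2 (x y : (qPow n s 1).V) : msL s n (vec2 (qPow n s) (a := 1) (b := 1) x y) =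
    duo (qPow n s) 1 1 (qCom s 1 1 (qMulB s 1 1 x y)) :=
  seqSplit_vec1 (qPow n s) (fun a b => qSplit s a b) 1 1 _

lemma msL_tv (i j : Fin n) : msL s n (tv s i j) =
    fmu s i j • tv s i j + (if i = j then 0 else eps s) • tv s j i := by
  refine (msL_vec2 s (qth s i) (qth s j)).trans ?_
  refine (congrArg (duo (qPow n s) 1 1) (fmu_smul_qth s i j)).trans ?_
  exact (map_add (duo (qPow n s) 1 1) _ _).trans
    (congrArg₂ (· + ·) (map_smul (duo (qPow n s) 1 1) _ _) (map_smul (duo (qPow n s) 1 1) _ _))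

lemma lten_msL_qc (i j : Fin n) (z : (seqObj (qPow n s) X').V) :
    lten (qPow n s) (X := [1, 1]) (Y := [1, 1]) (msL s n) LinearMap.id (qc s i (qc s j z)) =
      fmu s i j • qc s i (qc s j z) + (if i = j then 0 else eps s) • qc s j (qc s i z) := by
  refine (lten_pair (qPow n s) (a := 1) (b := 1) (Y := [1, 1]) (msL s n) LinearMap.id (qth s i)
    (qth s j) z).trans ?_
  have h : msL s n (vec2 (qPow n s) (a := 1) (b := 1) (qth s i) (qth s j)) ⊗ₜ[Kq] z =
      fmu s i j • (tv s i j ⊗ₜ[Kq] z) + (if i = j then 0 else eps s) • (tv s j i ⊗ₜ[Kq] z) := by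
    refine (congrArg (· ⊗ₜ[Kq] z) (msL_tv s i j)).trans ?_
    rw [add_tmul, smul_tmul', smul_tmul']
  refine (congrArg (AlgRep.lin (seqMu (qPow n s) [1, 1] X').inv) h).trans ?_
  refine (map_add _ _ _).trans (congrArg₂ (· + ·) ((map_smul _ _ _).trans ?_)
    ((map_smul _ _ _).trans ?_))
  · exact congrArg _ (seqMu_inv_pair (qPow n s) 1 1 X' (qth s i) (qth s j) z)
  · exact congrArg _ (seqMu_inv_pair (qPow n s) 1 1 X' (qth s j) (qth s i) z)

/-- An endomorphism is changed to the common form of its symmetric and exterior version. -/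
noncomputable def tw {M : Type} [AddCommGroup M] [Module Kq M] (f : M →ₗ[Kq] M) : M →ₗ[Kq] M :=
  cS s • LinearMap.id + eS s • f

lemma tw_apply {M : Type} [AddCommGroup M] [Module Kq M] (f : M →ₗ[Kq] M) (x : M) :
    tw s f x = cS s • x + eS s • f x := rfl

lemma eq_tw {M : Type} [AddCommGroup M] [Module Kq M] (f : M →ₗ[Kq] M) (x : M) :
    f x = cS s • x + eS s • tw s f x := by
  rw [tw_apply]
  cases s
  · simp [cS, eS]
  · simp [cS, eS]

lemma tw_of {M : Type} [AddCommGroup M] [Module Kq M] {f : M →ₗ[Kq] M} {x y : M} {i j : Fin n}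
    (h : f x = fmu s i j • x + (if i = j then 0 else eps s) • y) :
    tw s f x = fmu false i.1 j.1 • x + xmu i j • y := by
  rw [tw_apply, h, ← cS_fmu s, ← eS_swap s]
  module

end Words
section Instances

variable {m : ℕ}

/-- Linear maps which act on given vectors like the endomorphism `μ`, the cup and the cap act on
words of length `1` and `3`. -/
structure OddStrands (m : ℕ) (M1 M3 : Type) [AddCommGroup M1] [Module Kq M1]
    [AddCommGroup M3] [Module Kq M3] where
  t1 : Fin (2 * m) → M1
  t3 : Fin (2 * m) → Fin (2 * m) → Fin (2 * m) → M3
  μ₁ : M3 →ₗ[Kq] M3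
  μ₂ : M3 →ₗ[Kq] M3
  C : M3 →ₗ[Kq] M1
  D : M1 →ₗ[Kq] M3
  ext1 : ∀ {N : Type} [AddCommGroup N] [Module Kq N] {f g : M1 →ₗ[Kq] N},
    (∀ a, f (t1 a) = g (t1 a)) → f = g
  ext3 : ∀ {N : Type} [AddCommGroup N] [Module Kq N] {f g : M3 →ₗ[Kq] N},
    (∀ a b c, f (t3 a b c) = g (t3 a b c)) → f = g
  h1 : ∀ a b c, μ₁ (t3 a b c) = fmu false a.1 b.1 • t3 a b c + xmu a b • t3 b a c
  h2 : ∀ a b c, μ₂ (t3 a b c) = fmu false b.1 c.1 • t3 a b c + xmu b c • t3 a c b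
  hC : ∀ a b c, C (t3 a b c) = mform (lam (2 * m)) b c • t1 a
  hD : ∀ a, D (t1 a) = ∑ i : Fin (2 * m), kappa i.1 • t3 a i (pt i)

namespace OddStrands

variable {M1 M3 : Type} [AddCommGroup M1] [Module Kq M1] [AddCommGroup M3] [Module Kq M3]
  (S : OddStrands m M1 M3)

lemma μ₂_D (x : M1) : S.μ₂ (S.D x) = qnum 2 • S.D x := by
  suffices h : S.μ₂ ∘ₗ S.D = qnum 2 • S.D from LinearMap.congr_fun h x
  refine S.ext1 fun a => ?_
  change S.μ₂ (S.D (S.t1 a)) = qnum 2 • S.D (S.t1 a)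
  rw [S.hD, ← Strands.sum_kappa_μ, map_sum]
  refine Finset.sum_congr rfl fun i _ => ?_
  rw [map_smul, S.h2]

lemma C_μ₂ (x : M3) : S.C (S.μ₂ x) = qnum 2 • S.C x := by
  suffices h : S.C ∘ₗ S.μ₂ = qnum 2 • S.C from LinearMap.congr_fun h x
  refine S.ext3 fun a b c => ?_
  change S.C (S.μ₂ (S.t3 a b c)) = qnum 2 • S.C (S.t3 a b c)
  rw [S.h2, map_add, map_smul, map_smul, S.hC, S.hC, smul_smul, smul_smul, smul_smul, ← add_smul,
    mform_mu (lam_mate (2 * m))]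

lemma C_D (x : M1) : S.C (S.D x) = qnum (2 * m : ℕ) • x := by
  suffices h : S.C ∘ₗ S.D = qnum (2 * m : ℕ) • LinearMap.id from LinearMap.congr_fun h x
  refine S.ext1 fun a => ?_
  change S.C (S.D (S.t1 a)) = qnum (2 * m : ℕ) • S.t1 a
  have h := sum_kappa_lam m
  rw [← sum_fin_eq_range] at h
  rw [S.hD, ← h, map_sum, Finset.sum_smul]
  refine Finset.sum_congr rfl fun i _ => ?_
  rw [map_smul, S.hC, pt_val, mform_mate, smul_smul]

lemma C_μ₁_D (x : M1) : S.C (S.μ₁ (S.D x)) = qnum ((2 * m : ℕ) - (1 : ℕ)) • x := by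
  suffices h : S.C ∘ₗ S.μ₁ ∘ₗ S.D = qnum ((2 * m : ℕ) - (1 : ℕ)) • LinearMap.id from
    LinearMap.congr_fun h x
  refine S.ext1 fun a => ?_
  change S.C (S.μ₁ (S.D (S.t1 a))) = qnum ((2 * m : ℕ) - (1 : ℕ)) • S.t1 a
  have h := sum_kappa_lam_fmu a.2
  rw [← sum_fin_eq_range] at h
  rw [S.hD, ← h, map_sum, map_sum, Finset.sum_smul]
  refine Finset.sum_congr rfl fun i _ => ?_
  rw [map_smul, map_smul, S.h1, map_add, map_smul, map_smul, S.hC, S.hC, pt_val, mform_mate,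
    smul_smul (xmu a i), xmu_mul_mform_mate]
  module

lemma braid (x : M3) : S.μ₁ (S.μ₂ (S.μ₁ x)) - S.μ₁ x = S.μ₂ (S.μ₁ (S.μ₂ x)) - S.μ₂ x := by
  suffices h : S.μ₂ ∘ₗ S.μ₁ ∘ₗ S.μ₂ + S.μ₁ = S.μ₁ ∘ₗ S.μ₂ ∘ₗ S.μ₁ + S.μ₂ by
    have h' : S.μ₂ (S.μ₁ (S.μ₂ x)) + S.μ₁ x = S.μ₁ (S.μ₂ (S.μ₁ x)) + S.μ₂ x :=
      LinearMap.congr_fun h x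
    rw [sub_eq_sub_iff_add_eq_add, h']
  exact S.ext3 fun a b c => Strands.braid_aux S.t3 S.μ₁ S.μ₂ S.h1 S.h2 a b c

lemma trace (x : M1) : S.C (S.μ₁ (S.μ₂ (S.μ₁ (S.D x))) - S.μ₁ (S.D x)) =
    (qnum 2 * qnum 2 * qnum ((2 * m : ℕ) - (1 : ℕ)) - qnum 2 * qnum (2 * m : ℕ)) • x := by
  rw [S.braid]
  simp only [map_sub, map_smul, S.μ₂_D, S.C_μ₂, S.C_D, S.C_μ₁_D]
  module

end OddStrands

variable (s : Bool)

/-- The linear map underlying the cap. -/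
noncomputable def capL (n : ℕ) :
    (seqObj (qPow n s) [1, 1]).V →ₗ[Kq] (seqObj (qPow n s) []).V := (capS s n).1

/-- The linear map underlying the cup. -/
noncomputable def cupL (m : ℕ) :
    (seqObj (qPow (2 * m) s) []).V →ₗ[Kq] (seqObj (qPow (2 * m) s) [1, 1]).V := (cupS s m).1

lemma capL_tv {n : ℕ} (i j : Fin n) :
    capL s n (tv s i j) = mform (lam n) i j • unitVec (qPow n s) := capS_tv s i j

lemma cupL_unitVec (m : ℕ) : cupL s m (unitVec (qPow (2 * m) s)) =
    ∑ i : Fin (2 * m), kappa i.1 • tv s i (pt i) := cupS_unitVec s m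

/-- Two and four thin strands. -/
noncomputable def strands (m : ℕ) : Strands m (seqObj (qPow (2 * m) s) []).V
    (seqObj (qPow (2 * m) s) [1, 1]).V (seqObj (qPow (2 * m) s) [1, 1, 1, 1]).V where
  t0 := unitVec (qPow (2 * m) s)
  t2 := tv s
  t4 a b c d := qc s a (qc s b (tv s c d))
  μ := tw s (msL s (2 * m))
  μ₁ := tw s (lten (qPow (2 * m) s) (X := [1, 1]) (Y := [1, 1]) (X' := [1, 1]) (Y' := [1, 1])
    (msL s (2 * m)) LinearMap.id)
  μ₂ := tw s (lten (qPow (2 * m) s) (X := [1]) (Y := [1]) (X' := [1, 1, 1]) (Y' := [1, 1, 1])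
    LinearMap.id (lten (qPow (2 * m) s) (X := [1, 1]) (Y := [1, 1]) (X' := [1]) (Y' := [1])
      (msL s (2 * m)) LinearMap.id))
  μ₃ := tw s (lten (qPow (2 * m) s) (X := [1, 1]) (Y := [1, 1]) (X' := [1, 1]) (Y' := [1, 1])
    LinearMap.id (msL s (2 * m)))
  C₂ := capL s (2 * m)
  C₄ := lten (qPow (2 * m) s) (X := [1, 1]) (Y := [1, 1]) (X' := [1, 1]) (Y' := [])
    LinearMap.id (capL s (2 * m))
  D₂ := cupL s m
  D₄ := lten (qPow (2 * m) s) (X := [1, 1]) (Y := [1, 1]) (X' := []) (Y' := [1, 1])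
    LinearMap.id (cupL s m)
  ext0 h := unit_ext s h
  ext2 {N _ _ f g} h := qc_ext s fun i z => by
    refine LinearMap.congr_fun (f := f ∘ₗ qc s i) (g := g ∘ₗ qc s i) (qc_ext s fun j z => ?_) z
    exact LinearMap.congr_fun (f := f ∘ₗ qc s i ∘ₗ qc s j) (g := g ∘ₗ qc s i ∘ₗ qc s j)
      (unit_ext s (h i j)) z
  ext4 {N _ _ f g} h := qc_ext s fun a z => by
    refine LinearMap.congr_fun (f := f ∘ₗ qc s a) (g := g ∘ₗ qc s a) (qc_ext s fun b z => ?_) z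
    refine LinearMap.congr_fun (f := f ∘ₗ qc s a ∘ₗ qc s b) (g := g ∘ₗ qc s a ∘ₗ qc s b)
      (qc_ext s fun c z => ?_) z
    refine LinearMap.congr_fun (f := f ∘ₗ qc s a ∘ₗ qc s b ∘ₗ qc s c)
      (g := g ∘ₗ qc s a ∘ₗ qc s b ∘ₗ qc s c) (qc_ext s fun d z => ?_) z
    exact LinearMap.congr_fun (f := f ∘ₗ qc s a ∘ₗ qc s b ∘ₗ qc s c ∘ₗ qc s d)
      (g := g ∘ₗ qc s a ∘ₗ qc s b ∘ₗ qc s c ∘ₗ qc s d) (unit_ext s (h a b c d)) z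
  hμ a b := tw_of s (msL_tv s a b)
  h1 a b c d := tw_of s (lten_msL_qc s a b (tv s c d))
  h2 a b c d := tw_of s (by
    refine (lten_one_qc s _ a (qc s b (tv s c d))).trans ?_
    refine (congrArg (qc s a) (lten_msL_qc s b c (qc s d (unitVec _)))).trans ?_
    exact (map_add (qc s a) _ _).trans
      (congrArg₂ (· + ·) (map_smul (qc s a) _ _) (map_smul (qc s a) _ _)))
  h3 a b c d := tw_of s (by
    refine (lten_two_qc s _ a b (tv s c d)).trans ?_
    refine (congrArg (qc s a ∘ₗ qc s b) (msL_tv s c d)).trans ?_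
    exact (map_add (qc s a ∘ₗ qc s b) _ _).trans
      (congrArg₂ (· + ·) (map_smul (qc s a ∘ₗ qc s b) _ _) (map_smul (qc s a ∘ₗ qc s b) _ _)))
  hC₂ a b := capL_tv s a b
  hC₄ a b c d := by
    refine (lten_two_qc s _ a b (tv s c d)).trans ?_
    refine (congrArg (qc s a ∘ₗ qc s b) (capL_tv s c d)).trans ?_
    exact map_smul (qc s a ∘ₗ qc s b) _ _
  hD₂ := cupL_unitVec s m
  hD₄ a b := by
    refine (lten_two_qc s _ a b (unitVec _)).trans ?_
    refine (congrArg (qc s a ∘ₗ qc s b) (cupL_unitVec s m)).trans ?_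
    refine (map_sum (qc s a ∘ₗ qc s b) _ _).trans ?_
    exact Finset.sum_congr rfl fun i _ => map_smul (qc s a ∘ₗ qc s b) _ _

/-- One and three thin strands. -/
noncomputable def oddStrands (m : ℕ) : OddStrands m (seqObj (qPow (2 * m) s) [1]).V
    (seqObj (qPow (2 * m) s) [1, 1, 1]).V where
  t1 a := qc s a (unitVec _)
  t3 a b c := qc s a (tv s b c)
  μ₁ := tw s (lten (qPow (2 * m) s) (X := [1, 1]) (Y := [1, 1]) (X' := [1]) (Y' := [1])
    (msL s (2 * m)) LinearMap.id)
  μ₂ := tw s (lten (qPow (2 * m) s) (X := [1]) (Y := [1]) (X' := [1, 1]) (Y' := [1, 1])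
    LinearMap.id (msL s (2 * m)))
  C := lten (qPow (2 * m) s) (X := [1]) (Y := [1]) (X' := [1, 1]) (Y' := [])
    LinearMap.id (capL s (2 * m))
  D := lten (qPow (2 * m) s) (X := [1]) (Y := [1]) (X' := []) (Y' := [1, 1])
    LinearMap.id (cupL s m)
  ext1 {N _ _ f g} h := qc_ext s fun i z =>
    LinearMap.congr_fun (f := f ∘ₗ qc s i) (g := g ∘ₗ qc s i) (unit_ext s (h i)) z
  ext3 {N _ _ f g} h := qc_ext s fun a z => by
    refine LinearMap.congr_fun (f := f ∘ₗ qc s a) (g := g ∘ₗ qc s a) (qc_ext s fun b z => ?_) z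
    refine LinearMap.congr_fun (f := f ∘ₗ qc s a ∘ₗ qc s b) (g := g ∘ₗ qc s a ∘ₗ qc s b)
      (qc_ext s fun c z => ?_) z
    exact LinearMap.congr_fun (f := f ∘ₗ qc s a ∘ₗ qc s b ∘ₗ qc s c)
      (g := g ∘ₗ qc s a ∘ₗ qc s b ∘ₗ qc s c) (unit_ext s (h a b c)) z
  h1 a b c := tw_of s (lten_msL_qc s a b (qc s c (unitVec _)))
  h2 a b c := tw_of s (by
    refine (lten_one_qc s _ a (tv s b c)).trans ?_
    refine (congrArg (qc s a) (msL_tv s b c)).trans ?_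
    exact (map_add (qc s a) _ _).trans
      (congrArg₂ (· + ·) (map_smul (qc s a) _ _) (map_smul (qc s a) _ _)))
  hC a b c := by
    refine (lten_one_qc s _ a (tv s b c)).trans ?_
    refine (congrArg (qc s a) (capL_tv s b c)).trans ?_
    exact map_smul (qc s a) _ _
  hD a := by
    refine (lten_one_qc s _ a (unitVec _)).trans ?_
    refine (congrArg (qc s a) (cupL_unitVec s m)).trans ?_
    refine (map_sum (qc s a) _ _).trans ?_
    exact Finset.sum_congr rfl fun i _ => map_smul (qc s a) _ _

end Instances
section CupRelations

variable {n : ℕ} (s : Bool)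

/-- The type A presentation functor. -/
noncomputable def typeA (s : Bool) (n : ℕ) : LinFunctorOn (C := WebA) (seqObj (qPow n s)) :=
  webFunctor (qPow_webRelations s)

lemma typeA_tens {X Y X' Y' : WebA} (f : X ⟶ Y) (g : X' ⟶ Y') : (typeA s n).map (f ⊗ₘ g) =
    (seqMu (qPow n s) X X').hom ≫ ((typeA s n).map f ⊗ₘ (typeA s n).map g) ≫
      (seqMu (qPow n s) Y Y').inv := webFunctor_tens _ f g

lemma lten_id (P : ℕ → AlgRep Kq (Uq n)) (X Y : List ℕ+) :
    lten P (X := X) (Y := X) (X' := Y) (Y' := Y) LinearMap.id LinearMap.id = LinearMap.id := by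
  refine LinearMap.ext fun x => ?_
  refine (congrArg (fun f => AlgRep.lin (seqMu P X Y).inv (f (AlgRep.lin (seqMu P X Y).hom x)))
    (TensorProduct.map_id (R := Kq))).trans ?_
  exact seqMu_hom_inv P X Y x

lemma duo_injective (P : ℕ → AlgRep Kq (Uq n)) (a b : ℕ+) : Function.Injective (duo P a b) := by
  have h : (P a ◁ (ρ_ (P b)).hom).1 ∘ₗ duo P a b = LinearMap.id :=
    TensorProduct.ext' fun x y => congrArg (x ⊗ₜ[Kq] ·) (one_smul Kq y)
  exact Function.LeftInverse.injective (LinearMap.congr_fun h)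

lemma ddL_injective (n : ℕ) : Function.Injective (ddL s n) := by
  intro x y h
  have e : ∀ z : (seqObj (qPow n s) [2]).V, ddL s n z =
      duo (qPow n s) 1 1 (qCom s 1 1 (unvec (qPow n s) 2 z)) := fun z =>
    (congrArg (ddL s n) (vec1_unvec (qPow n s) 2 z).symm).trans
      (seqSplit_vec1 (qPow n s) (fun a b => qSplit s a b) 1 1 (unvec (qPow n s) 2 z))
  have h' := (e x).symm.trans (h.trans (e y))
  exact unvec_injective (qPow n s) 2
    (qCom_thin_injective s 1 (duo_injective (qPow n s) 1 1 h'))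

lemma mmL_duo (t : (qPow n s 1 ⊗ qPow n s 1 : AlgRep Kq (Uq n)).V) :
    mmL s n (duo (qPow n s) 1 1 t) =
      vec1 (qPow n s) (a := 2) (AlgRep.lin (qMul s 1 1) t) := by
  have h : mmL s n ∘ₗ duo (qPow n s) 1 1 =
      (TensorProduct.mk Kq (qPow n s (1 + 1)).V Kq).flip 1 ∘ₗ AlgRep.lin (qMul s 1 1) :=
    TensorProduct.ext' fun x y => rfl
  exact LinearMap.congr_fun h t

lemma mmL_surjective (n : ℕ) : Function.Surjective (mmL s n) := by
  intro z
  obtain ⟨t, ht⟩ := qMul_thin_surjective s 1 (unvec (qPow n s) 2 z)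
  refine ⟨duo (qPow n s) 1 1 t, (mmL_duo s t).trans ?_⟩
  exact (congrArg (vec1 (qPow n s) (a := 2)) ht).trans (vec1_unvec (qPow n s) 2 z)

variable (m : ℕ)

/-- The web `ms` on the first two of four strands. -/
noncomputable def L₁ (n : ℕ) : (seqObj (qPow n s) [1, 1, 1, 1]).V →ₗ[Kq]
    (seqObj (qPow n s) [1, 1, 1, 1]).V :=
  lten (qPow n s) (X := [1, 1]) (Y := [1, 1]) (X' := [1, 1]) (Y' := [1, 1]) (msL s n)
    LinearMap.id

/-- The web `ms` on the middle two of four strands. -/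
noncomputable def L₂ (n : ℕ) : (seqObj (qPow n s) [1, 1, 1, 1]).V →ₗ[Kq]
    (seqObj (qPow n s) [1, 1, 1, 1]).V :=
  lten (qPow n s) (X := [1]) (Y := [1]) (X' := [1, 1, 1]) (Y' := [1, 1, 1]) LinearMap.id
    (lten (qPow n s) (X := [1, 1]) (Y := [1, 1]) (X' := [1]) (Y' := [1]) (msL s n) LinearMap.id)

/-- The web `ms` on the last two of four strands. -/
noncomputable def L₃ (n : ℕ) : (seqObj (qPow n s) [1, 1, 1, 1]).V →ₗ[Kq]
    (seqObj (qPow n s) [1, 1, 1, 1]).V :=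
  lten (qPow n s) (X := [1, 1]) (Y := [1, 1]) (X' := [1, 1]) (Y' := [1, 1]) LinearMap.id
    (msL s n)

lemma msL_apply (x : (seqObj (qPow (2 * m) s) [1, 1]).V) :
    msL s (2 * m) x = cS s • x + eS s • (strands s m).μ x := eq_tw s _ x

lemma L₁_apply (x : (seqObj (qPow (2 * m) s) [1, 1, 1, 1]).V) :
    L₁ s (2 * m) x = cS s • x + eS s • (strands s m).μ₁ x := eq_tw s _ x

lemma L₂_apply (x : (seqObj (qPow (2 * m) s) [1, 1, 1, 1]).V) :
    L₂ s (2 * m) x = cS s • x + eS s • (strands s m).μ₂ x := eq_tw s _ x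

lemma L₃_apply (x : (seqObj (qPow (2 * m) s) [1, 1, 1, 1]).V) :
    L₃ s (2 * m) x = cS s • x + eS s • (strands s m).μ₃ x := eq_tw s _ x

lemma slide_cap_apply (x : (seqObj (qPow (2 * m) s) [1, 1, 1, 1]).V) :
    (strands s m).C₂ ((strands s m).C₄ (L₂ s (2 * m) (L₁ s (2 * m) x))) =
      (strands s m).C₂ ((strands s m).C₄ (L₂ s (2 * m) (L₃ s (2 * m) x))) := by
  rw [L₂_apply, L₂_apply, L₁_apply, L₃_apply]
  exact (strands s m).slide_cap (cS s) (eS s) x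

lemma slide_cup_apply (x : (seqObj (qPow (2 * m) s) []).V) :
    L₁ s (2 * m) (L₂ s (2 * m) ((strands s m).D₄ ((strands s m).D₂ x))) =
      L₃ s (2 * m) (L₂ s (2 * m) ((strands s m).D₄ ((strands s m).D₂ x))) := by
  rw [L₂_apply, L₁_apply, L₃_apply]
  exact (strands s m).slide_cup (cS s) (eS s) x

/-- The values of the generators of cup webs. -/
noncomputable def cupVal : {X Y : List ℕ+} → CupGen X Y →
    (seqRes (qPow (2 * m) true) X ⟶ seqRes (qPow (2 * m) true) Y)
  | _, _, .cup => cupS true m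
  | _, _, .cap => capS true (2 * m)

lemma cup_circle : evAct (typeA true (2 * m)) (cupVal m) (cup.comp cap) =
    evAct (typeA true (2 * m)) (cupVal m)
      (ActTm.smul (zqnum (-(qpar ^ (2 * m))⁻¹) 1 0) (ActTm.one [])) := by
  refine AlgRep.hom_ext ((strands true m).loop_two.trans ?_)
  have h : qnum (2 * m : ℕ) = zqnum (-(qpar ^ (2 * m))⁻¹) 1 0 := by
    rw [zqnum_zero, qnum_nat_cast, pow_one, inv_neg, inv_inv]
    ring
  rw [h]
  rfl

lemma bubble_apply (x : (seqObj (qPow (2 * m) true) [1]).V) :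
    (oddStrands true m).C (lten (qPow (2 * m) true) (X := [1, 1]) (Y := [1, 1]) (X' := [1])
      (Y' := [1]) (msL true (2 * m)) LinearMap.id ((oddStrands true m).D x)) =
      zqnum (-(qpar ^ (2 * m))⁻¹) 1 (-1) • x := by
  have e : lten (qPow (2 * m) true) (X := [1, 1]) (Y := [1, 1]) (X' := [1]) (Y' := [1])
      (msL true (2 * m)) LinearMap.id ((oddStrands true m).D x) =
      cS true • (oddStrands true m).D x +
        eS true • (oddStrands true m).μ₁ ((oddStrands true m).D x) := eq_tw true _ _
  refine (congrArg (oddStrands true m).C e).trans ?_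
  rw [map_add, map_smul, map_smul, OddStrands.C_D, OddStrands.C_μ₁_D, smul_smul, smul_smul,
    ← add_smul]
  congr 1
  have h0 := qpar_ne_zero
  have h1 := qpar_sub_ne_zero
  have := zqnum_neg (-(qpar ^ (2 * m))⁻¹) 1 1
  rw [Nat.cast_one, pow_one, pow_one, inv_neg, inv_inv] at this
  rw [this, qnum_nat_cast, qnum_sub_nat, pow_one]
  simp only [cS, eS, if_true, qnum_two]
  field_simp
  ring

lemma cup_bubble : evAct (typeA true (2 * m)) (cupVal m)
      ((pad [1] cup).comp ((ActTm.onUnit (WHom.tens ms (WHom.one [1]))).comp (pad [1] cap))) =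
    evAct (typeA true (2 * m)) (cupVal m)
      (ActTm.smul (zqnum (-(qpar ^ (2 * m))⁻¹) 1 (-1)) (ActTm.one [1])) :=
  AlgRep.hom_ext (LinearMap.ext fun x => bubble_apply m x)

lemma lten_cross (c : Kq) (x : (seqObj (qPow n s) [1, 1, 1, 1]).V) :
    lten (qPow n s) (X := [1]) (Y := [1]) (X' := [1, 1, 1]) (Y' := [1, 1, 1]) LinearMap.id
      (lten (qPow n s) (X := [1, 1]) (Y := [1, 1]) (X' := [1]) (Y' := [1])
        (c • LinearMap.id + msL s n) LinearMap.id) x = c • x + L₂ s n x := by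
  rw [lten_add_left, lten_smul_left, lten_id, lten_add_right, lten_smul_right]
  exact congrArg (fun f => (c • f) x + L₂ s n x) (lten_id (qPow n s) [1] [1, 1, 1])

lemma msms_apply (w : (seqObj (qPow n s) [1, 1, 1, 1]).V) :
    lten (qPow n s) (X := [1, 1]) (Y := [1, 1]) (X' := [1, 1]) (Y' := [1, 1])
      (msL s n) (msL s n) w = L₁ s n (L₃ s n w) :=
  LinearMap.congr_fun (lten_comp (qPow n s) LinearMap.id (msL s n) (msL s n) LinearMap.id) w

lemma lasso_cross (x : (seqObj (qPow (2 * m) true) [1, 1]).V)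
    {w y : (seqObj (qPow (2 * m) true) [1, 1, 1, 1]).V}
    (hw : w = (-qpar) • (strands true m).D₄ x + L₂ true (2 * m) ((strands true m).D₄ x))
    (hy : y = L₁ true (2 * m) (L₃ true (2 * m) w)) :
    (strands true m).C₄ ((-qpar⁻¹) • y + L₂ true (2 * m) y) = (strands true m).D₂
      ((strands true m).C₂ x) + zqnum (-(qpar ^ (2 * m))⁻¹) 1 (-2) • x := by
  have h0 := qpar_ne_zero
  rw [← (strands true m).lasso_apply x (w := w) (z := L₃ true (2 * m) w) (y := y) (by
      rw [hw, L₂_apply]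
      simp only [cS, eS, if_true, qnum_two]
      module) (by
      rw [L₃_apply]
      simp only [cS, eS, if_true]
      module) (by
      rw [hy, L₁_apply]
      simp only [cS, eS, if_true]
      module), L₂_apply]
  congr 1
  simp only [cS, eS, if_true, qnum_two]
  module

/-- A crossing of the middle two of four strands. -/
noncomputable def Lx (n : ℕ) (c : Kq) : (seqObj (qPow n s) [1, 1, 1, 1]).V →ₗ[Kq]
    (seqObj (qPow n s) [1, 1, 1, 1]).V :=
  lten (qPow n s) (X := [1]) (Y := [1]) (X' := [1, 1, 1]) (Y' := [1, 1, 1]) LinearMap.id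
    (lten (qPow n s) (X := [1, 1]) (Y := [1, 1]) (X' := [1]) (Y' := [1])
      (c • LinearMap.id + msL s n) LinearMap.id)

lemma lasso_lin (x : (seqObj (qPow (2 * m) true) [1, 1]).V) :
    (strands true m).C₄ (Lx true (2 * m) (-qpar⁻¹) (lten (qPow (2 * m) true) (X := [1, 1])
      (Y := [1, 1]) (X' := [1, 1]) (Y' := [1, 1]) (msL true (2 * m)) (msL true (2 * m))
        (Lx true (2 * m) (-qpar) ((strands true m).D₄ x)))) = (strands true m).D₂
      ((strands true m).C₂ x) + zqnum (-(qpar ^ (2 * m))⁻¹) 1 (-2) • x := by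
  rw [← lasso_cross m x rfl rfl, msms_apply, Lx, Lx, lten_cross, lten_cross]

lemma typeA_tens_lin {X Y X' Y' : List ℕ+} (f : WHom X Y) (g : WHom X' Y') :
    ((typeA s n).map (X := (X ++ X' : List ℕ+)) (Y := (Y ++ Y' : List ℕ+)) (WHom.tens f g)).1 =
      lten (qPow n s) ((typeA s n).map (X := (X : WebA)) (Y := (Y : WebA)) f).1
        ((typeA s n).map (X := (X' : WebA)) (Y := (Y' : WebA)) g).1 :=
  congrArg AlgRep.lin (typeA_tens s (X := X) (Y := Y) (X' := X') (Y' := Y') f g)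

lemma typeA_cross (c : Kq) :
    ((typeA s n).map (X := ([1, 1] : List ℕ+)) (Y := ([1, 1] : List ℕ+))
      (c • WHom.one [1, 1] + ms)).1 = c • LinearMap.id + msL s n := by
  refine (congrArg AlgRep.lin (map_add ((typeA s n).map (X := ([1, 1] : List ℕ+))
    (Y := ([1, 1] : List ℕ+))) (c • WHom.one [1, 1]) ms)).trans ?_
  have h := congrArg AlgRep.lin (map_smul ((typeA s n).map (X := ([1, 1] : List ℕ+))
    (Y := ([1, 1] : List ℕ+))) c (WHom.one [1, 1]))
  exact congrArg (· + msL s n) h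

lemma typeA_mid_cross (c : Kq) :
    ((typeA s n).map (X := ([1, 1, 1, 1] : List ℕ+)) (Y := ([1, 1, 1, 1] : List ℕ+))
      (mid [1] [1] (c • WHom.one [1, 1] + ms))).1 = Lx s n c := by
  refine (typeA_tens_lin s (X := [1]) (Y := [1]) (X' := [1, 1, 1]) (Y' := [1, 1, 1])
    (WHom.one [1]) (WHom.tens (c • WHom.one [1, 1] + ms) (WHom.one [1]))).trans ?_
  refine congrArg (lten (qPow n s) (X := [1]) (Y := [1]) (X' := [1, 1, 1]) (Y' := [1, 1, 1])
    LinearMap.id) ((typeA_tens_lin s (X := [1, 1]) (Y := [1, 1]) (X' := [1]) (Y' := [1])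
      (c • WHom.one [1, 1] + ms) (WHom.one [1])).trans ?_)
  exact congrArg (fun f => lten (qPow n s) (X := [1, 1]) (Y := [1, 1]) (X' := [1]) (Y' := [1])
    f LinearMap.id) (typeA_cross s c)

lemma typeA_lasso : ((typeA s n).map (X := ([1, 1, 1, 1] : List ℕ+))
      (Y := ([1, 1, 1, 1] : List ℕ+)) (WHom.comp (mid [1] [1] crossUnder)
        (WHom.comp msms (mid [1] [1] crossOver)))).1 =
    Lx s n (-qpar⁻¹) ∘ₗ lten (qPow n s) (X := [1, 1]) (Y := [1, 1]) (X' := [1, 1])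
      (Y' := [1, 1]) (msL s n) (msL s n) ∘ₗ Lx s n (-qpar) := by
  have h := fun f g : WHom [1, 1, 1, 1] [1, 1, 1, 1] => congrArg AlgRep.lin
    ((typeA s n).map_comp (X := ([1, 1, 1, 1] : List ℕ+)) (Y := ([1, 1, 1, 1] : List ℕ+))
      (Z := ([1, 1, 1, 1] : List ℕ+)) f g)
  refine (h _ _).trans ((congrArg (fun u => u ∘ₗ _) (h _ _)).trans ?_)
  exact congrArg₂ (fun u v => (u ∘ₗ lten (qPow n s) (X := [1, 1]) (Y := [1, 1]) (X' := [1, 1])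
      (Y' := [1, 1]) (msL s n) (msL s n)) ∘ₗ v) (typeA_mid_cross s (-qpar⁻¹))
        (typeA_mid_cross s (-qpar))

lemma evAct_sandwich {P : ℕ → AlgRep Kq (Uq n)} {G : List ℕ+ → List ℕ+ → Type}
    (FA : LinFunctorOn (C := WebA) (seqObj P))
    (γ : {X Y : List ℕ+} → G X Y → (seqRes P X ⟶ seqRes P Y)) {X Y Z W : List ℕ+}
    (a : ActTm G X Y) (f : WHom Y Z) (b : ActTm G Z W) :
    (evAct FA γ (a.comp ((ActTm.onUnit f).comp b))).1 =
      (evAct FA γ b).1 ∘ₗ (FA.map (X := (Y : WebA)) (Y := (Z : WebA)) f).1 ∘ₗ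
        (evAct FA γ a).1 := rfl

lemma cup_lasso : evAct (typeA true (2 * m)) (cupVal m)
      ((pad [1, 1] cup).comp ((ActTm.onUnit (WHom.comp (mid [1] [1] crossUnder)
        (WHom.comp msms (mid [1] [1] crossOver)))).comp (pad [1, 1] cap))) =
    evAct (typeA true (2 * m)) (cupVal m)
      (ActTm.add (cap.comp cup) (ActTm.smul (zqnum (-(qpar ^ (2 * m))⁻¹) 1 (-2))
        (ActTm.one [1, 1]))) := by
  refine AlgRep.hom_ext ((evAct_sandwich (typeA true (2 * m)) (cupVal m) (X := [1, 1])
    (Y := [1, 1, 1, 1]) (Z := [1, 1, 1, 1]) (W := [1, 1]) (pad [1, 1] cup) _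
    (pad [1, 1] cap)).trans ?_)
  refine (congrArg (fun u => (strands true m).C₄ ∘ₗ u ∘ₗ (strands true m).D₄)
    (typeA_lasso true)).trans ?_
  exact LinearMap.ext fun x => lasso_lin m x

lemma msL_cupL (x : (seqObj (qPow (2 * m) true) []).V) :
    msL true (2 * m) (cupL true m x) = 0 := by
  have h : (strands true m).μ (cupL true m x) = qnum 2 • cupL true m x :=
    LinearMap.congr_fun (strands true m).μ_D₂ x
  rw [msL_apply, h]
  simp only [cS, eS, if_true]
  module

lemma capL_msL (x : (seqObj (qPow (2 * m) true) [1, 1]).V) :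
    capL true (2 * m) (msL true (2 * m) x) = 0 := by
  have h : capL true (2 * m) ((strands true m).μ x) = qnum 2 • capL true (2 * m) x :=
    LinearMap.congr_fun (strands true m).C₂_μ x
  rw [msL_apply, map_add, map_smul, map_smul, h]
  simp only [cS, eS, if_true]
  module

lemma cup_lollipopCup : evAct (typeA true (2 * m)) (cupVal m)
    (cup.comp (ActTm.onUnit (WHom.merge 1 1))) =
      evAct (typeA true (2 * m)) (cupVal m) ActTm.zero := by
  refine AlgRep.hom_ext (LinearMap.ext fun x => ?_)
  exact ddL_injective true (2 * m) ((msL_cupL m x).trans (map_zero (ddL true (2 * m))).symm)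

lemma cup_lollipopCap : evAct (typeA true (2 * m)) (cupVal m)
    ((ActTm.onUnit (WHom.split 1 1)).comp cap) =
      evAct (typeA true (2 * m)) (cupVal m) ActTm.zero := by
  refine AlgRep.hom_ext (LinearMap.ext fun z => ?_)
  obtain ⟨x, rfl⟩ := mmL_surjective true (2 * m) z
  exact capL_msL m x

lemma cup_slideCap : evAct (typeA true (2 * m)) (cupVal m) (slideCap cap msLeft) =
    evAct (typeA true (2 * m)) (cupVal m) (slideCap cap msRight) :=
  AlgRep.hom_ext (LinearMap.ext fun x => slide_cap_apply true m x)

lemma cup_slideCup : evAct (typeA true (2 * m)) (cupVal m) (slideCup cup msLeft) =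
    evAct (typeA true (2 * m)) (cupVal m) (slideCup cup msRight) :=
  AlgRep.hom_ext (LinearMap.ext fun x => slide_cup_apply true m x)

/-- The values of the cup and of the cap satisfy the relations of cup webs. -/
lemma cupVal_relations {X Y : List ℕ+} {f g : ActTm CupGen X Y}
    (h : CupRel (-(qpar ^ (2 * m))⁻¹) f g) :
    evAct (typeA true (2 * m)) (cupVal m) f = evAct (typeA true (2 * m)) (cupVal m) g := by
  cases h with
  | circle => exact cup_circle m
  | bubble => exact cup_bubble m
  | lasso => exact cup_lasso m
  | lollipopCup => exact cup_lollipopCup m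
  | lollipopCap => exact cup_lollipopCap m
  | slideCap => exact cup_slideCap m
  | slideCup => exact cup_slideCup m

end CupRelations
section ThinSwitch

variable {n : ℕ} (s : Bool)

/-- The linear map underlying a merge. -/
noncomputable def mgL (n : ℕ) (a b : ℕ+) :
    (seqObj (qPow n s) [a, b]).V →ₗ[Kq] (seqObj (qPow n s) [a + b]).V :=
  (seqMerge (qPow n s) (fun a b => qMul s a b) a b).1

/-- The linear map underlying a split. -/
noncomputable def spL (n : ℕ) (a b : ℕ+) :
    (seqObj (qPow n s) [a + b]).V →ₗ[Kq] (seqObj (qPow n s) [a, b]).V :=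
  (seqSplit (qPow n s) (fun a b => qSplit s a b) a b).1

/-- A merge with a thin strand, next to another thin strand. -/
noncomputable def mgT (n : ℕ) (a : ℕ+) :
    (seqObj (qPow n s) [a, 1, 1]).V →ₗ[Kq] (seqObj (qPow n s) [a + 1, 1]).V :=
  lten (qPow n s) (X := [a, 1]) (Y := [a + 1]) (X' := [1]) (Y' := [1]) (mgL s n a 1) LinearMap.id

/-- The split of a thin strand, next to another thin strand. -/
noncomputable def spT (n : ℕ) (a : ℕ+) :
    (seqObj (qPow n s) [a + 1, 1]).V →ₗ[Kq] (seqObj (qPow n s) [a, 1, 1]).V :=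
  lten (qPow n s) (X := [a + 1]) (Y := [a, 1]) (X' := [1]) (Y' := [1]) (spL s n a 1) LinearMap.id

/-- The web `ms` on two thin strands, next to another strand. -/
noncomputable def msT (n : ℕ) (a : ℕ+) :
    (seqObj (qPow n s) [a, 1, 1]).V →ₗ[Kq] (seqObj (qPow n s) [a, 1, 1]).V :=
  lten (qPow n s) (X := [a]) (Y := [a]) (X' := [1, 1]) (Y' := [1, 1]) LinearMap.id (msL s n)

lemma lten_id_single {P : ℕ → AlgRep Kq (Uq n)} {X' Y' : List ℕ+} {a : ℕ+}
    (g : (seqObj P X').V →ₗ[Kq] (seqObj P Y').V) (x : (P a).V) (z : (seqObj P X').V) :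
    lten P (X := [a]) (Y := [a]) LinearMap.id g (x ⊗ₜ[Kq] z : (seqObj P (a :: X')).V) =
      (x ⊗ₜ[Kq] g z : (seqObj P (a :: Y')).V) :=
  (lten_single P LinearMap.id g x z).trans (seqMu_inv_single P a Y' x (g z))

lemma switch_inner (a : ℕ+) (u : (qPow n s a).V)
    (w : (qPow n s 1 ⊗ qPow n s 1 : AlgRep Kq (Uq n)).V) :
    mgT s n a (u ⊗ₜ[Kq] duo (qPow n s) 1 1 w : (seqObj (qPow n s) [a, 1, 1]).V) =
    duo (qPow n s) (a + 1) 1 (TensorProduct.map (qMul s a 1).1 LinearMap.id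
      ((TensorProduct.assoc Kq (qPow n s a).V (qPow n s 1).V (qPow n s 1).V).symm
        (u ⊗ₜ[Kq] w))) := by
  let F : (qPow n s 1 ⊗ qPow n s 1 : AlgRep Kq (Uq n)).V →ₗ[Kq] (seqObj (qPow n s) [a + 1, 1]).V :=
    mgT s n a ∘ₗ TensorProduct.mk Kq (qPow n s a).V (seqObj (qPow n s) [1, 1]).V u ∘ₗ
        duo (qPow n s) 1 1
  let G : (qPow n s 1 ⊗ qPow n s 1 : AlgRep Kq (Uq n)).V →ₗ[Kq] (seqObj (qPow n s) [a + 1, 1]).V :=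
    duo (qPow n s) (a + 1) 1 ∘ₗ TensorProduct.map (qMul s a 1).1 LinearMap.id ∘ₗ
      (TensorProduct.assoc Kq (qPow n s a).V (qPow n s 1).V (qPow n s 1).V).symm.toLinearMap ∘ₗ
        TensorProduct.mk Kq (qPow n s a).V _ u
  have h : F = G := TensorProduct.ext' fun x y =>
    (lten_pair (qPow n s) (a := a) (b := 1) (X' := [1]) (Y := [a + 1]) (Y' := [1])
      (mgL s n a 1) LinearMap.id u x (vec1 (qPow n s) (a := 1) y)).trans
        (seqMu_inv_single (qPow n s) (a + 1) [1] (qMulB s a 1 u x) (vec1 (qPow n s) (a := 1) y))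
  exact LinearMap.congr_fun h w

lemma switch_middle (a : ℕ+) (y : (qPow n s 1).V)
    (t : (qPow n s a ⊗ qPow n s 1 : AlgRep Kq (Uq n)).V) :
    mgT s n a (msT s n a (AlgRep.lin (seqMu (qPow n s) [a, 1] [1]).inv
          (duo (qPow n s) a 1 t ⊗ₜ vec1 (qPow n s) (a := 1) y))) =
    duo (qPow n s) (a + 1) 1 (TensorProduct.map (qMul s a 1).1 LinearMap.id
      ((TensorProduct.assoc Kq (qPow n s a).V (qPow n s 1).V (qPow n s 1).V).symm
        (TensorProduct.map LinearMap.id (qCom s 1 1 ∘ₗ (qMul s 1 1).1)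
          (TensorProduct.assoc Kq (qPow n s a).V (qPow n s 1).V (qPow n s 1).V (t ⊗ₜ y))))) := by
  let F : (qPow n s a ⊗ qPow n s 1 : AlgRep Kq (Uq n)).V →ₗ[Kq] (seqObj (qPow n s) [a + 1, 1]).V :=
    mgT s n a ∘ₗ msT s n a ∘ₗ AlgRep.lin (seqMu (qPow n s) [a, 1] [1]).inv ∘ₗ
          (TensorProduct.mk Kq (seqObj (qPow n s) [a, 1]).V (seqObj (qPow n s) [1]).V).flip
            (vec1 (qPow n s) (a := 1) y) ∘ₗ duo (qPow n s) a 1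
  let G : (qPow n s a ⊗ qPow n s 1 : AlgRep Kq (Uq n)).V →ₗ[Kq] (seqObj (qPow n s) [a + 1, 1]).V :=
    duo (qPow n s) (a + 1) 1 ∘ₗ TensorProduct.map (qMul s a 1).1 LinearMap.id ∘ₗ
      (TensorProduct.assoc Kq (qPow n s a).V (qPow n s 1).V (qPow n s 1).V).symm.toLinearMap ∘ₗ
        TensorProduct.map LinearMap.id (qCom s 1 1 ∘ₗ (qMul s 1 1).1) ∘ₗ
          (TensorProduct.assoc Kq (qPow n s a).V (qPow n s 1).V (qPow n s 1).V).toLinearMap ∘ₗ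
            (TensorProduct.mk Kq _ (qPow n s 1).V).flip y
  have h : F = G := TensorProduct.ext' fun u v => by
    have e1 : AlgRep.lin (seqMu (qPow n s) [a, 1] [1]).inv
        (vec2 (qPow n s) (a := a) (b := 1) u v ⊗ₜ vec1 (qPow n s) (a := 1) y) =
        (u ⊗ₜ[Kq] vec2 (qPow n s) (a := 1) (b := 1) v y : (seqObj (qPow n s) [a, 1, 1]).V) :=
      seqMu_inv_pair (qPow n s) a 1 [1] u v (vec1 (qPow n s) (a := 1) y)
    have e2 : msT s n a
          (u ⊗ₜ[Kq] vec2 (qPow n s) (a := 1) (b := 1) v y : (seqObj (qPow n s) [a, 1, 1]).V) =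
        (u ⊗ₜ[Kq] duo (qPow n s) 1 1 (qCom s 1 1 (qMulB s 1 1 v y)) :
          (seqObj (qPow n s) [a, 1, 1]).V) :=
      (lten_id_single (msL s n) u _).trans (congrArg (u ⊗ₜ[Kq] ·) (msL_vec2 s v y))
    refine (congrArg (fun z => mgT s n a (msT s n a z)) e1).trans ?_
    refine (congrArg (mgT s n a) e2).trans ?_
    exact switch_inner s a u _
  exact LinearMap.congr_fun h t

/-- The split after the merge of a strand of thickness `a + 1` and a thin strand. -/
lemma spL_mgL (a : ℕ+) (z : (seqObj (qPow n s) [a + 1, 1]).V) :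
    spL s n (a + 1) 1 (mgL s n (a + 1) 1 z) =
    mgT s n a (msT s n a (spT s n a z)) - qnum (a : ℕ) • z := by
  let F : (seqObj (qPow n s) [a + 1, 1]).V →ₗ[Kq] (seqObj (qPow n s) [a + 1, 1]).V :=
    spL s n (a + 1) 1 ∘ₗ mgL s n (a + 1) 1
  let G : (seqObj (qPow n s) [a + 1, 1]).V →ₗ[Kq] (seqObj (qPow n s) [a + 1, 1]).V :=
    mgT s n a ∘ₗ msT s n a ∘ₗ spT s n a - qnum (a : ℕ) • LinearMap.id
  have h : F = G := seq2_ext (qPow n s) fun x y => by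
    have e1 : spT s n a (vec2 (qPow n s) (a := a + 1) (b := 1) x y) =
        AlgRep.lin (seqMu (qPow n s) [a, 1] [1]).inv
          (duo (qPow n s) a 1 (qCom s a 1 x) ⊗ₜ vec1 (qPow n s) (a := 1) y) :=
      (lten_single (qPow n s) (a := a + 1) (Y := [a, 1]) (spL s n a 1) LinearMap.id x
        (vec1 (qPow n s) (a := 1) y)).trans
        (congrArg (fun t => AlgRep.lin (seqMu (qPow n s) [a, 1] [1]).inv
          (t ⊗ₜ vec1 (qPow n s) (a := 1) y))
            (seqSplit_vec1 (qPow n s) (fun a b => qSplit s a b) a 1 x))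
    have e2 := (congrArg (fun z => mgT s n a (msT s n a z)) e1).trans
          (switch_middle s a y (qCom s a 1 x))
    refine (seqSplit_vec1 (qPow n s) (fun a b => qSplit s a b) (a + 1) 1
      (qMulB s (a + 1 : ℕ) 1 x y)).trans ?_
    refine (congrArg (duo (qPow n s) (a + 1) 1) (qCom_qMul_right s a x y)).trans ?_
    refine (map_sub (duo (qPow n s) (a + 1) 1) _ _).trans ?_
    exact congrArg₂ (· - ·) e2.symm (map_smul (duo (qPow n s) (a + 1) 1) _ _)
  exact LinearMap.congr_fun h z

end ThinSwitch
section ThickTrace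

variable {m : ℕ} {M0 M2 M4 : Type} [AddCommGroup M0] [Module Kq M0] [AddCommGroup M2]
  [Module Kq M2] [AddCommGroup M4] [Module Kq M4] (S : Strands m M0 M2 M4)

lemma zqnum_pow_two (n j : ℕ) : zqnum (qpar ^ n) 2 (-j) =
    (qpar ^ n * ((qpar ^ 2) ^ j)⁻¹ - (qpar ^ n)⁻¹ * (qpar ^ 2) ^ j) /
      ((qpar - qpar⁻¹) * qnum 2) := by
  rw [zqnum_neg, qpar_sq_sub_inv]

lemma Strands.thick_apply (hc : ∀ y, S.μ₃ (S.μ₁ y) = S.μ₁ (S.μ₃ y)) (x : M2) {v : M4}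
    (hv : v = S.μ₂ (S.μ₁ (S.D₄ x)) - S.D₄ x) :
    S.C₄ (S.μ₁ (S.μ₂ (S.μ₃ (S.μ₁ v))) - S.μ₃ (S.μ₁ v) - qnum 2 • S.μ₁ v) =
      (qnum 2 * qnum 2) • (S.D₂ (S.C₂ x) + zqnum (qpar ^ (2 * m)) 2 (-2) • S.μ x) := by
  have h0 := qpar_ne_zero
  have h1 := qpar_sub_ne_zero
  have h2 := qnum_two_ne_zero
  have W : ∀ x, S.C₄ (S.μ₂ (S.μ₁ (S.μ₃ (S.μ₂ (S.D₄ x))))) = S.D₂ (S.C₂ x) +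
      (qnum 2 * qnum ((2 * m : ℕ) - (2 : ℕ))) • S.μ x + qnum ((2 * m : ℕ) - (2 : ℕ)) • x :=
    fun x => LinearMap.congr_fun S.trace_two x
  have h3 : S.μ (S.D₂ (S.C₂ (S.μ x))) = (qnum 2 * qnum 2) • S.D₂ (S.C₂ x) := by
    have e1 : S.C₂ (S.μ x) = qnum 2 • S.C₂ x := LinearMap.congr_fun S.C₂_μ x
    have e2 : S.μ (S.D₂ (S.C₂ x)) = qnum 2 • S.D₂ (S.C₂ x) :=
      LinearMap.congr_fun S.μ_D₂ (S.C₂ x)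
    rw [e1, map_smul, map_smul, e2, smul_smul]
  rw [hv]
  simp only [map_sub, map_smul, hc, S.C₄_μ₁, S.C₄_μ₃, S.μ₁_D₄, S.μ₃_D₄, S.C₄_D₄, S.C₄_μ₂_D₄,
    S.μ_μ, W, map_add, h3]
  have := zqnum_pow_two (2 * m) 2
  rw [show (-2 : ℤ) = -((2 : ℕ) : ℤ) from rfl, this]
  simp only [qnum_nat_cast, qnum_sub_nat]
  have h4 := qnum_two
  match_scalars
  · ring
  · rw [qnum_two] at h2 ⊢
    field_simp
    ring

end ThickTrace

section DotRelations

variable {n : ℕ} (s : Bool)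

lemma mgL_assoc (a b c : ℕ+) (z : (seqObj (qPow n s) [a, b, c]).V) :
    AlgRep.lin (seqCast (qPow n s) (congrArg (fun x => [x]) (_root_.add_assoc a b c)))
      (mgL s n (a + b) c (lten (qPow n s) (X := [a, b]) (Y := [a + b]) (X' := [c]) (Y' := [c])
        (mgL s n a b) LinearMap.id z)) =
    mgL s n a (b + c) (lten (qPow n s) (X := [a]) (Y := [a]) (X' := [b, c]) (Y' := [b + c])
        LinearMap.id (mgL s n b c) z) :=
  LinearMap.congr_fun (congrArg AlgRep.lin (qMul_merge_assoc s a b c)) z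

lemma spL_coassoc (a b c : ℕ+) (z : (seqObj (qPow n s) [a + (b + c)]).V) :
    lten (qPow n s) (X := [a + b]) (Y := [a, b]) (X' := [c]) (Y' := [c]) (spL s n a b)
      LinearMap.id (spL s n (a + b) c (AlgRep.lin (seqCast (qPow n s)
        (congrArg (fun x => [x]) (_root_.add_assoc a b c).symm)) z)) =
    lten (qPow n s) (X := [a]) (Y := [a]) (X' := [b + c]) (Y' := [b, c]) LinearMap.id
      (spL s n b c) (spL s n a (b + c) z) :=
  LinearMap.congr_fun (congrArg AlgRep.lin (qSplit_coassoc s a b c)) z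

/-- The web with two outer merges and splits, written with thin strands on the right. -/
lemma switch_thick (a : ℕ+) (z : (seqObj (qPow n s) [a, 1, 1]).V) :
    lten (qPow n s) (X := [a]) (Y := [a]) (X' := [1 + 1]) (Y' := [1, 1]) LinearMap.id
      (spL s n 1 1) (spL s n a (1 + 1) (mgL s n a (1 + 1) (lten (qPow n s) (X := [a]) (Y := [a])
        (X' := [1, 1]) (Y' := [1 + 1]) LinearMap.id (mgL s n 1 1) z))) =
    spT s n a (mgT s n a (msT s n a (spT s n a (mgT s n a z)))) -
      qnum (a : ℕ) • spT s n a (mgT s n a z) := by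
  rw [← spL_coassoc, ← mgL_assoc]
  have h := seqCast_comp (qPow n s) (congrArg (fun x => [x]) (_root_.add_assoc a 1 1))
    (congrArg (fun x => [x]) (_root_.add_assoc a 1 1).symm)
  have h' := LinearMap.congr_fun (congrArg AlgRep.lin h)
    (mgL s n (a + 1) 1 (mgT s n a z))
  refine (congrArg (fun t => spT s n a (spL s n (a + 1) 1 t)) h').trans ?_
  refine (congrArg (spT s n a) (spL_mgL s a (mgT s n a z))).trans ?_
  rw [map_sub, map_smul]

end DotRelations
section ThickStrands

variable {n : ℕ} (s : Bool) (m : ℕ)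

/-- The merge of the first two of four thin strands. -/
noncomputable def mm₄ (n : ℕ) : (seqObj (qPow n s) [1, 1, 1, 1]).V →ₗ[Kq]
    (seqObj (qPow n s) [1 + 1, 1, 1]).V :=
  lten (qPow n s) (X := [1, 1]) (Y := [1 + 1]) (X' := [1, 1]) (Y' := [1, 1]) (mmL s n)
    LinearMap.id

/-- The split into the first two of four thin strands. -/
noncomputable def dd₄ (n : ℕ) : (seqObj (qPow n s) [1 + 1, 1, 1]).V →ₗ[Kq]
    (seqObj (qPow n s) [1, 1, 1, 1]).V :=
  lten (qPow n s) (X := [1 + 1]) (Y := [1, 1]) (X' := [1, 1]) (Y' := [1, 1]) (ddL s n)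
    LinearMap.id

lemma dd₄_mm₄ (x : (seqObj (qPow n s) [1, 1, 1, 1]).V) : dd₄ s n (mm₄ s n x) = L₁ s n x :=
  (LinearMap.congr_fun (lten_comp (qPow n s) (X := [1, 1]) (Y := [1 + 1]) (Z := [1, 1])
    (X' := [1, 1]) (Y' := [1, 1]) (Z' := [1, 1]) (mmL s n) LinearMap.id (ddL s n)
      LinearMap.id) x).symm

lemma dd₄_msT (z : (seqObj (qPow n s) [1 + 1, 1, 1]).V) :
    dd₄ s n (msT s n (1 + 1) z) = L₃ s n (dd₄ s n z) :=
  (LinearMap.congr_fun (lten_comp (qPow n s) (X := [1 + 1]) (Y := [1 + 1]) (Z := [1, 1])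
    (X' := [1, 1]) (Y' := [1, 1]) (Z' := [1, 1]) LinearMap.id (msL s n) (ddL s n)
      LinearMap.id) z).symm.trans
  (LinearMap.congr_fun (lten_comp (qPow n s) (X := [1 + 1]) (Y := [1, 1]) (Z := [1, 1])
    (X' := [1, 1]) (Y' := [1, 1]) (Z' := [1, 1]) (ddL s n) LinearMap.id LinearMap.id
      (msL s n)) z)

lemma L₃_L₁ (w : (seqObj (qPow n s) [1, 1, 1, 1]).V) :
    L₃ s n (L₁ s n w) = L₁ s n (L₃ s n w) :=
  (LinearMap.congr_fun (lten_comp (qPow n s) (X := [1, 1]) (Y := [1, 1]) (Z := [1, 1])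
    (X' := [1, 1]) (Y' := [1, 1]) (Z' := [1, 1]) (msL s n) LinearMap.id LinearMap.id
      (msL s n)) w).symm.trans (msms_apply s w)

lemma spT_mgT_eq (z : (seqObj (qPow n s) [1 + 1, 1, 1]).V) :
    spT s n (1 + 1) (mgT s n (1 + 1) z) = mm₄ s n (L₂ s n (dd₄ s n z)) - z := by
  have h1 : spT s n (1 + 1) (mgT s n (1 + 1) z) =
      lten (qPow n s) (X := [1 + 1, 1]) (Y := [1 + 1, 1]) (X' := [1]) (Y' := [1])
        (spL s n (1 + 1) 1 ∘ₗ mgL s n (1 + 1) 1) LinearMap.id z :=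
    (LinearMap.congr_fun (lten_comp (qPow n s) (X := [1 + 1, 1]) (Y := [1 + 1 + 1])
      (Z := [1 + 1, 1]) (X' := [1]) (Y' := [1]) (Z' := [1]) (mgL s n (1 + 1) 1) LinearMap.id
        (spL s n (1 + 1) 1) LinearMap.id) z).symm
  have h2 : spL s n (1 + 1) 1 ∘ₗ mgL s n (1 + 1) 1 =
      mgT s n 1 ∘ₗ msT s n 1 ∘ₗ spT s n 1 + (-1 : Kq) • LinearMap.id := by
    refine LinearMap.ext fun z => (spL_mgL s 1 z).trans ?_
    have : qnum ((1 : ℕ+) : ℕ) = 1 := qnum_one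
    rw [this]
    change mgT s n 1 (msT s n 1 (spT s n 1 z)) - (1 : Kq) • z =
      mgT s n 1 (msT s n 1 (spT s n 1 z)) + (-1 : Kq) • z
    module
  have a1 : ∀ z, lten (qPow n s) (X := [1 + 1, 1]) (Y := [1, 1, 1]) (X' := [1]) (Y' := [1])
      (spT s n 1) LinearMap.id z = dd₄ s n z := fun z =>
    (LinearMap.congr_fun (lten_assoc (qPow n s) (X := [1 + 1]) (Y := [1, 1]) (X' := [1])
      (Y' := [1]) (X'' := [1]) (Y'' := [1]) (ddL s n) LinearMap.id LinearMap.id) z).trans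
      (congrArg (fun g => lten (qPow n s) (X := [1 + 1]) (Y := [1, 1]) (X' := [1, 1])
        (Y' := [1, 1]) (ddL s n) g z) (lten_id (qPow n s) [1] [1]))
  have a2 : ∀ z, lten (qPow n s) (X := [1, 1, 1]) (Y := [1, 1, 1]) (X' := [1]) (Y' := [1])
      (msT s n 1) LinearMap.id z = L₂ s n z := fun z =>
    LinearMap.congr_fun (lten_assoc (qPow n s) (X := [1]) (Y := [1]) (X' := [1, 1])
      (Y' := [1, 1]) (X'' := [1]) (Y'' := [1]) LinearMap.id (msL s n) LinearMap.id) z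
  have a3 : ∀ z, lten (qPow n s) (X := [1, 1, 1]) (Y := [1 + 1, 1]) (X' := [1]) (Y' := [1])
      (mgT s n 1) LinearMap.id z = mm₄ s n z := fun z =>
    (LinearMap.congr_fun (lten_assoc (qPow n s) (X := [1, 1]) (Y := [1 + 1]) (X' := [1])
      (Y' := [1]) (X'' := [1]) (Y'' := [1]) (mmL s n) LinearMap.id LinearMap.id) z).trans
      (congrArg (fun g => lten (qPow n s) (X := [1, 1]) (Y := [1 + 1]) (X' := [1, 1])
        (Y' := [1, 1]) (mmL s n) g z) (lten_id (qPow n s) [1] [1]))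
  have c1 : lten (qPow n s) (X := [1 + 1, 1]) (Y := [1 + 1, 1]) (X' := [1]) (Y' := [1])
      (mgT s n 1 ∘ₗ msT s n 1 ∘ₗ spT s n 1) LinearMap.id z =
      lten (qPow n s) (X := [1, 1, 1]) (Y := [1 + 1, 1]) (X' := [1]) (Y' := [1])
        (mgT s n 1) LinearMap.id (lten (qPow n s) (X := [1, 1, 1]) (Y := [1, 1, 1]) (X' := [1])
          (Y' := [1]) (msT s n 1) LinearMap.id (lten (qPow n s) (X := [1 + 1, 1])
            (Y := [1, 1, 1]) (X' := [1]) (Y' := [1]) (spT s n 1) LinearMap.id z)) :=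
    (LinearMap.congr_fun (lten_comp (qPow n s) (X := [1 + 1, 1]) (Y := [1, 1, 1])
      (Z := [1 + 1, 1]) (X' := [1]) (Y' := [1]) (Z' := [1]) (msT s n 1 ∘ₗ spT s n 1)
        LinearMap.id (mgT s n 1) LinearMap.id) z).trans
    (congrArg (lten (qPow n s) (X := [1, 1, 1]) (Y := [1 + 1, 1]) (X' := [1]) (Y' := [1])
        (mgT s n 1) LinearMap.id) (LinearMap.congr_fun (lten_comp (qPow n s) (X := [1 + 1, 1])
          (Y := [1, 1, 1]) (Z := [1, 1, 1]) (X' := [1]) (Y' := [1]) (Z' := [1]) (spT s n 1)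
            LinearMap.id (msT s n 1) LinearMap.id) z))
  rw [h1, h2, lten_add_left, lten_smul_left, lten_id]
  refine (congrArg (· + (-1 : Kq) • z) (c1.trans ((a3 _).trans
    (congrArg (mm₄ s n) ((a2 _).trans (congrArg (L₂ s n) (a1 z))))))).trans ?_
  rw [neg_one_smul, sub_eq_add_neg]

/-- The cap on the last two of three strands. -/
noncomputable def capT (n : ℕ) : (seqObj (qPow n s) [1 + 1, 1, 1]).V →ₗ[Kq]
    (seqObj (qPow n s) [1 + 1]).V :=
  lten (qPow n s) (X := [1 + 1]) (Y := [1 + 1]) (X' := [1, 1]) (Y' := []) LinearMap.id (capL s n)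

/-- The cup on the last two of three strands. -/
noncomputable def cupT (m : ℕ) : (seqObj (qPow (2 * m) s) [1 + 1]).V →ₗ[Kq]
    (seqObj (qPow (2 * m) s) [1 + 1, 1, 1]).V :=
  lten (qPow (2 * m) s) (X := [1 + 1]) (Y := [1 + 1]) (X' := []) (Y' := [1, 1]) LinearMap.id
    (cupL s m)

lemma ddL_capT (z : (seqObj (qPow (2 * m) s) [1 + 1, 1, 1]).V) :
    ddL s (2 * m) (capT s (2 * m) z) = (strands s m).C₄ (dd₄ s (2 * m) z) := by
  have h : lten (qPow (2 * m) s) (X := [1 + 1]) (Y := [1, 1]) (X' := []) (Y' := [])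
      (ddL s (2 * m)) LinearMap.id = ddL s (2 * m) :=
    congrArg AlgRep.lin (seqTens_unit (qPow (2 * m) s) (X := [1 + 1]) (Y := [1, 1])
      (seqSplit (qPow (2 * m) s) (fun a b => qSplit s a b) 1 1))
  refine (LinearMap.congr_fun h.symm (capT s (2 * m) z)).trans ?_
  exact (LinearMap.congr_fun (lten_comp (qPow (2 * m) s) (X := [1 + 1]) (Y := [1 + 1])
    (Z := [1, 1]) (X' := [1, 1]) (Y' := []) (Z' := []) LinearMap.id (capL s (2 * m))
      (ddL s (2 * m)) LinearMap.id) z).symm.trans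
    (LinearMap.congr_fun (lten_comp (qPow (2 * m) s) (X := [1 + 1]) (Y := [1, 1])
    (Z := [1, 1]) (X' := [1, 1]) (Y' := [1, 1]) (Z' := []) (ddL s (2 * m)) LinearMap.id
      LinearMap.id (capL s (2 * m))) z)

lemma cupT_mmL (x : (seqObj (qPow (2 * m) s) [1, 1]).V) :
    cupT s m (mmL s (2 * m) x) = mm₄ s (2 * m) ((strands s m).D₄ x) := by
  have h : lten (qPow (2 * m) s) (X := [1, 1]) (Y := [1 + 1]) (X' := []) (Y' := [])
      (mmL s (2 * m)) LinearMap.id = mmL s (2 * m) :=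
    congrArg AlgRep.lin (seqTens_unit (qPow (2 * m) s) (X := [1, 1]) (Y := [1 + 1])
      (seqMerge (qPow (2 * m) s) (fun a b => qMul s a b) 1 1))
  refine (congrArg (cupT s m) (LinearMap.congr_fun h.symm x)).trans ?_
  exact (LinearMap.congr_fun (lten_comp (qPow (2 * m) s) (X := [1, 1]) (Y := [1 + 1])
    (Z := [1 + 1]) (X' := []) (Y' := []) (Z' := [1, 1]) (mmL s (2 * m)) LinearMap.id
      LinearMap.id (cupL s m)) x).symm.trans
    (LinearMap.congr_fun (lten_comp (qPow (2 * m) s) (X := [1, 1]) (Y := [1, 1])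
    (Z := [1 + 1]) (X' := []) (Y' := [1, 1]) (Z' := [1, 1]) LinearMap.id (cupL s m)
      (mmL s (2 * m)) LinearMap.id) x)

end ThickStrands
section DotValues

variable (m : ℕ)

/-- The linear map underlying the start dot. -/
noncomputable def startL (m : ℕ) : (seqObj (qPow (2 * m) false) []).V →ₗ[Kq]
    (seqObj (qPow (2 * m) false) [1 + 1]).V :=
  (qnum 2)⁻¹ • (mmL false (2 * m) ∘ₗ cupL false m)

/-- The linear map underlying the end dot. -/
noncomputable def endL (n : ℕ) : (seqObj (qPow n false) [1 + 1]).V →ₗ[Kq]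
    (seqObj (qPow n false) []).V :=
  (qnum 2)⁻¹ • (capL false n ∘ₗ ddL false n)

/-- The values of the generators of dot webs. -/
noncomputable def dotVal : {X Y : List ℕ+} → DotGen X Y →
    (seqRes (qPow (2 * m) false) X ⟶ seqRes (qPow (2 * m) false) Y)
  | _, _, .startDot => (qnum 2)⁻¹ • (cupS false m ≫ (resSp (2 * m)).map
      (seqMerge (qPow (2 * m) false) (fun a b => qMul false a b) 1 1))
  | _, _, .endDot => (qnum 2)⁻¹ • ((resSp (2 * m)).map
      (seqSplit (qPow (2 * m) false) (fun a b => qSplit false a b) 1 1) ≫ capS false (2 * m))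

lemma msL_false (x : (seqObj (qPow (2 * m) false) [1, 1]).V) :
    msL false (2 * m) x = (strands false m).μ x := by
  rw [msL_apply]
  simp [cS, eS]

lemma endL_mmL (x : (seqObj (qPow (2 * m) false) [1, 1]).V) :
    endL (2 * m) (mmL false (2 * m) x) = (strands false m).C₂ x := by
  have h : (strands false m).C₂ ((strands false m).μ x) = qnum 2 • (strands false m).C₂ x :=
    LinearMap.congr_fun (strands false m).C₂_μ x
  change (qnum 2)⁻¹ • (strands false m).C₂ (msL false (2 * m) x) = _
  rw [msL_false, h, smul_smul, inv_mul_cancel₀ qnum_two_ne_zero, one_smul]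

lemma ddL_startL (x : (seqObj (qPow (2 * m) false) []).V) :
    ddL false (2 * m) (startL m x) = (strands false m).D₂ x := by
  have h : (strands false m).μ ((strands false m).D₂ x) = qnum 2 • (strands false m).D₂ x :=
    LinearMap.congr_fun (strands false m).μ_D₂ x
  refine (map_smul (ddL false (2 * m)) _ _).trans ?_
  change (qnum 2)⁻¹ • msL false (2 * m) ((strands false m).D₂ x) = _
  rw [msL_false, h, smul_smul, inv_mul_cancel₀ qnum_two_ne_zero, one_smul]

lemma lten_endL {n : ℕ} (X : List ℕ+) (z : (seqObj (qPow n false) (X ++ [1 + 1])).V) :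
    lten (qPow n false) (X := X) (Y := X) LinearMap.id (endL n) z = (qnum 2)⁻¹ •
      lten (qPow n false) (X := X) (Y := X) LinearMap.id (capL false n)
        (lten (qPow n false) (X := X) (Y := X) LinearMap.id (ddL false n) z) := by
  refine (LinearMap.congr_fun (lten_smul_right (qPow n false) (X := X) (Y := X) (qnum 2)⁻¹
    LinearMap.id (capL false n ∘ₗ ddL false n)) z).trans ?_
  exact congrArg (fun f => (qnum 2)⁻¹ • f z) (lten_comp (qPow n false) (X := X) (Y := X) (Z := X)
    LinearMap.id (ddL false n) LinearMap.id (capL false n))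

lemma lten_startL (X : List ℕ+) (z : (seqObj (qPow (2 * m) false) (X ++ [])).V) :
    lten (qPow (2 * m) false) (X := X) (Y := X) LinearMap.id (startL m) z = (qnum 2)⁻¹ •
      lten (qPow (2 * m) false) (X := X) (Y := X) LinearMap.id (mmL false (2 * m))
        (lten (qPow (2 * m) false) (X := X) (Y := X) LinearMap.id (cupL false m) z) := by
  refine (LinearMap.congr_fun (lten_smul_right (qPow (2 * m) false) (X := X) (Y := X)
    (qnum 2)⁻¹ LinearMap.id (mmL false (2 * m) ∘ₗ cupL false m)) z).trans ?_
  exact congrArg (fun f => (qnum 2)⁻¹ • f z) (lten_comp (qPow (2 * m) false) (X := X) (Y := X)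
    (Z := X) LinearMap.id (cupL false m) LinearMap.id (mmL false (2 * m)))

lemma barbell_apply (x : (seqObj (qPow (2 * m) false) []).V) :
    endL (2 * m) (startL m x) = zqnum (qpar ^ (2 * m)) 2 0 • x := by
  have h1 : (strands false m).C₂ ((strands false m).D₂ x) = qnum (2 * m : ℕ) • x :=
    LinearMap.congr_fun (strands false m).loop_two x
  have h2 : endL (2 * m) (startL m x) = (qnum 2)⁻¹ • (strands false m).C₂
      ((strands false m).D₂ x) :=
    (map_smul (endL (2 * m)) _ _).trans (congrArg ((qnum 2)⁻¹ • ·) (endL_mmL m _))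
  rw [h2, h1, smul_smul, zqnum_zero, qnum_nat_cast, qpar_sq_sub_inv]
  congr 1
  have := qnum_two_ne_zero
  field_simp

/-- The web with outer merges and splits, between an end dot and a start dot. -/
noncomputable def knot (a : ℕ+) : (seqObj (qPow (2 * m) false) [a]).V →ₗ[Kq]
    (seqObj (qPow (2 * m) false) [a]).V :=
  lten (qPow (2 * m) false) (X := [a]) (Y := [a]) (X' := [1 + 1]) (Y' := []) LinearMap.id
      (endL (2 * m)) ∘ₗ spL false (2 * m) a (1 + 1) ∘ₗ mgL false (2 * m) a (1 + 1) ∘ₗ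
    lten (qPow (2 * m) false) (X := [a]) (Y := [a]) (X' := []) (Y' := [1 + 1]) LinearMap.id
      (startL m)

lemma knot_apply (a : ℕ+) (x : (seqObj (qPow (2 * m) false) [a]).V)
    {z : (seqObj (qPow (2 * m) false) [a, 1, 1]).V}
    (hz : z = lten (qPow (2 * m) false) (X := [a]) (Y := [a]) (X' := []) (Y' := [1, 1])
      LinearMap.id (cupL false m) x) :
    knot m a x = ((qnum 2)⁻¹ * (qnum 2)⁻¹) • lten (qPow (2 * m) false) (X := [a]) (Y := [a])
      (X' := [1, 1]) (Y' := []) LinearMap.id (capL false (2 * m))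
        (spT false (2 * m) a (mgT false (2 * m) a (msT false (2 * m) a
          (spT false (2 * m) a (mgT false (2 * m) a z)))) -
            qnum (a : ℕ) • spT false (2 * m) a (mgT false (2 * m) a z)) := by
  rw [← switch_thick]
  refine (lten_endL [a] _).trans ?_
  rw [mul_smul]
  refine congrArg ((qnum 2)⁻¹ • ·) ?_
  let F : (seqObj (qPow (2 * m) false) [a, 1 + 1]).V →ₗ[Kq]
      (seqObj (qPow (2 * m) false) [a]).V :=
    lten (qPow (2 * m) false) (X := [a]) (Y := [a]) (X' := [1, 1]) (Y' := []) LinearMap.id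
      (capL false (2 * m)) ∘ₗ lten (qPow (2 * m) false) (X := [a]) (Y := [a]) (X' := [1 + 1])
        (Y' := [1, 1]) LinearMap.id (ddL false (2 * m)) ∘ₗ spL false (2 * m) a (1 + 1) ∘ₗ
          mgL false (2 * m) a (1 + 1)
  refine (congrArg F (lten_startL m [a] x)).trans ((map_smul F _ _).trans ?_)
  rw [hz]
  rfl

lemma thin_knot (x : (seqObj (qPow (2 * m) false) [1]).V) :
    knot m 1 x = zqnum (qpar ^ (2 * m)) 2 (-1) • x := by
  have e1 : ∀ z, spT false (2 * m) 1 (mgT false (2 * m) 1 z) = (oddStrands false m).μ₁ z := by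
    intro z
    have h1 : spT false (2 * m) 1 (mgT false (2 * m) 1 z) =
        lten (qPow (2 * m) false) (X := [1, 1]) (Y := [1, 1]) (X' := [1]) (Y' := [1])
          (msL false (2 * m)) LinearMap.id z :=
      (LinearMap.congr_fun (lten_comp (qPow (2 * m) false) (X := [1, 1]) (Y := [1 + 1])
        (Z := [1, 1]) (X' := [1]) (Y' := [1]) (Z' := [1]) (mmL false (2 * m)) LinearMap.id
          (ddL false (2 * m)) LinearMap.id) z).symm
    refine h1.trans ((eq_tw false (M := (seqObj (qPow (2 * m) false) [1, 1, 1]).V) _ z).trans ?_)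
    simp [cS, eS]
    rfl
  have e2 : ∀ z, msT false (2 * m) 1 z = (oddStrands false m).μ₂ z := by
    intro z
    refine (eq_tw false (M := (seqObj (qPow (2 * m) false) [1, 1, 1]).V) _ z).trans ?_
    simp [cS, eS]
    rfl
  rw [knot_apply m 1 x (z := (oddStrands false m).D x) rfl, e1, e1, e2]
  have h := (oddStrands false m).trace x
  have h1 : qnum ((1 : ℕ+) : ℕ) = 1 := qnum_one
  rw [h1, one_smul]
  refine (congrArg (((qnum 2)⁻¹ * (qnum 2)⁻¹) • ·) h).trans ?_
  rw [smul_smul]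
  congr 1
  have h0 := qpar_ne_zero
  have h2 := qpar_sub_ne_zero
  have h3 := qnum_two_ne_zero
  have := zqnum_pow_two (2 * m) 1
  rw [Nat.cast_one] at this
  rw [this, qnum_nat_cast, qnum_sub_nat]
  rw [qnum_two] at h3 ⊢
  field_simp
  ring

lemma thick_knot (x : (seqObj (qPow (2 * m) false) [1 + 1]).V) :
    knot m (1 + 1) x = startL m (endL (2 * m) x) + zqnum (qpar ^ (2 * m)) 2 (-2) • x := by
  have l1 : ∀ z, L₁ false (2 * m) z = (strands false m).μ₁ z := fun z => by
    rw [L₁_apply]; simp [cS, eS]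
  have l2 : ∀ z, L₂ false (2 * m) z = (strands false m).μ₂ z := fun z => by
    rw [L₂_apply]; simp [cS, eS]
  have l3 : ∀ z, L₃ false (2 * m) z = (strands false m).μ₃ z := fun z => by
    rw [L₃_apply]; simp [cS, eS]
  obtain ⟨y, rfl⟩ := mmL_surjective false (2 * m) x
  apply ddL_injective false (2 * m)
  have hc : ∀ y, (strands false m).μ₃ ((strands false m).μ₁ y) =
      (strands false m).μ₁ ((strands false m).μ₃ y) := fun y => by
    rw [← l1, ← l3, ← l3, ← l1, L₃_L₁]
  have key := (strands false m).thick_apply hc y rfl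
  set v := (strands false m).μ₂ ((strands false m).μ₁ ((strands false m).D₄ y)) -
    (strands false m).D₄ y with hv
  have e1 : spT false (2 * m) (1 + 1) (mgT false (2 * m) (1 + 1) (cupT false m
      (mmL false (2 * m) y))) = mm₄ false (2 * m) v := by
    rw [spT_mgT_eq, cupT_mmL, dd₄_mm₄, l1, l2, ← map_sub]
  have hq : qnum ((1 + 1 : ℕ+) : ℕ) = qnum 2 := rfl
  have e2 := knot_apply m (1 + 1) (mmL false (2 * m) y) (z := cupT false m (mmL false (2 * m) y)) rfl
  rw [e1, hq] at e2
  have e3 : ddL false (2 * m) (knot m (1 + 1) (mmL false (2 * m) y)) =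
      ((qnum 2)⁻¹ * (qnum 2)⁻¹) • (strands false m).C₄ (dd₄ false (2 * m)
        (spT false (2 * m) (1 + 1) (mgT false (2 * m) (1 + 1) (msT false (2 * m) (1 + 1)
          (mm₄ false (2 * m) v))) - qnum 2 • mm₄ false (2 * m) v)) := by
    rw [e2]
    exact (map_smul (ddL false (2 * m)) _ _).trans
      (congrArg (((qnum 2)⁻¹ * (qnum 2)⁻¹) • ·) (ddL_capT false m _))
  have e4 : dd₄ false (2 * m) (spT false (2 * m) (1 + 1) (mgT false (2 * m) (1 + 1)
      (msT false (2 * m) (1 + 1) (mm₄ false (2 * m) v))) - qnum 2 • mm₄ false (2 * m) v) =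
      (strands false m).μ₁ ((strands false m).μ₂ ((strands false m).μ₃ ((strands false m).μ₁ v))) -
        (strands false m).μ₃ ((strands false m).μ₁ v) - qnum 2 • (strands false m).μ₁ v := by
    rw [spT_mgT_eq]
    simp only [map_sub, map_smul, dd₄_mm₄, dd₄_msT, l1, l2, l3]
  refine e3.trans ?_
  rw [e4, key, smul_smul]
  have h3 := qnum_two_ne_zero
  rw [show (qnum 2)⁻¹ * (qnum 2)⁻¹ * (qnum 2 * qnum 2) = 1 by field_simp, one_smul]
  refine Eq.symm ((map_add (ddL false (2 * m)) _ _).trans (congrArg₂ (· + ·) ?_ ?_))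
  · exact (ddL_startL m _).trans (congrArg (strands false m).D₂ (endL_mmL m y))
  · exact (map_smul (ddL false (2 * m)) _ _).trans
      (congrArg (zqnum (qpar ^ (2 * m)) 2 (-2) • ·) (msL_false m y))

lemma dotCap_val : evAct (typeA false (2 * m)) (dotVal m) dotCap = capS false (2 * m) :=
  AlgRep.hom_ext (LinearMap.ext fun x => endL_mmL m x)

lemma dotCup_val : evAct (typeA false (2 * m)) (dotVal m) dotCup = cupS false m :=
  AlgRep.hom_ext (LinearMap.ext fun x => ddL_startL m x)

end DotValues
section DotFunctor

variable (m : ℕ)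

lemma dot_barbell : evAct (typeA false (2 * m)) (dotVal m) (startDot.comp endDot) =
    evAct (typeA false (2 * m)) (dotVal m)
      (ActTm.smul (zqnum (qpar ^ (2 * m)) 2 0) (ActTm.one [])) :=
  AlgRep.hom_ext (LinearMap.ext fun x => barbell_apply m x)

lemma dot_thinK : evAct (typeA false (2 * m)) (dotVal m)
      ((pad [1] startDot).comp ((ActTm.onUnit (WHom.comp (WHom.merge 1 2) (WHom.split 1 2))).comp
        (pad [1] endDot))) =
    evAct (typeA false (2 * m)) (dotVal m)
      (ActTm.smul (zqnum (qpar ^ (2 * m)) 2 (-1)) (ActTm.one [1])) :=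
  AlgRep.hom_ext ((evAct_sandwich (typeA false (2 * m)) (dotVal m) (X := [1]) (Y := [1, 2])
    (Z := [1, 2]) (W := [1]) (pad [1] startDot) (WHom.comp (WHom.merge 1 2) (WHom.split 1 2))
      (pad [1] endDot)).trans (LinearMap.ext fun x => thin_knot m x))

lemma dot_thickK : evAct (typeA false (2 * m)) (dotVal m)
      ((pad [2] startDot).comp ((ActTm.onUnit (WHom.comp (WHom.merge 2 2) (WHom.split 2 2))).comp
        (pad [2] endDot))) =
    evAct (typeA false (2 * m)) (dotVal m) (ActTm.add (endDot.comp startDot)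
      (ActTm.smul (zqnum (qpar ^ (2 * m)) 2 (-2)) (ActTm.one [2]))) :=
  AlgRep.hom_ext ((evAct_sandwich (typeA false (2 * m)) (dotVal m) (X := [2]) (Y := [2, 2])
    (Z := [2, 2]) (W := [2]) (pad [2] startDot) (WHom.comp (WHom.merge 2 2) (WHom.split 2 2))
      (pad [2] endDot)).trans (LinearMap.ext fun x => thick_knot m x))

lemma evAct_slideCap {n : ℕ} {P : ℕ → AlgRep Kq (Uq n)} {G : List ℕ+ → List ℕ+ → Type}
    (FA : LinFunctorOn (C := WebA) (seqObj P))
    (γ : {X Y : List ℕ+} → G X Y → (seqRes P X ⟶ seqRes P Y)) (c : ActTm G [1, 1] [])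
    (f : WHom [1, 1, 1, 1] [1, 1, 1, 1]) {v : seqRes P [1, 1] ⟶ seqRes P []}
    (h : evAct FA γ c = v) : (evAct FA γ (slideCap c f)).1 =
      v.1 ∘ₗ lten P (X := [1, 1]) (Y := [1, 1]) (X' := [1, 1]) (Y' := [])
        (FA.map (X := ([1, 1] : List ℕ+)) (Y := ([1, 1] : List ℕ+)) (WHom.one [1, 1])).1
          v.1 ∘ₗ
        (FA.map (X := ([1, 1, 1, 1] : List ℕ+)) (Y := ([1, 1, 1, 1] : List ℕ+))
          (WHom.comp f (mid [1] [1] ms))).1 := by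
  subst h
  rfl

lemma evAct_slideCup {n : ℕ} {P : ℕ → AlgRep Kq (Uq n)} {G : List ℕ+ → List ℕ+ → Type}
    (FA : LinFunctorOn (C := WebA) (seqObj P))
    (γ : {X Y : List ℕ+} → G X Y → (seqRes P X ⟶ seqRes P Y)) (c : ActTm G [] [1, 1])
    (f : WHom [1, 1, 1, 1] [1, 1, 1, 1]) {v : seqRes P [] ⟶ seqRes P [1, 1]}
    (h : evAct FA γ c = v) : (evAct FA γ (slideCup c f)).1 =
      (FA.map (X := ([1, 1, 1, 1] : List ℕ+)) (Y := ([1, 1, 1, 1] : List ℕ+))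
          (WHom.comp (mid [1] [1] ms) f)).1 ∘ₗ
        lten P (X := [1, 1]) (Y := [1, 1]) (X' := []) (Y' := [1, 1])
          (FA.map (X := ([1, 1] : List ℕ+)) (Y := ([1, 1] : List ℕ+)) (WHom.one [1, 1])).1
            v.1 ∘ₗ v.1 := by
  subst h
  rfl

lemma dot_slideCap : evAct (typeA false (2 * m)) (dotVal m) (slideCap dotCap msLeft) =
    evAct (typeA false (2 * m)) (dotVal m) (slideCap dotCap msRight) := by
  refine AlgRep.hom_ext ((evAct_slideCap (typeA false (2 * m)) (dotVal m) dotCap msLeft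
    (dotCap_val m)).trans (Eq.trans ?_ (evAct_slideCap (typeA false (2 * m)) (dotVal m) dotCap
      msRight (dotCap_val m)).symm))
  exact LinearMap.ext fun x => slide_cap_apply false m x

lemma dot_slideCup : evAct (typeA false (2 * m)) (dotVal m) (slideCup dotCup msLeft) =
    evAct (typeA false (2 * m)) (dotVal m) (slideCup dotCup msRight) := by
  refine AlgRep.hom_ext ((evAct_slideCup (typeA false (2 * m)) (dotVal m) dotCup msLeft
    (dotCup_val m)).trans (Eq.trans ?_ (evAct_slideCup (typeA false (2 * m)) (dotVal m) dotCup
      msRight (dotCup_val m)).symm))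
  exact LinearMap.ext fun x => slide_cup_apply false m x

/-- The values of the dots satisfy the relations of dot webs. -/
lemma dotVal_relations {X Y : List ℕ+} {f g : ActTm DotGen X Y}
    (h : DotRel (qpar ^ (2 * m)) f g) :
    evAct (typeA false (2 * m)) (dotVal m) f = evAct (typeA false (2 * m)) (dotVal m) g := by
  cases h with
  | barbell => exact dot_barbell m
  | thinK => exact dot_thinK m
  | thickK => exact dot_thickK m
  | slideCap => exact dot_slideCap m
  | slideCup => exact dot_slideCup m

end DotFunctor
section Proposition

variable {m : ℕ} (s : Bool)

lemma qVec_single {n : ℕ} (i : Fin n) : qVec s ![i] = qth s i :=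
  congrArg (qVec s) (funext fun k => by rw [Subsingleton.elim k 0]; rfl)

lemma cupL_pairs : cupL s m (unitVec (qPow (2 * m) s)) = ∑ k : Fin (2 * m / 2),
    qpar ^ (-(k : ℤ)) • (qpar • tv s (evenIdx k) (oddIdx k) - tv s (oddIdx k) (evenIdx k)) := by
  have e : ∀ M : Type, [AddCommMonoid M] → ∀ F : Fin (2 * m) → M,
      ∑ i, F i = ∑ k : Fin (2 * m / 2), (F (evenIdx k) + F (oddIdx k)) := by
    intro M _ F
    let G : ℕ → M := fun i => if h : i < 2 * m then F ⟨i, h⟩ else 0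
    have h1 : ∀ i : Fin (2 * m), F i = G i := fun i => by simp only [G, i.2, dite_true]
    simp only [h1]
    rw [sum_fin_eq_range G, sum_range_two_mul]
    refine (sum_fin_eq_range fun k => G (2 * k) + G (2 * k + 1)).symm.trans ?_
    exact Fintype.sum_equiv (finCongr (by omega)) _ _ fun k => rfl
  rw [cupL_unitVec, e]
  refine Finset.sum_congr rfl fun k _ => ?_
  have h1 : pt (evenIdx k) = oddIdx k := Fin.ext (mate_even k)
  have h2 : pt (oddIdx k) = evenIdx k := Fin.ext (mate_odd k)
  have h3 : kappa (evenIdx k : Fin (2 * m)).1 = _ := kappa_even k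
  have h4 : kappa (oddIdx k : Fin (2 * m)).1 = _ := kappa_odd k
  rw [h1, h2, h3, h4]
  module

lemma tv_qVec {n : ℕ} (i j : Fin n) : tv s i j =
    vec2 (qPow n s) (a := 1) (b := 1) (qVec s ![i]) (qVec s ![j]) :=
  congrArg₂ (fun x y => vec2 (qPow n s) (a := 1) (b := 1) x y) (qVec_single s i).symm
    (qVec_single s j).symm

lemma cupL_vec2 : cupL s m (unitVec (qPow (2 * m) s)) = ∑ k : Fin (2 * m / 2),
    qpar ^ (-(k : ℤ)) • (qpar • vec2 (qPow (2 * m) s) (a := 1) (b := 1)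
      (qVec s ![evenIdx k]) (qVec s ![oddIdx k]) - vec2 (qPow (2 * m) s) (a := 1) (b := 1)
        (qVec s ![oddIdx k]) (qVec s ![evenIdx k])) :=
  (cupL_pairs s).trans (Finset.sum_congr rfl fun k _ => congrArg (qpar ^ (-(k : ℤ)) • ·)
    (congrArg₂ (fun x y => qpar • x - y) (tv_qVec s _ _) (tv_qVec s _ _)))

lemma mform_lam (n i j : ℕ) : mform (lam n) i j =
    if Even i ∧ j = i + 1 then qpar ^ ((n : ℤ) - 3 * (i / 2 : ℕ) - 2)
      else if Odd i ∧ i = j + 1 then -qpar ^ ((n : ℤ) - 3 * (i / 2 : ℕ) - 3) else 0 := by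
  rw [mform, lam, mate]
  rcases Nat.even_or_odd i with h | h
  · simp [h, Nat.not_odd_iff_even.mpr h]
  · have h1 := Nat.not_even_iff_odd.mpr h
    have h2 : j = i - 1 ↔ i = j + 1 := by
      have := h.pos
      omega
    simp [h, h1, h2]

lemma mform_lam_of_lt {n i j : ℕ} (h : i < j) : mform (lam n) i j =
    if Even i ∧ j = i + 1 then qpar ^ ((n : ℤ) - 3 * (i / 2 : ℕ) - 2) else 0 := by
  rw [mform_lam, if_neg (c := Odd i ∧ i = j + 1) (by omega)]

lemma capS_vec2 {n : ℕ} (i j : Fin n) : AlgRep.lin (capS s n)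
    (vec2 (qPow n s) (a := 1) (b := 1) (qVec s ![i]) (qVec s ![j])) =
      mform (lam n) i j • unitVec (qPow n s) :=
  (congrArg (AlgRep.lin (capS s n)) (tv_qVec s i j).symm).trans (capS_tv s i j)

lemma vec1_pair {n : ℕ} (i j : Fin n) :
    vec1 (qPow n s) (a := 2) (qVec s ![i, j]) = mmL s n (tv s i j) := by
  refine Eq.trans ?_ (mmL_duo s (qth s i ⊗ₜ[Kq] qth s j)).symm
  have h : AlgRep.lin (qMul s 1 1) (qth s i ⊗ₜ[Kq] qth s j) = _ :=
    qMulB_qVec s (fun _ : Fin 1 => i) (fun _ : Fin 1 => j)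
  have e : (![i, j] : Fin (1 + 1) → Fin n) = Fin.append (fun _ : Fin 1 => i) fun _ : Fin 1 => j :=
    funext fun k => by fin_cases k <;> rfl
  exact congrArg (vec1 (qPow n s) (a := 2)) ((congrArg (qVec s) e).trans h.symm)

lemma startL_unitVec : startL m (unitVec (qPow (2 * m) false)) = ∑ k : Fin (2 * m / 2),
    qpar ^ (-(k : ℤ)) • vec1 (qPow (2 * m) false) (a := 2)
      (qVec false ![evenIdx k, oddIdx k]) := by
  apply ddL_injective false (2 * m)
  refine (ddL_startL m _).trans ((cupL_pairs false).trans ?_)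
  refine Eq.trans ?_ (map_sum (ddL false (2 * m)) _ _).symm
  refine Finset.sum_congr rfl fun k _ => ?_
  refine Eq.trans ?_ (map_smul (ddL false (2 * m)) _ _).symm
  refine congrArg (qpar ^ (-(k : ℤ)) • ·) ?_
  rw [vec1_pair]
  refine Eq.trans ?_ (msL_tv false _ _).symm
  have h : (evenIdx k : Fin (2 * m)) < oddIdx k := Nat.lt_succ_self _
  have h1 : fmu false (evenIdx k : Fin (2 * m)) (oddIdx k) = qpar := by simp [fmu, h, qp]
  rw [h1, if_neg h.ne, show eps false = -1 from rfl, neg_one_smul, sub_eq_add_neg]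

lemma isGammaCSym_actFunctor : IsGammaCSym (2 * m) (typeA true (2 * m))
    (actFunctor (typeA_tens true) (cupVal_relations m)) where
  toIsExtension := actFunctor_isExtension _ _
  cup := cupL_vec2 true
  cap i j := (capS_vec2 true i j).trans (by rw [mform_lam]; rfl)

lemma isGammaCExt_actFunctor : IsGammaCExt (2 * m) (typeA false (2 * m))
    (actFunctor (typeA_tens false) (dotVal_relations m)) where
  toIsExtension := actFunctor_isExtension _ _
  startDot := startL_unitVec
  endDot i j h := by
    refine (congrArg (endL (2 * m)) (vec1_pair false i j)).trans ((endL_mmL m _).trans ?_)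
    exact (capL_tv false i j).trans (by rw [mform_lam_of_lt h]; rfl)

lemma IsGammaCSym.eq {n : ℕ} {FA : LinFunctorOn (C := WebA) (seqObj (symPow n))}
    {F F' : LinFunctorOn (C := CupWeb (-(qpar ^ n)⁻¹)) (seqRes (symPow n))}
    (h : IsGammaCSym n FA F) (h' : IsGammaCSym n FA F') : F = F' := by
  refine actWeb_functor_ext h.toIsExtension h'.toIsExtension fun g => ?_
  cases g with
  | cup => exact AlgRep.hom_ext (unit_ext true (h.cup.trans h'.cup.symm))
  | cap =>
    refine AlgRep.hom_ext (seq2_ext (symPow n) (a := 1) (b := 1) fun x y => ?_)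
    let V2 : (qPow n true 1).V →ₗ[Kq] (qPow n true 1).V →ₗ[Kq] (seqObj (qPow n true) [1, 1]).V :=
      (TensorProduct.mk Kq _ _).compr₂ (duo (qPow n true) 1 1)
    have key : V2.compr₂ (F.map (X := ([1, 1] : List ℕ+)) (Y := ([] : List ℕ+))
          (AHom.gen CupGen.cap)).1 =
        V2.compr₂ (F'.map (X := ([1, 1] : List ℕ+)) (Y := ([] : List ℕ+))
          (AHom.gen CupGen.cap)).1 := by
      refine qth_ext fun i => qth_ext fun j => ?_
      have e := (h.cap i j).trans (h'.cap i j).symm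
      exact (congrArg (F.map (X := ([1, 1] : List ℕ+)) (Y := ([] : List ℕ+))
        (AHom.gen CupGen.cap)).1 (tv_qVec true i j)).trans (e.trans (congrArg
          (F'.map (X := ([1, 1] : List ℕ+)) (Y := ([] : List ℕ+))
            (AHom.gen CupGen.cap)).1 (tv_qVec true i j).symm))
    exact LinearMap.congr_fun (LinearMap.congr_fun key x) y

lemma IsGammaCExt.eq {n : ℕ} {FA : LinFunctorOn (C := WebA) (seqObj (extPow n))}
    {F F' : LinFunctorOn (C := DotWeb (qpar ^ n)) (seqRes (extPow n))}
    (h : IsGammaCExt n FA F) (h' : IsGammaCExt n FA F') : F = F' := by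
  refine actWeb_functor_ext h.toIsExtension h'.toIsExtension fun g => ?_
  cases g with
  | startDot => exact AlgRep.hom_ext (unit_ext false (h.startDot.trans h'.startDot.symm))
  | endDot =>
    refine AlgRep.hom_ext (seq1_ext (extPow n) (a := 2) fun x => ?_)
    let V1 : (qPow n false 2).V →ₗ[Kq] (seqObj (qPow n false) [2]).V :=
      (ρ_ (qPow n false 2)).inv.1
    have key : (F.map (X := ([2] : List ℕ+)) (Y := ([] : List ℕ+))
          (AHom.gen DotGen.endDot)).1 ∘ₗ V1 =
        (F'.map (X := ([2] : List ℕ+)) (Y := ([] : List ℕ+))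
          (AHom.gen DotGen.endDot)).1 ∘ₗ V1 := by
      refine qPow_std_ext (s := false) fun w hw => ?_
      have e : w = ![w 0, w 1] := funext fun k => by fin_cases k <;> rfl
      have hlt : w 0 < w 1 := hw (by decide)
      rw [e]
      exact (h.endDot _ _ hlt).trans (h'.endDot _ _ hlt).symm
    exact LinearMap.congr_fun key x

end Proposition

theorem proposition5p12 (n : ℕ) (hn : Even n) :
    ((∃! ΓA, IsGammaAExt n ΓA) ∧
      ∀ ΓA, IsGammaAExt n ΓA →
        (∃! Γ, IsGammaCExt n ΓA Γ) ∧
          ∀ Γ, IsGammaCExt n ΓA Γ → Commutes (extPow n) ΓA Γ) ∧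
    ((∃! ΓA, IsGammaASym n ΓA) ∧
      ∀ ΓA, IsGammaASym n ΓA →
        (∃! Γ, IsGammaCSym n ΓA Γ) ∧
          ∀ Γ, IsGammaCSym n ΓA Γ → Commutes (symPow n) ΓA Γ) := by
  obtain ⟨m, rfl⟩ := even_iff_exists_two_mul.mp hn
  refine ⟨⟨gammaAExt_exists_unique _, fun ΓA hA => ?_⟩, gammaASym_exists_unique _, fun ΓA hA => ?_⟩
  · obtain rfl := (gammaAExt_exists_unique _).unique hA (isGammaA_webFunctor false)
    exact ⟨⟨_, isGammaCExt_actFunctor, fun Γ h => h.eq isGammaCExt_actFunctor⟩,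
      fun Γ h => h.toIsExtension.commutes⟩
  · obtain rfl := (gammaASym_exists_unique _).unique hA (isGammaA_webFunctor true)
    exact ⟨⟨_, isGammaCSym_actFunctor, fun Γ h => h.eq isGammaCSym_actFunctor⟩,
      fun Γ h => h.toIsExtension.commutes⟩
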